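/- Let $k$ be a field and $H$ a Hopf algebra over $k$. A Hopf bimodule over $H$ is an $H$-bimodule and $H$-bicomodule whose left and right coactions are morphisms of $H$-bimodules (for the codiagonal actions); let $\mathcal H$ be the category of Hopf bimodules over $H$. For $n\ge 1$ let $\mathcal{E}xt^n=\mathcal{E}xt_{\mathcal H}^n(H,H)$ be the category of exact sequences $$\mathbf E:\ 0\to H\xrightarrow{i_{\mathbf E}} E_{n-1}\to\cdots\to E_0\xrightarrow{p_{\mathbf E}} H\to 0$$ in $\mathcal H$, with morphisms the morphisms of complexes that are the identity on both copies of $H$; put $E_n=H$. Let $\pi_0\mathcal{E}xt^n$ be its set of connected components, and consider its fundamental groupoid (the free groupoid on the category). All the groups $\pi_1(\mathcal{E}xt^n,\mathbf X)$ are identified with one another by change of base point along paths and by the maps induced by the functors $\mathbf X\mapsto\mathbf X+\mathbf A$ (Baer sum with a fixed extension $\mathbf A$): an element of $\pi_1\mathcal{E}xt^n$ is a family of elements of $\pi_1(\mathcal{E}xt^n,\mathbf X)$, one for each $\mathbf X$, compatible with these maps. For $\mathbf E\in\mathcal{E}xt^m$ and $\mathbf F\in\mathcal{E}xt^n$ with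 $m,n\ge 1$ let $$\mathbf E\#\mathbf F:\ 0\to H\to F_{n-1}\to\cdots\to F_0\xrightarrow{i_{\mathbf E}p_{\mathbf F}}E_{m-1}\to\cdots\to E_0\to H\to 0$$ be the Yoneda product; let $(-1)\mathbf E$ be $\mathbf E$ with $p_{\mathbf E}$ replaced by $-p_{\mathbf E}$; and let $\mathbf E\otimes_H\mathbf F$ be the extension with $(\mathbf E\otimes_H\mathbf F)_r=\bigoplus_{s+t=r}E_s\otimes_HF_t$ (codiagonal coactions, outer actions), differential $d(e\otimes f)=de\otimes f+(-1)^{s}e\otimes df$ for $e\in E_s$, and augmentation and coaugmentation induced by those of $\mathbf E$ and $\mathbf F$ and by $H\otimes_HH\cong H$. Let $\lambda_{\mathbf E,\mathbf F}:\mathbf E\otimes_H\mathbf F\to\mathbf F\#\mathbf E$ be the morphism which in degree $i<n$ is $p_{\mathbf E}\otimes\mathrm{id}:E_0\otimes_HF_i\to F_i$, in degree $i\ge n$ is the canonical isomorphism $E_{i-n}\otimes_HF_n\cong E_{i-n}$, and vanishes on the other summands. Let $\rho_{\mathbf E,\mathbf F}:\mathbf E\otimes_H\mathbf F\to(-1)^{mn}\mathbf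 E\#\mathbf F$ be the morphism which in degree $j<m$ is $(-1)^{mn}(\mathrm{id}\otimes p_{\mathbf F}):E_j\otimes_HF_0\to E_j$, in degree $j\ge m$ is $(-1)^{m(m+n-j)}$ times the canonical isomorphism $E_m\otimes_HF_{j-m}\cong F_{j-m}$, and vanishes on the other summands. These define the loop $$\mathbf E\#\mathbf F\xleftarrow{\rho_{\mathbf E,\mathbf F}}(-1)^{mn}\mathbf E\otimes_H\mathbf F\xrightarrow{\lambda_{\mathbf E,\mathbf F}}(-1)^{mn}\mathbf F\#\mathbf E\xleftarrow{\rho_{\mathbf F,\mathbf E}}\mathbf F\otimes_H\mathbf E\xrightarrow{\lambda_{\mathbf F,\mathbf E}}\mathbf E\#\mathbf F$$ based at $\mathbf E\#\mathbf F$ in $\mathcal{E}xt^{m+n}$. Then there are unique maps (the loop bracket) $$\Omega:\pi_0\mathcal{E}xt^m\times\pi_0\mathcal{E}xt^n\to\pi_1\mathcal{E}xt^{m+n}\qquad(m,n\ge 1)$$ such that for all $\mathbf E,\mathbf F$ the component of $\Omega(\mathbf E,\mathbf F)$ at the base point $\mathbf E\#\mathbf F$ is the class of this loop. They satisfy $$\Omega(\mathbf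 E,\mathbf F)=\Omega(\mathbf F,\mathbf E)^{(-1)^{mn}}$$ for all $\mathbf E$ of degree $m$ and $\mathbf F$ of degree $n$. Moreover $\Omega$ turns Baer sums into products (concatenation of loops) in each variable: $$\Omega(\mathbf E,\mathbf F+\mathbf G)=\Omega(\mathbf E,\mathbf F)\,\Omega(\mathbf E,\mathbf G),\qquad \Omega(\mathbf E+\mathbf F,\mathbf G)=\Omega(\mathbf E,\mathbf G)\,\Omega(\mathbf F,\mathbf G),$$ and $\Omega(\mathbf F,\mathbf Z)=1$ for every extension $\mathbf Z$ whose augmentation $p_{\mathbf Z}$ has a section in $\mathcal H$, in particular for the trivial extension $\mathbf Z=\mathbf 0$. -/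

import Mathlib

open CategoryTheory
open scoped TensorProduct

universe u v

noncomputable section

section Bimodules

variable (k : Type u) (H : Type v) [Field k] [Ring H] [HopfAlgebra k H]

/-- The codiagonal action on `V ⊗ W`: if `h` acts on `V` by `f h` and on `W` by `g h`, then
`h` acts on `V ⊗ W` by `v ⊗ w ↦ h₍₁₎ v ⊗ h₍₂₎ w`. -/
def diagAct {V W : Type v} [AddCommGroup V] [Module k V] [AddCommGroup W] [Module k W]
    (f : H →ₗ[k] V →ₗ[k] V) (g : H →ₗ[k] W →ₗ[k] W) : H →ₗ[k] (V ⊗[k] W) →ₗ[k] (V ⊗[k] W) :=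
  (TensorProduct.homTensorHomMap (RingHom.id k) V W V W) ∘ₗ
    (TensorProduct.map f g) ∘ₗ Coalgebra.comul

/-- A `k`-vector space with two actions `lact h m = h m`, `ract h m = m h` of `H` and two coactions
of `H`, not yet subject to any condition. -/
structure HopfData where
  carrier : Type v
  [isAddCommGroup : AddCommGroup carrier]
  [isModule : Module k carrier]
  lact : H →ₗ[k] carrier →ₗ[k] carrier
  ract : H →ₗ[k] carrier →ₗ[k] carrier
  lcoact : carrier →ₗ[k] H ⊗[k] carrier
  rcoact : carrier →ₗ[k] carrier ⊗[k] H

attribute [instance] HopfData.isAddCommGroup HopfData.isModule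

instance : CoeSort (HopfData k H) (Type v) := ⟨HopfData.carrier⟩

variable {k H} in
/-- The conditions defining a Hopf bimodule over `H`: the actions make it an `H`-bimodule, the coactions make
it an `H`-bicomodule, and both coactions are morphisms of `H`-bimodules. -/
structure HopfData.IsHopf (M : HopfData k H) : Prop where
  lact_one : ∀ m, M.lact 1 m = m
  lact_mul : ∀ a b m, M.lact (a * b) m = M.lact a (M.lact b m)
  ract_one : ∀ m, M.ract 1 m = m
  ract_mul : ∀ a b m, M.ract (a * b) m = M.ract b (M.ract a m)
  lact_ract : ∀ a b m, M.lact a (M.ract b m) = M.ract b (M.lact a m)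
  lcounit : ∀ m, TensorProduct.lid k M (Coalgebra.counit.rTensor M (M.lcoact m)) = m
  lcoassoc : ∀ m, TensorProduct.assoc k H H M (Coalgebra.comul.rTensor M (M.lcoact m)) =
    M.lcoact.lTensor H (M.lcoact m)
  rcounit : ∀ m, TensorProduct.rid k M (Coalgebra.counit.lTensor M (M.rcoact m)) = m
  rcoassoc : ∀ m, TensorProduct.assoc k M H H (M.rcoact.rTensor H (M.rcoact m)) =
    Coalgebra.comul.lTensor M (M.rcoact m)
  lcoact_rcoact : ∀ m, TensorProduct.assoc k H M H (M.lcoact.rTensor H (M.rcoact m)) =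
    M.rcoact.lTensor H (M.lcoact m)
  lcoact_lact : ∀ h m, M.lcoact (M.lact h m) = diagAct k H (LinearMap.mul k H) M.lact h (M.lcoact m)
  lcoact_ract : ∀ h m, M.lcoact (M.ract h m) = diagAct k H (LinearMap.mul k H).flip M.ract h (M.lcoact m)
  rcoact_lact : ∀ h m, M.rcoact (M.lact h m) = diagAct k H M.lact (LinearMap.mul k H) h (M.rcoact m)
  rcoact_ract : ∀ h m, M.rcoact (M.ract h m) = diagAct k H M.ract (LinearMap.mul k H).flip h (M.rcoact m)

/-- A Hopf bimodule over `H`. -/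
structure HopfBimod extends HopfData k H where
  isHopf : toHopfData.IsHopf

instance : CoeSort (HopfBimod k H) (Type v) := ⟨fun M => M.carrier⟩

variable {k H}

lemma diagAct_natural {V W V' W' : Type v} [AddCommGroup V] [Module k V] [AddCommGroup W]
    [Module k W] [AddCommGroup V'] [Module k V'] [AddCommGroup W'] [Module k W']
    {f : H →ₗ[k] V →ₗ[k] V} {g : H →ₗ[k] W →ₗ[k] W}
    {f' : H →ₗ[k] V' →ₗ[k] V'} {g' : H →ₗ[k] W' →ₗ[k] W'} (a : V →ₗ[k] V') (b : W →ₗ[k] W')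
    (ha : ∀ h v, a (f h v) = f' h (a v)) (hb : ∀ h v, b (g h v) = g' h (b v)) (h : H)
    (x : V ⊗[k] W) :
    TensorProduct.map a b (diagAct k H f g h x) = diagAct k H f' g' h (TensorProduct.map a b x) := by
  unfold diagAct
  simp only [LinearMap.comp_apply]
  generalize (Coalgebra.comul h : H ⊗[k] H) = s
  induction x using TensorProduct.induction_on with
  | zero => simp
  | add x y hx hy => simp only [map_add, hx, hy]
  | tmul v w =>
    induction s using TensorProduct.induction_on with
    | zero => simp
    | add x y hx hy => simp only [map_add, LinearMap.add_apply, hx, hy]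
    | tmul c d => simp [ha, hb]

lemma diagAct_mul (h : H) (t : H ⊗[k] H) :
    diagAct k H (LinearMap.mul k H) (LinearMap.mul k H) h t = Coalgebra.comul (R := k) h * t := by
  simp only [diagAct, LinearMap.comp_apply]
  generalize (Coalgebra.comul h : H ⊗[k] H) = s
  induction s using TensorProduct.induction_on with
  | zero => simp
  | add x y hx hy => simp only [map_add, LinearMap.add_apply, add_mul, hx, hy]
  | tmul c d =>
    induction t using TensorProduct.induction_on with
    | zero => simp
    | add x y hx hy => simp only [map_add, mul_add, hx, hy]
    | tmul a b => simp

lemma diagAct_mul_flip (h : H) (t : H ⊗[k] H) :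
    diagAct k H (LinearMap.mul k H).flip (LinearMap.mul k H).flip h t =
      t * Coalgebra.comul (R := k) h := by
  simp only [diagAct, LinearMap.comp_apply]
  generalize (Coalgebra.comul h : H ⊗[k] H) = s
  induction s using TensorProduct.induction_on with
  | zero => simp
  | add x y hx hy => simp only [map_add, LinearMap.add_apply, mul_add, hx, hy]
  | tmul c d =>
    induction t using TensorProduct.induction_on with
    | zero => simp
    | add x y hx hy => simp only [map_add, add_mul, hx, hy]
    | tmul a b => simp

namespace HopfBimod

/-- The conditions for a `k`-linear map between Hopf bimodules to be a morphism:
it commutes with both actions and both coactions. -/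
structure IsHom (M N : HopfData k H) (f : M →ₗ[k] N) : Prop where
  lact : ∀ h m, f (M.lact h m) = N.lact h (f m)
  ract : ∀ h m, f (M.ract h m) = N.ract h (f m)
  lcoact : ∀ m, f.lTensor H (M.lcoact m) = N.lcoact (f m)
  rcoact : ∀ m, f.rTensor H (M.rcoact m) = N.rcoact (f m)

/-- The `k`-vector space of morphisms of Hopf bimodules. -/
def homs (M N : HopfBimod k H) : Submodule k (M →ₗ[k] N) where
  carrier := {f | IsHom M.toHopfData N.toHopfData f}
  zero_mem' := ⟨by simp, by simp, by simp, by simp⟩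
  add_mem' {f g} hf hg := ⟨by simp [hf.lact, hg.lact], by simp [hf.ract, hg.ract],
    by simp [LinearMap.lTensor_add, hf.lcoact, hg.lcoact],
    by simp [LinearMap.rTensor_add, hf.rcoact, hg.rcoact]⟩
  smul_mem' c f hf := ⟨by simp [hf.lact], by simp [hf.ract],
    by simp [LinearMap.lTensor_smul, hf.lcoact], by simp [LinearMap.rTensor_smul, hf.rcoact]⟩

lemma IsHom.comp {M N P : HopfData k H} {g : N →ₗ[k] P} {f : M →ₗ[k] N} (hg : IsHom N P g)
    (hf : IsHom M N f) : IsHom M P (g ∘ₗ f) :=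
  ⟨by simp [hf.lact, hg.lact], by simp [hf.ract, hg.ract],
    fun m => by rw [LinearMap.lTensor_comp, LinearMap.comp_apply, hf.lcoact, hg.lcoact]; rfl,
    fun m => by rw [LinearMap.rTensor_comp, LinearMap.comp_apply, hf.rcoact, hg.rcoact]; rfl⟩

instance : Category (HopfBimod k H) where
  Hom M N := homs M N
  id M := ⟨LinearMap.id, ⟨by simp, by simp, by simp, by simp⟩⟩
  comp f g := ⟨g.1 ∘ₗ f.1, g.2.comp f.2⟩

/-- The underlying linear map of a morphism. -/
def lin {M N : HopfBimod k H} (f : M ⟶ N) : M →ₗ[k] N := Subtype.val (p := (· ∈ homs M N)) f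

lemma isHom {M N : HopfBimod k H} (f : M ⟶ N) : IsHom M.toHopfData N.toHopfData (lin f) := Subtype.property f

/-- A linear map satisfying the conditions is a morphism. -/
def mkHom {M N : HopfBimod k H} (f : M →ₗ[k] N) (hf : IsHom M.toHopfData N.toHopfData f) : M ⟶ N :=
  (⟨f, hf⟩ : homs M N)

instance (M N : HopfBimod k H) : AddCommGroup (M ⟶ N) := inferInstanceAs (AddCommGroup (homs M N))
instance (M N : HopfBimod k H) : Module k (M ⟶ N) := inferInstanceAs (Module k (homs M N))

@[ext] lemma hom_ext {M N : HopfBimod k H} {f g : M ⟶ N} (h : ∀ m, lin f m = lin g m) : f = g :=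
  Subtype.ext (LinearMap.ext h)

@[simp] lemma lin_mkHom {M N : HopfBimod k H} (f : M →ₗ[k] N) (hf) : lin (mkHom f hf) = f := rfl
@[simp] lemma lin_id (M : HopfBimod k H) (m : M) : lin (𝟙 M) m = m := rfl
@[simp] lemma lin_comp {M N P : HopfBimod k H} (f : M ⟶ N) (g : N ⟶ P) (m : M) :
    lin (f ≫ g) m = lin g (lin f m) := rfl
@[simp] lemma lin_zero {M N : HopfBimod k H} (m : M) : lin (0 : M ⟶ N) m = 0 := rfl
@[simp] lemma lin_add {M N : HopfBimod k H} (f g : M ⟶ N) (m : M) :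
    lin (f + g) m = lin f m + lin g m := rfl
@[simp] lemma lin_neg {M N : HopfBimod k H} (f : M ⟶ N) (m : M) : lin (-f) m = -lin f m := rfl
@[simp] lemma lin_sub {M N : HopfBimod k H} (f g : M ⟶ N) (m : M) :
    lin (f - g) m = lin f m - lin g m := rfl
@[simp] lemma lin_smul {M N : HopfBimod k H} (c : k) (f : M ⟶ N) (m : M) :
    lin (c • f) m = c • lin f m := rfl

/-- The linear map underlying a sum, as an additive map. -/
def linHom (M N : HopfBimod k H) : (M ⟶ N) →+ (M →ₗ[k] N) := (homs M N).subtype.toAddMonoidHom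

@[simp] lemma lin_sum {M N : HopfBimod k H} {J : Type*} (s : Finset J) (f : J → (M ⟶ N)) (m : M) :
    lin (∑ j ∈ s, f j) m = ∑ j ∈ s, lin (f j) m := by
  have := congrArg (fun g : M →ₗ[k] N => g m) (map_sum (linHom M N) f s)
  exact this.trans (by rw [LinearMap.sum_apply]; rfl)

/-- The inverse of a bijective morphism. -/
def inv {M N : HopfBimod k H} (f : M ⟶ N) (hf : Function.Bijective (lin f)) : N ⟶ M :=
  let e := LinearEquiv.ofBijective (lin f) hf
  have he : ∀ m, e.symm (lin f m) = m := fun m => e.symm_apply_apply m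
  have hl : (e.symm : N →ₗ[k] M) ∘ₗ lin f = LinearMap.id := LinearMap.ext he
  mkHom (e.symm : N →ₗ[k] M)
    ⟨fun h n => by
      obtain ⟨m, rfl⟩ := hf.2 n
      simp [← (isHom f).lact, he],
     fun h n => by
      obtain ⟨m, rfl⟩ := hf.2 n
      simp [← (isHom f).ract, he],
     fun n => by
      obtain ⟨m, rfl⟩ := hf.2 n
      rw [← (isHom f).lcoact, ← LinearMap.comp_apply, ← LinearMap.lTensor_comp, hl]
      simp [he],
     fun n => by
      obtain ⟨m, rfl⟩ := hf.2 n
      rw [← (isHom f).rcoact, ← LinearMap.comp_apply, ← LinearMap.rTensor_comp, hl]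
      simp [he]⟩

@[simp] lemma inv_lin {M N : HopfBimod k H} (f : M ⟶ N) (hf : Function.Bijective (lin f)) (m : M) :
    lin (inv f hf) (lin f m) = m :=
  (LinearEquiv.ofBijective (lin f) hf).symm_apply_apply m

@[simp] lemma lin_inv {M N : HopfBimod k H} (f : M ⟶ N) (hf : Function.Bijective (lin f)) (n : N) :
    lin f (lin (inv f hf) n) = n :=
  (LinearEquiv.ofBijective (lin f) hf).apply_symm_apply n

variable (k H) in
/-- `H` as a Hopf bimodule over itself, with its multiplication and comultiplication. -/
def unit : HopfBimod k H where
  carrier := H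
  lact := LinearMap.mul k H
  ract := (LinearMap.mul k H).flip
  lcoact := Coalgebra.comul
  rcoact := Coalgebra.comul
  isHopf :=
  { lact_one := by simp
    lact_mul := by simp [mul_assoc]
    ract_one := by simp
    ract_mul := by simp [mul_assoc]
    lact_ract := by simp [mul_assoc]
    lcounit := by simp
    lcoassoc := by simp
    rcounit := by simp
    rcoassoc := by simp
    lcoact_rcoact := by simp
    lcoact_lact := fun h m => by rw [diagAct_mul]; simp
    rcoact_lact := fun h m => by rw [diagAct_mul]; simp
    lcoact_ract := fun h m => by rw [diagAct_mul_flip]; simp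
    rcoact_ract := fun h m => by rw [diagAct_mul_flip]; simp }

section Transfer

variable {M N : HopfData k H} {f : M →ₗ[k] N}

lemma IsHom.nat_lcounit (hf : IsHom M N f) (m : M) :
    TensorProduct.lid k N (Coalgebra.counit.rTensor N (N.lcoact (f m))) =
      f (TensorProduct.lid k M (Coalgebra.counit.rTensor M (M.lcoact m))) := by
  rw [← hf.lcoact]
  generalize M.lcoact m = x
  induction x using TensorProduct.induction_on with
  | zero => simp
  | add x y hx hy => simp only [map_add, hx, hy]
  | tmul a b => simp

lemma IsHom.nat_rcounit (hf : IsHom M N f) (m : M) :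
    TensorProduct.rid k N (Coalgebra.counit.lTensor N (N.rcoact (f m))) =
      f (TensorProduct.rid k M (Coalgebra.counit.lTensor M (M.rcoact m))) := by
  rw [← hf.rcoact]
  generalize M.rcoact m = x
  induction x using TensorProduct.induction_on with
  | zero => simp
  | add x y hx hy => simp only [map_add, hx, hy]
  | tmul a b => simp

lemma IsHom.nat_ll (hf : IsHom M N f) (x : H ⊗[k] M) :
    N.lcoact.lTensor H (f.lTensor H x) = (f.lTensor H).lTensor H (M.lcoact.lTensor H x) := by
  induction x using TensorProduct.induction_on with
  | zero => simp
  | add x y hx hy => simp only [map_add, hx, hy]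
  | tmul a b => simp [hf.lcoact]

lemma IsHom.nat_rl (hf : IsHom M N f) (x : H ⊗[k] M) :
    N.rcoact.lTensor H (f.lTensor H x) = (f.rTensor H).lTensor H (M.rcoact.lTensor H x) := by
  induction x using TensorProduct.induction_on with
  | zero => simp
  | add x y hx hy => simp only [map_add, hx, hy]
  | tmul a b => simp [hf.rcoact]

lemma IsHom.nat_rr (hf : IsHom M N f) (x : M ⊗[k] H) :
    TensorProduct.assoc k N H H (N.rcoact.rTensor H (f.rTensor H x)) =
      f.rTensor (H ⊗[k] H) (TensorProduct.assoc k M H H (M.rcoact.rTensor H x)) := by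
  induction x using TensorProduct.induction_on with
  | zero => simp
  | add x y hx hy => simp only [map_add, hx, hy]
  | tmul a b =>
    simp only [LinearMap.rTensor_tmul, ← hf.rcoact]
    generalize M.rcoact a = y
    induction y using TensorProduct.induction_on with
    | zero => simp
    | add x y hx hy => simp only [map_add, TensorProduct.add_tmul, hx, hy]
    | tmul c d => simp

lemma IsHom.nat_lr (hf : IsHom M N f) (x : M ⊗[k] H) :
    TensorProduct.assoc k H N H (N.lcoact.rTensor H (f.rTensor H x)) =
      (f.rTensor H).lTensor H (TensorProduct.assoc k H M H (M.lcoact.rTensor H x)) := by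
  induction x using TensorProduct.induction_on with
  | zero => simp
  | add x y hx hy => simp only [map_add, hx, hy]
  | tmul a b =>
    simp only [LinearMap.rTensor_tmul, ← hf.lcoact]
    generalize M.lcoact a = y
    induction y using TensorProduct.induction_on with
    | zero => simp
    | add x y hx hy => simp only [map_add, TensorProduct.add_tmul, hx, hy]
    | tmul c d => simp

lemma nat_comul_l (f : M →ₗ[k] N) (x : H ⊗[k] M) :
    TensorProduct.assoc k H H N (Coalgebra.comul.rTensor N (f.lTensor H x)) =
      (f.lTensor H).lTensor H (TensorProduct.assoc k H H M (Coalgebra.comul.rTensor M x)) := by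
  induction x using TensorProduct.induction_on with
  | zero => simp
  | add x y hx hy => simp only [map_add, hx, hy]
  | tmul a b =>
    simp only [LinearMap.rTensor_tmul, LinearMap.lTensor_tmul]
    generalize (Coalgebra.comul a : H ⊗[k] H) = y
    induction y using TensorProduct.induction_on with
    | zero => simp
    | add x y hx hy => simp only [map_add, TensorProduct.add_tmul, hx, hy]
    | tmul c d => simp

lemma nat_comul_r (f : M →ₗ[k] N) (x : M ⊗[k] H) :
    Coalgebra.comul.lTensor N (f.rTensor H x) =
      f.rTensor (H ⊗[k] H) (Coalgebra.comul.lTensor M x) := by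
  induction x using TensorProduct.induction_on with
  | zero => simp
  | add x y hx hy => simp only [map_add, hx, hy]
  | tmul a b => simp

lemma IsHom.nat_diag_l (hf : IsHom M N f) (h : H) (m : M) :
    diagAct k H (LinearMap.mul k H) N.lact h (N.lcoact (f m)) =
      f.lTensor H (diagAct k H (LinearMap.mul k H) M.lact h (M.lcoact m)) := by
  rw [← hf.lcoact, LinearMap.lTensor, diagAct_natural (f' := LinearMap.mul k H) (g' := N.lact)]
  · simp
  · exact hf.lact

lemma IsHom.nat_diag_l' (hf : IsHom M N f) (h : H) (m : M) :
    diagAct k H (LinearMap.mul k H).flip N.ract h (N.lcoact (f m)) =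
      f.lTensor H (diagAct k H (LinearMap.mul k H).flip M.ract h (M.lcoact m)) := by
  rw [← hf.lcoact, LinearMap.lTensor, diagAct_natural (f' := (LinearMap.mul k H).flip)
    (g' := N.ract)]
  · simp
  · exact hf.ract

lemma IsHom.nat_diag_r (hf : IsHom M N f) (h : H) (m : M) :
    diagAct k H N.lact (LinearMap.mul k H) h (N.rcoact (f m)) =
      f.rTensor H (diagAct k H M.lact (LinearMap.mul k H) h (M.rcoact m)) := by
  rw [← hf.rcoact, LinearMap.rTensor, diagAct_natural (f' := N.lact) (g' := LinearMap.mul k H)]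
  · exact hf.lact
  · simp

lemma IsHom.nat_diag_r' (hf : IsHom M N f) (h : H) (m : M) :
    diagAct k H N.ract (LinearMap.mul k H).flip h (N.rcoact (f m)) =
      f.rTensor H (diagAct k H M.ract (LinearMap.mul k H).flip h (M.rcoact m)) := by
  rw [← hf.rcoact, LinearMap.rTensor, diagAct_natural (f' := N.ract)
    (g' := (LinearMap.mul k H).flip)]
  · exact hf.ract
  · simp

/-- A subobject of a Hopf bimodule is a Hopf bimodule. -/
lemma IsHom.isHopf_of_injective (hf : IsHom M N f) (hi : Function.Injective f) (hN : N.IsHopf) : M.IsHopf where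
  lact_one m := hi (by rw [hf.lact, hN.lact_one])
  lact_mul a b m := hi (by simp only [hf.lact, hN.lact_mul])
  ract_one m := hi (by rw [hf.ract, hN.ract_one])
  ract_mul a b m := hi (by simp only [hf.ract, hN.ract_mul])
  lact_ract a b m := hi (by simp only [hf.ract, hf.lact, hN.lact_ract])
  lcounit m := hi (by rw [← hf.nat_lcounit, hN.lcounit])
  rcounit m := hi (by rw [← hf.nat_rcounit, hN.rcounit])
  lcoassoc m := Module.Flat.lTensor_preserves_injective_linearMap (M := H) _
    (Module.Flat.lTensor_preserves_injective_linearMap (M := H) _ hi) (by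
      rw [← nat_comul_l, ← hf.nat_ll, hf.lcoact, hN.lcoassoc])
  rcoassoc m := Module.Flat.rTensor_preserves_injective_linearMap (M := H ⊗[k] H) _ hi (by
      rw [← nat_comul_r, ← hf.nat_rr, hf.rcoact, hN.rcoassoc])
  lcoact_rcoact m := Module.Flat.lTensor_preserves_injective_linearMap (M := H) _
    (Module.Flat.rTensor_preserves_injective_linearMap (M := H) _ hi) (by
      rw [← hf.nat_lr, ← hf.nat_rl, hf.rcoact, hf.lcoact, hN.lcoact_rcoact])
  lcoact_lact h m := Module.Flat.lTensor_preserves_injective_linearMap (M := H) _ hi (by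
      rw [← hf.nat_diag_l, hf.lcoact, hf.lact, hN.lcoact_lact])
  lcoact_ract h m := Module.Flat.lTensor_preserves_injective_linearMap (M := H) _ hi (by
      rw [← hf.nat_diag_l', hf.lcoact, hf.ract, hN.lcoact_ract])
  rcoact_lact h m := Module.Flat.rTensor_preserves_injective_linearMap (M := H) _ hi (by
      rw [← hf.nat_diag_r, hf.rcoact, hf.lact, hN.rcoact_lact])
  rcoact_ract h m := Module.Flat.rTensor_preserves_injective_linearMap (M := H) _ hi (by
      rw [← hf.nat_diag_r', hf.rcoact, hf.ract, hN.rcoact_ract])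

end Transfer

/-- A jointly surjective family of compatible maps from Hopf bimodules. -/
lemma isHopf_of_surjective {N : HopfData k H} {J : Type*} (M : J → HopfData k H)
    (f : ∀ j, M j →ₗ[k] N) (hf : ∀ j, IsHom (M j) N (f j)) (hM : ∀ j, (M j).IsHopf)
    (hs : ∀ n, n ∈ ⨆ j, LinearMap.range (f j)) : N.IsHopf := by
  have key : ∀ {P : Type v} [AddCommGroup P] [Module k P] (φ ψ : N →ₗ[k] P),
      (∀ j m, φ (f j m) = ψ (f j m)) → ∀ n, φ n = ψ n := by
    intro P _ _ φ ψ h n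
    induction hs n using Submodule.iSup_induction' with
    | mem j x hx => obtain ⟨m, rfl⟩ := hx; exact h j m
    | zero => simp
    | add x y _ _ hx hy => simp [hx, hy]
  exact
  { lact_one := key (N.lact 1) LinearMap.id fun j m => by simp [← (hf j).lact, (hM j).lact_one]
    lact_mul := fun a b => key (N.lact (a * b)) (N.lact a ∘ₗ N.lact b) fun j m => by
      simp [← (hf j).lact, (hM j).lact_mul]
    ract_one := key (N.ract 1) LinearMap.id fun j m => by simp [← (hf j).ract, (hM j).ract_one]
    ract_mul := fun a b => key (N.ract (a * b)) (N.ract b ∘ₗ N.ract a) fun j m => by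
      simp [← (hf j).ract, (hM j).ract_mul]
    lact_ract := fun a b => key (N.lact a ∘ₗ N.ract b) (N.ract b ∘ₗ N.lact a) fun j m => by
      simp [← (hf j).ract, ← (hf j).lact, (hM j).lact_ract]
    lcounit := key ((TensorProduct.lid k N).toLinearMap ∘ₗ Coalgebra.counit.rTensor N ∘ₗ N.lcoact)
      LinearMap.id fun j m => by
        simp only [LinearMap.comp_apply, LinearEquiv.coe_coe, (hf j).nat_lcounit, (hM j).lcounit,
          LinearMap.id_apply]
    rcounit := key ((TensorProduct.rid k N).toLinearMap ∘ₗ Coalgebra.counit.lTensor N ∘ₗ N.rcoact)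
      LinearMap.id fun j m => by
        simp only [LinearMap.comp_apply, LinearEquiv.coe_coe, (hf j).nat_rcounit, (hM j).rcounit,
          LinearMap.id_apply]
    lcoassoc := key ((TensorProduct.assoc k H H N).toLinearMap ∘ₗ Coalgebra.comul.rTensor N ∘ₗ
        N.lcoact) (N.lcoact.lTensor H ∘ₗ N.lcoact) fun j m => by
      simp only [LinearMap.comp_apply, LinearEquiv.coe_coe, ← (hf j).lcoact, (hf j).nat_ll,
        nat_comul_l, (hM j).lcoassoc]
    rcoassoc := key ((TensorProduct.assoc k N H H).toLinearMap ∘ₗ N.rcoact.rTensor H ∘ₗ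
        N.rcoact) (Coalgebra.comul.lTensor N ∘ₗ N.rcoact) fun j m => by
      simp only [LinearMap.comp_apply, LinearEquiv.coe_coe, ← (hf j).rcoact, (hf j).nat_rr,
        nat_comul_r, (hM j).rcoassoc]
    lcoact_rcoact := key ((TensorProduct.assoc k H N H).toLinearMap ∘ₗ N.lcoact.rTensor H ∘ₗ
        N.rcoact) (N.rcoact.lTensor H ∘ₗ N.lcoact) fun j m => by
      simp only [LinearMap.comp_apply, LinearEquiv.coe_coe, ← (hf j).rcoact, ← (hf j).lcoact,
        (hf j).nat_lr, (hf j).nat_rl, (hM j).lcoact_rcoact]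
    lcoact_lact := fun h => key (N.lcoact ∘ₗ N.lact h)
      (diagAct k H (LinearMap.mul k H) N.lact h ∘ₗ N.lcoact) fun j m => by
        simp only [LinearMap.comp_apply, ← (hf j).lact, (hf j).nat_diag_l, ← (hM j).lcoact_lact,
          (hf j).lcoact]
    lcoact_ract := fun h => key (N.lcoact ∘ₗ N.ract h)
      (diagAct k H (LinearMap.mul k H).flip N.ract h ∘ₗ N.lcoact) fun j m => by
        simp only [LinearMap.comp_apply, ← (hf j).ract, (hf j).nat_diag_l', ← (hM j).lcoact_ract,
          (hf j).lcoact]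
    rcoact_lact := fun h => key (N.rcoact ∘ₗ N.lact h)
      (diagAct k H N.lact (LinearMap.mul k H) h ∘ₗ N.rcoact) fun j m => by
        simp only [LinearMap.comp_apply, ← (hf j).lact, (hf j).nat_diag_r, ← (hM j).rcoact_lact,
          (hf j).rcoact]
    rcoact_ract := fun h => key (N.rcoact ∘ₗ N.ract h)
      (diagAct k H N.ract (LinearMap.mul k H).flip h ∘ₗ N.rcoact) fun j m => by
        simp only [LinearMap.comp_apply, ← (hf j).ract, (hf j).nat_diag_r', ← (hM j).rcoact_ract,
          (hf j).rcoact] }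

/-! ### Finite products -/

section Pi

variable {J : Type} [Fintype J] [DecidableEq J] (M : J → HopfBimod k H)

/-- The factorwise left coaction on a finite product. -/
def piLcoact : (∀ j, (M j).carrier) →ₗ[k] H ⊗[k] (∀ j, (M j).carrier) :=
  ∑ j, (LinearMap.single k (fun j => (M j).carrier) j).lTensor H ∘ₗ (M j).lcoact ∘ₗ
    LinearMap.proj j

/-- The factorwise right coaction on a finite product. -/
def piRcoact : (∀ j, (M j).carrier) →ₗ[k] (∀ j, (M j).carrier) ⊗[k] H :=
  ∑ j, (LinearMap.single k (fun j => (M j).carrier) j).rTensor H ∘ₗ (M j).rcoact ∘ₗ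
    LinearMap.proj j

/-- A factorwise action on a finite product. -/
def piAct (act : ∀ j, H →ₗ[k] M j →ₗ[k] M j) :
    H →ₗ[k] (∀ j, (M j).carrier) →ₗ[k] (∀ j, (M j).carrier) :=
  LinearMap.mk₂ k (fun h z j => act j h (z j))
    (by intros; ext; simp) (by intros; ext; simp) (by intros; ext; simp) (by intros; ext; simp)

lemma piAct_single (act : ∀ j, H →ₗ[k] M j →ₗ[k] M j) (j : J) (h : H) (m : M j) :
    LinearMap.single k (fun j => (M j).carrier) j (act j h m) =
      piAct M act h (LinearMap.single k (fun j => (M j).carrier) j m) := by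
  funext i
  by_cases hi : i = j
  · subst hi; simp [piAct]
  · simp [piAct, hi]

lemma piLcoact_single (j : J) (m : M j) :
    (LinearMap.single k (fun j => (M j).carrier) j).lTensor H ((M j).lcoact m) =
      piLcoact M (LinearMap.single k (fun j => (M j).carrier) j m) := by
  simp only [piLcoact, LinearMap.sum_apply, LinearMap.comp_apply]
  rw [Finset.sum_eq_single j]
  · simp
  · intro i _ hi; simp [hi]
  · simp

lemma piRcoact_single (j : J) (m : M j) :
    (LinearMap.single k (fun j => (M j).carrier) j).rTensor H ((M j).rcoact m) =
      piRcoact M (LinearMap.single k (fun j => (M j).carrier) j m) := by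
  simp only [piRcoact, LinearMap.sum_apply, LinearMap.comp_apply]
  rw [Finset.sum_eq_single j]
  · simp
  · intro i _ hi; simp [hi]
  · simp

lemma proj_piLcoact (j : J) (z : ∀ j, (M j).carrier) :
    (LinearMap.proj j : (∀ j, (M j).carrier) →ₗ[k] _).lTensor H (piLcoact M z) =
      (M j).lcoact (z j) := by
  simp only [piLcoact, LinearMap.sum_apply, LinearMap.comp_apply, map_sum]
  rw [Finset.sum_eq_single j]
  · rw [← LinearMap.comp_apply, ← LinearMap.lTensor_comp, LinearMap.proj_comp_single_same]
    simp
  · intro i _ hi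
    rw [← LinearMap.comp_apply, ← LinearMap.lTensor_comp,
      LinearMap.proj_comp_single_ne k _ _ _ hi.symm]
    simp
  · simp

lemma proj_piRcoact (j : J) (z : ∀ j, (M j).carrier) :
    (LinearMap.proj j : (∀ j, (M j).carrier) →ₗ[k] _).rTensor H (piRcoact M z) =
      (M j).rcoact (z j) := by
  simp only [piRcoact, LinearMap.sum_apply, LinearMap.comp_apply, map_sum]
  rw [Finset.sum_eq_single j]
  · rw [← LinearMap.comp_apply, ← LinearMap.rTensor_comp, LinearMap.proj_comp_single_same]
    simp
  · intro i _ hi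
    rw [← LinearMap.comp_apply, ← LinearMap.rTensor_comp,
      LinearMap.proj_comp_single_ne k _ _ _ hi.symm]
    simp
  · simp

/-- The data underlying a finite product (= direct sum). -/
def piData : HopfData k H where
  carrier := ∀ j, M j
  lact := piAct M fun j => (M j).lact
  ract := piAct M fun j => (M j).ract
  lcoact := piLcoact M
  rcoact := piRcoact M

lemma isHom_single (j : J) :
    IsHom (M j).toHopfData (piData M) (LinearMap.single k (fun j => (M j).carrier) j) where
  lact h m := piAct_single M (fun j => (M j).lact) j h m
  ract h m := piAct_single M (fun j => (M j).ract) j h m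
  lcoact m := piLcoact_single M j m
  rcoact m := piRcoact_single M j m

lemma mem_iSup_single (n : ∀ j, (M j).carrier) :
    n ∈ ⨆ j, LinearMap.range (LinearMap.single k (fun j => (M j).carrier) j) := by
  have : n = ∑ j, LinearMap.single k (fun j => (M j).carrier) j (n j) := by
    simpa using (Finset.univ_sum_single n).symm
  rw [this]
  exact Submodule.sum_mem _ fun j _ => Submodule.mem_iSup_of_mem j ⟨n j, rfl⟩

/-- The product (= direct sum) of a finite family of Hopf bimodules. -/
def pi : HopfBimod k H where
  toHopfData := piData M
  isHopf := isHopf_of_surjective _ _ (isHom_single M) (fun j => (M j).isHopf) (mem_iSup_single M)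

/-- Inclusion of a factor. -/
def incl (j : J) : M j ⟶ pi M := mkHom _ (isHom_single M j)

lemma incl_apply (j : J) (m : M j) : lin (incl M j) m = Pi.single j m := rfl

/-- Projection to a factor. -/
def proj (j : J) : pi M ⟶ M j := mkHom (M := pi M) (LinearMap.proj j)
  { lact := fun _ _ => rfl
    ract := fun _ _ => rfl
    lcoact := fun m => proj_piLcoact M j m
    rcoact := fun m => proj_piRcoact M j m }

@[simp] lemma proj_apply (j : J) (z : pi M) : lin (proj M j) z = z j := rfl

variable {M} in
/-- The morphism into a product with given components. -/
def lift {N : HopfBimod k H} (f : ∀ j, N ⟶ M j) : N ⟶ pi M := ∑ j, f j ≫ incl M j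

@[simp] lemma lift_apply {N : HopfBimod k H} (f : ∀ j, N ⟶ M j) (n : N) (j : J) :
    lin (lift f) n j = lin (f j) n := by
  simp only [lift, lin_sum, lin_comp, incl_apply]
  erw [Finset.sum_apply]
  rw [Finset.sum_eq_single j]
  · simp
  · intro i _ hi; exact Pi.single_eq_of_ne hi.symm _
  · simp

end Pi
/-! ### Quotients, kernels and homology -/

section Quotient

variable (M : HopfBimod k H) (W : Submodule k M)
  (hl : ∀ h, ∀ m ∈ W, M.lact h m ∈ W) (hr : ∀ h, ∀ m ∈ W, M.ract h m ∈ W)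
  (hlc : ∀ m ∈ W, W.mkQ.lTensor H (M.lcoact m) = 0)
  (hrc : ∀ m ∈ W, W.mkQ.rTensor H (M.rcoact m) = 0)

/-- The action induced on a quotient. -/
def quotAct (act : H →ₗ[k] M →ₗ[k] M) (ha : ∀ h, ∀ m ∈ W, act h m ∈ W) :
    H →ₗ[k] (M ⧸ W) →ₗ[k] (M ⧸ W) where
  toFun h := W.mapQ W (act h) (ha h)
  map_add' a b := by ext; simp
  map_smul' c a := by ext; simp

/-- The data underlying a quotient by a sub-Hopf bimodule. -/
def quotData : HopfData k H where
  carrier := M ⧸ W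
  lact := quotAct M W M.lact hl
  ract := quotAct M W M.ract hr
  lcoact := W.liftQ (W.mkQ.lTensor H ∘ₗ M.lcoact) hlc
  rcoact := W.liftQ (W.mkQ.rTensor H ∘ₗ M.rcoact) hrc

lemma isHom_mkQ : IsHom M.toHopfData (quotData M W hl hr hlc hrc) W.mkQ where
  lact _ _ := rfl
  ract _ _ := rfl
  lcoact _ := rfl
  rcoact _ := rfl

/-- The quotient of a Hopf bimodule by a subspace stable under the actions and coactions. -/
def quot : HopfBimod k H where
  toHopfData := quotData M W hl hr hlc hrc
  isHopf := isHopf_of_surjective (J := Unit) (fun _ => M.toHopfData) (fun _ => W.mkQ)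
    (fun _ => isHom_mkQ M W hl hr hlc hrc) (fun _ => M.isHopf) (fun n => by
      obtain ⟨m, rfl⟩ := W.mkQ_surjective n
      exact Submodule.mem_iSup_of_mem () ⟨m, rfl⟩)

/-- The projection to the quotient. -/
def quotMk : M ⟶ quot M W hl hr hlc hrc := mkHom (N := quot M W hl hr hlc hrc) W.mkQ
  (isHom_mkQ M W hl hr hlc hrc)

lemma quotMk_surjective : Function.Surjective (lin (quotMk M W hl hr hlc hrc)) :=
  W.mkQ_surjective

lemma quotMk_eq_zero {m : M} : lin (quotMk M W hl hr hlc hrc) m = 0 ↔ m ∈ W :=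
  Submodule.Quotient.mk_eq_zero W

/-- A morphism out of a quotient. -/
def quotDesc {N : HopfBimod k H} (f : M ⟶ N) (hf : ∀ m ∈ W, lin f m = 0) :
    quot M W hl hr hlc hrc ⟶ N :=
  mkHom (M := quot M W hl hr hlc hrc) (W.liftQ (lin f) hf)
    { lact := fun h x => by
        obtain ⟨m, rfl⟩ := W.mkQ_surjective x
        exact (isHom f).lact h m
      ract := fun h x => by
        obtain ⟨m, rfl⟩ := W.mkQ_surjective x
        exact (isHom f).ract h m
      lcoact := fun x => by
        obtain ⟨m, rfl⟩ := W.mkQ_surjective x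
        refine Eq.trans ?_ ((isHom f).lcoact m)
        change (W.liftQ (lin f) hf).lTensor H (W.mkQ.lTensor H (M.lcoact m)) = _
        rw [← LinearMap.comp_apply, ← LinearMap.lTensor_comp]
        rfl
      rcoact := fun x => by
        obtain ⟨m, rfl⟩ := W.mkQ_surjective x
        refine Eq.trans ?_ ((isHom f).rcoact m)
        change (W.liftQ (lin f) hf).rTensor H (W.mkQ.rTensor H (M.rcoact m)) = _
        rw [← LinearMap.comp_apply, ← LinearMap.rTensor_comp]
        rfl }

@[simp] lemma quotDesc_mk {N : HopfBimod k H} (f : M ⟶ N) (hf : ∀ m ∈ W, lin f m = 0) (m : M) :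
    lin (quotDesc M W hl hr hlc hrc f hf) (lin (quotMk M W hl hr hlc hrc) m) = lin f m := rfl

end Quotient

section Kernel

variable {M N : HopfBimod k H} (g : M ⟶ N)

/-- A linear retraction onto the kernel. -/
def kerRetr : M →ₗ[k] LinearMap.ker (lin g) :=
  ((LinearMap.ker (lin g)).subtype.exists_leftInverse_of_injective (Submodule.ker_subtype _)).choose

lemma kerRetr_comp : kerRetr g ∘ₗ (LinearMap.ker (lin g)).subtype = LinearMap.id :=
  ((LinearMap.ker (lin g)).subtype.exists_leftInverse_of_injective
    (Submodule.ker_subtype _)).choose_spec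

/-- The data underlying the kernel.  The coactions are the restrictions of those of `M`. -/
def kerData : HopfData k H where
  carrier := LinearMap.ker (lin g)
  lact :=
    { toFun := fun h => (M.lact h).restrict (fun m hm => by
        rw [LinearMap.mem_ker] at hm ⊢
        rw [(isHom g).lact, hm, map_zero])
      map_add' := fun a b => by ext; simp
      map_smul' := fun a b => by ext; simp }
  ract :=
    { toFun := fun h => (M.ract h).restrict (fun m hm => by
        rw [LinearMap.mem_ker] at hm ⊢
        rw [(isHom g).ract, hm, map_zero])
      map_add' := fun a b => by ext; simp
      map_smul' := fun a b => by ext; simp }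
  lcoact := (kerRetr g).lTensor H ∘ₗ M.lcoact ∘ₗ (LinearMap.ker (lin g)).subtype
  rcoact := (kerRetr g).rTensor H ∘ₗ M.rcoact ∘ₗ (LinearMap.ker (lin g)).subtype

lemma ker_lcoact (m : LinearMap.ker (lin g)) :
    (LinearMap.ker (lin g)).subtype.lTensor H ((kerRetr g).lTensor H (M.lcoact m.1)) =
      M.lcoact m.1 := by
  have hex : Function.Exact (LinearMap.ker (lin g)).subtype (lin g) :=
    LinearMap.exact_subtype_ker_map _
  obtain ⟨y, hy⟩ := (Module.Flat.lTensor_exact H hex (M.lcoact m.1)).1 (by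
    rw [(isHom g).lcoact, m.2, map_zero])
  rw [← hy, ← LinearMap.comp_apply ((kerRetr g).lTensor H), ← LinearMap.lTensor_comp, kerRetr_comp]
  simp

lemma ker_rcoact (m : LinearMap.ker (lin g)) :
    (LinearMap.ker (lin g)).subtype.rTensor H ((kerRetr g).rTensor H (M.rcoact m.1)) =
      M.rcoact m.1 := by
  have hex : Function.Exact (LinearMap.ker (lin g)).subtype (lin g) :=
    LinearMap.exact_subtype_ker_map _
  obtain ⟨y, hy⟩ := (Module.Flat.rTensor_exact H hex (M.rcoact m.1)).1 (by
    rw [(isHom g).rcoact, m.2, map_zero])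
  rw [← hy, ← LinearMap.comp_apply ((kerRetr g).rTensor H), ← LinearMap.rTensor_comp, kerRetr_comp]
  simp

lemma isHom_kerSubtype : IsHom (kerData g) M.toHopfData (LinearMap.ker (lin g)).subtype where
  lact _ _ := rfl
  ract _ _ := rfl
  lcoact m := ker_lcoact g m
  rcoact m := ker_rcoact g m

/-- The kernel of a morphism of Hopf bimodules. -/
def ker : HopfBimod k H where
  toHopfData := kerData g
  isHopf := (isHom_kerSubtype g).isHopf_of_injective Subtype.val_injective M.isHopf

/-- The inclusion of the kernel. -/
def kerι : ker g ⟶ M := mkHom (M := ker g) _ (isHom_kerSubtype g)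

lemma kerι_injective : Function.Injective (lin (kerι g)) := Subtype.val_injective

@[simp] lemma lin_kerι (m : ker g) : lin g (lin (kerι g) m) = 0 := m.2

/-- A morphism into the kernel. -/
def kerLift {P : HopfBimod k H} (f : P ⟶ M) (hf : f ≫ g = 0) : P ⟶ ker g :=
  have hi := kerι_injective g
  let φ : P →ₗ[k] (ker g) := (lin f).codRestrict (LinearMap.ker (lin g))
    (fun p => congrArg (fun φ : P ⟶ N => lin φ p) hf)
  have hφ : lin (kerι g) ∘ₗ φ = lin f := rfl
  mkHom φ
    { lact := fun h p => hi ((isHom f).lact h p)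
      ract := fun h p => hi ((isHom f).ract h p)
      lcoact := fun p => Module.Flat.lTensor_preserves_injective_linearMap (M := H) _ hi (by
        rw [← LinearMap.comp_apply, ← LinearMap.lTensor_comp, hφ, (isHom f).lcoact,
          (isHom (kerι g)).lcoact]
        rfl)
      rcoact := fun p => Module.Flat.rTensor_preserves_injective_linearMap (M := H) _ hi (by
        rw [← LinearMap.comp_apply, ← LinearMap.rTensor_comp, hφ, (isHom f).rcoact,
          (isHom (kerι g)).rcoact]
        rfl) }

@[simp] lemma kerι_kerLift {P : HopfBimod k H} (f : P ⟶ M) (hf : f ≫ g = 0) (p : P) :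
    lin (kerι g) (lin (kerLift g f hf) p) = lin f p := rfl

end Kernel

section Homology

variable {A B C : HopfBimod k H} (f : A ⟶ B) (g : B ⟶ C) (w : f ≫ g = 0)

/-- The homology `ker g / im f` of a pair of composable morphisms with `g ∘ f = 0`. -/
def homology : HopfBimod k H :=
  quot (ker g) (LinearMap.range (lin (kerLift g f w)))
    (by rintro h _ ⟨a, rfl⟩; exact ⟨_, (isHom (kerLift g f w)).lact h a⟩)
    (by rintro h _ ⟨a, rfl⟩; exact ⟨_, (isHom (kerLift g f w)).ract h a⟩)
    (by
      rintro _ ⟨a, rfl⟩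
      rw [← (isHom (kerLift g f w)).lcoact, ← LinearMap.comp_apply, ← LinearMap.lTensor_comp,
        LinearMap.range_mkQ_comp]
      simp)
    (by
      rintro _ ⟨a, rfl⟩
      rw [← (isHom (kerLift g f w)).rcoact, ← LinearMap.comp_apply, ← LinearMap.rTensor_comp,
        LinearMap.range_mkQ_comp]
      simp)

/-- The class of a cycle. -/
def homologyπ : ker g ⟶ homology f g w := quotMk _ _ _ _ _ _

lemma homologyπ_surjective : Function.Surjective (lin (homologyπ f g w)) :=
  quotMk_surjective _ _ _ _ _ _

lemma homologyπ_eq_zero {z : ker g} :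
    lin (homologyπ f g w) z = 0 ↔ ∃ a, lin f a = lin (kerι g) z := by
  refine (quotMk_eq_zero _ _ _ _ _ _).trans ⟨?_, ?_⟩
  · rintro ⟨a, rfl⟩; exact ⟨a, rfl⟩
  · rintro ⟨a, ha⟩; exact ⟨a, kerι_injective g ha⟩

/-- A morphism out of the homology. -/
def homologyDesc {P : HopfBimod k H} (φ : ker g ⟶ P) (hφ : kerLift g f w ≫ φ = 0) :
    homology f g w ⟶ P :=
  quotDesc _ _ _ _ _ _ φ (by
    rintro _ ⟨a, rfl⟩; exact congrArg (fun φ : A ⟶ P => lin φ a) hφ)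

@[simp] lemma homologyDesc_π {P : HopfBimod k H} (φ : ker g ⟶ P) (hφ) (z : ker g) :
    lin (homologyDesc f g w φ hφ) (lin (homologyπ f g w) z) = lin φ z := rfl

end Homology
/-! ### The tensor product over `k` (regular actions, codiagonal coactions) and over `H` -/

section Codiag

variable (V W : Type v) [AddCommGroup V] [Module k V] [AddCommGroup W] [Module k W]

/-- `(a ⊗ v) ⊗ (b ⊗ w) ↦ ab ⊗ (v ⊗ w)`. -/
def codiagL : (H ⊗[k] V) ⊗[k] (H ⊗[k] W) →ₗ[k] H ⊗[k] (V ⊗[k] W) :=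
  (LinearMap.mul' k H).rTensor (V ⊗[k] W) ∘ₗ
    (TensorProduct.tensorTensorTensorComm k H V H W).toLinearMap

/-- `(v ⊗ a) ⊗ (w ⊗ b) ↦ (v ⊗ w) ⊗ ab`. -/
def codiagR : (V ⊗[k] H) ⊗[k] (W ⊗[k] H) →ₗ[k] (V ⊗[k] W) ⊗[k] H :=
  (LinearMap.mul' k H).lTensor (V ⊗[k] W) ∘ₗ
    (TensorProduct.tensorTensorTensorComm k V H W H).toLinearMap

variable {V W}

@[simp] lemma codiagL_tmul (a b : H) (v : V) (w : W) :
    codiagL V W ((a ⊗ₜ[k] v) ⊗ₜ[k] (b ⊗ₜ[k] w)) = (a * b) ⊗ₜ (v ⊗ₜ w) := by simp [codiagL]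

@[simp] lemma codiagR_tmul (a b : H) (v : V) (w : W) :
    codiagR V W ((v ⊗ₜ[k] a) ⊗ₜ[k] (w ⊗ₜ[k] b)) = (v ⊗ₜ w) ⊗ₜ (a * b) := by simp [codiagR]

end Codiag

section TensorK

variable (M N : HopfBimod k H)

/-- `h (m ⊗ n) = hm ⊗ n`. -/
def tKlact : H →ₗ[k] (M ⊗[k] N) →ₗ[k] (M ⊗[k] N) := LinearMap.rTensorHom N.carrier ∘ₗ M.lact

/-- `(m ⊗ n) h = m ⊗ nh`. -/
def tKract : H →ₗ[k] (M ⊗[k] N) →ₗ[k] (M ⊗[k] N) := LinearMap.lTensorHom M.carrier ∘ₗ N.ract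

/-- `m ⊗ n ↦ m₍₋₁₎ n₍₋₁₎ ⊗ (m₍₀₎ ⊗ n₍₀₎)`. -/
def tKlcoact : (M ⊗[k] N) →ₗ[k] H ⊗[k] (M ⊗[k] N) :=
  codiagL M N ∘ₗ TensorProduct.map M.lcoact N.lcoact

/-- `m ⊗ n ↦ (m₍₀₎ ⊗ n₍₀₎) ⊗ m₍₁₎ n₍₁₎`. -/
def tKrcoact : (M ⊗[k] N) →ₗ[k] (M ⊗[k] N) ⊗[k] H :=
  codiagR M N ∘ₗ TensorProduct.map M.rcoact N.rcoact

variable {M N} in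
@[simp] lemma tKlact_tmul (h : H) (m : M) (n : N) :
    tKlact M N h (m ⊗ₜ n) = M.lact h m ⊗ₜ n := rfl

variable {M N} in
@[simp] lemma tKract_tmul (h : H) (m : M) (n : N) :
    tKract M N h (m ⊗ₜ n) = m ⊗ₜ N.ract h n := rfl

/-- The data underlying `M ⊗ N` over `k`: the actions are the regular ones,
`h (m ⊗ n) = hm ⊗ n` and `(m ⊗ n) h = m ⊗ nh`, and the coactions are codiagonal. -/
def tensorKData : HopfData k H where
  carrier := M ⊗[k] N
  lact := tKlact M N
  ract := tKract M N
  lcoact := tKlcoact M N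
  rcoact := tKrcoact M N

lemma tK_ext {P : Type v} [AddCommGroup P] [Module k P] {φ ψ : (M ⊗[k] N) →ₗ[k] P}
    (h : ∀ m n, φ (m ⊗ₜ n) = ψ (m ⊗ₜ n)) (x) : φ x = ψ x := by
  rw [TensorProduct.ext' h]

lemma lcoassoc_aux (x : H ⊗[k] M) (y : H ⊗[k] N) :
    TensorProduct.assoc k H H (M ⊗[k] N) (Coalgebra.comul.rTensor (M ⊗[k] N)
      (codiagL M N (x ⊗ₜ y))) =
    (codiagL M N).lTensor H (codiagL (H ⊗[k] M) (H ⊗[k] N)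
      (TensorProduct.assoc k H H M (Coalgebra.comul.rTensor M x) ⊗ₜ
        TensorProduct.assoc k H H N (Coalgebra.comul.rTensor N y))) := by
  induction x using TensorProduct.induction_on with
  | zero => simp
  | add x x' hx hx' => simp only [TensorProduct.add_tmul, map_add, hx, hx']
  | tmul a m =>
  induction y using TensorProduct.induction_on with
  | zero => simp
  | add x x' hx hx' => simp only [TensorProduct.tmul_add, map_add, hx, hx']
  | tmul b n =>
  simp only [codiagL_tmul, LinearMap.rTensor_tmul, Bialgebra.comul_mul]
  generalize (Coalgebra.comul a : H ⊗[k] H) = s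
  generalize (Coalgebra.comul b : H ⊗[k] H) = t
  induction s using TensorProduct.induction_on with
  | zero => simp
  | add x x' hx hx' => simp only [TensorProduct.add_tmul, map_add, add_mul, hx, hx']
  | tmul c d =>
  induction t using TensorProduct.induction_on with
  | zero => simp
  | add x x' hx hx' =>
    simp only [TensorProduct.add_tmul, TensorProduct.tmul_add, map_add, mul_add, hx, hx']
  | tmul c' d' => simp

lemma rcoassoc_aux (x : M ⊗[k] H) (y : N ⊗[k] H) :
    Coalgebra.comul.lTensor (M ⊗[k] N) (codiagR M N (x ⊗ₜ y)) =
    TensorProduct.assoc k (M ⊗[k] N) H H ((codiagR M N).rTensor H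
      (codiagR (M ⊗[k] H) (N ⊗[k] H)
      ((TensorProduct.assoc k M H H).symm (Coalgebra.comul.lTensor M x) ⊗ₜ
        (TensorProduct.assoc k N H H).symm (Coalgebra.comul.lTensor N y)))) := by
  induction x using TensorProduct.induction_on with
  | zero => simp
  | add x x' hx hx' => simp only [TensorProduct.add_tmul, map_add, hx, hx']
  | tmul m a =>
  induction y using TensorProduct.induction_on with
  | zero => simp
  | add x x' hx hx' => simp only [TensorProduct.tmul_add, map_add, hx, hx']
  | tmul n b =>
  simp only [codiagR_tmul, LinearMap.lTensor_tmul, Bialgebra.comul_mul]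
  generalize (Coalgebra.comul a : H ⊗[k] H) = s
  generalize (Coalgebra.comul b : H ⊗[k] H) = t
  induction s using TensorProduct.induction_on with
  | zero => simp
  | add x x' hx hx' =>
    simp only [TensorProduct.add_tmul, TensorProduct.tmul_add, map_add, add_mul, hx, hx']
  | tmul c d =>
  induction t using TensorProduct.induction_on with
  | zero => simp
  | add x x' hx hx' =>
    simp only [TensorProduct.tmul_add, map_add, mul_add, hx, hx']
  | tmul c' d' => simp

lemma lrcoassoc_aux (x : M ⊗[k] H) (y : N ⊗[k] H) :
    TensorProduct.assoc k H (M ⊗[k] N) H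
      ((codiagL M N ∘ₗ TensorProduct.map M.lcoact N.lcoact).rTensor H (codiagR M N (x ⊗ₜ y))) =
    (codiagR M N).lTensor H (codiagL (M ⊗[k] H) (N ⊗[k] H)
      (TensorProduct.assoc k H M H (M.lcoact.rTensor H x) ⊗ₜ
        TensorProduct.assoc k H N H (N.lcoact.rTensor H y))) := by
  induction x using TensorProduct.induction_on with
  | zero => simp
  | add x x' hx hx' => simp only [TensorProduct.add_tmul, map_add, hx, hx']
  | tmul m a =>
  induction y using TensorProduct.induction_on with
  | zero => simp
  | add x x' hx hx' => simp only [TensorProduct.tmul_add, map_add, hx, hx']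
  | tmul n b =>
  simp only [codiagR_tmul, LinearMap.rTensor_tmul, LinearMap.comp_apply, TensorProduct.map_tmul]
  generalize M.lcoact m = s
  generalize N.lcoact n = t
  induction s using TensorProduct.induction_on with
  | zero => simp
  | add x x' hx hx' => simp only [TensorProduct.add_tmul, map_add, hx, hx']
  | tmul c d =>
  induction t using TensorProduct.induction_on with
  | zero => simp
  | add x x' hx hx' =>
    simp only [TensorProduct.add_tmul, TensorProduct.tmul_add, map_add, hx, hx']
  | tmul c' d' => simp

lemma map_codiagL {V W V' W' : Type v} [AddCommGroup V] [Module k V] [AddCommGroup W]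
    [Module k W] [AddCommGroup V'] [Module k V'] [AddCommGroup W'] [Module k W']
    (f : V →ₗ[k] V') (g : W →ₗ[k] W') (x : H ⊗[k] V) (y : H ⊗[k] W) :
    (TensorProduct.map f g).lTensor H (codiagL V W (x ⊗ₜ y)) =
      codiagL V' W' (f.lTensor H x ⊗ₜ g.lTensor H y) := by
  induction x using TensorProduct.induction_on with
  | zero => simp
  | add x x' hx hx' => simp only [TensorProduct.add_tmul, map_add, hx, hx']
  | tmul a m =>
  induction y using TensorProduct.induction_on with
  | zero => simp
  | add x x' hx hx' => simp only [TensorProduct.tmul_add, map_add, hx, hx']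
  | tmul b n => simp

lemma map_codiagR {V W V' W' : Type v} [AddCommGroup V] [Module k V] [AddCommGroup W]
    [Module k W] [AddCommGroup V'] [Module k V'] [AddCommGroup W'] [Module k W']
    (f : V →ₗ[k] V') (g : W →ₗ[k] W') (x : V ⊗[k] H) (y : W ⊗[k] H) :
    (TensorProduct.map f g).rTensor H (codiagR V W (x ⊗ₜ y)) =
      codiagR V' W' (f.rTensor H x ⊗ₜ g.rTensor H y) := by
  induction x using TensorProduct.induction_on with
  | zero => simp
  | add x x' hx hx' => simp only [TensorProduct.add_tmul, map_add, hx, hx']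
  | tmul a m =>
  induction y using TensorProduct.induction_on with
  | zero => simp
  | add x x' hx hx' => simp only [TensorProduct.tmul_add, map_add, hx, hx']
  | tmul b n => simp

/-- The left action on the left factor of a codiagonal tensor. -/
lemma codiagL_lact (h : H) (x : H ⊗[k] M) (y : H ⊗[k] N) :
    codiagL M N (diagAct k H (LinearMap.mul k H) M.lact h x ⊗ₜ y) =
      diagAct k H (LinearMap.mul k H) (tKlact M N) h (codiagL M N (x ⊗ₜ y)) := by
  simp only [diagAct, LinearMap.comp_apply]
  generalize (Coalgebra.comul h : H ⊗[k] H) = s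
  induction x using TensorProduct.induction_on with
  | zero => simp
  | add x x' hx hx' => simp only [TensorProduct.add_tmul, map_add, hx, hx']
  | tmul a m =>
  induction y using TensorProduct.induction_on with
  | zero => simp
  | add x x' hx hx' => simp only [TensorProduct.tmul_add, map_add, hx, hx']
  | tmul b n =>
  induction s using TensorProduct.induction_on with
  | zero => simp
  | add x x' hx hx' => simp only [TensorProduct.add_tmul, map_add, LinearMap.add_apply, hx, hx']
  | tmul c d => simp [mul_assoc]

lemma codiagL_ract (h : H) (x : H ⊗[k] M) (y : H ⊗[k] N) :
    codiagL M N (x ⊗ₜ diagAct k H (LinearMap.mul k H).flip N.ract h y) =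
      diagAct k H (LinearMap.mul k H).flip (tKract M N) h (codiagL M N (x ⊗ₜ y)) := by
  simp only [diagAct, LinearMap.comp_apply]
  generalize (Coalgebra.comul h : H ⊗[k] H) = s
  induction x using TensorProduct.induction_on with
  | zero => simp
  | add x x' hx hx' => simp only [TensorProduct.add_tmul, map_add, hx, hx']
  | tmul a m =>
  induction y using TensorProduct.induction_on with
  | zero => simp
  | add x x' hx hx' => simp only [TensorProduct.tmul_add, map_add, hx, hx']
  | tmul b n =>
  induction s using TensorProduct.induction_on with
  | zero => simp
  | add x x' hx hx' => simp only [TensorProduct.tmul_add, map_add, LinearMap.add_apply, hx, hx']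
  | tmul c d => simp [mul_assoc]

lemma codiagR_lact (h : H) (x : M ⊗[k] H) (y : N ⊗[k] H) :
    codiagR M N (diagAct k H M.lact (LinearMap.mul k H) h x ⊗ₜ y) =
      diagAct k H (tKlact M N) (LinearMap.mul k H) h (codiagR M N (x ⊗ₜ y)) := by
  simp only [diagAct, LinearMap.comp_apply]
  generalize (Coalgebra.comul h : H ⊗[k] H) = s
  induction x using TensorProduct.induction_on with
  | zero => simp
  | add x x' hx hx' => simp only [TensorProduct.add_tmul, map_add, hx, hx']
  | tmul a m =>
  induction y using TensorProduct.induction_on with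
  | zero => simp
  | add x x' hx hx' => simp only [TensorProduct.tmul_add, map_add, hx, hx']
  | tmul b n =>
  induction s using TensorProduct.induction_on with
  | zero => simp
  | add x x' hx hx' => simp only [TensorProduct.add_tmul, map_add, LinearMap.add_apply, hx, hx']
  | tmul c d => simp [mul_assoc]

lemma codiagR_ract (h : H) (x : M ⊗[k] H) (y : N ⊗[k] H) :
    codiagR M N (x ⊗ₜ diagAct k H N.ract (LinearMap.mul k H).flip h y) =
      diagAct k H (tKract M N) (LinearMap.mul k H).flip h (codiagR M N (x ⊗ₜ y)) := by
  simp only [diagAct, LinearMap.comp_apply]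
  generalize (Coalgebra.comul h : H ⊗[k] H) = s
  induction x using TensorProduct.induction_on with
  | zero => simp
  | add x x' hx hx' => simp only [TensorProduct.add_tmul, map_add, hx, hx']
  | tmul a m =>
  induction y using TensorProduct.induction_on with
  | zero => simp
  | add x x' hx hx' => simp only [TensorProduct.tmul_add, map_add, hx, hx']
  | tmul b n =>
  induction s using TensorProduct.induction_on with
  | zero => simp
  | add x x' hx hx' => simp only [TensorProduct.tmul_add, map_add, LinearMap.add_apply, hx, hx']
  | tmul c d => simp [mul_assoc]

/-- The Hopf bimodule `M ⊗ N` over `k`. -/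
def tensorK : HopfBimod k H where
  toHopfData := tensorKData M N
  isHopf :=
  { lact_one := tK_ext M N (φ := (tKlact M N) 1) (ψ := LinearMap.id)
      fun m n => by simp [M.isHopf.lact_one]
    lact_mul := fun a b => tK_ext M N (φ := (tKlact M N) (a * b))
      (ψ := (tKlact M N) a ∘ₗ (tKlact M N) b)
      fun m n => by simp [M.isHopf.lact_mul]
    ract_one := tK_ext M N (φ := (tKract M N) 1) (ψ := LinearMap.id)
      fun m n => by simp [N.isHopf.ract_one]
    ract_mul := fun a b => tK_ext M N (φ := (tKract M N) (a * b))
      (ψ := (tKract M N) b ∘ₗ (tKract M N) a)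
      fun m n => by simp [N.isHopf.ract_mul]
    lact_ract := fun a b => tK_ext M N (φ := (tKlact M N) a ∘ₗ (tKract M N) b)
      (ψ := (tKract M N) b ∘ₗ (tKlact M N) a)
      fun m n => by simp
    lcounit := tK_ext M N (φ := (TensorProduct.lid k _).toLinearMap ∘ₗ
        Coalgebra.counit.rTensor (M ⊗[k] N) ∘ₗ (tKlcoact M N)) (ψ := LinearMap.id)
      fun m n => by
        have key : ∀ (x : H ⊗[k] M) (y : H ⊗[k] N),
            TensorProduct.lid k _ (Coalgebra.counit.rTensor (M ⊗[k] N) (codiagL M N (x ⊗ₜ y))) =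
            TensorProduct.lid k _ (Coalgebra.counit.rTensor M x) ⊗ₜ
              TensorProduct.lid k _ (Coalgebra.counit.rTensor N y) := by
          intro x y
          induction x using TensorProduct.induction_on with
          | zero => simp
          | add x x' hx hx' => simp only [TensorProduct.add_tmul, map_add, hx, hx']
          | tmul a m =>
          induction y using TensorProduct.induction_on with
          | zero => simp
          | add x x' hx hx' => simp only [TensorProduct.tmul_add, map_add, hx, hx']
          | tmul b n =>
            simp only [codiagL_tmul, LinearMap.rTensor_tmul, TensorProduct.lid_tmul,
              TensorProduct.tmul_smul, ← TensorProduct.smul_tmul', smul_smul,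
              Bialgebra.counit_mul, mul_comm]
        exact (key _ _).trans (by rw [M.isHopf.lcounit, N.isHopf.lcounit]; rfl)
    rcounit := tK_ext M N (φ := (TensorProduct.rid k _).toLinearMap ∘ₗ
        Coalgebra.counit.lTensor (M ⊗[k] N) ∘ₗ (tKrcoact M N)) (ψ := LinearMap.id)
      fun m n => by
        have key : ∀ (x : M ⊗[k] H) (y : N ⊗[k] H),
            TensorProduct.rid k _ (Coalgebra.counit.lTensor (M ⊗[k] N) (codiagR M N (x ⊗ₜ y))) =
            TensorProduct.rid k _ (Coalgebra.counit.lTensor M x) ⊗ₜ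
              TensorProduct.rid k _ (Coalgebra.counit.lTensor N y) := by
          intro x y
          induction x using TensorProduct.induction_on with
          | zero => simp
          | add x x' hx hx' => simp only [TensorProduct.add_tmul, map_add, hx, hx']
          | tmul a m =>
          induction y using TensorProduct.induction_on with
          | zero => simp
          | add x x' hx hx' => simp only [TensorProduct.tmul_add, map_add, hx, hx']
          | tmul b n =>
            simp only [codiagR_tmul, LinearMap.lTensor_tmul, TensorProduct.rid_tmul,
              TensorProduct.tmul_smul, ← TensorProduct.smul_tmul', smul_smul,
              Bialgebra.counit_mul, mul_comm]
        exact (key _ _).trans (by rw [M.isHopf.rcounit, N.isHopf.rcounit]; rfl)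
    lcoassoc := tK_ext M N (φ := (TensorProduct.assoc k H H (M ⊗[k] N)).toLinearMap ∘ₗ
        Coalgebra.comul.rTensor (M ⊗[k] N) ∘ₗ (tKlcoact M N))
        (ψ := (tKlcoact M N).lTensor H ∘ₗ (tKlcoact M N))
      fun m n => by
        refine (lcoassoc_aux M N (M.lcoact m) (N.lcoact n)).trans ?_
        rw [M.isHopf.lcoassoc, N.isHopf.lcoassoc, ← map_codiagL, ← LinearMap.comp_apply,
          ← LinearMap.lTensor_comp]
        rfl
    rcoassoc := tK_ext M N (φ := (TensorProduct.assoc k (M ⊗[k] N) H H).toLinearMap ∘ₗ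
        (tKrcoact M N).rTensor H ∘ₗ (tKrcoact M N))
        (ψ := Coalgebra.comul.lTensor (M ⊗[k] N) ∘ₗ (tKrcoact M N))
      fun m n => by
        refine Eq.trans ?_ (rcoassoc_aux M N (M.rcoact m) (N.rcoact n)).symm
        rw [← M.isHopf.rcoassoc, ← N.isHopf.rcoassoc, LinearEquiv.symm_apply_apply,
          LinearEquiv.symm_apply_apply, ← map_codiagR, ← LinearMap.comp_apply (LinearMap.rTensor _ _),
          ← LinearMap.rTensor_comp]
        rfl
    lcoact_rcoact := tK_ext M N (φ := (TensorProduct.assoc k H (M ⊗[k] N) H).toLinearMap ∘ₗ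
        (tKlcoact M N).rTensor H ∘ₗ (tKrcoact M N))
        (ψ := (tKrcoact M N).lTensor H ∘ₗ (tKlcoact M N))
      fun m n => by
        refine (lrcoassoc_aux M N (M.rcoact m) (N.rcoact n)).trans ?_
        rw [M.isHopf.lcoact_rcoact, N.isHopf.lcoact_rcoact, ← map_codiagL, ← LinearMap.comp_apply,
          ← LinearMap.lTensor_comp]
        rfl
    lcoact_lact := fun h => tK_ext M N (φ := (tKlcoact M N) ∘ₗ (tKlact M N) h)
      (ψ := diagAct k H (LinearMap.mul k H) (tKlact M N) h ∘ₗ (tKlcoact M N))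
      fun m n => by
        refine Eq.trans ?_ (codiagL_lact M N h (M.lcoact m) (N.lcoact n))
        rw [← M.isHopf.lcoact_lact]; rfl
    lcoact_ract := fun h => tK_ext M N (φ := (tKlcoact M N) ∘ₗ (tKract M N) h)
      (ψ := diagAct k H (LinearMap.mul k H).flip (tKract M N) h ∘ₗ
        (tKlcoact M N))
      fun m n => by
        refine Eq.trans ?_ (codiagL_ract M N h (M.lcoact m) (N.lcoact n))
        rw [← N.isHopf.lcoact_ract]; rfl
    rcoact_lact := fun h => tK_ext M N (φ := (tKrcoact M N) ∘ₗ (tKlact M N) h)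
      (ψ := diagAct k H (tKlact M N) (LinearMap.mul k H) h ∘ₗ (tKrcoact M N))
      fun m n => by
        refine Eq.trans ?_ (codiagR_lact M N h (M.rcoact m) (N.rcoact n))
        rw [← M.isHopf.rcoact_lact]; rfl
    rcoact_ract := fun h => tK_ext M N (φ := (tKrcoact M N) ∘ₗ (tKract M N) h)
      (ψ := diagAct k H (tKract M N) (LinearMap.mul k H).flip h ∘ₗ
        (tKrcoact M N))
      fun m n => by
        refine Eq.trans ?_ (codiagR_ract M N h (M.rcoact m) (N.rcoact n))
        rw [← N.isHopf.rcoact_ract]; rfl }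

end TensorK
section TensorH

variable (M N : HopfBimod k H)

/-- The subspace spanned by all `mh ⊗ n - m ⊗ hn`. -/
def balanced : Submodule k (tensorK M N) :=
  Submodule.span k {x : M ⊗[k] N | ∃ m h n, x = M.ract h m ⊗ₜ n - m ⊗ₜ N.lact h n}

lemma balanced_le {W : Submodule k (tensorK M N)}
    (h : ∀ m h n, (M.ract h m ⊗ₜ n - m ⊗ₜ N.lact h n : M ⊗[k] N) ∈ W) : balanced M N ≤ W :=
  Submodule.span_le.2 (by rintro _ ⟨m, a, n, rfl⟩; exact h m a n)

lemma mem_balanced (m : M) (h : H) (n : N) :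
    (M.ract h m ⊗ₜ n - m ⊗ₜ N.lact h n : M ⊗[k] N) ∈ balanced M N :=
  Submodule.subset_span ⟨m, h, n, rfl⟩

lemma balanced_lact (h : H) : ∀ x ∈ balanced M N, (tensorK M N).lact h x ∈ balanced M N := by
  refine balanced_le M N (W := (balanced M N).comap ((tensorK M N).lact h)) fun m a n => ?_
  have : tKlact M N h (M.ract a m ⊗ₜ n - m ⊗ₜ N.lact a n) ∈ balanced M N := by
    rw [map_sub, tKlact_tmul, tKlact_tmul, M.isHopf.lact_ract]
    exact mem_balanced M N _ _ _
  exact this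

lemma balanced_ract (h : H) : ∀ x ∈ balanced M N, (tensorK M N).ract h x ∈ balanced M N := by
  refine balanced_le M N (W := (balanced M N).comap ((tensorK M N).ract h)) fun m a n => ?_
  have : tKract M N h (M.ract a m ⊗ₜ n - m ⊗ₜ N.lact a n) ∈ balanced M N := by
    rw [map_sub, tKract_tmul, tKract_tmul, ← N.isHopf.lact_ract]
    exact mem_balanced M N _ _ _
  exact this

/-- The quotient map, on the tensor product of vector spaces. -/
def balMk : M ⊗[k] N →ₗ[k] (tensorK M N).carrier ⧸ balanced M N := (balanced M N).mkQ

variable {M N} in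
lemma balMk_ract (m : M) (h : H) (n : N) :
    balMk M N (M.ract h m ⊗ₜ n) = balMk M N (m ⊗ₜ N.lact h n) :=
  (Submodule.Quotient.eq _).2 (mem_balanced M N m h n)

lemma balanced_lcoact : ∀ x ∈ balanced M N,
    (balanced M N).mkQ.lTensor H ((tensorK M N).lcoact x) = 0 := by
  refine balanced_le M N
    (W := LinearMap.ker ((balanced M N).mkQ.lTensor H ∘ₗ (tensorK M N).lcoact)) fun m h n => ?_
  suffices h' : (balMk M N).lTensor H (tKlcoact M N (M.ract h m ⊗ₜ n - m ⊗ₜ N.lact h n)) = 0 from h'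
  rw [map_sub, map_sub, sub_eq_zero]
  simp only [tKlcoact, LinearMap.comp_apply, TensorProduct.map_tmul, M.isHopf.lcoact_ract,
    N.isHopf.lcoact_lact, diagAct]
  generalize M.lcoact m = x
  generalize N.lcoact n = y
  generalize (Coalgebra.comul h : H ⊗[k] H) = s
  induction x using TensorProduct.induction_on with
  | zero => simp
  | add x x' hx hx' => simp only [TensorProduct.add_tmul, map_add, hx, hx']
  | tmul a m =>
  induction y using TensorProduct.induction_on with
  | zero => simp
  | add x x' hx hx' => simp only [TensorProduct.tmul_add, map_add, hx, hx']
  | tmul b n =>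
  induction s using TensorProduct.induction_on with
  | zero => simp
  | add x x' hx hx' =>
    simp only [TensorProduct.add_tmul, TensorProduct.tmul_add, map_add, LinearMap.add_apply, hx, hx']
  | tmul c d => simp [mul_assoc, balMk_ract]

lemma balanced_rcoact : ∀ x ∈ balanced M N,
    (balanced M N).mkQ.rTensor H ((tensorK M N).rcoact x) = 0 := by
  refine balanced_le M N
    (W := LinearMap.ker ((balanced M N).mkQ.rTensor H ∘ₗ (tensorK M N).rcoact)) fun m h n => ?_
  suffices h' : (balMk M N).rTensor H (tKrcoact M N (M.ract h m ⊗ₜ n - m ⊗ₜ N.lact h n)) = 0 from h'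
  rw [map_sub, map_sub, sub_eq_zero]
  simp only [tKrcoact, LinearMap.comp_apply, TensorProduct.map_tmul, M.isHopf.rcoact_ract,
    N.isHopf.rcoact_lact, diagAct]
  generalize M.rcoact m = x
  generalize N.rcoact n = y
  generalize (Coalgebra.comul h : H ⊗[k] H) = s
  induction x using TensorProduct.induction_on with
  | zero => simp
  | add x x' hx hx' => simp only [TensorProduct.add_tmul, map_add, hx, hx']
  | tmul a m =>
  induction y using TensorProduct.induction_on with
  | zero => simp
  | add x x' hx hx' => simp only [TensorProduct.tmul_add, map_add, hx, hx']
  | tmul b n =>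
  induction s using TensorProduct.induction_on with
  | zero => simp
  | add x x' hx hx' =>
    simp only [TensorProduct.add_tmul, TensorProduct.tmul_add, map_add, LinearMap.add_apply, hx, hx']
  | tmul c d => simp [mul_assoc, balMk_ract]

/-- The tensor product `M ⊗_H N` of Hopf bimodules, with regular actions and codiagonal
coactions. -/
def tensor : HopfBimod k H :=
  quot (tensorK M N) (balanced M N) (balanced_lact M N) (balanced_ract M N)
    (balanced_lcoact M N) (balanced_rcoact M N)

/-- The projection `M ⊗ N ⟶ M ⊗_H N`. -/
def tensorMk : tensorK M N ⟶ tensor M N := quotMk _ _ _ _ _ _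

/-- The projection `M ⊗ N ⟶ M ⊗_H N` as a linear map. -/
def tmk : M ⊗[k] N →ₗ[k] tensor M N := lin (tensorMk M N)

lemma tmk_surjective : Function.Surjective (tmk M N) := quotMk_surjective _ _ _ _ _ _

variable {M N}

lemma tmk_ract (m : M) (h : H) (n : N) : tmk M N (M.ract h m ⊗ₜ n) = tmk M N (m ⊗ₜ N.lact h n) :=
  balMk_ract m h n

lemma tensor_ext {P : Type v} [AddCommGroup P] [Module k P] {φ ψ : tensor M N →ₗ[k] P}
    (h : ∀ m n, φ (tmk M N (m ⊗ₜ n)) = ψ (tmk M N (m ⊗ₜ n))) (x) : φ x = ψ x := by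
  obtain ⟨x, rfl⟩ := tmk_surjective M N x
  have : φ ∘ₗ tmk M N = ψ ∘ₗ tmk M N := TensorProduct.ext' h
  exact LinearMap.congr_fun this x

/-- A balanced morphism out of `M ⊗ N` factors through `M ⊗_H N`. -/
def tensorDesc {P : HopfBimod k H} (f : tensorK M N ⟶ P)
    (hf : ∀ (m : M) (h : H) (n : N),
      lin f (M.ract h m ⊗ₜ[k] n : M ⊗[k] N) = lin f (m ⊗ₜ[k] N.lact h n : M ⊗[k] N)) :
    tensor M N ⟶ P :=
  quotDesc _ _ _ _ _ _ f (balanced_le M N (W := LinearMap.ker (lin f)) fun m h n => by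
    exact (map_sub (lin f) _ _).trans (sub_eq_zero.2 (hf m h n)))

lemma tensorDesc_tmk {P : HopfBimod k H} (f : tensorK M N ⟶ P) (hf) (x : M ⊗[k] N) :
    lin (tensorDesc f hf) (tmk M N x) = lin f x := rfl

variable {M' N' : HopfBimod k H}

/-- The tensor product over `k` of two morphisms. -/
def tensorKMap (f : M ⟶ M') (g : N ⟶ N') : tensorK M N ⟶ tensorK M' N' :=
  mkHom (M := tensorK M N) (N := tensorK M' N') (TensorProduct.map (lin f) (lin g))
    { lact := fun h => tK_ext M N (φ := TensorProduct.map (lin f) (lin g) ∘ₗ tKlact M N h)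
        (ψ := tKlact M' N' h ∘ₗ TensorProduct.map (lin f) (lin g))
        fun m n => by simp [(isHom f).lact]
      ract := fun h => tK_ext M N (φ := TensorProduct.map (lin f) (lin g) ∘ₗ tKract M N h)
        (ψ := tKract M' N' h ∘ₗ TensorProduct.map (lin f) (lin g))
        fun m n => by simp [(isHom g).ract]
      lcoact := tK_ext M N (φ := (TensorProduct.map (lin f) (lin g)).lTensor H ∘ₗ tKlcoact M N)
        (ψ := tKlcoact M' N' ∘ₗ TensorProduct.map (lin f) (lin g))
        fun m n => by
          simp only [tKlcoact, LinearMap.comp_apply, TensorProduct.map_tmul, map_codiagL,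
            (isHom f).lcoact, (isHom g).lcoact]
      rcoact := tK_ext M N (φ := (TensorProduct.map (lin f) (lin g)).rTensor H ∘ₗ tKrcoact M N)
        (ψ := tKrcoact M' N' ∘ₗ TensorProduct.map (lin f) (lin g))
        fun m n => by
          simp only [tKrcoact, LinearMap.comp_apply, TensorProduct.map_tmul, map_codiagR,
            (isHom f).rcoact, (isHom g).rcoact] }

/-- The tensor product over `H` of two morphisms. -/
def tensorMap (f : M ⟶ M') (g : N ⟶ N') : tensor M N ⟶ tensor M' N' :=
  tensorDesc (tensorKMap f g ≫ tensorMk M' N') fun m h n => by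
    refine Eq.trans (?_ : _ = tmk M' N' (lin f (M.ract h m) ⊗ₜ[k] lin g n)) ?_
    · rfl
    · rw [(isHom f).ract, tmk_ract, ← (isHom g).lact]; rfl

lemma tensorMap_tmk (f : M ⟶ M') (g : N ⟶ N') (x : M ⊗[k] N) :
    lin (tensorMap f g) (tmk M N x) = tmk M' N' (TensorProduct.map (lin f) (lin g) x) := rfl

@[simp] lemma tensorMap_tmul (f : M ⟶ M') (g : N ⟶ N') (m : M) (n : N) :
    lin (tensorMap f g) (tmk M N (m ⊗ₜ n)) = tmk M' N' (lin f m ⊗ₜ lin g n) := rfl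

lemma tensorHom_ext {P : HopfBimod k H} {f g : tensor M N ⟶ P}
    (h : ∀ m n, lin f (tmk M N (m ⊗ₜ n)) = lin g (tmk M N (m ⊗ₜ n))) : f = g :=
  hom_ext (tensor_ext h)

lemma tensorMap_comp {M'' N'' : HopfBimod k H} (f : M ⟶ M') (g : N ⟶ N')
    (f' : M' ⟶ M'') (g' : N' ⟶ N'') :
    tensorMap f g ≫ tensorMap f' g' = tensorMap (f ≫ f') (g ≫ g') :=
  tensorHom_ext fun m n => by simp

lemma lift_codiagL_lact (a : H) (x : H ⊗[k] N) :
    (TensorProduct.lift N.lact).lTensor H (codiagL H N ((Coalgebra.comul a : H ⊗[k] H) ⊗ₜ x)) = diagAct k H (LinearMap.mul k H) N.lact a x := by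
  simp only [diagAct, LinearMap.comp_apply]
  generalize (Coalgebra.comul a : H ⊗[k] H) = s
  induction s using TensorProduct.induction_on with
  | zero => simp
  | add x x' hx hx' => simp only [TensorProduct.add_tmul, map_add, LinearMap.add_apply, hx, hx']
  | tmul c d =>
  induction x using TensorProduct.induction_on with
  | zero => simp
  | add x x' hx hx' => simp only [TensorProduct.tmul_add, map_add, hx, hx']
  | tmul b n => simp

lemma lift_codiagR_lact (a : H) (x : N ⊗[k] H) :
    (TensorProduct.lift N.lact).rTensor H (codiagR H N ((Coalgebra.comul a : H ⊗[k] H) ⊗ₜ x)) = diagAct k H N.lact (LinearMap.mul k H) a x := by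
  simp only [diagAct, LinearMap.comp_apply]
  generalize (Coalgebra.comul a : H ⊗[k] H) = s
  induction s using TensorProduct.induction_on with
  | zero => simp
  | add x x' hx hx' => simp only [TensorProduct.add_tmul, map_add, LinearMap.add_apply, hx, hx']
  | tmul c d =>
  induction x using TensorProduct.induction_on with
  | zero => simp
  | add x x' hx hx' => simp only [TensorProduct.tmul_add, map_add, hx, hx']
  | tmul b n => simp

lemma lift_codiagL_ract (a : H) (x : H ⊗[k] N) :
    (TensorProduct.lift N.ract.flip).lTensor H (codiagL N H (x ⊗ₜ (Coalgebra.comul a : H ⊗[k] H))) = diagAct k H (LinearMap.mul k H).flip N.ract a x := by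
  simp only [diagAct, LinearMap.comp_apply]
  generalize (Coalgebra.comul a : H ⊗[k] H) = s
  induction s using TensorProduct.induction_on with
  | zero => simp
  | add x x' hx hx' => simp only [TensorProduct.tmul_add, map_add, LinearMap.add_apply, hx, hx']
  | tmul c d =>
  induction x using TensorProduct.induction_on with
  | zero => simp
  | add x x' hx hx' => simp only [TensorProduct.add_tmul, map_add, hx, hx']
  | tmul b n => simp

lemma lift_codiagR_ract (a : H) (x : N ⊗[k] H) :
    (TensorProduct.lift N.ract.flip).rTensor H (codiagR N H (x ⊗ₜ (Coalgebra.comul a : H ⊗[k] H))) = diagAct k H N.ract (LinearMap.mul k H).flip a x := by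
  simp only [diagAct, LinearMap.comp_apply]
  generalize (Coalgebra.comul a : H ⊗[k] H) = s
  induction s using TensorProduct.induction_on with
  | zero => simp
  | add x x' hx hx' => simp only [TensorProduct.tmul_add, map_add, LinearMap.add_apply, hx, hx']
  | tmul c d =>
  induction x using TensorProduct.induction_on with
  | zero => simp
  | add x x' hx hx' => simp only [TensorProduct.add_tmul, map_add, hx, hx']
  | tmul b n => simp

variable (N) in
/-- The canonical isomorphism `H ⊗_H N ⟶ N`, `h ⊗ n ↦ hn`. -/
def lunit : tensor (unit k H) N ⟶ N :=
  tensorDesc (mkHom (M := tensorK (unit k H) N) (TensorProduct.lift N.lact)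
    { lact := fun h => tK_ext (unit k H) N
        (φ := TensorProduct.lift N.lact ∘ₗ tKlact (unit k H) N h)
        (ψ := N.lact h ∘ₗ TensorProduct.lift N.lact)
        fun a n => N.isHopf.lact_mul h a n
      ract := fun h => tK_ext (unit k H) N
        (φ := TensorProduct.lift N.lact ∘ₗ tKract (unit k H) N h)
        (ψ := N.ract h ∘ₗ TensorProduct.lift N.lact)
        fun a n => N.isHopf.lact_ract a h n
      lcoact := tK_ext (unit k H) N
        (φ := (TensorProduct.lift N.lact).lTensor H ∘ₗ tKlcoact (unit k H) N)
        (ψ := N.lcoact ∘ₗ TensorProduct.lift N.lact)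
        fun a n => by
          exact (lift_codiagL_lact (H := H) a (N.lcoact n)).trans (N.isHopf.lcoact_lact a n).symm
      rcoact := tK_ext (unit k H) N
        (φ := (TensorProduct.lift N.lact).rTensor H ∘ₗ tKrcoact (unit k H) N)
        (ψ := N.rcoact ∘ₗ TensorProduct.lift N.lact)
        fun a n => by
          exact (lift_codiagR_lact (H := H) a (N.rcoact n)).trans (N.isHopf.rcoact_lact a n).symm })
    fun a h n => N.isHopf.lact_mul a h n

@[simp] lemma lunit_tmul (h : H) (n : N) :
    lin (lunit N) (tmk (unit k H) N (h ⊗ₜ[k] n : (unit k H) ⊗[k] N)) = N.lact h n := rfl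

variable (M) in
/-- The canonical isomorphism `M ⊗_H H ⟶ M`, `m ⊗ h ↦ mh`. -/
def runit : tensor M (unit k H) ⟶ M :=
  tensorDesc (mkHom (M := tensorK M (unit k H)) (TensorProduct.lift M.ract.flip)
    { lact := fun h => tK_ext M (unit k H)
        (φ := TensorProduct.lift M.ract.flip ∘ₗ tKlact M (unit k H) h)
        (ψ := M.lact h ∘ₗ TensorProduct.lift M.ract.flip)
        fun m a => (M.isHopf.lact_ract h a m).symm
      ract := fun h => tK_ext M (unit k H)
        (φ := TensorProduct.lift M.ract.flip ∘ₗ tKract M (unit k H) h)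
        (ψ := M.ract h ∘ₗ TensorProduct.lift M.ract.flip)
        fun m a => M.isHopf.ract_mul a h m
      lcoact := tK_ext M (unit k H)
        (φ := (TensorProduct.lift M.ract.flip).lTensor H ∘ₗ tKlcoact M (unit k H))
        (ψ := M.lcoact ∘ₗ TensorProduct.lift M.ract.flip)
        fun m a => by
          exact (lift_codiagL_ract (H := H) a (M.lcoact m)).trans (M.isHopf.lcoact_ract a m).symm
      rcoact := tK_ext M (unit k H)
        (φ := (TensorProduct.lift M.ract.flip).rTensor H ∘ₗ tKrcoact M (unit k H))
        (ψ := M.rcoact ∘ₗ TensorProduct.lift M.ract.flip)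
        fun m a => by
          exact (lift_codiagR_ract (H := H) a (M.rcoact m)).trans (M.isHopf.rcoact_ract a m).symm })
    fun m h a => (M.isHopf.ract_mul h a m).symm

@[simp] lemma runit_tmul (m : M) (h : H) :
    lin (runit M) (tmk M (unit k H) (m ⊗ₜ[k] h : M ⊗[k] (unit k H))) = M.ract h m := rfl

lemma lunit_bijective : Function.Bijective (lin (lunit N)) := by
  have key : ∀ x, tmk (unit k H) N ((1 : H) ⊗ₜ[k] lin (lunit N) x : (unit k H) ⊗[k] N) = x :=
    tensor_ext (φ := tmk (unit k H) N ∘ₗ TensorProduct.mk k (unit k H) N (1 : H) ∘ₗ lin (lunit N))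
      (ψ := LinearMap.id) fun a n => by
        refine (tmk_ract (M := unit k H) (1 : H) a n).symm.trans ?_
        exact congrArg (fun b : H => tmk (unit k H) N (b ⊗ₜ[k] n : (unit k H) ⊗[k] N))
          (one_mul (M := H) a)
  refine ⟨fun x y hxy => by rw [← key x, ← key y, hxy], fun n => ⟨tmk (unit k H) N
    ((1 : H) ⊗ₜ[k] n : (unit k H) ⊗[k] N), ?_⟩⟩
  rw [lunit_tmul, N.isHopf.lact_one]

lemma runit_bijective : Function.Bijective (lin (runit M)) := by
  have key : ∀ x, tmk M (unit k H) (lin (runit M) x ⊗ₜ[k] (1 : H) : M ⊗[k] (unit k H)) = x :=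
    tensor_ext (φ := tmk M (unit k H) ∘ₗ (TensorProduct.mk k M (unit k H)).flip (1 : H) ∘ₗ
      lin (runit M)) (ψ := LinearMap.id) fun m a => by
        refine (tmk_ract (N := unit k H) m a (1 : H)).trans ?_
        exact congrArg (fun b : H => tmk M (unit k H) (m ⊗ₜ[k] b : M ⊗[k] (unit k H)))
          (mul_one (M := H) a)
  refine ⟨fun x y hxy => by rw [← key x, ← key y, hxy], fun m => ⟨tmk M (unit k H)
    (m ⊗ₜ[k] (1 : H) : M ⊗[k] (unit k H)), ?_⟩⟩
  rw [runit_tmul, M.isHopf.ract_one]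

end TensorH
/-! ### Exactness of `E ⊗_H -` -/

section Flat

/-- `c ⊗ (d ⊗ e) ↦ c S(d) ⊗ e`. -/
def antiK : H ⊗[k] (H ⊗[k] H) →ₗ[k] H ⊗[k] H :=
  (LinearMap.mul' k H).rTensor H ∘ₗ (TensorProduct.assoc k H H H).symm.toLinearMap ∘ₗ
    ((HopfAlgebra.antipode k).rTensor H).lTensor H

@[simp] lemma antiK_tmul (c d e : H) :
    antiK (k := k) (c ⊗ₜ (d ⊗ₜ e)) = (c * HopfAlgebra.antipode k d) ⊗ₜ e := by simp [antiK]

lemma antiK_comul (h : H) :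
    antiK (k := k) (Coalgebra.comul.lTensor H (Coalgebra.comul h)) = 1 ⊗ₜ h := by
  rw [← Coalgebra.coassoc_apply]
  have key : ∀ s : H ⊗[k] H, antiK (k := k) (TensorProduct.assoc k H H H
      (Coalgebra.comul.rTensor H s)) =
      (Algebra.linearMap k H).rTensor H (Coalgebra.counit.rTensor H s) := by
    intro s
    induction s using TensorProduct.induction_on with
    | zero => simp
    | add x y hx hy => simp only [map_add, hx, hy]
    | tmul c d =>
      simp only [LinearMap.rTensor_tmul, Algebra.linearMap_apply,
        ← HopfAlgebra.mul_antipode_lTensor_comul_apply]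
      generalize (Coalgebra.comul c : H ⊗[k] H) = t
      induction t using TensorProduct.induction_on with
      | zero => simp
      | add x y hx hy => simp only [map_add, TensorProduct.add_tmul, hx, hy]
      | tmul a b => simp
  rw [key, Coalgebra.rTensor_counit_comul]
  simp

variable (E : HopfBimod k H)

/-- `e ⊗ (a ⊗ b) ↦ e S(a) ⊗ b`. -/
def twistS : E ⊗[k] (H ⊗[k] H) →ₗ[k] E ⊗[k] H :=
  (TensorProduct.lift E.ract.flip).rTensor H ∘ₗ (TensorProduct.assoc k E H H).symm.toLinearMap ∘ₗ
    ((HopfAlgebra.antipode k).rTensor H).lTensor E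

variable {E} in
@[simp] lemma twistS_tmul (e : E) (a b : H) :
    twistS E (e ⊗ₜ (a ⊗ₜ b)) = E.ract (HopfAlgebra.antipode k a) e ⊗ₜ b := by simp [twistS]

/-- `e ↦ e₍₀₎ S(e₍₁₎) ⊗ e₍₂₎`, a section of the right action. -/
def sect : E →ₗ[k] E ⊗[k] H := twistS E ∘ₗ Coalgebra.comul.lTensor E ∘ₗ E.rcoact

lemma sect_ract (h : H) (e : E) :
    sect E (E.ract h e) = ((LinearMap.mul k H).flip h).lTensor E (sect E e) := by
  simp only [sect, LinearMap.comp_apply, E.isHopf.rcoact_ract]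
  generalize E.rcoact e = x
  induction x using TensorProduct.induction_on with
  | zero => simp
  | add x y hx hy => simp only [map_add, hx, hy]
  | tmul e a =>
  have h1 : ∀ s : H ⊗[k] H, Coalgebra.comul.lTensor E
      (TensorProduct.homTensorHomMap (RingHom.id k) E H E H
        (TensorProduct.map E.ract (LinearMap.mul k H).flip s) (e ⊗ₜ a)) =
      TensorProduct.map (E.ract.flip e) (LinearMap.mul k (H ⊗[k] H) (Coalgebra.comul a))
        (Coalgebra.comul.lTensor H s) := by
    intro s
    induction s using TensorProduct.induction_on with
    | zero => simp
    | add x y hx hy => simp only [map_add, LinearMap.add_apply, hx, hy]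
    | tmul c d => simp
  have h2 : ∀ (p q : H) (u : H ⊗[k] (H ⊗[k] H)),
      twistS E (TensorProduct.map (E.ract.flip e) (LinearMap.mul k (H ⊗[k] H) (p ⊗ₜ q)) u) =
      TensorProduct.map (E.ract (HopfAlgebra.antipode k p) ∘ₗ E.ract.flip e) (LinearMap.mul k H q)
        (antiK u) := by
    intro p q u
    induction u using TensorProduct.induction_on with
    | zero => simp
    | add x y hx hy => simp only [map_add, hx, hy]
    | tmul c v =>
    induction v using TensorProduct.induction_on with
    | zero => simp
    | add x y hx hy => simp only [TensorProduct.tmul_add, map_add, hx, hy]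
    | tmul d d' =>
      simp [HopfAlgebra.antipode_mul_antidistrib, ← E.isHopf.ract_mul, mul_assoc]
  simp only [diagAct, LinearMap.comp_apply, h1, LinearMap.lTensor_tmul]
  generalize (Coalgebra.comul a : H ⊗[k] H) = t
  induction t using TensorProduct.induction_on with
  | zero => simp
  | add x y hx hy =>
    simp only [map_add, TensorProduct.map_add_right, LinearMap.add_apply, TensorProduct.tmul_add,
      hx, hy]
  | tmul p q =>
    rw [h2, antiK_comul]
    simp [E.isHopf.ract_one]

lemma ract_sect (e : E) : TensorProduct.lift E.ract.flip (sect E e) = e := by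
  conv_rhs => rw [← E.isHopf.rcounit e]
  simp only [sect, LinearMap.comp_apply]
  generalize E.rcoact e = x
  induction x using TensorProduct.induction_on with
  | zero => simp
  | add x y hx hy => simp only [map_add, hx, hy]
  | tmul e a =>
  have h1 : ∀ t : H ⊗[k] H, TensorProduct.lift E.ract.flip (twistS E (e ⊗ₜ t)) =
      E.ract (LinearMap.mul' k H ((HopfAlgebra.antipode k).rTensor H t)) e := by
    intro t
    induction t using TensorProduct.induction_on with
    | zero => simp
    | add x y hx hy => simp only [TensorProduct.tmul_add, map_add, LinearMap.add_apply, hx, hy]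
    | tmul p q => simp [E.isHopf.ract_mul]
  rw [LinearMap.lTensor_tmul, h1, HopfAlgebra.mul_antipode_rTensor_comul_apply,
    Algebra.algebraMap_eq_smul_one]
  simp [E.isHopf.ract_one]

variable (N : HopfBimod k H)

/-- `(e ⊗ a) ⊗ n ↦ e ⊗ an`. -/
def actN : (E ⊗[k] H) ⊗[k] N →ₗ[k] E ⊗[k] N :=
  (TensorProduct.lift N.lact).lTensor E ∘ₗ (TensorProduct.assoc k E H N).toLinearMap

variable {E N} in
@[simp] lemma actN_tmul (e : E) (a : H) (n : N) :
    actN E N ((e ⊗ₜ[k] a) ⊗ₜ[k] n) = e ⊗ₜ N.lact a n := by simp [actN]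

/-- A linear section of `E ⊗ N → E ⊗_H N`, natural in `N`: it is `e ⊗ n ↦ e₍₀₎ S(e₍₁₎) ⊗ e₍₂₎ n`. -/
def tsect : tensor E N →ₗ[k] E ⊗[k] N :=
  (balanced E N).liftQ (actN E N ∘ₗ (sect E).rTensor N)
    (balanced_le E N (W := LinearMap.ker (actN E N ∘ₗ (sect E).rTensor N)) fun m h n => by
      refine (map_sub (actN E N ∘ₗ (sect E).rTensor N) _ _).trans (sub_eq_zero.2 ?_)
      simp only [LinearMap.comp_apply, LinearMap.rTensor_tmul, sect_ract]
      generalize sect E m = x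
      induction x using TensorProduct.induction_on with
      | zero => simp
      | add x y hx hy => simp only [TensorProduct.add_tmul, map_add, hx, hy]
      | tmul e a => simp [N.isHopf.lact_mul])

variable {E N}

lemma tsect_tmul (e : E) (n : N) : tsect E N (tmk E N (e ⊗ₜ n)) = actN E N (sect E e ⊗ₜ n) := rfl

lemma tmk_tsect (x : tensor E N) : tmk E N (tsect E N x) = x := by
  refine tensor_ext (φ := tmk E N ∘ₗ tsect E N) (ψ := LinearMap.id) (fun e n => ?_) x
  simp only [LinearMap.comp_apply, tsect_tmul, LinearMap.id_apply]
  have h1 : ∀ y : E ⊗[k] H, tmk E N (actN E N (y ⊗ₜ n)) =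
      tmk E N (TensorProduct.lift E.ract.flip y ⊗ₜ n) := by
    intro y
    induction y using TensorProduct.induction_on with
    | zero => simp
    | add x y hx hy => simp only [TensorProduct.add_tmul, map_add, hx, hy]
    | tmul e a => simp [tmk_ract]
  rw [h1, ract_sect]

lemma tsect_natural {N' : HopfBimod k H} (g : N ⟶ N') (x : tensor E N) :
    tsect E N' (lin (tensorMap (𝟙 E) g) x) = (lin g).lTensor E (tsect E N x) := by
  refine tensor_ext (φ := tsect E N' ∘ₗ lin (tensorMap (𝟙 E) g))
    (ψ := (lin g).lTensor E ∘ₗ tsect E N) (fun e n => ?_) x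
  simp only [LinearMap.comp_apply, tensorMap_tmul, lin_id, tsect_tmul]
  generalize sect E e = y
  induction y using TensorProduct.induction_on with
  | zero => simp
  | add x y hx hy => simp only [TensorProduct.add_tmul, map_add, hx, hy]
  | tmul e a => simp [(isHom g).lact]

/-- Tensoring over `H` with a Hopf bimodule preserves exactness. -/
lemma tensor_exact (E : HopfBimod k H) {A B C : HopfBimod k H} {f : A ⟶ B} {g : B ⟶ C}
    (h : Function.Exact (lin f) (lin g)) :
    Function.Exact (lin (tensorMap (𝟙 E) f)) (lin (tensorMap (𝟙 E) g)) := by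
  intro z
  constructor
  · intro hz
    have h1 : (lin g).lTensor E (tsect E B z) = 0 := by rw [← tsect_natural, hz, map_zero]
    obtain ⟨y, hy⟩ := (Module.Flat.lTensor_exact E h _).1 h1
    refine ⟨tmk E A y, ?_⟩
    rw [tensorMap_tmk, ← tmk_tsect z, ← hy]
    rfl
  · rintro ⟨y, rfl⟩
    refine tensor_ext (φ := lin (tensorMap (𝟙 E) g) ∘ₗ lin (tensorMap (𝟙 E) f)) (ψ := 0)
      (fun e a => ?_) y
    simp [h.apply_apply_eq_zero a]

lemma tensor_surjective (E : HopfBimod k H) {B C : HopfBimod k H} {g : B ⟶ C}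
    (h : Function.Surjective (lin g)) : Function.Surjective (lin (tensorMap (𝟙 E) g)) := by
  intro z
  obtain ⟨x, rfl⟩ := tmk_surjective E C z
  obtain ⟨y, rfl⟩ := LinearMap.lTensor_surjective E h x
  exact ⟨tmk E B y, rfl⟩

end Flat
end HopfBimod

open HopfBimod

/-! ### Extensions -/

variable (k H) in
/-- An `n`-fold extension of `H` by `H` in Hopf bimodules: an exact sequence
`0 → H → X (n-1) → ⋯ → X 0 → H → 0`.  It is written as a complex `X` with `X n` identified with
the left hand `H` by the isomorphism `top`, and with `X i = 0` for `i > n`. -/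
structure HopfExt (n : ℕ) where
  X : ℕ → HopfBimod k H
  d : ∀ i, X (i + 1) ⟶ X i
  top : unit k H ⟶ X n
  aug : X 0 ⟶ unit k H
  top_bijective : Function.Bijective (lin top)
  subsingleton : ∀ i, n < i → Subsingleton (X i)
  aug_surjective : Function.Surjective (lin aug)
  exact_zero : Function.Exact (lin (d 0)) (lin aug)
  exact : ∀ i, Function.Exact (lin (d (i + 1))) (lin (d i))

namespace HopfExt

/-- A morphism of extensions: a morphism of complexes which is the identity on both copies
of `H`. -/
@[ext] structure Hom {n : ℕ} (E F : HopfExt k H n) where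
  f : ∀ i, E.X i ⟶ F.X i
  comm : ∀ i, E.d i ≫ f i = f (i + 1) ≫ F.d i
  top : E.top ≫ f n = F.top
  aug : f 0 ≫ F.aug = E.aug

/-- The category of `n`-fold extensions of `H` by `H`. -/
instance (n : ℕ) : Category (HopfExt k H n) where
  Hom E F := Hom E F
  id E := ⟨fun i => 𝟙 _, by simp, by simp, by simp⟩
  comp φ ψ := ⟨fun i => φ.f i ≫ ψ.f i,
    fun i => by rw [← Category.assoc, φ.comm, Category.assoc, ψ.comm, Category.assoc],
    by rw [← Category.assoc, φ.top, ψ.top], by rw [Category.assoc, ψ.aug, φ.aug]⟩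
  id_comp _ := by apply Hom.ext; funext i; exact Category.id_comp _
  comp_id _ := by apply Hom.ext; funext i; exact Category.comp_id _
  assoc _ _ _ := by apply Hom.ext; funext i; exact Category.assoc _ _ _

@[ext] lemma hom_ext' {n : ℕ} {E F : HopfExt k H n} {φ ψ : E ⟶ F} (h : ∀ i, φ.f i = ψ.f i) :
    φ = ψ := Hom.ext (funext h)

@[simp] lemma id_f {n : ℕ} (E : HopfExt k H n) (i : ℕ) : Hom.f (𝟙 E) i = 𝟙 (E.X i) := rfl
@[simp] lemma comp_f {n : ℕ} {E F G : HopfExt k H n} (φ : E ⟶ F) (ψ : F ⟶ G) (i : ℕ) :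
    Hom.f (φ ≫ ψ) i = φ.f i ≫ ψ.f i := rfl

section Basic

variable {n : ℕ} (E : HopfExt k H n)

@[simp] lemma aug_d (x : E.X 1) : lin E.aug (lin (E.d 0) x) = 0 :=
  E.exact_zero.apply_apply_eq_zero x

@[simp] lemma d_d (i : ℕ) (x : E.X (i + 2)) : lin (E.d i) (lin (E.d (i + 1)) x) = 0 :=
  (E.exact i).apply_apply_eq_zero x

/-- The inverse of the identification of `H` with the last term. -/
def topInv : E.X n ⟶ unit k H := HopfBimod.inv E.top E.top_bijective

lemma neg_one_pow_ne (s : ℕ) : ((-1 : k) ^ s) ≠ 0 := pow_ne_zero _ (neg_ne_zero.2 one_ne_zero)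

lemma neg_one_pow_sq (s : ℕ) : ((-1 : k) ^ s) * ((-1 : k) ^ s) = 1 := by
  rw [← mul_pow]; simp

/-- The extension `(-1)^s E`: the augmentation is multiplied by `(-1)^s`. -/
def twist (s : ℕ) : HopfExt k H n where
  X := E.X
  d := E.d
  top := E.top
  aug := ((-1 : k) ^ s) • E.aug
  top_bijective := E.top_bijective
  subsingleton := E.subsingleton
  aug_surjective h := by
    obtain ⟨x, hx⟩ := E.aug_surjective (((-1 : k) ^ s) • h)
    exact ⟨x, by rw [lin_smul, hx, smul_smul, neg_one_pow_sq, one_smul]⟩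
  exact_zero x := by
    rw [lin_smul, smul_eq_zero_iff_right (neg_one_pow_ne s)]
    exact E.exact_zero x
  exact := E.exact

variable {E} in
/-- `(-1)^s` on morphisms. -/
def twistMap {F : HopfExt k H n} (s : ℕ) (φ : E ⟶ F) : E.twist s ⟶ F.twist s where
  f := φ.f
  comm := φ.comm
  top := φ.top
  aug := hom_ext fun x => by
    have := congrArg (fun g : E.X 0 ⟶ unit k H => lin g x) φ.aug
    exact congrArg (fun y => ((-1 : k) ^ s) • y) this

/-- The identity `(-1)^s (-1)^s E ⟶ E`. -/
def twistTwist (s : ℕ) : (E.twist s).twist s ⟶ E where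
  f i := 𝟙 (E.X i)
  comm i := by simp [twist]
  top := by simp [twist]
  aug := by simp [twist, smul_smul, neg_one_pow_sq]

end Basic

/-! ### The Yoneda product -/

section Splice

/-- The sequence `X 0, …, X (m-1), Y 0, Y 1, …`. -/
def spliceX : ℕ → (ℕ → HopfBimod k H) → (ℕ → HopfBimod k H) → ℕ → HopfBimod k H
  | 0, _, Y => Y
  | m + 1, X, Y => fun
    | 0 => X 0
    | i + 1 => spliceX m (fun j => X (j + 1)) Y i

/-- The differentials of `X 0 ← ⋯ ← X m ← Y 0 ← Y 1 ← ⋯`, where `c : Y 0 ⟶ X m`. -/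
def spliceD : ∀ (m : ℕ) (X Y : ℕ → HopfBimod k H) (_ : ∀ i, X (i + 1) ⟶ X i)
    (_ : ∀ i, Y (i + 1) ⟶ Y i) (_ : Y 0 ⟶ X m) (i : ℕ),
    spliceX (m + 1) X Y (i + 1) ⟶ spliceX (m + 1) X Y i
  | 0, _, _, _, _, c, 0 => c
  | 0, _, _, _, dY, _, i + 1 => dY i
  | _ + 1, _, _, dX, _, _, 0 => dX 0
  | m + 1, X, Y, dX, dY, c, i + 1 =>
    spliceD m (fun j => X (j + 1)) Y (fun j => dX (j + 1)) dY c i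

/-- The inclusion of the term `Y i`, in degree `j = i + m`. -/
def spliceInr : ∀ (m : ℕ) (X Y : ℕ → HopfBimod k H) (i j : ℕ) (_ : i + m = j),
    Y i ⟶ spliceX m X Y j
  | 0, _, Y, i, j, h => eqToHom (congrArg Y (show i = j from h))
  | m + 1, _, _, _, 0, h => absurd h (by omega)
  | m + 1, X, Y, i, j + 1, h => spliceInr m (fun j => X (j + 1)) Y i j (by omega)

/-- A family of morphisms into a spliced sequence. -/
def spliceLift : ∀ (m : ℕ) (X Y T : ℕ → HopfBimod k H) (_ : ∀ i, T i ⟶ X i)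
    (_ : ∀ i j, i + m = j → (T j ⟶ Y i)) (i : ℕ), T i ⟶ spliceX m X Y i
  | 0, _, _, _, _, b, i => b i i rfl
  | _ + 1, _, _, _, a, _, 0 => a 0
  | m + 1, X, Y, T, a, b, i + 1 =>
    spliceLift m (fun j => X (j + 1)) Y (fun j => T (j + 1)) (fun j => a (j + 1))
      (fun i j h => b i (j + 1) (by omega)) i

lemma spliceInr_bijective : ∀ (m : ℕ) (X Y : ℕ → HopfBimod k H) (i j : ℕ) (h : i + m = j),
    Function.Bijective (lin (spliceInr m X Y i j h))
  | 0, _, Y, i, j, h => by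
    have h' : i = j := h
    subst h'
    exact Function.bijective_id
  | m + 1, _, _, _, 0, h => absurd h (by omega)
  | m + 1, X, Y, i, j + 1, h => spliceInr_bijective m (fun j => X (j + 1)) Y i j (by omega)

lemma spliceX_subsingleton {n : ℕ} : ∀ (m : ℕ) (X Y : ℕ → HopfBimod k H)
    (_ : ∀ i, n < i → Subsingleton (Y i)) (j : ℕ) (_ : n + m < j),
    Subsingleton (spliceX m X Y j)
  | 0, _, _, hY, j, h => hY j h
  | m + 1, _, _, _, 0, h => absurd h (by omega)
  | m + 1, X, Y, hY, j + 1, h =>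
    spliceX_subsingleton m (fun j => X (j + 1)) Y hY j (by omega)

lemma splice_exact_aux : ∀ (m : ℕ) (X Y : ℕ → HopfBimod k H) (dX : ∀ i, X (i + 1) ⟶ X i)
    (dY : ∀ i, Y (i + 1) ⟶ Y i) (c : Y 0 ⟶ X m)
    (_ : ∀ i, Function.Exact (lin (dX (i + 1))) (lin (dX i)))
    (_ : ∀ i, Function.Exact (lin (dY (i + 1))) (lin (dY i)))
    (_ : Function.Exact (lin (dY 0)) (lin c))
    (_ : ∀ x, x ∈ Set.range (lin c) ↔ x ∈ Set.range (lin (dX m))),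
    (∀ x, x ∈ Set.range (lin (spliceD m X Y dX dY c 0)) ↔ x ∈ Set.range (lin (dX 0))) ∧
    ∀ i, Function.Exact (lin (spliceD m X Y dX dY c (i + 1))) (lin (spliceD m X Y dX dY c i))
  | 0, _, _, _, _, _, _, hY, hc, hr => ⟨hr, fun
    | 0 => hc
    | i + 1 => hY i⟩
  | m + 1, X, Y, dX, dY, c, hX, hY, hc, hr => by
    have ih := splice_exact_aux m (fun j => X (j + 1)) Y (fun j => dX (j + 1)) dY c
      (fun i => hX (i + 1)) hY hc hr
    exact ⟨fun x => Iff.rfl, fun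
      | 0 => fun x => (hX 0 x).trans (ih.1 x).symm
      | i + 1 => ih.2 i⟩

lemma spliceLift_inr : ∀ (m : ℕ) (X Y T : ℕ → HopfBimod k H) (a : ∀ i, T i ⟶ X i)
    (b : ∀ i j, i + m = j → (T j ⟶ Y i)) (i j : ℕ) (h : i + m = j),
    spliceLift m X Y T a b j = b i j h ≫ spliceInr m X Y i j h
  | 0, _, _, _, _, b, i, j, h => by
    have h' : i = j := h
    subst h'
    exact (Category.comp_id _).symm
  | m + 1, _, _, _, _, _, _, 0, h => absurd h (by omega)
  | m + 1, X, Y, T, a, b, i, j + 1, h =>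
    spliceLift_inr m (fun j => X (j + 1)) Y (fun j => T (j + 1)) (fun j => a (j + 1))
      (fun i j h => b i (j + 1) (by omega)) i j (by omega)

lemma spliceLift_comm : ∀ (m : ℕ) (X Y T : ℕ → HopfBimod k H) (dX : ∀ i, X (i + 1) ⟶ X i)
    (dY : ∀ i, Y (i + 1) ⟶ Y i) (c : Y 0 ⟶ X m) (dT : ∀ i, T (i + 1) ⟶ T i)
    (a : ∀ i, T i ⟶ X i) (b : ∀ i j, i + (m + 1) = j → (T j ⟶ Y i))
    (_ : ∀ i, dT i ≫ a i = a (i + 1) ≫ dX i)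
    (_ : ∀ i j h, dT j ≫ b i j h = b (i + 1) (j + 1) (by omega) ≫ dY i)
    (_ : dT m ≫ a m = b 0 (m + 1) (by omega) ≫ c) (i : ℕ),
    dT i ≫ spliceLift (m + 1) X Y T a b i =
      spliceLift (m + 1) X Y T a b (i + 1) ≫ spliceD m X Y dX dY c i
  | 0, _, _, _, _, _, _, _, _, _, _, _, hc, 0 => hc
  | 0, _, _, _, _, _, _, _, _, _, _, hb, _, i + 1 => hb i (i + 1) rfl
  | _ + 1, _, _, _, _, _, _, _, _, _, ha, _, _, 0 => ha 0
  | m + 1, X, Y, T, dX, dY, c, dT, a, b, ha, hb, hc, i + 1 =>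
    spliceLift_comm m (fun j => X (j + 1)) Y (fun j => T (j + 1)) (fun j => dX (j + 1)) dY c
      (fun j => dT (j + 1)) (fun j => a (j + 1)) (fun i j h => b i (j + 1) (by omega))
      (fun i => ha (i + 1)) (fun i j h => hb i (j + 1) (by omega)) hc i

variable {m n N : ℕ}

/-- The Yoneda product `E # F`, obtained by splicing:
`0 → H → F (n-1) → ⋯ → F 0 → E m → ⋯ → E 0 → H → 0`. -/
def splice (E : HopfExt k H (m + 1)) (F : HopfExt k H n) (h : n + (m + 1) = N) :
    HopfExt k H N :=
  have hE : Function.Injective (lin (E.d m)) := by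
    rw [injective_iff_map_eq_zero]
    intro x hx
    obtain ⟨y, rfl⟩ := (E.exact m x).1 hx
    have := E.subsingleton (m + 2) (by omega)
    rw [Subsingleton.elim y 0, map_zero]
  have aux := splice_exact_aux m E.X F.X E.d F.d (F.aug ≫ E.top ≫ E.d m) E.exact F.exact
    (fun x => by
      rw [← F.exact_zero x]
      simp only [lin_comp]
      rw [map_eq_zero_iff _ hE, map_eq_zero_iff _ E.top_bijective.1])
    (fun x => by
      constructor
      · rintro ⟨y, rfl⟩; exact ⟨_, rfl⟩
      · rintro ⟨y, rfl⟩
        obtain ⟨y, rfl⟩ := E.top_bijective.2 y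
        obtain ⟨y, rfl⟩ := F.aug_surjective y
        exact ⟨y, rfl⟩)
  { X := spliceX (m + 1) E.X F.X
    d := spliceD m E.X F.X E.d F.d (F.aug ≫ E.top ≫ E.d m)
    top := F.top ≫ spliceInr (m + 1) E.X F.X n N h
    aug := E.aug
    top_bijective := (spliceInr_bijective _ _ _ _ _ h).comp F.top_bijective
    subsingleton := fun j hj => spliceX_subsingleton _ _ _ F.subsingleton j (by omega)
    aug_surjective := E.aug_surjective
    exact_zero := fun x => (E.exact_zero x).trans (aux.1 x).symm
    exact := aux.2 }

end Splice
/-! ### The tensor product of two extensions -/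

section Staircase

variable {C : ℕ × ℕ → Type*} [∀ p, AddCommGroup (C p)] [∀ p, Module k (C p)]
  {B : ℕ → Type*} [∀ s, AddCommGroup (B s)] [∀ s, Module k (B s)]

/-- The total complex of a first quadrant bicomplex with exact columns resolving an exact complex
is exact. -/
lemma total_exact (dh : ∀ s t, C (s + 1, t) →ₗ[k] C (s, t)) (dv : ∀ s t, C (s, t + 1) →ₗ[k] C (s, t))
    (ε : ∀ s, C (s, 0) →ₗ[k] B s) (dB : ∀ s, B (s + 1) →ₗ[k] B s)
    (hhv : ∀ s t x, dh s t (dv (s + 1) t x) = dv s t (dh s (t + 1) x))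
    (hv : ∀ s t, Function.Exact (dv s (t + 1)) (dv s t))
    (hε : ∀ s, Function.Exact (dv s 0) (ε s)) (hεs : ∀ s, Function.Surjective (ε s))
    (hεd : ∀ s x, ε s (dh s 0 x) = dB s (ε (s + 1) x))
    (hB : ∀ s, Function.Exact (dB (s + 1)) (dB s)) (r : ℕ) (z : ∀ p, C p)
    (hz : ∀ s t, s + t = r → dh s t (z (s + 1, t)) + (-1 : k) ^ s • dv s t (z (s, t + 1)) = 0)
    (hh : ∀ s t x, dh s t (dh (s + 1) t x) = 0) :
    ∃ w : ∀ p, C p, ∀ s t, s + t = r + 1 →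
      dh s t (w (s + 1, t)) + (-1 : k) ^ s • dv s t (w (s, t + 1)) = z (s, t) := by
  have sq : ∀ (s : ℕ) {p : ℕ × ℕ} (x : C p), (-1 : k) ^ s • (-1 : k) ^ s • x = x := fun s p x => by
    rw [smul_smul, neg_one_pow_sq, one_smul]
  have key : ∀ T, T ≤ r + 1 → ∃ w : ∀ p, C p, ∀ s t, s + t = r + 1 → t ≤ T →
      dh s t (w (s + 1, t)) + (-1 : k) ^ s • dv s t (w (s, t + 1)) = z (s, t) := by
    intro T
    induction T with
    | zero =>
      intro _
      have h1 : dB r (ε (r + 1) (z (r + 1, 0))) = 0 := by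
        rw [← hεd, eq_neg_of_add_eq_zero_left (hz r 0 rfl), map_neg, map_smul,
          (hε r).apply_apply_eq_zero, smul_zero, neg_zero]
      obtain ⟨y, hy⟩ := (hB r _).1 h1
      obtain ⟨c, rfl⟩ := hεs _ y
      have h2 : ε (r + 1) (z (r + 1, 0) - dh (r + 1) 0 c) = 0 := by
        rw [map_sub, hεd, hy, sub_self]
      obtain ⟨b, hb⟩ := (hε _ _).1 h2
      refine ⟨Function.update (Function.update 0 (r + 2, 0) c) (r + 1, 0 + 1) ((-1 : k) ^ (r + 1) • b),
        fun s t hst ht => ?_⟩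
      obtain rfl : t = 0 := by omega
      obtain rfl : s = r + 1 := by omega
      rw [Function.update_of_ne (by simp), Function.update_self]
      rw [Function.update_self, map_smul, sq, hb]
      abel
    | succ T ih =>
      intro hT
      obtain ⟨w, hw⟩ := ih (by omega)
      obtain ⟨s, hs⟩ : ∃ s, s + T = r := ⟨r - T, by omega⟩
      have e1 := hw (s + 1) T (by omega) le_rfl
      have h1 : dv s T (z (s, T + 1) - dh s (T + 1) (w (s + 1, T + 1))) = 0 := by
        have e2 := congrArg (dh s T) e1
        rw [map_add, hh, zero_add, map_smul, hhv, pow_succ, mul_neg_one, neg_smul,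
          eq_neg_of_add_eq_zero_left (hz s T hs), neg_inj] at e2
        have e3 := congrArg (fun x => (-1 : k) ^ s • x) e2
        simp only [sq] at e3
        rw [map_sub, e3, sub_self]
      obtain ⟨b, hb⟩ := (hv _ _ _).1 h1
      refine ⟨Function.update w (s, T + 1 + 1) ((-1 : k) ^ s • b), fun s' t hst ht => ?_⟩
      rcases Nat.lt_or_ge t (T + 1) with h | h
      · rw [Function.update_of_ne (by simp; omega), Function.update_of_ne (by simp; omega)]
        exact hw s' t hst (by omega)
      · obtain rfl : t = T + 1 := by omega
        obtain rfl : s' = s := by omega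
        rw [Function.update_of_ne (by simp)]
        rw [Function.update_self, map_smul, sq, hb]
        abel
  obtain ⟨w, hw⟩ := key (r + 1) le_rfl
  exact ⟨w, fun s t h => hw s t h (by omega)⟩

end Staircase

section Tensor

variable {m n N : ℕ} (E : HopfExt k H m) (F : HopfExt k H n)

/-- The degree `r` term of `E ⊗_H F`. -/
def tensorX (r : ℕ) : HopfBimod k H :=
  pi fun x : {x // x ∈ Finset.HasAntidiagonal.antidiagonal r} => tensor (E.X x.1.1) (F.X x.1.2)

/-- The projection to a summand. -/
def tensorProj {r : ℕ} (s t : ℕ) (h : s + t = r) : tensorX E F r ⟶ tensor (E.X s) (F.X t) :=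
  proj (fun x : {x // x ∈ Finset.HasAntidiagonal.antidiagonal r} => tensor (E.X x.1.1) (F.X x.1.2))
    ⟨(s, t), Finset.HasAntidiagonal.mem_antidiagonal.2 h⟩

/-- The inclusion of a summand. -/
def tensorIncl {r : ℕ} (s t : ℕ) (h : s + t = r) : tensor (E.X s) (F.X t) ⟶ tensorX E F r :=
  incl (fun x : {x // x ∈ Finset.HasAntidiagonal.antidiagonal r} => tensor (E.X x.1.1) (F.X x.1.2))
    ⟨(s, t), Finset.HasAntidiagonal.mem_antidiagonal.2 h⟩

/-- The differential of `E ⊗_H F`: `e ⊗ f ↦ d e ⊗ f + (-1)^|e| e ⊗ d f`. -/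
def tensorD (r : ℕ) : tensorX E F (r + 1) ⟶ tensorX E F r :=
  HopfBimod.lift fun x =>
    tensorProj E F (x.1.1 + 1) x.1.2 (by have := Finset.HasAntidiagonal.mem_antidiagonal.1 x.2; omega) ≫
        tensorMap (E.d x.1.1) (𝟙 _) +
      (-1 : k) ^ x.1.1 • tensorProj E F x.1.1 (x.1.2 + 1)
        (by have := Finset.HasAntidiagonal.mem_antidiagonal.1 x.2; omega) ≫ tensorMap (𝟙 _) (F.d x.1.2)

/-- The morphism `e ⊗ f ↦ e (p_F f)`. -/
def tensorAugR (s : ℕ) : tensor (E.X s) (F.X 0) ⟶ E.X s := tensorMap (𝟙 _) F.aug ≫ runit _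

/-- The morphism `e ⊗ f ↦ (p_E e) f`. -/
def tensorAugL (t : ℕ) : tensor (E.X 0) (F.X t) ⟶ F.X t := tensorMap E.aug (𝟙 _) ≫ lunit _

variable {E F} in
lemma tensorX_ext {r : ℕ} {x y : tensorX E F r}
    (h : ∀ s t h, lin (tensorProj E F s t h) x = lin (tensorProj E F s t h) y) : x = y :=
  funext fun p => h p.1.1 p.1.2 (Finset.HasAntidiagonal.mem_antidiagonal.1 p.2)

lemma tensorProj_d {r : ℕ} (s t : ℕ) (h : s + t = r) (x : tensorX E F (r + 1)) :
    lin (tensorProj E F s t h) (lin (tensorD E F r) x) =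
      lin (tensorMap (E.d s) (𝟙 _)) (lin (tensorProj E F (s + 1) t (by omega)) x) +
      (-1 : k) ^ s • lin (tensorMap (𝟙 _) (F.d t)) (lin (tensorProj E F s (t + 1) (by omega)) x) :=
  lift_apply _ _ _ _

lemma exists_tensorX {r : ℕ} (z : ∀ s t : ℕ, s + t = r → tensor (E.X s) (F.X t)) :
    ∃ x : tensorX E F r, ∀ s t h, lin (tensorProj E F s t h) x = z s t h :=
  ⟨fun p => z p.1.1 p.1.2 (Finset.HasAntidiagonal.mem_antidiagonal.1 p.2), fun _ _ _ => rfl⟩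

lemma tensorMap_zero_left {M M' N N' : HopfBimod k H} (g : N ⟶ N') :
    tensorMap (0 : M ⟶ M') g = 0 := tensorHom_ext fun m n => by simp

lemma tensorMap_zero_right {M M' N N' : HopfBimod k H} (f : M ⟶ M') :
    tensorMap f (0 : N ⟶ N') = 0 := tensorHom_ext fun m n => by simp

lemma tensor_subsingleton_left {M N : HopfBimod k H} [Subsingleton M] : Subsingleton (tensor M N) :=
  subsingleton_of_forall_eq 0 <| tensor_ext (φ := LinearMap.id) (ψ := 0) fun m n => by
    rw [Subsingleton.elim m 0, TensorProduct.zero_tmul]; simp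

lemma tensor_subsingleton_right {M N : HopfBimod k H} [Subsingleton N] : Subsingleton (tensor M N) :=
  subsingleton_of_forall_eq 0 <| tensor_ext (φ := LinearMap.id) (ψ := 0) fun m n => by
    rw [Subsingleton.elim n 0, TensorProduct.tmul_zero]; simp

lemma tensorMap_bijective {M M' N N' : HopfBimod k H} {f : M ⟶ M'} {g : N ⟶ N'}
    (hf : Function.Bijective (lin f)) (hg : Function.Bijective (lin g)) :
    Function.Bijective (lin (tensorMap f g)) := by
  have h1 : tensorMap f g ≫ tensorMap (HopfBimod.inv f hf) (HopfBimod.inv g hg) = 𝟙 _ :=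
    tensorHom_ext fun m n => by simp
  have h2 : tensorMap (HopfBimod.inv f hf) (HopfBimod.inv g hg) ≫ tensorMap f g = 𝟙 _ :=
    tensorHom_ext fun m n => by simp
  exact Function.bijective_iff_has_inverse.2 ⟨_, fun x => congrArg (fun φ => lin φ x) h1,
    fun x => congrArg (fun φ => lin φ x) h2⟩

lemma inv_bijective {M M' : HopfBimod k H} {f : M ⟶ M'} (hf : Function.Bijective (lin f)) :
    Function.Bijective (lin (HopfBimod.inv f hf)) :=
  Function.bijective_iff_has_inverse.2 ⟨lin f, fun x => by simp, fun x => by simp⟩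

lemma tensorX_subsingleton (s t : ℕ) (h : m < s ∨ n < t) : Subsingleton (tensor (E.X s) (F.X t)) := by
  rcases h with h | h
  · have := E.subsingleton s h
    exact tensor_subsingleton_left
  · have := F.subsingleton t h
    exact tensor_subsingleton_right

lemma d_comp_d (i : ℕ) : E.d (i + 1) ≫ E.d i = 0 := HopfBimod.hom_ext fun x => E.d_d i x

lemma tensorAugR_surjective (s : ℕ) : Function.Surjective (lin (tensorAugR E F s)) :=
  runit_bijective.2.comp (tensor_surjective _ F.aug_surjective)

lemma tensorAugR_exact (s : ℕ) :
    Function.Exact (lin (tensorMap (𝟙 (E.X s)) (F.d 0))) (lin (tensorAugR E F s)) := fun x => by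
  refine Iff.trans ?_ (tensor_exact _ F.exact_zero x)
  exact map_eq_zero_iff (lin (runit _)) runit_bijective.1

lemma tensorAugR_d (s : ℕ) (x : tensor (E.X (s + 1)) (F.X 0)) :
    lin (tensorAugR E F s) (lin (tensorMap (E.d s) (𝟙 _)) x) =
      lin (E.d s) (lin (tensorAugR E F (s + 1)) x) := by
  refine congrArg (fun φ => lin φ x)
    (?_ : tensorMap (E.d s) (𝟙 _) ≫ tensorAugR E F s = tensorAugR E F (s + 1) ≫ E.d s)
  refine tensorHom_ext fun e f => ?_
  simp only [tensorAugR, lin_comp, tensorMap_tmul, lin_id]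
  exact ((isHom (E.d s)).ract _ _).symm

lemma tensorMap_interchange {M M' N N' : HopfBimod k H} (f : M ⟶ M') (g : N ⟶ N')
    (x : tensor M N) :
    lin (tensorMap f (𝟙 _)) (lin (tensorMap (𝟙 _) g) x) =
      lin (tensorMap (𝟙 _) g) (lin (tensorMap f (𝟙 _)) x) := by
  rw [← lin_comp, ← lin_comp, tensorMap_comp, tensorMap_comp]
  simp

lemma tensorMap_dl (s : ℕ) {M : HopfBimod k H} (x : tensor (E.X (s + 2)) M) :
    lin (tensorMap (E.d s) (𝟙 M)) (lin (tensorMap (E.d (s + 1)) (𝟙 M)) x) = 0 := by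
  rw [← lin_comp, tensorMap_comp, d_comp_d, tensorMap_zero_left, lin_zero]

lemma tensorProj_incl_self {r : ℕ} (s t : ℕ) (h : s + t = r) (x : tensor (E.X s) (F.X t)) :
    lin (tensorProj E F s t h) (lin (tensorIncl E F s t h) x) = x :=
  Pi.single_eq_same _ _

lemma tensorIncl_bijective (h : m + n = N) : Function.Bijective (lin (tensorIncl E F m n h)) := by
  refine Function.bijective_iff_has_inverse.2 ⟨lin (tensorProj E F m n h),
    tensorProj_incl_self E F m n h, fun x => tensorX_ext fun s t hst => ?_⟩
  by_cases hs : s = m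
  · subst hs
    obtain rfl : t = n := by omega
    rw [tensorProj_incl_self]
  · have := tensorX_subsingleton E F s t (by omega)
    exact Subsingleton.elim _ _

lemma tensorAug_eq : tensorMap E.aug F.aug ≫ lunit _ = tensorAugR E F 0 ≫ E.aug :=
  tensorHom_ext fun e f => ((isHom E.aug).ract _ _).symm

/-- The tensor product `E ⊗_H F` of two extensions. -/
def tensorExt (h : m + n = N) : HopfExt k H N where
  X := tensorX E F
  d := tensorD E F
  top := HopfBimod.inv (lunit _) lunit_bijective ≫ tensorMap E.top F.top ≫ tensorIncl E F m n h
  aug := tensorProj E F 0 0 rfl ≫ tensorMap E.aug F.aug ≫ lunit _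
  top_bijective := (tensorIncl_bijective E F h).comp
    ((tensorMap_bijective E.top_bijective F.top_bijective).comp (inv_bijective lunit_bijective))
  subsingleton r hr := ⟨fun x y => tensorX_ext fun s t hst => by
    have := tensorX_subsingleton E F s t (by omega)
    exact Subsingleton.elim _ _⟩
  aug_surjective h := by
    obtain ⟨x, rfl⟩ := E.aug_surjective h
    obtain ⟨y, rfl⟩ := tensorAugR_surjective E F 0 x
    obtain ⟨z, hz⟩ := exists_tensorX E F (r := 0) fun s t _ =>
      if h : 0 = s ∧ 0 = t then h.1 ▸ h.2 ▸ y else 0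
    refine ⟨z, ?_⟩
    rw [tensorAug_eq, lin_comp, hz]
    simp
  exact_zero x := by
    have aug_eq : ∀ x, lin (tensorProj E F 0 0 rfl ≫ tensorMap E.aug F.aug ≫ lunit _) x =
        lin E.aug (lin (tensorAugR E F 0) (lin (tensorProj E F 0 0 rfl) x)) := fun x => by
      rw [tensorAug_eq]; rfl
    rw [aug_eq]
    constructor
    · intro hx
      obtain ⟨y, hy⟩ := (E.exact_zero _).1 hx
      obtain ⟨c, rfl⟩ := tensorAugR_surjective E F 1 y
      have h2 : lin (tensorAugR E F 0) (lin (tensorProj E F 0 0 rfl) x -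
          lin (tensorMap (E.d 0) (𝟙 _)) c) = 0 := by
        rw [map_sub, tensorAugR_d, hy, sub_self]
      obtain ⟨b, hb⟩ := (tensorAugR_exact E F 0 _).1 h2
      obtain ⟨z, hz⟩ := exists_tensorX E F (r := 1) fun s t _ =>
        if h : 1 = s ∧ 0 = t then h.1 ▸ h.2 ▸ c else if h : 0 = s ∧ 1 = t then h.1 ▸ h.2 ▸ b else 0
      refine ⟨z, tensorX_ext fun s t hst => ?_⟩
      obtain rfl : s = 0 := by omega
      obtain rfl : t = 0 := by omega
      rw [tensorProj_d, hz, hz]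
      simp [hb]
    · rintro ⟨y, rfl⟩
      rw [tensorProj_d, map_add, tensorAugR_d, map_smul, (tensorAugR_exact E F 0).apply_apply_eq_zero]
      simp
  exact r z := by
    constructor
    · intro hz
      have hz' : ∀ s t (hst : s + t = r), _ = lin (tensorProj E F s t hst) 0 := fun s t hst =>
        (tensorProj_d E F s t hst z).symm.trans (congrArg (lin (tensorProj E F s t hst)) hz)
      simp only [map_zero] at hz'
      obtain ⟨w, hw⟩ := total_exact (k := k) (C := fun p => tensor (E.X p.1) (F.X p.2))
        (B := fun s => E.X s) (fun s t => lin (tensorMap (E.d s) (𝟙 (F.X t))))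
        (fun s t => lin (tensorMap (𝟙 (E.X s)) (F.d t))) (fun s => lin (tensorAugR E F s))
        (fun s => lin (E.d s)) (fun s t => tensorMap_interchange (E.d s) (F.d t))
        (fun s t => tensor_exact _ (F.exact t)) (tensorAugR_exact E F) (tensorAugR_surjective E F)
        (tensorAugR_d E F) E.exact r
        (fun p => if h : p.1 + p.2 = r + 1 then lin (tensorProj E F p.1 p.2 h) z else 0)
        (fun s t hst => by
          have h1 : s + 1 + t = r + 1 := by omega
          have h2 : s + (t + 1) = r + 1 := by omega
          simp only [h1, h2, dite_true]
          exact hz' s t hst)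
        (fun s t x => tensorMap_dl E s x)
      obtain ⟨x, hx⟩ := exists_tensorX E F (r := r + 2) fun s t _ => w (s, t)
      refine ⟨x, tensorX_ext fun s t hst => ?_⟩
      rw [tensorProj_d, hx, hx]
      refine (hw s t hst).trans ?_
      simp [hst]
    · rintro ⟨x, rfl⟩
      refine tensorX_ext fun s t hst => ?_
      rw [tensorProj_d, tensorProj_d, tensorProj_d, map_add, map_add, tensorMap_dl, map_smul,
        map_smul, tensorMap_interchange, ← lin_comp (tensorMap (𝟙 (E.X s)) (F.d (t + 1))),
        tensorMap_comp, d_comp_d, tensorMap_zero_right, pow_succ]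
      simp

end Tensor
/-! ### The comparison maps and the loop -/

section Comparison

variable {m n N : ℕ}

lemma tensorProj_incl_aux (E : HopfExt k H m) (F : HopfExt k H n) {r : ℕ} (s t : ℕ)
    (h : s + t = r) : tensorIncl E F s t h ≫ tensorProj E F s t h = 𝟙 _ :=
  HopfBimod.hom_ext fun x => tensorProj_incl_self E F s t h x

lemma tensorAugL_d (E : HopfExt k H m) (F : HopfExt k H n) (t : ℕ) :
    tensorMap (𝟙 _) (F.d t) ≫ tensorAugL E F t = tensorAugL E F (t + 1) ≫ F.d t :=
  tensorHom_ext fun _ _ => ((isHom (F.d t)).lact _ _).symm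

lemma tensorAugL_zero (E : HopfExt k H m) (F : HopfExt k H n) (t : ℕ) :
    tensorMap (E.d 0) (𝟙 _) ≫ tensorAugL E F t = 0 :=
  tensorHom_ext fun e f => by
    simp only [tensorAugL, lin_comp, tensorMap_tmul, aug_d, TensorProduct.zero_tmul, map_zero]; rfl

/-- The morphism `e ⊗ f ↦ e f` where `f` lies in the last term `H` of `F`. -/
def tensorTopR (E : HopfExt k H m) (F : HopfExt k H n) (s : ℕ) : tensor (E.X s) (F.X n) ⟶ E.X s :=
  tensorMap (𝟙 _) F.topInv ≫ runit _

/-- The morphism `e ⊗ f ↦ e f` where `e` lies in the last term `H` of `E`. -/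
def tensorTopL (E : HopfExt k H m) (F : HopfExt k H n) (t : ℕ) : tensor (E.X m) (F.X t) ⟶ F.X t :=
  tensorMap E.topInv (𝟙 _) ≫ lunit _

@[simp] lemma topInv_top (E : HopfExt k H m) (x : unit k H) : lin E.topInv (lin E.top x) = x :=
  inv_lin _ _ _

@[simp] lemma top_topInv (E : HopfExt k H m) (x : E.X m) : lin E.top (lin E.topInv x) = x :=
  lin_inv _ _ _

lemma tensorTopR_d (E : HopfExt k H m) (F : HopfExt k H n) (s : ℕ) :
    tensorMap (E.d s) (𝟙 _) ≫ tensorTopR E F s = tensorTopR E F (s + 1) ≫ E.d s :=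
  tensorHom_ext fun _ _ => ((isHom (E.d s)).ract _ _).symm

lemma tensorTopL_d (E : HopfExt k H m) (F : HopfExt k H n) (t : ℕ) :
    tensorMap (𝟙 _) (F.d t) ≫ tensorTopL E F t = tensorTopL E F (t + 1) ≫ F.d t :=
  tensorHom_ext fun _ _ => ((isHom (F.d t)).lact _ _).symm

lemma tensorAugL_top (E : HopfExt k H m) (F : HopfExt k H n) :
    tensorAugL E F n = tensorTopR E F 0 ≫ E.aug ≫ F.top :=
  tensorHom_ext fun e f => by
    obtain ⟨f, rfl⟩ := F.top_bijective.2 f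
    simp only [tensorAugL, tensorTopR, lin_comp, tensorMap_tmul, topInv_top, lin_id]
    refine ((isHom F.top).lact _ _).symm.trans (congrArg (lin F.top) ?_)
    exact ((isHom E.aug).ract _ _).symm

lemma tensorAugR_top (E : HopfExt k H m) (F : HopfExt k H n) :
    tensorAugR E F m = tensorTopL E F 0 ≫ F.aug ≫ E.top :=
  tensorHom_ext fun e f => by
    obtain ⟨e, rfl⟩ := E.top_bijective.2 e
    simp only [tensorAugR, tensorTopL, lin_comp, tensorMap_tmul, topInv_top, lin_id]
    refine ((isHom E.top).ract _ _).symm.trans (congrArg (lin E.top) ?_)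
    exact ((isHom F.aug).lact _ _).symm

lemma tensor_top_topR (E : HopfExt k H m) (F : HopfExt k H n) :
    HopfBimod.inv (lunit _) lunit_bijective ≫ tensorMap E.top F.top ≫ tensorTopR E F m = E.top := by
  have : tensorMap E.top F.top ≫ tensorTopR E F m = lunit _ ≫ E.top :=
    tensorHom_ext fun e f => by
      simp only [tensorTopR, lin_comp, tensorMap_tmul, topInv_top, lin_id]
      exact ((isHom E.top).ract _ _).symm
  rw [this]
  exact HopfBimod.hom_ext fun x => by simp

lemma tensor_top_topL (E : HopfExt k H m) (F : HopfExt k H n) :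
    HopfBimod.inv (lunit _) lunit_bijective ≫ tensorMap E.top F.top ≫ tensorTopL E F n = F.top := by
  have : tensorMap E.top F.top ≫ tensorTopL E F n = lunit _ ≫ F.top :=
    tensorHom_ext fun e f => by
      simp only [tensorTopL, lin_comp, tensorMap_tmul, topInv_top, lin_id]
      exact ((isHom F.top).lact _ _).symm
  rw [this]
  exact HopfBimod.hom_ext fun x => by simp

/-- The morphism `λ : E ⊗_H F ⟶ F # E`.  In degree `i < deg F` it is `p_E ⊗ id` on `E_0 ⊗ F_i`,
in degree `i + deg F` it is the identification of `E_i ⊗ H` with `E_i`, and it vanishes on the other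
summands. -/
def lambda (E : HopfExt k H m) (F : HopfExt k H (n + 1)) (h : m + (n + 1) = N) :
    tensorExt E F h ⟶ splice F E h where
  f := spliceLift (n + 1) F.X E.X (tensorX E F)
    (fun i => tensorProj E F 0 i (zero_add i) ≫ tensorAugL E F i)
    (fun i _ hj => tensorProj E F i (n + 1) hj ≫ tensorTopR E F i)
  comm := spliceLift_comm n F.X E.X (tensorX E F) F.d E.d (E.aug ≫ F.top ≫ F.d n) (tensorD E F) _ _
    (fun i => HopfBimod.hom_ext fun x => by
      rw [lin_comp, lin_comp, tensorProj_d, map_add, ← lin_comp (tensorMap (E.d 0) (𝟙 _)),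
        tensorAugL_zero, map_smul, ← lin_comp (tensorMap (𝟙 _) (F.d i)), tensorAugL_d]
      simp)
    (fun i j hj => HopfBimod.hom_ext fun x => by
      have := F.subsingleton (n + 1 + 1) (by omega)
      rw [lin_comp, lin_comp, tensorProj_d, map_add, ← lin_comp (tensorMap (E.d i) (𝟙 _)),
        tensorTopR_d, (tensor_subsingleton_right (M := E.X i) (N := F.X (n + 1 + 1))).elim
          (lin (tensorProj E F i (n + 1 + 1) _) x) 0]
      simp)
    (HopfBimod.hom_ext fun x => by
      rw [lin_comp, lin_comp, tensorProj_d, map_add, ← lin_comp (tensorMap (E.d 0) (𝟙 _)),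
        tensorAugL_zero, map_smul, ← lin_comp (tensorMap (𝟙 _) (F.d n)), tensorAugL_d,
        tensorAugL_top]
      simp)
  top := by
    rw [spliceLift_inr (n + 1) F.X E.X _ _ _ m N h]
    simp only [tensorExt, splice, Category.assoc]
    rw [← Category.assoc (tensorIncl E F m (n + 1) h), tensorProj_incl_aux, Category.id_comp,
      ← Category.assoc (tensorMap _ _), ← Category.assoc, tensor_top_topR]
  aug := by
    change (tensorProj E F 0 0 rfl ≫ tensorAugL E F 0) ≫ F.aug = tensorProj E F 0 0 rfl ≫ _
    rw [Category.assoc]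
    congr 1
    exact tensorHom_ext fun _ _ => (isHom F.aug).lact _ _

/-- The morphism `ρ : E ⊗_H F ⟶ (-1)^s E # F`, where `s = deg E * deg F`.  In degree `j < deg E` it
is `(-1)^s (id ⊗ p_F)` on `E_j ⊗ F_0`, in degree `i + deg E` it is `(-1)^(deg E * (deg F - i))` times
the identification of `H ⊗ F_i` with `F_i`, and it vanishes on the other summands. -/
def rho (E : HopfExt k H (m + 1)) (F : HopfExt k H n) (s : ℕ) (hs : s = (m + 1) * n)
    (h : m + 1 + n = N) (h' : n + (m + 1) = N) :
    tensorExt E F h ⟶ (splice E F h').twist s where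
  f := spliceLift (m + 1) E.X F.X (tensorX E F)
    (fun j => (-1 : k) ^ s • (tensorProj E F j 0 (add_zero j) ≫ tensorAugR E F j))
    (fun i _ hj => (-1 : k) ^ ((m + 1) * (n + i)) •
      (tensorProj E F (m + 1) i (by omega) ≫ tensorTopL E F i))
  comm := spliceLift_comm m E.X F.X (tensorX E F) E.d F.d (F.aug ≫ E.top ≫ E.d m) (tensorD E F) _ _
    (fun j => HopfBimod.hom_ext fun x => by
      rw [lin_comp, lin_smul, lin_comp, tensorProj_d, map_add, tensorAugR_d, map_smul,
        (tensorAugR_exact E F j).apply_apply_eq_zero]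
      simp)
    (fun i j hj => HopfBimod.hom_ext fun x => by
      have := E.subsingleton (m + 1 + 1) (by omega)
      rw [lin_comp, lin_smul, lin_comp, tensorProj_d, map_add, map_smul,
        ← lin_comp (tensorMap (𝟙 _) (F.d i)),
        tensorTopL_d, (tensor_subsingleton_left (M := E.X (m + 1 + 1)) (N := F.X i)).elim
          (lin (tensorProj E F (m + 1 + 1) i _) x) 0]
      simp only [map_zero, zero_add, smul_smul, ← pow_add, lin_comp, lin_smul, map_smul]
      rfl)
    (HopfBimod.hom_ext fun x => by
      rw [lin_comp, lin_smul, lin_comp, tensorProj_d, map_add, tensorAugR_d, map_smul,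
        (tensorAugR_exact E F m).apply_apply_eq_zero, tensorAugR_top]
      simp [hs])
  top := by
    rw [spliceLift_inr (m + 1) E.X F.X _ _ _ n N h']
    have e : (-1 : k) ^ ((m + 1) * (n + n)) = 1 := by
      rw [mul_add, pow_add, neg_one_pow_sq]
    simp only [tensorExt, splice, twist, e, one_smul, Category.assoc]
    rw [← Category.assoc (tensorIncl E F (m + 1) n h), tensorProj_incl_aux, Category.id_comp,
      ← Category.assoc (tensorMap _ _), ← Category.assoc, tensor_top_topL]
  aug := by
    change ((-1 : k) ^ s • (tensorProj E F 0 0 rfl ≫ tensorAugR E F 0)) ≫ ((-1 : k) ^ s • E.aug) =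
      tensorProj E F 0 0 rfl ≫ tensorMap E.aug F.aug ≫ lunit _
    rw [tensorAug_eq]
    exact HopfBimod.hom_ext fun x => by
      simp only [lin_comp, lin_smul, map_smul, smul_smul, neg_one_pow_sq, one_smul]

end Comparison

section Loop

variable {m n N : ℕ}

/-- The loop of `E` and `F`, based at `E # F`, in the fundamental groupoid of the category of
extensions: with `s = deg E * deg F` it is
`E # F ←ρ- (-1)^s E ⊗ F -λ→ (-1)^s F # E ←ρ- F ⊗ E -λ→ E # F`. -/
def loop (E : HopfExt k H (m + 1)) (F : HopfExt k H (n + 1)) (h : m + n + 1 = N) :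
    FreeGroupoid.mk (splice E F (N := N + 1) (by omega)) ⟶
      FreeGroupoid.mk (splice E F (N := N + 1) (by omega)) :=
  let s := (m + 1) * (n + 1)
  Groupoid.inv (FreeGroupoid.homMk
      (twistMap s (rho E F s rfl (by omega) (by omega)) ≫ twistTwist _ s)) ≫
    FreeGroupoid.homMk (twistMap s (lambda E F (by omega))) ≫
    Groupoid.inv (FreeGroupoid.homMk (rho F E s (Nat.mul_comm _ _) (by omega) (by omega))) ≫
    FreeGroupoid.homMk (lambda F E (by omega))

end Loop
/-! ### Baer sums -/

section Baer

/-- The direct sum of two Hopf bimodules. -/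
def prod (M N : HopfBimod k H) : HopfBimod k H := pi fun b : Bool => if b then M else N

/-- The first projection. -/
def fst (M N : HopfBimod k H) : prod M N ⟶ M := proj (fun b : Bool => if b then M else N) true

/-- The second projection. -/
def snd (M N : HopfBimod k H) : prod M N ⟶ N := proj (fun b : Bool => if b then M else N) false

/-- The components of a morphism to a direct sum. -/
def pairAux {P M N : HopfBimod k H} (f : P ⟶ M) (g : P ⟶ N) :
    ∀ b : Bool, P ⟶ if b then M else N
  | true => f
  | false => g

/-- The morphism to a direct sum with given components. -/
def pair {P M N : HopfBimod k H} (f : P ⟶ M) (g : P ⟶ N) : P ⟶ prod M N :=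
  HopfBimod.lift (pairAux f g)

@[simp] lemma fst_pair {P M N : HopfBimod k H} (f : P ⟶ M) (g : P ⟶ N) (p : P) :
    lin (fst M N) (lin (pair f g) p) = lin f p :=
  lift_apply (fun b : Bool => if b then M else N) (pairAux f g) p true

@[simp] lemma snd_pair {P M N : HopfBimod k H} (f : P ⟶ M) (g : P ⟶ N) (p : P) :
    lin (snd M N) (lin (pair f g) p) = lin g p :=
  lift_apply (fun b : Bool => if b then M else N) (pairAux f g) p false

lemma prod_ext {M N : HopfBimod k H} {x y : prod M N} (h1 : lin (fst M N) x = lin (fst M N) y)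
    (h2 : lin (snd M N) x = lin (snd M N) y) : x = y := by
  funext b
  cases b
  · exact h2
  · exact h1

lemma exists_prod {M N : HopfBimod k H} (m : M) (n : N) :
    ∃ x : prod M N, lin (fst M N) x = m ∧ lin (snd M N) x = n :=
  ⟨fun | true => m
       | false => n, rfl, rfl⟩

/-- An element of a kernel. -/
def kerMk {B C : HopfBimod k H} (g : B ⟶ C) (x : B) (hx : lin g x = 0) : ker g :=
  (⟨x, LinearMap.mem_ker.2 hx⟩ : LinearMap.ker (lin g))

/-- The class of a cycle. -/
def cls {A B C : HopfBimod k H} (f : A ⟶ B) (g : B ⟶ C) (w : f ≫ g = 0) (x : B)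
    (hx : lin g x = 0) : homology f g w :=
  lin (homologyπ f g w) (kerMk g x hx)

lemma cls_surjective {A B C : HopfBimod k H} {f : A ⟶ B} {g : B ⟶ C} {w : f ≫ g = 0}
    (z : homology f g w) : ∃ x hx, cls f g w x hx = z := by
  obtain ⟨⟨x, hx⟩, rfl⟩ := homologyπ_surjective f g w z
  exact ⟨x, hx, rfl⟩

lemma cls_eq_iff {A B C : HopfBimod k H} {f : A ⟶ B} {g : B ⟶ C} {w : f ≫ g = 0} {x y : B}
    {hx : lin g x = 0} {hy : lin g y = 0} :
    cls f g w x hx = cls f g w y hy ↔ ∃ a, x = y + lin f a := by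
  rw [← sub_eq_zero, cls, cls, ← map_sub]
  refine (homologyπ_eq_zero f g w).trans (exists_congr fun a => ?_)
  change lin f a = x - y ↔ _
  rw [eq_sub_iff_add_eq, add_comm, eq_comm]

lemma cls_congr {A B C : HopfBimod k H} {f : A ⟶ B} {g : B ⟶ C} {w : f ≫ g = 0} {x y : B}
    {hx : lin g x = 0} {hy : lin g y = 0} (h : x = y) : cls f g w x hx = cls f g w y hy := by
  subst h; rfl

lemma cls_eq_zero_iff {A B C : HopfBimod k H} {f : A ⟶ B} {g : B ⟶ C} {w : f ≫ g = 0} {x : B}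
    {hx : lin g x = 0} : cls f g w x hx = 0 ↔ ∃ a, x = lin f a :=
  (homologyπ_eq_zero f g w).trans (exists_congr fun _ => eq_comm)

/-- The morphism induced on homology. -/
def homologyMap {A B C A' B' C' : HopfBimod k H} (f : A ⟶ B) (g : B ⟶ C) (w : f ≫ g = 0)
    (f' : A' ⟶ B') (g' : B' ⟶ C') (w' : f' ≫ g' = 0) (φ : B ⟶ B')
    (h1 : ∀ x, lin g x = 0 → lin g' (lin φ x) = 0) (h2 : ∀ a, ∃ a', lin φ (lin f a) = lin f' a') :
    homology f g w ⟶ homology f' g' w' :=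
  homologyDesc f g w
    (kerLift g' (kerι g ≫ φ) (HopfBimod.hom_ext fun x => h1 _ x.2) ≫ homologyπ f' g' w')
    (HopfBimod.hom_ext fun a => (homologyπ_eq_zero f' g' w').2 (by
      obtain ⟨b, hb⟩ := h2 a
      exact ⟨b, hb.symm⟩))

@[simp] lemma homologyMap_cls {A B C A' B' C' : HopfBimod k H} {f : A ⟶ B} {g : B ⟶ C}
    {w : f ≫ g = 0} {f' : A' ⟶ B'} {g' : B' ⟶ C'} {w' : f' ≫ g' = 0} {φ : B ⟶ B'}
    {h1 : ∀ x, lin g x = 0 → lin g' (lin φ x) = 0}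
    {h2 : ∀ a, ∃ a', lin φ (lin f a) = lin f' a'} (x : B) (hx : lin g x = 0) :
    lin (homologyMap f g w f' g' w' φ h1 h2) (cls f g w x hx) =
      cls f' g' w' (lin φ x) (h1 x hx) := rfl

variable {N : ℕ}

/-- The morphism `top`, extended by zero to all degrees. -/
def topAt (X : HopfExt k H N) (i : ℕ) : unit k H ⟶ X.X i :=
  if h : N = i then X.top ≫ eqToHom (congrArg X.X h) else 0

lemma topAt_self (X : HopfExt k H N) : X.topAt N = X.top := by simp [topAt]

lemma topAt_of_ne (X : HopfExt k H N) {i : ℕ} (h : N ≠ i) : X.topAt i = 0 := by simp [topAt, h]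

/-- The two copies of `H` to be identified in a Baer sum: in degree `N` this is `top`, in degree
`N - 1` it is the inclusion of `H`, and it vanishes in the other degrees. -/
def baerTop (X : HopfExt k H N) (i : ℕ) : unit k H ⟶ X.X i := X.topAt i + X.topAt (i + 1) ≫ X.d i

/-- In degree `0` this is `(x, y) ↦ p_X x - p_Y y`, and it vanishes in the other degrees. -/
def baerAug (X Y : HopfExt k H N) : ∀ i, prod (X.X i) (Y.X i) ⟶ unit k H
  | 0 => fst _ _ ≫ X.aug - snd _ _ ≫ Y.aug
  | _ + 1 => 0

lemma baerAug_succ (X Y : HopfExt k H N) (i : ℕ) (x : prod (X.X (i + 1)) (Y.X (i + 1))) :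
    lin (baerAug X Y (i + 1)) x = 0 := lin_zero x

/-- `h ↦ (h, -h)`. -/
def baerIncl (X Y : HopfExt k H N) (i : ℕ) : unit k H ⟶ prod (X.X i) (Y.X i) :=
  pair (X.baerTop i) (-Y.baerTop i)

lemma baerTop_aug (X : HopfExt k H (N + 1)) : X.baerTop 0 ≫ X.aug = 0 :=
  HopfBimod.hom_ext fun h => by simp [baerTop, topAt_of_ne X (Nat.succ_ne_zero N)]

lemma baerTop_d (X : HopfExt k H (N + 1)) (i : ℕ) :
    X.baerTop (i + 1) ≫ X.d i = if N = i then X.baerTop i else 0 := by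
  refine HopfBimod.hom_ext fun h => ?_
  split_ifs with hi
  · subst hi
    simp [baerTop, topAt_of_ne X (Nat.succ_ne_self N)]
  · have : N + 1 ≠ i + 1 := by omega
    simp [baerTop, topAt_of_ne X this]

lemma baerIncl_aug (X Y : HopfExt k H (N + 1)) (i : ℕ) : baerIncl X Y i ≫ baerAug X Y i = 0 := by
  refine HopfBimod.hom_ext fun h => ?_
  cases i with
  | zero =>
    have h1 := congrArg (fun φ => lin φ h) X.baerTop_aug
    have h2 := congrArg (fun φ => lin φ h) Y.baerTop_aug
    simp only [lin_comp, lin_zero] at h1 h2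
    simp [baerIncl, baerAug, h1, h2]
  | succ i => simp [baerAug]

/-- The map `(x, y) ↦ (dx, dy)`. -/
def baerD (X Y : HopfExt k H N) (i : ℕ) : prod (X.X (i + 1)) (Y.X (i + 1)) ⟶ prod (X.X i) (Y.X i) :=
  pair (fst _ _ ≫ X.d i) (snd _ _ ≫ Y.d i)

lemma baerD_aug (X Y : HopfExt k H N) (i : ℕ) (x : prod (X.X (i + 1)) (Y.X (i + 1))) :
    lin (baerAug X Y i) (lin (baerD X Y i) x) = 0 := by
  cases i <;> simp [baerAug, baerD]

lemma baerD_incl (X Y : HopfExt k H (N + 1)) (i : ℕ) (h : unit k H) :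
    lin (baerD X Y i) (lin (baerIncl X Y (i + 1)) h) = if N = i then lin (baerIncl X Y i) h else 0 := by
  have h1 := congrArg (fun φ => lin φ h) (X.baerTop_d i)
  have h2 := congrArg (fun φ => lin φ h) (Y.baerTop_d i)
  split_ifs with hi
  · simp only [lin_comp, hi, if_true] at h1 h2
    exact prod_ext (by simp [baerD, baerIncl, h1]) (by simp [baerD, baerIncl, h2])
  · simp only [lin_comp, hi, if_false] at h1 h2
    exact prod_ext (by simp [baerD, baerIncl, h1]) (by simp [baerD, baerIncl, h2])

lemma baerTop_self (X : HopfExt k H (N + 1)) : X.baerTop (N + 1) = X.top := by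
  rw [baerTop, topAt_self, topAt_of_ne X (Nat.succ_ne_self (N + 1)).symm]
  exact HopfBimod.hom_ext fun x => by simp

/-- The Baer sum `X + Y` of two extensions of positive degree: the fibre product over `H` in
degree `0`, the amalgamated sum under `H` in the last degree, and the direct sum in between. -/
def baer (X Y : HopfExt k H (N + 1)) : HopfExt k H (N + 1) where
  X i := homology (baerIncl X Y i) (baerAug X Y i) (baerIncl_aug X Y i)
  d i := homologyMap _ _ _ _ _ _ (baerD X Y i) (fun x _ => baerD_aug X Y i x) (fun h => by
    rw [baerD_incl]
    split_ifs
    · exact ⟨h, rfl⟩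
    · exact ⟨0, (map_zero _).symm⟩)
  top := kerLift _ (pair X.top 0) (HopfBimod.hom_ext fun _ => rfl) ≫ homologyπ _ _ _
  aug := homologyDesc _ _ _ (kerι _ ≫ fst _ _ ≫ X.aug)
    (HopfBimod.hom_ext fun h => by
      have h1 := congrArg (fun φ => lin φ h) X.baerTop_aug
      simpa [baerIncl] using h1)
  top_bijective := by
    have hg : ∀ x, lin (baerAug X Y (N + 1)) x = 0 := baerAug_succ X Y N
    constructor
    · rw [injective_iff_map_eq_zero]
      intro a ha
      obtain ⟨b, hb⟩ := (cls_eq_zero_iff (hx := hg _)).1 ha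
      have h1 := congrArg (lin (fst _ _)) hb
      have h2 := congrArg (lin (snd _ _)) hb
      simp only [baerIncl, fst_pair, snd_pair, baerTop_self, lin_neg, lin_zero] at h1 h2
      rw [X.top_bijective.1 h1]
      exact (map_eq_zero_iff _ Y.top_bijective.1).1 (neg_eq_zero.1 h2.symm)
    · intro z
      obtain ⟨x, hx, rfl⟩ := cls_surjective z
      obtain ⟨a, ha⟩ := X.top_bijective.2 (lin (fst _ _) x)
      obtain ⟨b, hb⟩ := Y.top_bijective.2 (lin (snd _ _) x)
      refine ⟨a + b, (cls_eq_iff (hx := hg _)).2 ⟨b, prod_ext ?_ ?_⟩⟩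
      · simp [baerIncl, baerTop_self, ha]
      · simp [baerIncl, baerTop_self, hb]
  subsingleton i hi := by
    have := X.subsingleton i hi
    have := Y.subsingleton i hi
    refine subsingleton_of_forall_eq 0 fun z => ?_
    obtain ⟨x, hx, rfl⟩ := cls_surjective z
    exact cls_eq_zero_iff.2 ⟨0, prod_ext (Subsingleton.elim _ _) (Subsingleton.elim _ _)⟩
  aug_surjective h := by
    obtain ⟨x, hx⟩ := X.aug_surjective h
    obtain ⟨y, hy⟩ := Y.aug_surjective h
    obtain ⟨z, h1, h2⟩ := exists_prod x y
    have hz : lin (baerAug X Y 0) z = 0 := by simp [baerAug, h1, h2, hx, hy]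
    refine ⟨cls (baerIncl X Y 0) (baerAug X Y 0) (baerIncl_aug X Y 0) z hz, ?_⟩
    exact (congrArg (lin X.aug) h1).trans hx
  exact_zero z := by
    constructor
    · intro h
      obtain ⟨x, hx, rfl⟩ := cls_surjective z
      have h1 : lin X.aug (lin (fst _ _) x) = 0 := h
      have h2 : lin Y.aug (lin (snd _ _) x) = 0 := by
        simpa [baerAug, h1] using hx
      obtain ⟨x', hx'⟩ := (X.exact_zero _).1 h1
      obtain ⟨y', hy'⟩ := (Y.exact_zero _).1 h2
      obtain ⟨w, hw1, hw2⟩ := exists_prod x' y'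
      refine ⟨cls (baerIncl X Y (0 + 1)) (baerAug X Y (0 + 1)) (baerIncl_aug X Y (0 + 1)) w (baerAug_succ X Y _ w), ?_⟩
      rw [homologyMap_cls]
      refine cls_eq_iff.2 ⟨0, ?_⟩
      rw [map_zero, add_zero]
      exact prod_ext (by simp [baerD, hw1, hx']) (by simp [baerD, hw2, hy'])
    · rintro ⟨w, rfl⟩
      obtain ⟨x, hx, rfl⟩ := cls_surjective w
      rw [homologyMap_cls]
      change lin X.aug (lin (fst _ _) (lin (baerD X Y 0) x)) = 0
      simp [baerD]
  exact i z := by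
    constructor
    · intro h
      obtain ⟨x, hx, rfl⟩ := cls_surjective z
      rw [homologyMap_cls] at h
      obtain ⟨a, ha⟩ := cls_eq_zero_iff.1 h
      have h1 := congrArg (lin (fst _ _)) ha
      have h2 := congrArg (lin (snd _ _)) ha
      simp only [baerD, baerIncl, fst_pair, snd_pair, lin_comp, lin_neg] at h1 h2
      rcases Nat.lt_or_ge N i with hi | hi
      · have := X.subsingleton (i + 1) (by omega)
        have := Y.subsingleton (i + 1) (by omega)
        exact ⟨0, (map_zero _).trans (cls_eq_zero_iff.2
          ⟨0, prod_ext (Subsingleton.elim _ _) (Subsingleton.elim _ _)⟩).symm⟩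
      · have hi' : N + 1 ≠ i := by omega
        simp only [baerTop, topAt_of_ne _ hi', zero_add, lin_comp] at h1 h2
        obtain ⟨x', hx'⟩ := (X.exact i (lin (fst _ _) x - lin (X.topAt (i + 1)) a)).1 (by
          rw [map_sub, h1, sub_self])
        obtain ⟨y', hy'⟩ := (Y.exact i (lin (snd _ _) x + lin (Y.topAt (i + 1)) a)).1 (by
          rw [map_add, h2, neg_add_cancel])
        obtain ⟨w, hw1, hw2⟩ := exists_prod (x' - lin (X.topAt (i + 2)) a)
          (y' + lin (Y.topAt (i + 2)) a)
        refine ⟨cls (baerIncl X Y (i + 1 + 1)) (baerAug X Y (i + 1 + 1)) (baerIncl_aug X Y (i + 1 + 1)) w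
          (baerAug_succ X Y _ w), ?_⟩
        rw [homologyMap_cls]
        refine cls_eq_iff.2 ⟨-a, prod_ext ?_ ?_⟩
        · simp only [baerD, baerIncl, baerTop, fst_pair, lin_comp, hw1, map_sub, hx', map_add,
            map_neg, lin_add]
          abel
        · simp only [baerD, baerIncl, baerTop, snd_pair, lin_comp, hw2, hy', map_add,
            map_neg, lin_add, lin_neg]
          abel
    · rintro ⟨w, rfl⟩
      obtain ⟨x, hx, rfl⟩ := cls_surjective w
      rw [homologyMap_cls, homologyMap_cls]
      refine cls_eq_zero_iff.2 ⟨0, ?_⟩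
      rw [map_zero]
      exact prod_ext (by simp [baerD]) (by simp [baerD])

lemma Hom.comm_apply {X Y : HopfExt k H N} (φ : X ⟶ Y) (i : ℕ) (x : X.X (i + 1)) :
    lin (φ.f i) (lin (X.d i) x) = lin (Y.d i) (lin (φ.f (i + 1)) x) :=
  congrArg (fun ψ : X.X (i + 1) ⟶ Y.X i => lin ψ x) (φ.comm i)

lemma Hom.aug_apply {X Y : HopfExt k H N} (φ : X ⟶ Y) (x : X.X 0) :
    lin Y.aug (lin (φ.f 0) x) = lin X.aug x :=
  congrArg (fun ψ : X.X 0 ⟶ unit k H => lin ψ x) φ.aug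

lemma Hom.top_apply {X Y : HopfExt k H N} (φ : X ⟶ Y) (h : unit k H) :
    lin (φ.f N) (lin X.top h) = lin Y.top h :=
  congrArg (fun ψ : unit k H ⟶ Y.X N => lin ψ h) φ.top

lemma Hom.topAt_apply {X Y : HopfExt k H N} (φ : X ⟶ Y) (i : ℕ) (h : unit k H) :
    lin (φ.f i) (lin (X.topAt i) h) = lin (Y.topAt i) h := by
  by_cases hi : N = i
  · subst hi
    rw [topAt_self, topAt_self, Hom.top_apply]
  · rw [topAt_of_ne X hi, topAt_of_ne Y hi, lin_zero, lin_zero, map_zero]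

lemma Hom.baerTop_apply {X Y : HopfExt k H N} (φ : X ⟶ Y) (i : ℕ) (h : unit k H) :
    lin (φ.f i) (lin (X.baerTop i) h) = lin (Y.baerTop i) h := by
  simp only [baerTop, lin_add, lin_comp, map_add, Hom.topAt_apply, Hom.comm_apply]

/-- The map `(x, y) ↦ (φ x, ψ y)`. -/
def baerProd {X Y X' Y' : HopfExt k H N} (φ : X ⟶ X') (ψ : Y ⟶ Y') (i : ℕ) :
    prod (X.X i) (Y.X i) ⟶ prod (X'.X i) (Y'.X i) :=
  pair (fst _ _ ≫ φ.f i) (snd _ _ ≫ ψ.f i)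

lemma baerProd_aug {X Y X' Y' : HopfExt k H N} (φ : X ⟶ X') (ψ : Y ⟶ Y') (i : ℕ)
    (x : prod (X.X i) (Y.X i)) (hx : lin (baerAug X Y i) x = 0) :
    lin (baerAug X' Y' i) (lin (baerProd φ ψ i) x) = 0 := by
  cases i with
  | zero => simpa [baerAug, baerProd, Hom.aug_apply] using hx
  | succ i => exact baerAug_succ _ _ _ _

lemma baerProd_d {X Y X' Y' : HopfExt k H N} (φ : X ⟶ X') (ψ : Y ⟶ Y') (i : ℕ)
    (x : prod (X.X (i + 1)) (Y.X (i + 1))) :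
    lin (baerProd φ ψ i) (lin (baerD X Y i) x) = lin (baerD X' Y' i) (lin (baerProd φ ψ (i + 1)) x) := by
  refine prod_ext ?_ ?_ <;> simp [baerD, baerProd, Hom.comm_apply]

/-- The morphism of Baer sums induced by two morphisms. -/
def baerMap {X Y X' Y' : HopfExt k H (N + 1)} (φ : X ⟶ X') (ψ : Y ⟶ Y') :
    baer X Y ⟶ baer X' Y' where
  f i := homologyMap _ _ _ _ _ _ (baerProd φ ψ i) (baerProd_aug φ ψ i)
    (fun h => ⟨h, prod_ext (by simp [baerIncl, baerProd, Hom.baerTop_apply])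
      (by simp [baerIncl, baerProd, Hom.baerTop_apply])⟩)
  comm i := HopfBimod.hom_ext fun z => by
    obtain ⟨x, hx, rfl⟩ := cls_surjective z
    exact cls_congr (hx := baerProd_aug φ ψ i _ (baerD_aug X Y i x)) (hy := baerD_aug X' Y' i _)
      (baerProd_d φ ψ i x)
  top := HopfBimod.hom_ext fun h => by
    refine cls_congr (hx := baerAug_succ _ _ _ _) (hy := baerAug_succ _ _ _ _) (prod_ext ?_ ?_)
    · refine (fst_pair _ _ _).trans ?_
      simp only [lin_comp]
      refine (congrArg _ (fst_pair _ _ _)).trans ?_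
      rw [Hom.top_apply, fst_pair]
    · refine (snd_pair _ _ _).trans ?_
      simp only [lin_comp]
      refine (congrArg _ (snd_pair _ _ _)).trans ?_
      rw [lin_zero, snd_pair, lin_zero, map_zero]
  aug := HopfBimod.hom_ext fun z => by
    obtain ⟨x, hx, rfl⟩ := cls_surjective z
    change lin X'.aug (lin (fst _ _) (lin (baerProd φ ψ 0) x)) = lin X.aug (lin (fst _ _) x)
    rw [baerProd, fst_pair, lin_comp, Hom.aug_apply]

/-- The functor `X ↦ X + A`. -/
def translate (A : HopfExt k H (N + 1)) : HopfExt k H (N + 1) ⥤ HopfExt k H (N + 1) where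
  obj X := baer X A
  map φ := baerMap φ (𝟙 A)
  map_id X := by
    refine hom_ext' fun i => HopfBimod.hom_ext fun z => ?_
    obtain ⟨x, hx, rfl⟩ := cls_surjective z
    exact cls_congr (hx := baerProd_aug (𝟙 X) (𝟙 A) i x hx) (hy := hx)
      (prod_ext (by simp [baerProd]) (by simp [baerProd]))
  map_comp φ ψ := by
    refine hom_ext' fun i => HopfBimod.hom_ext fun z => ?_
    obtain ⟨x, hx, rfl⟩ := cls_surjective z
    exact cls_congr (hx := baerProd_aug _ _ i x hx)
      (hy := baerProd_aug _ _ i _ (baerProd_aug _ _ i x hx))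
      (prod_ext (by simp [baerProd]) (by simp [baerProd]))

end Baer
/-! ### The fundamental group -/

section Pi1

/-- The functor `X ↦ X + A` on fundamental groupoids. -/
def translatePi {N : ℕ} (A : HopfExt k H (N + 1)) :
    FreeGroupoid (HopfExt k H (N + 1)) ⥤ FreeGroupoid (HopfExt k H (N + 1)) :=
  FreeGroupoid.map (translate A)

variable (k H) in
/-- The set `π₀` of connected components of the category of `n`-fold extensions. -/
abbrev Pi0 (n : ℕ) : Type (max u (v + 1)) :=
  CategoryTheory.ConnectedComponents (HopfExt k H n)

/-- The class of an extension in `π₀`. -/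
abbrev toPi0 {n : ℕ} (E : HopfExt k H n) : Pi0 k H n := CategoryTheory.ConnectedComponents.mk E

variable (k H) in
/-- The fundamental group `π₁` of the category of extensions of degree `N + 1`, independently of
the base point.  The fundamental group at `X` is the automorphism group of `X` in the fundamental
groupoid, with concatenation of loops as multiplication.  The fundamental groups at all base
points, in all components, are identified with each other by the canonical isomorphisms, which are
given by change of base point along a path and by Baer sum with a fixed extension `A`.  So an element
of `π₁` is a family of loops, one at each `X`, which are related by these isomorphisms. -/
def Pi1 (N : ℕ) : Subgroup (∀ X : HopfExt k H (N + 1), FreeGroupoid.mk X ⟶ FreeGroupoid.mk X) where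
  carrier := {γ |
    (∀ (X Y : HopfExt k H (N + 1)) (p : FreeGroupoid.mk X ⟶ FreeGroupoid.mk Y),
      γ X ≫ p = p ≫ γ Y) ∧
    ∀ X A : HopfExt k H (N + 1), γ (baer X A) = (translatePi A).map (γ X)}
  one_mem' := ⟨fun X Y p => (Category.id_comp p).trans (Category.comp_id p).symm,
    fun X A => ((translatePi A).map_id (FreeGroupoid.mk X)).symm⟩
  mul_mem' {γ δ} hγ hδ := ⟨fun X Y p => by
      change (γ X ≫ δ X) ≫ p = p ≫ γ Y ≫ δ Y
      rw [Category.assoc, hδ.1 X Y p, ← Category.assoc, hγ.1 X Y p, Category.assoc],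
    fun X A => by
      change γ (baer X A) ≫ δ (baer X A) = (translatePi A).map (γ X ≫ δ X)
      rw [hγ.2 X A, hδ.2 X A, Functor.map_comp]; rfl⟩
  inv_mem' {γ} hγ := ⟨fun X Y p => by
      change Groupoid.inv (γ X) ≫ p = p ≫ Groupoid.inv (γ Y)
      rw [Groupoid.inv_eq_inv, Groupoid.inv_eq_inv, IsIso.inv_comp_eq, ← Category.assoc,
        hγ.1 X Y p, Category.assoc, IsIso.hom_inv_id, Category.comp_id],
    fun X A => by
      change Groupoid.inv (γ (baer X A)) = (translatePi A).map (Groupoid.inv (γ X))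
      rw [hγ.2 X A]
      exact (map_inv ((translatePi A).mapVertexGroup (FreeGroupoid.mk X)) (γ X)).symm⟩

end Pi1

/-- `Ω : π₀ × π₀ → π₁` is the loop bracket if it sends the classes of `E` and `F` to the class of
the loop of `E` and `F`. -/
def IsLoopBracket (Ω : ∀ m n N : ℕ, m + n + 1 = N → Pi0 k H (m + 1) → Pi0 k H (n + 1) → Pi1 k H N) :
    Prop :=
  ∀ (m n N : ℕ) (h : m + n + 1 = N) (E : HopfExt k H (m + 1)) (F : HopfExt k H (n + 1)),
    (Ω m n N h (toPi0 E) (toPi0 F)).1 (splice E F (by omega)) = loop E F h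

end HopfExt

end Bimodules

end

/-!
Write `π₁` for the fundamental group. Two things have to be seen: that loops at different base
points can be compared, and that the loop of `E` and `F` depends on `E` and `F` as claimed.

*The fundamental group.* The Baer sum is a functor in each variable, with natural morphisms
expressing commutativity (`baerSwap`), associativity (`baerAssoc`), the neutrality of split
extensions (`addSplit`: a section `s` of the augmentation of `Z` gives `x ↦ [x, s p x]` from `X` to
`X + Z`) and the cancellation of `X + (-X)` (`cancel`, to a split extension). A functor acts on
paths, and a natural morphism gives a relation between the paths (`pmap_natural`). Therefore every
loop `γ` at `X` can be moved to any base point `Y`, as the translate of `γ` by `(-X) + Y` followed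
by a change of base point (`spread`). The result is natural in `Y` and compatible with translation,
and at `Y = X` it gives back `γ`: hence the loops at `X` commute, each of them is the component of
exactly one element of `π₁` (`ofLoop`, `Pi1.ext_at`), and sums of loops are products in `π₁`
(`Pi1.addPath`). Changing signs, `X ↦ (-1)^s X`, inverts `π₁` for odd `s` (`Pi1.twist_odd`), because
`γ + (-γ)` is carried by `cancel` to a loop of split extensions, which is trivial
(`splitLoop_eq_id`).

*The bracket.* It is the element of `π₁` whose component at `E # F` is the given loop. It only
depends on the connected components since `λ` and `ρ` are natural. For the antisymmetry, let
`a : (-1)^s E # F ← E ⊗ F → F # E` be the path given by `ρ` and `λ`, where `s = mn`, and let `b` be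
the same path with `E` and `F` exchanged. The loop of `E` and `F` is `(-1)^s a` followed by `b`, the
loop of `F` and `E` is `(-1)^s b` followed by `a`, and so `(-1)^s` of the first one is conjugate to
the second one (`bracket₀_antisymm`).

*Additivity.* There are morphisms `E # G + F # G → (E + F) # G` (`sumLeft`) and
`G # (E + F) → G # E + G # F` (`sumRight`), and the paths `a` for `E`, `F` and `E + F` have to be
compared along them. There is no evident morphism between `(E + F) ⊗ G` and `E ⊗ G + F ⊗ G`, but
there is an extension with morphisms to both of them: the tensor product with `G` of the fibre
product of `E` and `F` over `H`, in which the two copies of `H` on the left are identified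
(`pairRight`, and `pairLeft` for the tensor product with `G` on the other side). The four squares
`pairRight_lambda`, `pairLeft_lambda`, `pairRight_rho`, `pairLeft_rho` give additivity in the first
variable (`bracket₀_add_left`); the second variable follows by antisymmetry. Finally, if the
augmentation of `Z` has a section, then `addSplit` is a morphism from `Z` to `Z + Z`, so
`Ω(F, Z) = Ω(F, Z)²`.
-/

noncomputable section

open HopfBimod

variable {k : Type u} {H : Type v} [Field k] [Ring H] [HopfAlgebra k H]

/-! ### Paths in a free groupoid -/

section Paths

variable {C D : Type*} [Category C] [Category D]

/-- Functors on a free groupoid are natural in all paths if they are so in the generating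
morphisms. -/
lemma freeGroupoid_natural {G : Type*} [Groupoid G] {F F' : FreeGroupoid C ⥤ G}
    (η : ∀ X : C, F.obj (FreeGroupoid.mk X) ⟶ F'.obj (FreeGroupoid.mk X))
    (hη : ∀ {X Y : C} (f : X ⟶ Y),
      F.map (FreeGroupoid.homMk f) ≫ η Y = η X ≫ F'.map (FreeGroupoid.homMk f))
    {X Y : C} (p : FreeGroupoid.mk X ⟶ FreeGroupoid.mk Y) :
    F.map p ≫ η Y = η X ≫ F'.map p := by
  have := (FreeGroupoid.liftNatIso F F' (NatIso.ofComponents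
    (fun X => Groupoid.isoEquivHom _ _ |>.symm (η X)) (fun f => hη f))).hom.naturality p
  simpa using this

/-- The map of paths induced by a functor. -/
def pmap (Φ : C ⥤ D) {X Y : C} (p : FreeGroupoid.mk X ⟶ FreeGroupoid.mk Y) :
    FreeGroupoid.mk (Φ.obj X) ⟶ FreeGroupoid.mk (Φ.obj Y) := (FreeGroupoid.map Φ).map p

@[simp] lemma pmap_id (Φ : C ⥤ D) (X : C) : pmap Φ (𝟙 (FreeGroupoid.mk X)) = 𝟙 _ :=
  (FreeGroupoid.map Φ).map_id _

@[simp] lemma pmap_comp (Φ : C ⥤ D) {X Y Z : C} (p : FreeGroupoid.mk X ⟶ FreeGroupoid.mk Y)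
    (q : FreeGroupoid.mk Y ⟶ FreeGroupoid.mk Z) : pmap Φ (p ≫ q) = pmap Φ p ≫ pmap Φ q :=
  (FreeGroupoid.map Φ).map_comp p q

@[simp] lemma pmap_inv (Φ : C ⥤ D) {X Y : C} (p : FreeGroupoid.mk X ⟶ FreeGroupoid.mk Y) :
    pmap Φ (inv p) = inv (pmap Φ p) := by
  rw [← cancel_mono (pmap Φ p), ← pmap_comp]
  simp

/-- A natural transformation gives a relation between the induced paths. -/
lemma pmap_natural {Φ Ψ : C ⥤ D} (η : Φ ⟶ Ψ) {X Y : C}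
    (p : FreeGroupoid.mk X ⟶ FreeGroupoid.mk Y) :
    pmap Φ p ≫ FreeGroupoid.homMk (η.app Y) = FreeGroupoid.homMk (η.app X) ≫ pmap Ψ p :=
  freeGroupoid_natural (F := FreeGroupoid.map Φ) (F' := FreeGroupoid.map Ψ)
    (fun X => FreeGroupoid.homMk (η.app X))
    (fun f => ((FreeGroupoid.of D).map_comp _ _).symm.trans
      ((congrArg (FreeGroupoid.of D).map (η.naturality f)).trans
        ((FreeGroupoid.of D).map_comp _ _))) p

lemma pmap_id_functor {X Y : C} (p : FreeGroupoid.mk X ⟶ FreeGroupoid.mk Y) :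
    pmap (𝟭 C) p = p := by
  have := freeGroupoid_natural (F := FreeGroupoid.map (𝟭 C)) (F' := 𝟭 (FreeGroupoid C))
    (fun X => 𝟙 (FreeGroupoid.mk X))
    (fun f => (Category.comp_id (FreeGroupoid.homMk f)).trans (Category.id_comp _).symm) p
  exact (Category.comp_id (pmap (𝟭 C) p)).symm.trans (this.trans (Category.id_comp p))

lemma pmap_comp_functor {E : Type*} [Category E] (Φ : C ⥤ D) (Ψ : D ⥤ E) {X Y : C}
    (p : FreeGroupoid.mk X ⟶ FreeGroupoid.mk Y) : pmap (Φ ⋙ Ψ) p = pmap Ψ (pmap Φ p) := by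
  have := freeGroupoid_natural (F := FreeGroupoid.map (Φ ⋙ Ψ))
    (F' := FreeGroupoid.map Φ ⋙ FreeGroupoid.map Ψ)
    (fun X => 𝟙 (FreeGroupoid.mk (Ψ.obj (Φ.obj X))))
    (fun f => (Category.comp_id (FreeGroupoid.homMk (Ψ.map (Φ.map f)))).trans
      (Category.id_comp _).symm) p
  exact (Category.comp_id (pmap (Φ ⋙ Ψ) p)).symm.trans (this.trans (Category.id_comp _))

end Paths

namespace HopfBimod

/-- A morphism out of the image of a surjection `π` is a morphism out of its source which vanishes
on the kernel of `π`. -/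
def surjDesc {T A B : HopfBimod k H} (π : T ⟶ A) (hs : Function.Surjective (lin π)) (f : T ⟶ B)
    (hk : ∀ t, lin π t = 0 → lin f t = 0) : A ⟶ B :=
  have hk' : LinearMap.ker (lin π) ≤ LinearMap.ker (lin f) := fun t ht => hk t ht
  let φ : A →ₗ[k] B :=
    (LinearMap.ker (lin π)).liftQ (lin f) hk' ∘ₗ
      ((lin π).quotKerEquivOfSurjective hs).symm.toLinearMap
  have hφ : ∀ t, φ (lin π t) = lin f t := fun t => by
    have : ((lin π).quotKerEquivOfSurjective hs).symm (lin π t) =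
        (LinearMap.ker (lin π)).mkQ t := by
      rw [LinearEquiv.symm_apply_eq]; rfl
    change (LinearMap.ker (lin π)).liftQ (lin f) hk'
      (((lin π).quotKerEquivOfSurjective hs).symm (lin π t)) = _
    rw [this]
    rfl
  have hc : φ ∘ₗ lin π = lin f := LinearMap.ext hφ
  mkHom φ
    { lact := fun h a => by
        obtain ⟨t, rfl⟩ := hs a
        rw [← (isHom π).lact, hφ, hφ, (isHom f).lact]
      ract := fun h a => by
        obtain ⟨t, rfl⟩ := hs a
        rw [← (isHom π).ract, hφ, hφ, (isHom f).ract]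
      lcoact := fun a => by
        obtain ⟨t, rfl⟩ := hs a
        rw [← (isHom π).lcoact, hφ, ← LinearMap.comp_apply, ← LinearMap.lTensor_comp, hc,
          (isHom f).lcoact]
      rcoact := fun a => by
        obtain ⟨t, rfl⟩ := hs a
        rw [← (isHom π).rcoact, hφ, ← LinearMap.comp_apply, ← LinearMap.rTensor_comp, hc,
          (isHom f).rcoact] }

@[simp] lemma surjDesc_apply {T A B : HopfBimod k H} (π : T ⟶ A)
    (hs : Function.Surjective (lin π)) (f : T ⟶ B) (hk : ∀ t, lin π t = 0 → lin f t = 0) (t : T) :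
    lin (surjDesc π hs f hk) (lin π t) = lin f t := by
  have : ((lin π).quotKerEquivOfSurjective hs).symm (lin π t) =
      (LinearMap.ker (lin π)).mkQ t := by
    rw [LinearEquiv.symm_apply_eq]; rfl
  change (LinearMap.ker (lin π)).liftQ (lin f) (fun t ht => hk t ht)
    (((lin π).quotKerEquivOfSurjective hs).symm (lin π t)) = _
  rw [this]
  rfl

end HopfBimod

namespace HopfExt

variable {N : ℕ}

/-! ### Elements of Baer sums -/

section BaerElements

/-- The augmentation, extended by zero to all degrees. -/
def augAt (X : HopfExt k H N) : ∀ i, X.X i ⟶ unit k H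
  | 0 => X.aug
  | _ + 1 => 0

lemma augAt_zero (X : HopfExt k H N) : X.augAt 0 = X.aug := rfl

lemma augAt_succ (X : HopfExt k H N) (i : ℕ) (x : X.X (i + 1)) : lin (X.augAt (i + 1)) x = 0 := rfl

@[simp] lemma augAt_d (X : HopfExt k H N) (i : ℕ) (x : X.X (i + 1)) :
    lin (X.augAt i) (lin (X.d i) x) = 0 := by
  cases i
  · exact X.aug_d x
  · rfl

lemma Hom.augAt_apply {X Y : HopfExt k H N} (φ : X ⟶ Y) (i : ℕ) (x : X.X i) :
    lin (Y.augAt i) (lin (φ.f i) x) = lin (X.augAt i) x := by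
  cases i
  · exact φ.aug_apply x
  · rfl

lemma baerAug_apply (X Y : HopfExt k H N) (i : ℕ) (z : prod (X.X i) (Y.X i)) :
    lin (baerAug X Y i) z =
      lin (X.augAt i) (lin (fst _ _) z) - lin (Y.augAt i) (lin (snd _ _) z) := by
  cases i
  · rfl
  · exact (sub_self (0 : unit k H)).symm

@[simp] lemma augAt_baerTop (X : HopfExt k H (N + 1)) (i : ℕ) (h : unit k H) :
    lin (X.augAt i) (lin (X.baerTop i) h) = 0 := by
  cases i
  · exact congrArg (fun φ => lin φ h) X.baerTop_aug
  · rfl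

/-- The pairs of elements of equal augmentation, of which a Baer sum is a quotient. -/
def fib (X Y : HopfExt k H (N + 1)) (i : ℕ) : HopfBimod k H := ker (baerAug X Y i)

/-- The first component of a pair of equal augmentation. -/
def fibFst (X Y : HopfExt k H (N + 1)) (i : ℕ) : fib X Y i ⟶ X.X i := kerι _ ≫ fst _ _

/-- The second component of a pair of equal augmentation. -/
def fibSnd (X Y : HopfExt k H (N + 1)) (i : ℕ) : fib X Y i ⟶ Y.X i := kerι _ ≫ snd _ _

/-- The class in the Baer sum of a pair of equal augmentation. -/
def fibMk (X Y : HopfExt k H (N + 1)) (i : ℕ) : fib X Y i ⟶ (baer X Y).X i := homologyπ _ _ _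

variable {X Y : HopfExt k H (N + 1)}

lemma fib_ext {i : ℕ} {z w : fib X Y i} (h1 : lin (fibFst X Y i) z = lin (fibFst X Y i) w)
    (h2 : lin (fibSnd X Y i) z = lin (fibSnd X Y i) w) : z = w :=
  kerι_injective _ (prod_ext h1 h2)

lemma fib_aug {i : ℕ} (z : fib X Y i) :
    lin (X.augAt i) (lin (fibFst X Y i) z) = lin (Y.augAt i) (lin (fibSnd X Y i) z) := by
  have := (baerAug_apply X Y i _).symm.trans (lin_kerι (baerAug X Y i) z)
  exact sub_eq_zero.1 this

lemma exists_fib {i : ℕ} (x : X.X i) (y : Y.X i) (h : lin (X.augAt i) x = lin (Y.augAt i) y) :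
    ∃ z : fib X Y i, lin (fibFst X Y i) z = x ∧ lin (fibSnd X Y i) z = y := by
  obtain ⟨w, h1, h2⟩ := exists_prod x y
  exact ⟨kerMk _ w (by rw [baerAug_apply, h1, h2, h, sub_self]), h1, h2⟩

/-- A morphism to the object of pairs of equal augmentation. -/
def fibLift {T : HopfBimod k H} {i : ℕ} (f : T ⟶ X.X i) (g : T ⟶ Y.X i)
    (h : ∀ t, lin (X.augAt i) (lin f t) = lin (Y.augAt i) (lin g t)) : T ⟶ fib X Y i :=
  kerLift _ (pair f g) (HopfBimod.hom_ext fun t => by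
    rw [lin_comp, baerAug_apply, fst_pair, snd_pair, h, sub_self, lin_zero])

@[simp] lemma fibFst_fibLift {T : HopfBimod k H} {i : ℕ} (f : T ⟶ X.X i) (g : T ⟶ Y.X i)
    (h : ∀ t, lin (X.augAt i) (lin f t) = lin (Y.augAt i) (lin g t)) (t : T) :
    lin (fibFst X Y i) (lin (fibLift f g h) t) = lin f t := fst_pair f g t

@[simp] lemma fibSnd_fibLift {T : HopfBimod k H} {i : ℕ} (f : T ⟶ X.X i) (g : T ⟶ Y.X i)
    (h : ∀ t, lin (X.augAt i) (lin f t) = lin (Y.augAt i) (lin g t)) (t : T) :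
    lin (fibSnd X Y i) (lin (fibLift f g h) t) = lin g t := snd_pair f g t

lemma fibMk_surjective (i : ℕ) : Function.Surjective (lin (fibMk X Y i)) :=
  homologyπ_surjective _ _ _

lemma fibMk_eq_zero_iff {i : ℕ} {z : fib X Y i} : lin (fibMk X Y i) z = 0 ↔
    ∃ h, lin (fibFst X Y i) z = lin (X.baerTop i) h ∧
      lin (fibSnd X Y i) z = -lin (Y.baerTop i) h := by
  refine (homologyπ_eq_zero _ _ _).trans (exists_congr fun h => ⟨fun e => ?_, fun e => ?_⟩)
  · have h1 := congrArg (lin (fst _ _)) e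
    have h2 := congrArg (lin (snd _ _)) e
    rw [baerIncl, fst_pair] at h1
    rw [baerIncl, snd_pair] at h2
    exact ⟨h1.symm, h2.symm⟩
  · refine prod_ext ?_ ?_
    · rw [baerIncl, fst_pair]; exact e.1.symm
    · rw [baerIncl, snd_pair]; exact e.2.symm

/-- Two pairs have the same class as soon as they differ by some `(ι h, -ι h)`. -/
lemma fibMk_eq {i : ℕ} {z w : fib X Y i} (h : unit k H)
    (h1 : lin (fibFst X Y i) z = lin (fibFst X Y i) w + lin (X.baerTop i) h)
    (h2 : lin (fibSnd X Y i) z = lin (fibSnd X Y i) w - lin (Y.baerTop i) h) :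
    lin (fibMk X Y i) z = lin (fibMk X Y i) w := by
  rw [← sub_eq_zero, ← map_sub, fibMk_eq_zero_iff]
  exact ⟨h, by rw [map_sub, h1]; abel, by rw [map_sub, h2]; abel⟩

/-- The componentwise differential. -/
def fibD (X Y : HopfExt k H (N + 1)) (i : ℕ) : fib X Y (i + 1) ⟶ fib X Y i :=
  fibLift (fibFst X Y (i + 1) ≫ X.d i) (fibSnd X Y (i + 1) ≫ Y.d i) (fun t => by simp)

@[simp] lemma fibFst_fibD (i : ℕ) (z : fib X Y (i + 1)) :
    lin (fibFst X Y i) (lin (fibD X Y i) z) = lin (X.d i) (lin (fibFst X Y (i + 1)) z) :=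
  fibFst_fibLift _ _ _ _

@[simp] lemma fibSnd_fibD (i : ℕ) (z : fib X Y (i + 1)) :
    lin (fibSnd X Y i) (lin (fibD X Y i) z) = lin (Y.d i) (lin (fibSnd X Y (i + 1)) z) :=
  fibSnd_fibLift _ _ _ _

lemma baer_d_fibMk (i : ℕ) (z : fib X Y (i + 1)) :
    lin ((baer X Y).d i) (lin (fibMk X Y (i + 1)) z) = lin (fibMk X Y i) (lin (fibD X Y i) z) :=
  cls_congr (hx := baerD_aug X Y i _) (hy := (lin (fibD X Y i) z).2)
    (prod_ext ((fst_pair _ _ _).trans (fibFst_fibD i z).symm)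
      ((snd_pair _ _ _).trans (fibSnd_fibD i z).symm))

lemma baer_augAt_fibMk (i : ℕ) (z : fib X Y i) :
    lin ((baer X Y).augAt i) (lin (fibMk X Y i) z) = lin (X.augAt i) (lin (fibFst X Y i) z) := by
  cases i <;> rfl

/-- The inclusion of `H` into a Baer sum is represented by `h ↦ (i_X h, 0)`. -/
lemma baer_top (h : unit k H) (z : fib X Y (N + 1))
    (h1 : lin (fibFst X Y (N + 1)) z = lin X.top h) (h2 : lin (fibSnd X Y (N + 1)) z = 0) :
    lin (baer X Y).top h = lin (fibMk X Y (N + 1)) z :=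
  congrArg (lin (fibMk X Y (N + 1))) (kerι_injective _ (prod_ext ((fst_pair _ _ _).trans h1.symm)
    ((snd_pair _ _ _).trans h2.symm)))

lemma baer_topAt (i : ℕ) (h : unit k H) (z : fib X Y i)
    (h1 : lin (fibFst X Y i) z = lin (X.topAt i) h) (h2 : lin (fibSnd X Y i) z = 0) :
    lin ((baer X Y).topAt i) h = lin (fibMk X Y i) z := by
  by_cases hi : N + 1 = i
  · subst hi
    rw [topAt_self] at h1 ⊢
    exact baer_top h z h1 h2
  · rw [topAt_of_ne _ hi] at h1 ⊢
    rw [lin_zero] at h1 ⊢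
    rw [fib_ext (z := z) (w := 0) (by rw [h1, map_zero]) (by rw [h2, map_zero]), map_zero]

lemma baer_baerTop (i : ℕ) (h : unit k H) (z : fib X Y i)
    (h1 : lin (fibFst X Y i) z = lin (X.baerTop i) h) (h2 : lin (fibSnd X Y i) z = 0) :
    lin ((baer X Y).baerTop i) h = lin (fibMk X Y i) z := by
  have e : ∀ j, lin (X.augAt j) (lin (X.topAt j) h) = lin (Y.augAt j) 0 := fun j => by
    cases j
    · rw [topAt_of_ne X (Nat.succ_ne_zero N), lin_zero, map_zero, map_zero]
    · rfl
  obtain ⟨a, a1, a2⟩ := exists_fib (X := X) (Y := Y) (lin (X.topAt i) h) 0 (e i)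
  obtain ⟨b, b1, b2⟩ := exists_fib (X := X) (Y := Y) (lin (X.topAt (i + 1)) h) 0 (e (i + 1))
  rw [baerTop, lin_add, lin_comp, baer_topAt i h a a1 a2, baer_topAt (i + 1) h b b1 b2,
    baer_d_fibMk, ← map_add]
  congr 1
  refine fib_ext ?_ ?_
  · rw [map_add, fibFst_fibD, a1, b1, h1]; rfl
  · rw [map_add, fibSnd_fibD, a2, b2, h2, map_zero, add_zero]

lemma baerMap_fibMk {X' Y' : HopfExt k H (N + 1)} (φ : X ⟶ X') (ψ : Y ⟶ Y') (i : ℕ)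
    (z : fib X Y i) (w : fib X' Y' i)
    (h1 : lin (fibFst X' Y' i) w = lin (φ.f i) (lin (fibFst X Y i) z))
    (h2 : lin (fibSnd X' Y' i) w = lin (ψ.f i) (lin (fibSnd X Y i) z)) :
    lin ((baerMap φ ψ).f i) (lin (fibMk X Y i) z) = lin (fibMk X' Y' i) w :=
  congrArg (lin (fibMk X' Y' i)) (kerι_injective _ (prod_ext ((fst_pair _ _ _).trans h1.symm)
    ((snd_pair _ _ _).trans h2.symm)))

/-- The componentwise map on pairs of equal augmentation. -/
def fibMap {X' Y' : HopfExt k H (N + 1)} (φ : X ⟶ X') (ψ : Y ⟶ Y') (i : ℕ) :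
    fib X Y i ⟶ fib X' Y' i :=
  fibLift (fibFst X Y i ≫ φ.f i) (fibSnd X Y i ≫ ψ.f i) (fun t => by
    simp only [lin_comp, Hom.augAt_apply, fib_aug])

lemma baerMap_f {X' Y' : HopfExt k H (N + 1)} (φ : X ⟶ X') (ψ : Y ⟶ Y') (i : ℕ)
    (z : fib X Y i) : lin ((baerMap φ ψ).f i) (lin (fibMk X Y i) z) =
      lin (fibMk X' Y' i) (lin (fibMap φ ψ i) z) :=
  baerMap_fibMk φ ψ i z _ (fibFst_fibLift _ _ _ _) (fibSnd_fibLift _ _ _ _)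

@[simp] lemma fibFst_fibMap {X' Y' : HopfExt k H (N + 1)} (φ : X ⟶ X') (ψ : Y ⟶ Y') (i : ℕ)
    (z : fib X Y i) : lin (fibFst X' Y' i) (lin (fibMap φ ψ i) z) =
      lin (φ.f i) (lin (fibFst X Y i) z) := fibFst_fibLift _ _ _ _

@[simp] lemma fibSnd_fibMap {X' Y' : HopfExt k H (N + 1)} (φ : X ⟶ X') (ψ : Y ⟶ Y') (i : ℕ)
    (z : fib X Y i) : lin (fibSnd X' Y' i) (lin (fibMap φ ψ i) z) =
      lin (ψ.f i) (lin (fibSnd X Y i) z) := fibSnd_fibLift _ _ _ _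

end BaerElements

/-! ### The Baer sum as a group law up to natural morphisms -/

section BaerLaws

/-- A morphism out of a Baer sum, from maps on the pairs of equal augmentation. -/
def baerDesc {X Y F : HopfExt k H (N + 1)} (f : ∀ i, fib X Y i ⟶ F.X i)
    (hk : ∀ i z h, lin (fibFst X Y i) z = lin (X.baerTop i) h →
      lin (fibSnd X Y i) z = -lin (Y.baerTop i) h → lin (f i) z = 0)
    (comm : ∀ i z, lin (f i) (lin (fibD X Y i) z) = lin (F.d i) (lin (f (i + 1)) z))
    (top : ∀ z h, lin (fibFst X Y (N + 1)) z = lin X.top h → lin (fibSnd X Y (N + 1)) z = 0 →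
      lin (f (N + 1)) z = lin F.top h)
    (aug : ∀ z, lin F.aug (lin (f 0) z) = lin X.aug (lin (fibFst X Y 0) z)) : baer X Y ⟶ F where
  f i := surjDesc (fibMk X Y i) (fibMk_surjective i) (f i) fun z hz => by
    obtain ⟨h, h1, h2⟩ := fibMk_eq_zero_iff.1 hz
    exact hk i z h h1 h2
  comm i := HopfBimod.hom_ext fun z => by
    obtain ⟨z, rfl⟩ := fibMk_surjective (i + 1) z
    rw [lin_comp, lin_comp, baer_d_fibMk, surjDesc_apply, surjDesc_apply, comm]
  top := HopfBimod.hom_ext fun h => by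
    obtain ⟨z, h1, h2⟩ := exists_fib (X := X) (Y := Y) (i := N + 1) (lin X.top h) 0 rfl
    rw [lin_comp, baer_top h z h1 h2, surjDesc_apply, top z h h1 h2]
  aug := HopfBimod.hom_ext fun z => by
    obtain ⟨z, rfl⟩ := fibMk_surjective 0 z
    rw [lin_comp, surjDesc_apply, aug]
    rfl

lemma baerDesc_f {X Y F : HopfExt k H (N + 1)} (f : ∀ i, fib X Y i ⟶ F.X i) (hk) (comm) (top)
    (aug) (i : ℕ) (z : fib X Y i) :
    lin ((baerDesc f hk comm top aug).f i) (lin (fibMk X Y i) z) = lin (f i) z :=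
  surjDesc_apply _ _ _ _ _

/-- Morphisms out of a Baer sum agree if they do so on classes. -/
lemma baer_hom_ext {X Y F : HopfExt k H (N + 1)} {φ ψ : baer X Y ⟶ F}
    (h : ∀ i z, lin (φ.f i) (lin (fibMk X Y i) z) = lin (ψ.f i) (lin (fibMk X Y i) z)) : φ = ψ :=
  hom_ext' fun i => HopfBimod.hom_ext fun z => by
    obtain ⟨z, rfl⟩ := fibMk_surjective i z
    exact h i z

/-- A morphism into a Baer sum, from maps to the pairs of equal augmentation. -/
def baerLift {X Y F : HopfExt k H (N + 1)} (f : ∀ i, F.X i ⟶ X.X i) (g : ∀ i, F.X i ⟶ Y.X i)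
    (hfg : ∀ i x, lin (X.augAt i) (lin (f i) x) = lin (Y.augAt i) (lin (g i) x))
    (hf : ∀ i x, lin (f i) (lin (F.d i) x) = lin (X.d i) (lin (f (i + 1)) x))
    (hg : ∀ i x, lin (g i) (lin (F.d i) x) = lin (Y.d i) (lin (g (i + 1)) x))
    (top : ∀ h, ∃ b, lin (f (N + 1)) (lin F.top h) = lin X.top (h + b) ∧
      lin (g (N + 1)) (lin F.top h) = -lin Y.top b)
    (aug : ∀ x, lin X.aug (lin (f 0) x) = lin F.aug x) : F ⟶ baer X Y where
  f i := fibLift (f i) (g i) (hfg i) ≫ fibMk X Y i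
  comm i := HopfBimod.hom_ext fun x => by
    rw [lin_comp, lin_comp, lin_comp, lin_comp, baer_d_fibMk]
    congr 1
    exact fib_ext (by simp [hf]) (by simp [hg])
  top := HopfBimod.hom_ext fun h => by
    obtain ⟨z, h1, h2⟩ := exists_fib (X := X) (Y := Y) (i := N + 1) (lin X.top h) 0 rfl
    obtain ⟨b, h3, h4⟩ := top h
    rw [lin_comp, lin_comp, baer_top h z h1 h2]
    exact fibMk_eq b (by rw [fibFst_fibLift, h1, h3, baerTop_self, map_add])
      (by rw [fibSnd_fibLift, h2, h4, baerTop_self, zero_sub])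
  aug := HopfBimod.hom_ext fun x => (congrArg (lin X.aug) (fibFst_fibLift (f 0) (g 0) (hfg 0) x)).trans (aug x)

/-- The functor `X ↦ A + X`. -/
def leftTranslate (A : HopfExt k H (N + 1)) : HopfExt k H (N + 1) ⥤ HopfExt k H (N + 1) where
  obj X := baer A X
  map φ := baerMap (𝟙 A) φ
  map_id X := baer_hom_ext fun i z => baerMap_fibMk _ _ _ _ _ rfl rfl
  map_comp φ ψ := baer_hom_ext fun i z => by
    rw [comp_f, lin_comp, baerMap_f, baerMap_f, baerMap_f]
    congr 1
    exact fib_ext (by simp) (by simp)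

/-- The exchange of the components of a pair. -/
def fibSwap (X Y : HopfExt k H (N + 1)) (i : ℕ) : fib X Y i ⟶ fib Y X i :=
  fibLift (fibSnd X Y i) (fibFst X Y i) (fun z => (fib_aug z).symm)

@[simp] lemma fibFst_fibSwap {X Y : HopfExt k H (N + 1)} {i : ℕ} (z : fib X Y i) :
    lin (fibFst Y X i) (lin (fibSwap X Y i) z) = lin (fibSnd X Y i) z := fibFst_fibLift _ _ _ _

@[simp] lemma fibSnd_fibSwap {X Y : HopfExt k H (N + 1)} {i : ℕ} (z : fib X Y i) :
    lin (fibSnd Y X i) (lin (fibSwap X Y i) z) = lin (fibFst X Y i) z := fibSnd_fibLift _ _ _ _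

/-- The commutativity of the Baer sum. -/
def baerSwap (X Y : HopfExt k H (N + 1)) : baer X Y ⟶ baer Y X :=
  baerDesc (fun i => fibSwap X Y i ≫ fibMk Y X i)
    (fun i z h h1 h2 => by
      rw [lin_comp, fibMk_eq_zero_iff]
      exact ⟨-h, by rw [fibFst_fibSwap, h2, map_neg], by rw [fibSnd_fibSwap, h1, map_neg, neg_neg]⟩)
    (fun i z => by
      rw [lin_comp, lin_comp, baer_d_fibMk]
      congr 1
      exact fib_ext (by simp) (by simp))
    (fun z h h1 h2 => by
      obtain ⟨w, h3, h4⟩ := exists_fib (X := Y) (Y := X) (i := N + 1) (lin Y.top h) 0 rfl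
      rw [lin_comp, baer_top h w h3 h4]
      refine fibMk_eq (-h) ?_ ?_
      · rw [fibFst_fibSwap, h2, h3, baerTop_self, map_neg, add_neg_cancel]
      · rw [fibSnd_fibSwap, h1, h4, baerTop_self, map_neg, sub_neg_eq_add, zero_add])
    (fun z => (congrArg (lin Y.aug) (fibFst_fibSwap z)).trans (fib_aug (i := 0) z).symm)

lemma baerSwap_f {X Y : HopfExt k H (N + 1)} {i : ℕ} (z : fib X Y i) :
    lin ((baerSwap X Y).f i) (lin (fibMk X Y i) z) = lin (fibMk Y X i) (lin (fibSwap X Y i) z) :=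
  baerDesc_f _ _ _ _ _ _ _

lemma baerSwap_natural {X Y X' Y' : HopfExt k H (N + 1)} (φ : X ⟶ X') (ψ : Y ⟶ Y') :
    baerMap φ ψ ≫ baerSwap X' Y' = baerSwap X Y ≫ baerMap ψ φ :=
  baer_hom_ext fun i z => by
    rw [comp_f, comp_f, lin_comp, lin_comp, baerSwap_f, baerMap_f, baerMap_f, baerSwap_f]
    congr 1
    exact fib_ext (by simp) (by simp)

/-- The commutativity of the Baer sum, as a natural transformation. -/
def swapNat (A : HopfExt k H (N + 1)) : leftTranslate A ⟶ translate A where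
  app X := baerSwap A X
  naturality _ _ φ := baerSwap_natural (𝟙 A) φ

section Assoc

variable (X Y Z : HopfExt k H (N + 1))

/-- The triples of elements of equal augmentation. -/
def fib₃ (i : ℕ) : HopfBimod k H :=
  ker (fst (fib X Y i) (fib Y Z i) ≫ fibSnd X Y i - snd (fib X Y i) (fib Y Z i) ≫ fibFst Y Z i)

/-- The first two components of a triple. -/
def fib₃Fst (i : ℕ) : fib₃ X Y Z i ⟶ fib X Y i := kerι _ ≫ fst _ _

/-- The last two components of a triple. -/
def fib₃Snd (i : ℕ) : fib₃ X Y Z i ⟶ fib Y Z i := kerι _ ≫ snd _ _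

variable {X Y Z}

lemma fib₃_mid {i : ℕ} (t : fib₃ X Y Z i) :
    lin (fibSnd X Y i) (lin (fib₃Fst X Y Z i) t) = lin (fibFst Y Z i) (lin (fib₃Snd X Y Z i) t) :=
  sub_eq_zero.1 (lin_kerι _ t)

lemma exists_fib₃ {i : ℕ} (a : fib X Y i) (b : fib Y Z i)
    (h : lin (fibSnd X Y i) a = lin (fibFst Y Z i) b) :
    ∃ t, lin (fib₃Fst X Y Z i) t = a ∧ lin (fib₃Snd X Y Z i) t = b := by
  obtain ⟨w, h1, h2⟩ := exists_prod a b
  exact ⟨kerMk _ w (by rw [lin_sub, lin_comp, lin_comp, h1, h2, h, sub_self]), h1, h2⟩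

lemma fib₃_aug {i : ℕ} (t : fib₃ X Y Z i) :
    lin (X.augAt i) (lin (fibFst X Y i) (lin (fib₃Fst X Y Z i) t)) =
      lin (Z.augAt i) (lin (fibSnd Y Z i) (lin (fib₃Snd X Y Z i) t)) := by
  rw [fib_aug, fib₃_mid, fib_aug]

variable (X Y Z) in
/-- `(x, y, z) ↦ ([x, y], z)`. -/
def fib₃L (i : ℕ) : fib₃ X Y Z i ⟶ fib (baer X Y) Z i :=
  fibLift (fib₃Fst X Y Z i ≫ fibMk X Y i) (fib₃Snd X Y Z i ≫ fibSnd Y Z i) (fun t => by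
    rw [lin_comp, lin_comp, baer_augAt_fibMk, fib₃_aug])

variable (X Y Z) in
/-- `(x, y, z) ↦ (x, [y, z])`. -/
def fib₃R (i : ℕ) : fib₃ X Y Z i ⟶ fib X (baer Y Z) i :=
  fibLift (fib₃Fst X Y Z i ≫ fibFst X Y i) (fib₃Snd X Y Z i ≫ fibMk Y Z i) (fun t => by
    rw [lin_comp, lin_comp, baer_augAt_fibMk, fib_aug, fib₃_mid])

@[simp] lemma fibFst_fib₃L {i : ℕ} (t : fib₃ X Y Z i) : lin (fibFst _ _ i) (lin (fib₃L X Y Z i) t) =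
    lin (fibMk X Y i) (lin (fib₃Fst X Y Z i) t) := fibFst_fibLift _ _ _ _
@[simp] lemma fibSnd_fib₃L {i : ℕ} (t : fib₃ X Y Z i) : lin (fibSnd _ _ i) (lin (fib₃L X Y Z i) t) =
    lin (fibSnd Y Z i) (lin (fib₃Snd X Y Z i) t) := fibSnd_fibLift _ _ _ _
@[simp] lemma fibFst_fib₃R {i : ℕ} (t : fib₃ X Y Z i) : lin (fibFst _ _ i) (lin (fib₃R X Y Z i) t) =
    lin (fibFst X Y i) (lin (fib₃Fst X Y Z i) t) := fibFst_fibLift _ _ _ _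
@[simp] lemma fibSnd_fib₃R {i : ℕ} (t : fib₃ X Y Z i) : lin (fibSnd _ _ i) (lin (fib₃R X Y Z i) t) =
    lin (fibMk Y Z i) (lin (fib₃Snd X Y Z i) t) := fibSnd_fibLift _ _ _ _

lemma fib₃L_surjective (i : ℕ) : Function.Surjective (lin (fib₃L X Y Z i)) := fun w => by
  obtain ⟨a, ha⟩ := fibMk_surjective i (lin (fibFst _ _ i) w)
  obtain ⟨b, h1, h2⟩ := exists_fib (X := Y) (Y := Z) (lin (fibSnd X Y i) a) (lin (fibSnd _ _ i) w)
    (by rw [← fib_aug, ← fib_aug, ← ha, baer_augAt_fibMk])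
  obtain ⟨t, h3, h4⟩ := exists_fib₃ a b h1.symm
  exact ⟨t, fib_ext (by rw [fibFst_fib₃L, h3, ha]) (by rw [fibSnd_fib₃L, h4, h2])⟩

lemma baer_baerTop' (i : ℕ) (h : unit k H) (z : fib X Y i)
    (h1 : lin (fibFst X Y i) z = 0) (h2 : lin (fibSnd X Y i) z = lin (Y.baerTop i) h) :
    lin ((baer X Y).baerTop i) h = lin (fibMk X Y i) z := by
  obtain ⟨w, h3, h4⟩ := exists_fib (X := X) (Y := Y) (i := i) (lin (X.baerTop i) h) 0 (by simp)
  rw [baer_baerTop i h w h3 h4]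
  exact fibMk_eq h (by rw [h1, h3, zero_add]) (by rw [h2, h4, sub_self])

/-- The ambiguity in the choice of a representative of `[x, y]` and the kernel of the projection to
the Baer sum `(X + Y) + Z` both die in `X + (Y + Z)`. -/
lemma fib₃_kernel {i : ℕ} {t : fib₃ X Y Z i} {h : unit k H}
    (h1 : lin (fibMk X Y i) (lin (fib₃Fst X Y Z i) t) = lin ((baer X Y).baerTop i) h)
    (h2 : lin (fibSnd Y Z i) (lin (fib₃Snd X Y Z i) t) = -lin (Z.baerTop i) h) :
    lin (fibMk X (baer Y Z) i) (lin (fib₃R X Y Z i) t) = 0 := by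
  obtain ⟨a, a1, a2⟩ := exists_fib (X := X) (Y := Y) (i := i) (lin (X.baerTop i) h) 0 (by simp)
  rw [baer_baerTop i h a a1 a2, ← sub_eq_zero, ← map_sub, fibMk_eq_zero_iff] at h1
  obtain ⟨h', e1, e2⟩ := h1
  rw [map_sub, a1, sub_eq_iff_eq_add] at e1
  rw [map_sub, a2, sub_zero] at e2
  rw [fibMk_eq_zero_iff]
  obtain ⟨b, b1, b2⟩ := exists_fib (X := Y) (Y := Z) (i := i) 0 (lin (Z.baerTop i) (h' + h))
    (by simp)
  refine ⟨h' + h, by rw [fibFst_fib₃R, e1, map_add], ?_⟩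
  rw [fibSnd_fib₃R, baer_baerTop' i (h' + h) b b1 b2, ← map_neg]
  refine fibMk_eq (-h') ?_ ?_
  · rw [← fib₃_mid, e2, map_neg, map_neg, b1, neg_zero, zero_add]
  · rw [h2, map_neg, map_neg, b2, map_add]; abel

/-- The componentwise differential of triples. -/
def fib₃D (X Y Z : HopfExt k H (N + 1)) (i : ℕ) : fib₃ X Y Z (i + 1) ⟶ fib₃ X Y Z i :=
  kerLift _ (pair (fib₃Fst X Y Z (i + 1) ≫ fibD X Y i) (fib₃Snd X Y Z (i + 1) ≫ fibD Y Z i))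
    (HopfBimod.hom_ext fun t => by
      rw [lin_comp, lin_sub, lin_comp, lin_comp, fst_pair, snd_pair]
      simp [fib₃_mid])

@[simp] lemma fib₃Fst_fib₃D (i : ℕ) (t : fib₃ X Y Z (i + 1)) :
    lin (fib₃Fst X Y Z i) (lin (fib₃D X Y Z i) t) =
      lin (fibD X Y i) (lin (fib₃Fst X Y Z (i + 1)) t) :=
  fst_pair (fib₃Fst X Y Z (i + 1) ≫ fibD X Y i) (fib₃Snd X Y Z (i + 1) ≫ fibD Y Z i) t
@[simp] lemma fib₃Snd_fib₃D (i : ℕ) (t : fib₃ X Y Z (i + 1)) :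
    lin (fib₃Snd X Y Z i) (lin (fib₃D X Y Z i) t) =
      lin (fibD Y Z i) (lin (fib₃Snd X Y Z (i + 1)) t) :=
  snd_pair (fib₃Fst X Y Z (i + 1) ≫ fibD X Y i) (fib₃Snd X Y Z (i + 1) ≫ fibD Y Z i) t

variable (X Y Z) in
/-- The map `([x, y], z) ↦ [x, [y, z]]`. -/
def baerAssocAux (i : ℕ) : fib (baer X Y) Z i ⟶ (baer X (baer Y Z)).X i :=
  surjDesc (fib₃L X Y Z i) (fib₃L_surjective i) (fib₃R X Y Z i ≫ fibMk _ _ i) fun t ht => by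
    have h1 := congrArg (lin (fibFst _ _ i)) ht
    have h2 := congrArg (lin (fibSnd _ _ i)) ht
    rw [fibFst_fib₃L, map_zero] at h1
    rw [fibSnd_fib₃L, map_zero] at h2
    exact fib₃_kernel (h := 0) (by rw [h1, map_zero]) (by rw [h2, map_zero, neg_zero])

lemma baerAssocAux_apply {i : ℕ} (t : fib₃ X Y Z i) :
    lin (baerAssocAux X Y Z i) (lin (fib₃L X Y Z i) t) =
      lin (fibMk X (baer Y Z) i) (lin (fib₃R X Y Z i) t) := surjDesc_apply _ _ _ _ _

variable (X Y Z) in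
/-- The associativity of the Baer sum. -/
def baerAssoc : baer (baer X Y) Z ⟶ baer X (baer Y Z) :=
  baerDesc (baerAssocAux X Y Z)
    (fun i z h h1 h2 => by
      obtain ⟨t, rfl⟩ := fib₃L_surjective i z
      rw [fibFst_fib₃L] at h1
      rw [fibSnd_fib₃L] at h2
      rw [baerAssocAux_apply, fib₃_kernel h1 h2])
    (fun i z => by
      obtain ⟨t, rfl⟩ := fib₃L_surjective (i + 1) z
      have e : lin (fibD (baer X Y) Z i) (lin (fib₃L X Y Z (i + 1)) t) =
          lin (fib₃L X Y Z i) (lin (fib₃D X Y Z i) t) :=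
        fib_ext (by simp [baer_d_fibMk]) (by simp)
      rw [e, baerAssocAux_apply, baerAssocAux_apply, baer_d_fibMk]
      congr 1
      exact fib_ext (by simp) (by simp [baer_d_fibMk]))
    (fun z h h1 h2 => by
      obtain ⟨a, a1, a2⟩ := exists_fib (X := X) (Y := Y) (i := N + 1) (lin X.top h) 0 rfl
      obtain ⟨b, b1, b2⟩ := exists_fib (X := Y) (Y := Z) (i := N + 1) 0 0 rfl
      obtain ⟨t, t1, t2⟩ := exists_fib₃ a b (by rw [a2, b1])
      have e : z = lin (fib₃L X Y Z (N + 1)) t :=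
        fib_ext (by rw [h1, fibFst_fib₃L, t1, baer_top h a a1 a2])
          (by rw [h2, fibSnd_fib₃L, t2, b2])
      rw [e, baerAssocAux_apply]
      refine (baer_top h _ (by rw [fibFst_fib₃R, t1, a1]) ?_).symm
      rw [fibSnd_fib₃R, t2, fib_ext (z := b) (w := 0) (by rw [b1, map_zero]) (by rw [b2, map_zero]),
        map_zero])
    (fun z => by
      obtain ⟨t, rfl⟩ := fib₃L_surjective 0 z
      rw [baerAssocAux_apply, fibFst_fib₃L]
      refine (baer_augAt_fibMk (X := X) 0 _).trans ?_
      rw [fibFst_fib₃R]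
      exact (baer_augAt_fibMk 0 _).symm)

lemma baerAssoc_apply {i : ℕ} (t : fib₃ X Y Z i) :
    lin ((baerAssoc X Y Z).f i) (lin (fibMk _ _ i) (lin (fib₃L X Y Z i) t)) =
      lin (fibMk X (baer Y Z) i) (lin (fib₃R X Y Z i) t) := by
  rw [baerAssoc, baerDesc_f, baerAssocAux_apply]

lemma baerAssoc_natural {X' Y' Z' : HopfExt k H (N + 1)} (φ : X ⟶ X') (ψ : Y ⟶ Y') (χ : Z ⟶ Z') :
    baerMap (baerMap φ ψ) χ ≫ baerAssoc X' Y' Z' = baerAssoc X Y Z ≫ baerMap φ (baerMap ψ χ) :=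
  baer_hom_ext fun i z => by
    obtain ⟨t, rfl⟩ := fib₃L_surjective i z
    obtain ⟨t', h1, h2⟩ := exists_fib₃ (lin (fibMap φ ψ i) (lin (fib₃Fst X Y Z i) t))
      (lin (fibMap ψ χ i) (lin (fib₃Snd X Y Z i) t)) (by simp [fib₃_mid])
    rw [comp_f, comp_f, lin_comp, lin_comp, baerAssoc_apply, baerMap_f, baerMap_f]
    have e : lin (fibMap (baerMap φ ψ) χ i) (lin (fib₃L X Y Z i) t) =
        lin (fib₃L X' Y' Z' i) t' :=
      fib_ext (by simp [baerMap_f, h1]) (by simp [h2])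
    rw [e, baerAssoc_apply]
    congr 1
    exact fib_ext (by simp [h1]) (by simp [baerMap_f, h2])

lemma baerMap_id_id (X Y : HopfExt k H (N + 1)) : baerMap (𝟙 X) (𝟙 Y) = 𝟙 (baer X Y) :=
  (translate Y).map_id X

variable (X Y Z) in
/-- Associativity, as a natural transformation in the first variable. -/
def assocNatFst : translate Y ⋙ translate Z ⟶ translate (baer Y Z) where
  app X := baerAssoc X Y Z
  naturality X X' φ := by
    have h := baerAssoc_natural φ (𝟙 Y) (𝟙 Z)
    rw [baerMap_id_id] at h
    exact h

variable (X Y Z) in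
/-- Associativity, as a natural transformation in the last variable. -/
def assocNatTrd : leftTranslate (baer X Y) ⟶ leftTranslate Y ⋙ leftTranslate X where
  app Z := baerAssoc X Y Z
  naturality Z Z' φ := by
    have h := baerAssoc_natural (𝟙 X) (𝟙 Y) φ
    rw [baerMap_id_id] at h
    exact h

end Assoc

section Unit

/-- A section of the augmentation, extended by zero to all degrees. -/
def sectAt {Z : HopfExt k H (N + 1)} (s : unit k H ⟶ Z.X 0) : ∀ i, unit k H ⟶ Z.X i
  | 0 => s
  | _ + 1 => 0

lemma augAt_sectAt {Z : HopfExt k H (N + 1)} {s : unit k H ⟶ Z.X 0}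
    (hs : s ≫ Z.aug = 𝟙 (unit k H)) (X : HopfExt k H (N + 1)) (i : ℕ) (x : X.X i) :
    lin (Z.augAt i) (lin (sectAt s i) (lin (X.augAt i) x)) = lin (X.augAt i) x := by
  cases i
  · exact congrArg (fun φ => lin φ (lin X.aug x)) hs
  · rfl

lemma d_sectAt {Z : HopfExt k H (N + 1)} (s : unit k H ⟶ Z.X 0) (X : HopfExt k H (N + 1)) (i : ℕ)
    (x : X.X (i + 1)) : lin (sectAt s i) (lin (X.augAt i) (lin (X.d i) x)) =
      lin (Z.d i) (lin (sectAt s (i + 1)) (lin (X.augAt (i + 1)) x)) := by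
  rw [augAt_d, augAt_succ, map_zero, map_zero, map_zero]

/-- If `s` is a section of the augmentation of `Z`, then `x ↦ [x, s p x]` is a morphism
`X ⟶ X + Z`. -/
def addSplit (X : HopfExt k H (N + 1)) {Z : HopfExt k H (N + 1)} (s : unit k H ⟶ Z.X 0)
    (hs : s ≫ Z.aug = 𝟙 (unit k H)) : X ⟶ baer X Z :=
  baerLift (fun i => 𝟙 (X.X i)) (fun i => X.augAt i ≫ sectAt s i)
    (fun i x => (augAt_sectAt hs X i x).symm) (fun _ _ => rfl) (d_sectAt s X)
    (fun h => ⟨0, by simp, by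
      rw [lin_comp, augAt_succ, map_zero, map_zero, neg_zero]⟩) (fun _ => rfl)

lemma addSplit_f (X : HopfExt k H (N + 1)) {Z : HopfExt k H (N + 1)} (s : unit k H ⟶ Z.X 0)
    (hs : s ≫ Z.aug = 𝟙 (unit k H)) (i : ℕ) (x : X.X i) (z : fib X Z i)
    (h1 : lin (fibFst X Z i) z = x)
    (h2 : lin (fibSnd X Z i) z = lin (sectAt s i) (lin (X.augAt i) x)) :
    lin ((addSplit X s hs).f i) x = lin (fibMk X Z i) z :=
  congrArg (lin (fibMk X Z i)) (fib_ext
    ((fibFst_fibLift (𝟙 (X.X i)) (X.augAt i ≫ sectAt s i)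
      (fun x => (augAt_sectAt hs X i x).symm) x).trans h1.symm)
    ((fibSnd_fibLift (𝟙 (X.X i)) (X.augAt i ≫ sectAt s i)
      (fun x => (augAt_sectAt hs X i x).symm) x).trans h2.symm))

lemma addSplit_natural {X X' Z Z' : HopfExt k H (N + 1)} {s : unit k H ⟶ Z.X 0}
    (hs : s ≫ Z.aug = 𝟙 (unit k H)) {s' : unit k H ⟶ Z'.X 0} (hs' : s' ≫ Z'.aug = 𝟙 (unit k H))
    (φ : X ⟶ X') (ψ : Z ⟶ Z') (h : s ≫ ψ.f 0 = s') :
    φ ≫ addSplit X' s' hs' = addSplit X s hs ≫ baerMap φ ψ :=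
  hom_ext' fun i => HopfBimod.hom_ext fun x => by
    obtain ⟨z, h1, h2⟩ := exists_fib (X := X) (Y := Z) x (lin (sectAt s i) (lin (X.augAt i) x))
      (augAt_sectAt hs X i x).symm
    rw [comp_f, comp_f, lin_comp, lin_comp, addSplit_f X s hs i x z h1 h2, baerMap_f]
    refine addSplit_f X' s' hs' i _ _ (by simp [h1]) ?_
    rw [fibSnd_fibMap, h2, Hom.augAt_apply]
    cases i
    · exact congrArg (fun φ => lin φ (lin X.aug x)) h
    · rw [augAt_succ, map_zero, map_zero, map_zero]

/-- Adding a split extension on the right, as a natural transformation. -/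
def addSplitNat {Z : HopfExt k H (N + 1)} (s : unit k H ⟶ Z.X 0)
    (hs : s ≫ Z.aug = 𝟙 (unit k H)) : 𝟭 (HopfExt k H (N + 1)) ⟶ translate Z where
  app X := addSplit X s hs
  naturality _ _ φ := addSplit_natural hs hs φ (𝟙 Z) (Category.comp_id _)

end Unit

section Neg

/-- The term of degree `0` of the split extension attached to `X`. -/
def splitZero (X : HopfExt k H N) : HopfBimod k H := prod (ker X.aug) (unit k H)

/-- The component in `X`. -/
def splitVal (X : HopfExt k H N) : splitZero X ⟶ X.X 0 := fst _ _ ≫ kerι _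

/-- The component in `H`. -/
def splitAug (X : HopfExt k H N) : splitZero X ⟶ unit k H := snd _ _

/-- The morphism to `splitZero X` with given components. -/
def splitPair {X : HopfExt k H N} {T : HopfBimod k H} (f : T ⟶ X.X 0)
    (hf : ∀ t, lin X.aug (lin f t) = 0) (g : T ⟶ unit k H) : T ⟶ splitZero X :=
  pair (kerLift X.aug f (HopfBimod.hom_ext hf)) g

@[simp] lemma splitVal_splitPair {X : HopfExt k H N} {T : HopfBimod k H} (f : T ⟶ X.X 0)
    (hf : ∀ t, lin X.aug (lin f t) = 0) (g : T ⟶ unit k H) (t : T) :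
    lin (splitVal X) (lin (splitPair f hf g) t) = lin f t :=
  congrArg (lin (kerι X.aug)) (fst_pair (kerLift X.aug f (HopfBimod.hom_ext hf)) g t)

@[simp] lemma splitAug_splitPair {X : HopfExt k H N} {T : HopfBimod k H} (f : T ⟶ X.X 0)
    (hf : ∀ t, lin X.aug (lin f t) = 0) (g : T ⟶ unit k H) (t : T) :
    lin (splitAug X) (lin (splitPair f hf g) t) = lin g t :=
  snd_pair (kerLift X.aug f (HopfBimod.hom_ext hf)) g t

@[simp] lemma aug_splitVal {X : HopfExt k H N} (x : splitZero X) :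
    lin X.aug (lin (splitVal X) x) = 0 := lin_kerι _ _

lemma splitZero_ext {X : HopfExt k H N} {x y : splitZero X}
    (h1 : lin (splitVal X) x = lin (splitVal X) y) (h2 : lin (splitAug X) x = lin (splitAug X) y) :
    x = y := prod_ext (kerι_injective _ h1) h2

/-- The terms of the split extension attached to `X`. -/
def splitX (X : HopfExt k H N) : ℕ → HopfBimod k H
  | 0 => splitZero X
  | i + 1 => X.X (i + 1)

/-- The differential of the split extension attached to `X`. -/
def splitD (X : HopfExt k H N) : ∀ i, splitX X (i + 1) ⟶ splitX X i
  | 0 => splitPair (X.d 0) X.aug_d 0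
  | i + 1 => X.d (i + 1)

/-- The pullback of `X` along `0 : H ⟶ H`, which is a split extension: its term of degree `0` is
the direct sum of the kernel of the augmentation of `X` and `H`. -/
def split (X : HopfExt k H (N + 1)) : HopfExt k H (N + 1) where
  X := splitX X
  d := splitD X
  top := X.top
  aug := splitAug X
  top_bijective := X.top_bijective
  subsingleton
    | 0, h => absurd h (by omega)
    | i + 1, h => X.subsingleton (i + 1) h
  aug_surjective h := ⟨lin (splitPair (X := X) 0 (fun _ => map_zero _) (𝟙 _)) h,
    splitAug_splitPair _ _ _ _⟩
  exact_zero z := by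
    constructor
    · intro h
      obtain ⟨x, hx⟩ := (X.exact_zero (lin (splitVal X) z)).1 (aug_splitVal _)
      exact ⟨x, splitZero_ext ((splitVal_splitPair (X.d 0) X.aug_d 0 x).trans hx)
        ((splitAug_splitPair (X.d 0) X.aug_d 0 x).trans h.symm)⟩
    · rintro ⟨x, rfl⟩
      exact splitAug_splitPair (X.d 0) X.aug_d 0 x
  exact
    | 0 => fun x => by
      refine Iff.trans ⟨fun h => ?_, fun h => splitZero_ext ?_ ?_⟩ (X.exact 0 x)
      · exact (splitVal_splitPair (X.d 0) X.aug_d 0 x).symm.trans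
          ((congrArg (lin (splitVal X)) h).trans (map_zero _))
      · exact (splitVal_splitPair (X.d 0) X.aug_d 0 x).trans (h.trans (map_zero _).symm)
      · exact (splitAug_splitPair (X.d 0) X.aug_d 0 x).trans (map_zero _).symm
    | i + 1 => X.exact (i + 1)

/-- The section of the augmentation of the split extension attached to `X`. -/
def splitSect (X : HopfExt k H (N + 1)) : unit k H ⟶ (split X).X 0 :=
  splitPair (X := X) 0 (fun _ => map_zero _) (𝟙 _)

lemma splitSect_aug (X : HopfExt k H (N + 1)) : splitSect X ≫ (split X).aug = 𝟙 (unit k H) :=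
  HopfBimod.hom_ext fun h => splitAug_splitPair (X := X) 0 (fun _ => map_zero _) (𝟙 _) h

/-- The component of degree `0` of the morphism of split extensions induced by a morphism. -/
def splitMapZero {X Y : HopfExt k H N} (φ : X ⟶ Y) : splitZero X ⟶ splitZero Y :=
  splitPair (splitVal X ≫ φ.f 0) (fun x => (φ.aug_apply _).trans (aug_splitVal x)) (splitAug X)

@[simp] lemma splitVal_splitMapZero {X Y : HopfExt k H N} (φ : X ⟶ Y) (x : splitZero X) :
    lin (splitVal Y) (lin (splitMapZero φ) x) = lin (φ.f 0) (lin (splitVal X) x) :=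
  splitVal_splitPair _ _ _ _

@[simp] lemma splitAug_splitMapZero {X Y : HopfExt k H N} (φ : X ⟶ Y) (x : splitZero X) :
    lin (splitAug Y) (lin (splitMapZero φ) x) = lin (splitAug X) x :=
  splitAug_splitPair _ _ _ _

/-- The components of the morphism of split extensions induced by a morphism. -/
def splitMapF {X Y : HopfExt k H N} (φ : X ⟶ Y) : ∀ i, splitX X i ⟶ splitX Y i
  | 0 => splitMapZero φ
  | i + 1 => φ.f (i + 1)

/-- The morphism of split extensions induced by a morphism. -/
def splitMap {X Y : HopfExt k H (N + 1)} (φ : X ⟶ Y) : split X ⟶ split Y where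
  f := splitMapF φ
  comm
    | 0 => HopfBimod.hom_ext fun x => splitZero_ext
      ((splitVal_splitMapZero φ _).trans ((congrArg (lin (φ.f 0))
        (splitVal_splitPair (X.d 0) X.aug_d 0 x)).trans ((φ.comm_apply 0 x).trans
          (splitVal_splitPair (Y.d 0) Y.aug_d 0 (lin (φ.f 1) x)).symm)))
      ((splitAug_splitMapZero φ _).trans ((splitAug_splitPair (X.d 0) X.aug_d 0 x).trans
        (splitAug_splitPair (Y.d 0) Y.aug_d 0 (lin (φ.f 1) x)).symm))
    | i + 1 => φ.comm (i + 1)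
  top := φ.top
  aug := HopfBimod.hom_ext (splitAug_splitMapZero φ)

/-- The split extension attached to `X`, as a functor of `X`. -/
def splitFunctor : HopfExt k H (N + 1) ⥤ HopfExt k H (N + 1) where
  obj X := split X
  map φ := splitMap φ
  map_id X := hom_ext' fun
    | 0 => HopfBimod.hom_ext fun x => splitZero_ext (splitVal_splitMapZero (𝟙 X) x)
        (splitAug_splitMapZero (𝟙 X) x)
    | _ + 1 => rfl
  map_comp φ ψ := hom_ext' fun
    | 0 => HopfBimod.hom_ext fun x => splitZero_ext
        ((splitVal_splitMapZero (φ ≫ ψ) x).trans ((splitVal_splitMapZero ψ (lin (splitMapZero φ) x)).trans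
          (congrArg (lin (ψ.f 0)) (splitVal_splitMapZero φ x))).symm)
        ((splitAug_splitMapZero (φ ≫ ψ) x).trans
          ((splitAug_splitMapZero ψ (lin (splitMapZero φ) x)).trans (splitAug_splitMapZero φ x)).symm)
    | _ + 1 => rfl

lemma splitSect_natural {X Y : HopfExt k H (N + 1)} (φ : X ⟶ Y) :
    splitSect X ≫ (splitMap φ).f 0 = splitSect Y :=
  HopfBimod.hom_ext fun h => splitZero_ext
    ((splitVal_splitMapZero φ (lin (splitSect X) h)).trans ((congrArg (lin (φ.f 0))
      (splitVal_splitPair (X := X) 0 (fun _ => map_zero _) (𝟙 _) h)).trans ((map_zero _).trans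
        (splitVal_splitPair (X := Y) 0 (fun _ => map_zero _) (𝟙 _) h).symm)))
    ((splitAug_splitMapZero φ (lin (splitSect X) h)).trans
      ((splitAug_splitPair (X := X) 0 (fun _ => map_zero _) (𝟙 _) h).trans
        (splitAug_splitPair (X := Y) 0 (fun _ => map_zero _) (𝟙 _) h).symm))

/-- The functor `X ↦ (-1)^s X`. -/
def twistFunctor (n s : ℕ) : HopfExt k H n ⥤ HopfExt k H n where
  obj X := X.twist s
  map φ := twistMap s φ

lemma twist_augAt (X : HopfExt k H N) (s i : ℕ) (x : X.X i) :
    lin ((X.twist s).augAt i) x = (-1 : k) ^ s • lin (X.augAt i) x := by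
  cases i
  · rfl
  · exact (smul_zero _).symm

/-- `(x, y) ↦ x + y` on the pairs defining `X + (-1)^s X`. -/
def fibSum (X : HopfExt k H (N + 1)) (s i : ℕ) : fib X (X.twist s) i ⟶ X.X i :=
  fibFst X (X.twist s) i + (show fib X (X.twist s) i ⟶ X.X i from fibSnd X (X.twist s) i)

lemma fibSum_eq {X : HopfExt k H (N + 1)} {s i : ℕ} {z : fib X (X.twist s) i} {x y : X.X i}
    (h1 : lin (fibFst X (X.twist s) i) z = x) (h2 : lin (fibSnd X (X.twist s) i) z = y) :
    lin (fibSum X s i) z = x + y := by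
  subst h1; subst h2; rfl

lemma fibSum_d {X : HopfExt k H (N + 1)} {s : ℕ} (i : ℕ) (z : fib X (X.twist s) (i + 1)) :
    lin (fibSum X s i) (lin (fibD X (X.twist s) i) z) = lin (X.d i) (lin (fibSum X s (i + 1)) z) :=
  (fibSum_eq (fibFst_fibD i z) (fibSnd_fibD i z)).trans (map_add (lin (X.d i)) _ _).symm

lemma fibSum_natural {X Y : HopfExt k H (N + 1)} (φ : X ⟶ Y) {s : ℕ} (i : ℕ)
    (z : fib X (X.twist s) i) : lin (fibSum Y s i) (lin (fibMap φ (twistMap s φ) i) z) =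
      lin (φ.f i) (lin (fibSum X s i) z) :=
  (fibSum_eq (fibFst_fibMap φ (twistMap s φ) i z) (fibSnd_fibMap φ (twistMap s φ) i z)).trans
    (map_add (lin (φ.f i)) _ _).symm

lemma aug_fibSum (X : HopfExt k H (N + 1)) {s : ℕ} (hs : (-1 : k) ^ s = -1)
    (z : fib X (X.twist s) 0) : lin X.aug (lin (fibSum X s 0) z) = 0 := by
  have := (fib_aug (i := 0) z).trans (twist_augAt X s 0 _)
  rw [hs, neg_one_smul] at this
  exact (map_add (lin X.aug) _ _).trans (add_eq_zero_iff_eq_neg.2 this)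

/-- The components of the morphism from `X + (-1)^s X`, for odd `s`, to a split extension: it is
`[x, y] ↦ x + y`, together with the augmentation in degree `0`. -/
def cancelF (X : HopfExt k H (N + 1)) {s : ℕ} (hs : (-1 : k) ^ s = -1) :
    ∀ i, fib X (X.twist s) i ⟶ splitX X i
  | 0 => splitPair (fibSum X s 0) (aug_fibSum X hs) (fibFst X (X.twist s) 0 ≫ X.aug)
  | i + 1 => fibSum X s (i + 1)

lemma splitVal_cancelF (X : HopfExt k H (N + 1)) {s : ℕ} (hs : (-1 : k) ^ s = -1)
    (z : fib X (X.twist s) 0) :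
    lin (splitVal X) (lin (cancelF X hs 0) z) = lin (fibSum X s 0) z :=
  splitVal_splitPair (fibSum X s 0) (aug_fibSum X hs) _ z

lemma splitAug_cancelF (X : HopfExt k H (N + 1)) {s : ℕ} (hs : (-1 : k) ^ s = -1)
    (z : fib X (X.twist s) 0) : lin (splitAug X) (lin (cancelF X hs 0) z) =
      lin X.aug (lin (fibFst X (X.twist s) 0) z) :=
  splitAug_splitPair (fibSum X s 0) (aug_fibSum X hs) _ z

/-- For odd `s`, a morphism from `X + (-1)^s X` to a split extension. -/
def cancel (X : HopfExt k H (N + 1)) {s : ℕ} (hs : (-1 : k) ^ s = -1) :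
    baer X (X.twist s) ⟶ split X :=
  baerDesc (F := split X) (cancelF X hs)
    (fun
      | 0, z, h, h1, h2 => splitZero_ext
          ((splitVal_cancelF X hs z).trans ((fibSum_eq h1 h2).trans
            ((add_neg_cancel (lin (X.baerTop 0) h)).trans (map_zero (lin (splitVal X))).symm)))
          ((splitAug_cancelF X hs z).trans ((congrArg (lin X.aug) h1).trans
            ((augAt_baerTop X 0 h).trans (map_zero (lin (splitAug X))).symm)))
      | i + 1, _, h, h1, h2 => (fibSum_eq h1 h2).trans (add_neg_cancel (lin (X.baerTop (i + 1)) h)))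
    (fun
      | 0, z => splitZero_ext
          ((splitVal_cancelF X hs _).trans ((fibSum_d 0 z).trans
            (splitVal_splitPair (X.d 0) X.aug_d 0 _).symm))
          ((splitAug_cancelF X hs _).trans (((congrArg (lin X.aug) (fibFst_fibD 0 z)).trans
            (X.aug_d _)).trans
              (splitAug_splitPair (X.d 0) X.aug_d 0 (lin (cancelF X hs 1) z)).symm))
      | i + 1, z => fibSum_d (i + 1) z)
    (fun _ h h1 h2 => (fibSum_eq h1 h2).trans (add_zero (lin X.top h)))
    (fun z => splitAug_cancelF X hs z)

lemma cancel_f (X : HopfExt k H (N + 1)) {s : ℕ} (hs : (-1 : k) ^ s = -1) (i : ℕ)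
    (z : fib X (X.twist s) i) : lin ((cancel X hs).f i) (lin (fibMk X (X.twist s) i) z) =
      lin (cancelF X hs i) z :=
  baerDesc_f _ _ _ _ _ _ _

lemma cancel_natural {X Y : HopfExt k H (N + 1)} (φ : X ⟶ Y) {s : ℕ} (hs : (-1 : k) ^ s = -1) :
    baerMap φ (twistMap s φ) ≫ cancel Y hs = cancel X hs ≫ splitMap φ :=
  baer_hom_ext fun i z => by
    rw [comp_f, comp_f, lin_comp, lin_comp, baerMap_f, cancel_f, cancel_f]
    cases i with
    | zero =>
      refine splitZero_ext ((splitVal_cancelF Y hs _).trans ((fibSum_natural φ 0 z).trans ?_))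
        ((splitAug_cancelF Y hs _).trans ?_)
      · exact ((splitVal_splitMapZero φ _).trans
          (congrArg (lin (φ.f 0)) (splitVal_cancelF X hs z))).symm
      · refine Eq.trans ?_ ((splitAug_splitMapZero φ _).trans (splitAug_cancelF X hs z)).symm
        rw [fibFst_fibMap, Hom.aug_apply]
    | succ i => exact fibSum_natural φ (i + 1) z

end Neg

end BaerLaws

/-! ### The fundamental group -/

lemma pmap_const {C D : Type*} [Category C] [Category D] (d : D) {X Y : C}
    (p : FreeGroupoid.mk X ⟶ FreeGroupoid.mk Y) :
    pmap ((Functor.const C).obj d) p = 𝟙 (FreeGroupoid.mk d) := by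
  have h : ∀ {X Y : C} (f : X ⟶ Y),
      (FreeGroupoid.map ((Functor.const C).obj d)).map (FreeGroupoid.homMk f) =
        𝟙 (FreeGroupoid.mk d) := fun f => (FreeGroupoid.of D).map_id d
  have := freeGroupoid_natural (F := FreeGroupoid.map ((Functor.const C).obj d))
    (F' := (Functor.const _).obj (FreeGroupoid.mk d))
    (fun A => 𝟙 (FreeGroupoid.mk d))
    (fun {A B} f => congrArg (· ≫ 𝟙 (FreeGroupoid.mk d)) (h f)) p
  exact (Category.comp_id _).symm.trans (this.trans (Category.comp_id _))

section FundamentalGroup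

/-- Paths of extensions, that is, morphisms of the fundamental groupoid. -/
abbrev Path {n : ℕ} (X Y : HopfExt k H n) := FreeGroupoid.mk X ⟶ FreeGroupoid.mk Y

/-- The path given by a morphism. -/
abbrev ofHom {n : ℕ} {X Y : HopfExt k H n} (f : X ⟶ Y) : Path X Y := FreeGroupoid.homMk f

lemma ofHom_comp {n : ℕ} {X Y Z : HopfExt k H n} (f : X ⟶ Y) (g : Y ⟶ Z) :
    ofHom (f ≫ g) = ofHom f ≫ ofHom g := (FreeGroupoid.of _).map_comp f g

/-- The path `p + A`. -/
def addRight {X Y : HopfExt k H (N + 1)} (p : Path X Y) (A : HopfExt k H (N + 1)) :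
    Path (baer X A) (baer Y A) := pmap (translate A) p

/-- The path `A + p`. -/
def addLeft (A : HopfExt k H (N + 1)) {X Y : HopfExt k H (N + 1)} (p : Path X Y) :
    Path (baer A X) (baer A Y) := pmap (leftTranslate A) p

/-- The path `(-1)^s p`. -/
def twistPath {n : ℕ} (s : ℕ) {X Y : HopfExt k H n} (p : Path X Y) :
    Path (X.twist s) (Y.twist s) := pmap (twistFunctor n s) p

section

variable {X Y Z : HopfExt k H (N + 1)} (A : HopfExt k H (N + 1))

@[simp] lemma addRight_id : addRight (𝟙 (FreeGroupoid.mk X)) A = 𝟙 _ := pmap_id _ _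
@[simp] lemma addRight_comp (p : Path X Y) (q : Path Y Z) :
    addRight (p ≫ q) A = addRight p A ≫ addRight q A := pmap_comp _ _ _
@[simp] lemma addRight_inv (p : Path X Y) : addRight (inv p) A = inv (addRight p A) := pmap_inv _ _
lemma addRight_ofHom (f : X ⟶ Y) : addRight (ofHom f) A = ofHom (baerMap f (𝟙 A)) := rfl

@[simp] lemma addLeft_id : addLeft A (𝟙 (FreeGroupoid.mk X)) = 𝟙 _ := pmap_id _ _
@[simp] lemma addLeft_comp (p : Path X Y) (q : Path Y Z) :
    addLeft A (p ≫ q) = addLeft A p ≫ addLeft A q := pmap_comp _ _ _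
lemma addLeft_ofHom (f : X ⟶ Y) : addLeft A (ofHom f) = ofHom (baerMap (𝟙 A) f) := rfl

end

section

variable {n s : ℕ} {X Y Z : HopfExt k H n}

@[simp] lemma twistPath_comp (p : Path X Y) (q : Path Y Z) :
    twistPath s (p ≫ q) = twistPath s p ≫ twistPath s q := pmap_comp _ _ _
@[simp] lemma twistPath_inv (p : Path X Y) : twistPath s (inv p) = inv (twistPath s p) :=
  pmap_inv _ _
lemma twistPath_ofHom (f : X ⟶ Y) : twistPath s (ofHom f) = ofHom (twistMap s f) := rfl

end

lemma baerMap_comp {X Y X' Y' X'' Y'' : HopfExt k H (N + 1)} (φ : X ⟶ X') (ψ : Y ⟶ Y')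
    (φ' : X' ⟶ X'') (ψ' : Y' ⟶ Y'') :
    baerMap φ ψ ≫ baerMap φ' ψ' = baerMap (φ ≫ φ') (ψ ≫ ψ') :=
  baer_hom_ext fun i z => by
    rw [comp_f, lin_comp, baerMap_f, baerMap_f, baerMap_f]
    congr 1
    exact fib_ext (by simp) (by simp)

/-- The interchange law for sums of paths. -/
lemma addRight_addLeft {X X' Y Y' : HopfExt k H (N + 1)} (p : Path X X') (q : Path Y Y') :
    addRight p Y ≫ addLeft X' q = addLeft X q ≫ addRight p Y' := by
  have := freeGroupoid_natural (F := FreeGroupoid.map (leftTranslate X))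
    (F' := FreeGroupoid.map (leftTranslate X')) (fun Y => addRight p Y)
    (fun {Y Y'} f => ((pmap_natural (Φ := translate Y) (Ψ := translate Y')
      { app := fun X => baerMap (𝟙 X) f
        naturality := fun X X' g => (baerMap_comp _ _ _ _).trans ((by simp :
          baerMap (g ≫ 𝟙 X') (𝟙 Y ≫ f) = baerMap (𝟙 X ≫ g) (f ≫ 𝟙 Y')).trans
            (baerMap_comp _ _ _ _).symm) } p).symm)) q
  exact this.symm

/-- The sum `p + q` of two paths. -/
def addPath {X X' Y Y' : HopfExt k H (N + 1)} (p : Path X X') (q : Path Y Y') :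
    Path (baer X Y) (baer X' Y') := addRight p Y ≫ addLeft X' q

lemma addPath_comp {X X' X'' Y Y' Y'' : HopfExt k H (N + 1)} (p : Path X X') (q : Path Y Y')
    (p' : Path X' X'') (q' : Path Y' Y'') :
    addPath p q ≫ addPath p' q' = addPath (p ≫ p') (q ≫ q') := by
  simp only [addPath, addRight_comp, addLeft_comp, Category.assoc]
  rw [← Category.assoc (addLeft X' q), ← addRight_addLeft p' q, Category.assoc]

lemma addPath_inv {X X' Y Y' : HopfExt k H (N + 1)} (p : Path X X') (q : Path Y Y') :
    addPath (inv p) (inv q) = inv (addPath p q) := by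
  refine IsIso.eq_inv_of_hom_inv_id ?_
  rw [addPath_comp]
  simp [addPath]

lemma addPath_ofHom {X X' Y Y' : HopfExt k H (N + 1)} (f : X ⟶ X') (g : Y ⟶ Y') :
    addPath (ofHom f) (ofHom g) = ofHom (baerMap f g) := by
  rw [addPath, addRight_ofHom, addLeft_ofHom, ← ofHom_comp, baerMap_comp, Category.comp_id,
    Category.id_comp]

lemma addLeft_swap (A : HopfExt k H (N + 1)) {X Y : HopfExt k H (N + 1)} (p : Path X Y) :
    addLeft A p ≫ ofHom (baerSwap A Y) = ofHom (baerSwap A X) ≫ addRight p A :=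
  pmap_natural (swapNat A) p

lemma addRight_assoc (A B : HopfExt k H (N + 1)) {X Y : HopfExt k H (N + 1)} (p : Path X Y) :
    addRight (addRight p A) B ≫ ofHom (baerAssoc Y A B) =
      ofHom (baerAssoc X A B) ≫ addRight p (baer A B) :=
  (congrArg (· ≫ ofHom (baerAssoc Y A B))
    (pmap_comp_functor (translate A) (translate B) p).symm).trans
      (pmap_natural (assocNatFst A B) p)

lemma addLeft_assoc (A B : HopfExt k H (N + 1)) {X Y : HopfExt k H (N + 1)} (p : Path X Y) :
    addLeft (baer A B) p ≫ ofHom (baerAssoc A B Y) =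
      ofHom (baerAssoc A B X) ≫ addLeft A (addLeft B p) :=
  (pmap_natural (assocNatTrd A B) p).trans (congrArg (ofHom (baerAssoc A B X) ≫ ·)
    (pmap_comp_functor (leftTranslate B) (leftTranslate A) p))

lemma addSplit_path {Z : HopfExt k H (N + 1)} (s : unit k H ⟶ Z.X 0)
    (hs : s ≫ Z.aug = 𝟙 (unit k H)) {X Y : HopfExt k H (N + 1)} (p : Path X Y) :
    p ≫ ofHom (addSplit Y s hs) = ofHom (addSplit X s hs) ≫ addRight p Z :=
  (congrArg (· ≫ ofHom (addSplit Y s hs)) (pmap_id_functor p).symm).trans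
    (pmap_natural (addSplitNat s hs) p)

/-- The extension `-X`. -/
def neg (X : HopfExt k H N) : HopfExt k H N := X.twist 1

/-- The path from `X + (-X)` to a split extension. -/
def cancelPath (X : HopfExt k H (N + 1)) : Path (baer X (neg X)) (split X) :=
  ofHom (cancel X (s := 1) (pow_one _))

/-- The path from `X` to `X + A`, where `A = B + (-B)` up to the order of the summands. -/
def addCancel (X B : HopfExt k H (N + 1)) : Path X (baer X (baer (neg B) B)) :=
  ofHom (addSplit X (splitSect B) (splitSect_aug B)) ≫
    inv (addLeft X (ofHom (baerSwap (neg B) B) ≫ cancelPath B))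

lemma addCancel_natural (B : HopfExt k H (N + 1)) {X Y : HopfExt k H (N + 1)} (p : Path X Y) :
    p ≫ addCancel Y B = addCancel X B ≫ addRight p (baer (neg B) B) := by
  rw [addCancel, ← Category.assoc, addSplit_path, Category.assoc, addCancel, Category.assoc]
  congr 1
  rw [IsIso.comp_inv_eq, Category.assoc, IsIso.eq_inv_comp, addRight_addLeft]

/-- The path from `Y` to `X + ((-X) + Y)`. -/
def shift (X Y : HopfExt k H (N + 1)) : Path Y (baer X (baer (neg X) Y)) :=
  ofHom (addSplit Y (splitSect X) (splitSect_aug X)) ≫ inv (ofHom (baerSwap (split X) Y)) ≫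
    inv (addRight (cancelPath X) Y) ≫ ofHom (baerAssoc X (neg X) Y)

lemma shift_natural (X : HopfExt k H (N + 1)) {Y Y' : HopfExt k H (N + 1)} (p : Path Y Y') :
    p ≫ shift X Y' = shift X Y ≫ addLeft X (addLeft (neg X) p) := by
  have h1 : addRight p (split X) ≫ inv (ofHom (baerSwap (split X) Y')) =
      inv (ofHom (baerSwap (split X) Y)) ≫ addLeft (split X) p := by
    rw [IsIso.comp_inv_eq, Category.assoc, IsIso.eq_inv_comp, addLeft_swap]
  have h2 : addLeft (split X) p ≫ inv (addRight (cancelPath X) Y') =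
      inv (addRight (cancelPath X) Y) ≫ addLeft (baer X (neg X)) p := by
    rw [IsIso.comp_inv_eq, Category.assoc, IsIso.eq_inv_comp, addRight_addLeft]
  simp only [shift, Category.assoc]
  rw [← addLeft_assoc, ← reassoc_of% h2, ← reassoc_of% h1, ← Category.assoc, addSplit_path,
    Category.assoc]

/-- The family of loops attached to a loop at `X`: at `Y` it is the translate of the loop by
`(-X) + Y`, transported along the path from `Y` to `X + ((-X) + Y)`. -/
def spread {X : HopfExt k H (N + 1)} (γ : Path X X) (Y : HopfExt k H (N + 1)) : Path Y Y :=
  shift X Y ≫ addRight γ (baer (neg X) Y) ≫ inv (shift X Y)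

lemma spread_natural {X : HopfExt k H (N + 1)} (γ : Path X X) {Y Y' : HopfExt k H (N + 1)}
    (p : Path Y Y') : spread γ Y ≫ p = p ≫ spread γ Y' := by
  simp only [spread, ← Category.assoc]
  rw [IsIso.eq_comp_inv, Category.assoc, Category.assoc, shift_natural X p]
  simp only [Category.assoc, IsIso.inv_hom_id_assoc, addRight_addLeft]

lemma spread_self {X : HopfExt k H (N + 1)} (γ : Path X X) : spread γ X = γ := by
  have h1 := addCancel_natural X γ
  have h2 : addRight γ (baer (neg X) X) = inv (shift X X) ≫ spread γ X ≫ shift X X := by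
    simp [spread]
  -- `γ` is conjugate to the central element `spread γ X`
  have h3 := spread_natural γ (addCancel X X ≫ inv (shift X X))
  rw [h2] at h1
  rw [← cancel_mono (addCancel X X), h1]
  simp only [← Category.assoc] at h3 ⊢
  rw [← h3]
  simp

/-- The fundamental groups are commutative. -/
lemma loop_comm {X : HopfExt k H (N + 1)} (γ δ : Path X X) : γ ≫ δ = δ ≫ γ := by
  have := spread_natural γ δ
  rwa [spread_self] at this

/-- A change of base point does not depend on the path. -/
lemma conj_eq {X Y : HopfExt k H (N + 1)} (p q : Path X Y) (γ : Path X X) (δ : Path Y Y)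
    (h : γ ≫ p = p ≫ δ) : γ ≫ q = q ≫ δ := by
  have h2 : δ = inv p ≫ γ ≫ p := by rw [h]; simp
  rw [h2, ← cancel_mono (inv p)]
  have h3 := loop_comm γ (q ≫ inv p)
  simpa using h3

/-- The family `spread γ` is compatible with translation. -/
lemma spread_baer {X : HopfExt k H (N + 1)} (γ : Path X X) (Y A : HopfExt k H (N + 1)) :
    spread γ (baer Y A) = addRight (spread γ Y) A := by
  let q : Path (baer Y A) (baer X (baer (neg X) (baer Y A))) :=
    addRight (shift X Y) A ≫ ofHom (baerAssoc X (baer (neg X) Y) A) ≫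
      addLeft X (ofHom (baerAssoc (neg X) Y A))
  have h1 : addRight (spread γ Y) A ≫ q = q ≫ addRight γ (baer (neg X) (baer Y A)) := by
    simp only [q, spread, addRight_comp, addRight_inv, Category.assoc, IsIso.inv_hom_id_assoc]
    rw [← addRight_addLeft, ← Category.assoc (addRight (addRight γ _) A), addRight_assoc,
      Category.assoc]
  have h2 := conj_eq q (shift X (baer Y A)) _ _ h1
  rw [← cancel_mono (shift X (baer Y A)), h2, spread]
  simp

/-- The element of the fundamental group represented by a loop at `X`. -/
def ofLoop {X : HopfExt k H (N + 1)} (γ : Path X X) : Pi1 k H N :=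
  ⟨spread γ, fun _ _ p => spread_natural γ p, fun Y A => spread_baer γ Y A⟩

@[simp] lemma ofLoop_self {X : HopfExt k H (N + 1)} (γ : Path X X) : (ofLoop γ).1 X = γ :=
  spread_self γ

lemma Pi1.natural (γ : Pi1 k H N) {X Y : HopfExt k H (N + 1)} (p : Path X Y) :
    γ.1 X ≫ p = p ≫ γ.1 Y := γ.2.1 X Y p

lemma Pi1.addRight (γ : Pi1 k H N) (X A : HopfExt k H (N + 1)) :
    HopfExt.addRight (γ.1 X) A = γ.1 (baer X A) := (γ.2.2 X A).symm

lemma Pi1.addLeft (γ : Pi1 k H N) (A X : HopfExt k H (N + 1)) :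
    HopfExt.addLeft A (γ.1 X) = γ.1 (baer A X) := by
  rw [← cancel_mono (ofHom (baerSwap A X)), addLeft_swap, Pi1.natural γ, Pi1.addRight γ]

/-- Sums of loops are products in the fundamental group. -/
lemma Pi1.addPath (γ δ : Pi1 k H N) (X Y : HopfExt k H (N + 1)) :
    HopfExt.addPath (γ.1 X) (δ.1 Y) = (γ * δ).1 (baer X Y) := by
  rw [HopfExt.addPath, Pi1.addRight γ, Pi1.addLeft δ]
  rfl

/-- An element of the fundamental group is determined by its component at one base point. -/
lemma Pi1.ext_at (X : HopfExt k H (N + 1)) {γ δ : Pi1 k H N} (h : γ.1 X = δ.1 X) : γ = δ := by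
  refine Subtype.ext (funext fun Y => ?_)
  rw [← cancel_mono (shift X Y), Pi1.natural γ, Pi1.natural δ, ← Pi1.addRight γ,
    ← Pi1.addRight δ, h]

/-- Elements of the fundamental group may be compared along a path between two base points. -/
lemma Pi1.ext_path {X Y : HopfExt k H (N + 1)} {γ δ : Pi1 k H N} (p : Path X Y)
    (h : γ.1 X ≫ p = p ≫ δ.1 Y) : γ = δ := by
  refine Pi1.ext_at X ?_
  rw [← cancel_mono p, h, Pi1.natural δ]

lemma Pi1.mul_comm (γ δ : Pi1 k H N) : γ * δ = δ * γ :=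
  Subtype.ext (funext fun _ => loop_comm _ _)

end FundamentalGroup

section TwistPi1

/-- The path of split extensions induced by a path of extensions. -/
def splitPath {X Y : HopfExt k H (N + 1)} (p : Path X Y) : Path (split X) (split Y) :=
  pmap splitFunctor p

/-- Adding a split extension to `X` gives the same path for all split extensions, up to the paths
between these. -/
lemma addSplit_splitPath (X : HopfExt k H (N + 1)) {A B : HopfExt k H (N + 1)} (p : Path A B) :
    ofHom (addSplit X (splitSect A) (splitSect_aug A)) ≫ addLeft X (splitPath p) =
      ofHom (addSplit X (splitSect B) (splitSect_aug B)) := by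
  have h := freeGroupoid_natural
    (F := FreeGroupoid.map ((Functor.const (HopfExt k H (N + 1))).obj X))
    (F' := FreeGroupoid.map (splitFunctor ⋙ leftTranslate X))
    (fun A => ofHom (addSplit X (splitSect A) (splitSect_aug A)))
    (fun {A B} f => (ofHom_comp _ _).symm.trans ((congrArg ofHom
      (addSplit_natural (splitSect_aug A) (splitSect_aug B) (𝟙 X) (splitMap f)
        (splitSect_natural f))).trans (ofHom_comp _ _))) p
  have h0 : pmap ((Functor.const (HopfExt k H (N + 1))).obj X) p = 𝟙 (FreeGroupoid.mk X) :=
    pmap_const X p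
  refine (congrArg (_ ≫ ·) (pmap_comp_functor splitFunctor (leftTranslate X) p).symm).trans
    (h.symm.trans ?_)
  exact (congrArg (· ≫ _) h0).trans (Category.id_comp _)

/-- A loop of split extensions induced by a loop of extensions is trivial. -/
lemma splitLoop_eq_id {X : HopfExt k H (N + 1)} (γ : Path X X) : splitPath γ = 𝟙 _ := by
  have h1 : addLeft X (splitPath γ) = 𝟙 _ := by
    rw [← cancel_epi (ofHom (addSplit X (splitSect X) (splitSect_aug X))), addSplit_splitPath,
      Category.comp_id]
  have h3 : ofLoop (splitPath γ) = 1 := by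
    refine Pi1.ext_at (baer X (split X)) ?_
    rw [← Pi1.addLeft, ofLoop_self, h1]
    rfl
  rw [← ofLoop_self (splitPath γ), h3]
  rfl

variable {s : ℕ}

/-- The functor `X ↦ X + (-1)^s X`. -/
def diffFunctor (N s : ℕ) : HopfExt k H (N + 1) ⥤ HopfExt k H (N + 1) where
  obj X := baer X (X.twist s)
  map φ := baerMap φ (twistMap s φ)
  map_id _ := baerMap_id_id _ _
  map_comp φ ψ := (baerMap_comp φ (twistMap s φ) ψ (twistMap s ψ)).symm

/-- The functor `p ↦ p + (-1)^s p` on paths. -/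
def diffPath (N s : ℕ) : FreeGroupoid (HopfExt k H (N + 1)) ⥤ FreeGroupoid (HopfExt k H (N + 1)) where
  obj X := FreeGroupoid.mk (baer X.as.as (X.as.as.twist s))
  map {X Y} p := addPath (X := X.as.as) (X' := Y.as.as) p (twistPath s p)
  map_id := fun X => by
    refine (congrArg (addPath _) (pmap_id (twistFunctor (N + 1) s) X.as.as)).trans ?_
    exact (congrArg₂ (· ≫ ·) (addRight_id _) (addLeft_id _)).trans (Category.comp_id _)
  map_comp {X Y Z} p q := by
    refine (congrArg (addPath _) (twistPath_comp (X := X.as.as) (Y := Y.as.as) (Z := Z.as.as)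
      p q)).trans (addPath_comp _ _ _ _).symm

lemma addPath_twistPath {X Y : HopfExt k H (N + 1)} (p : Path X Y) :
    addPath p (twistPath s p) = pmap (diffFunctor N s) p := by
  have h : ∀ {X Y : HopfExt k H (N + 1)} (f : X ⟶ Y),
      (diffPath N s).map (FreeGroupoid.homMk f) = ofHom (baerMap f (twistMap s f)) := fun f =>
    addPath_ofHom f (twistMap s f)
  have := freeGroupoid_natural (F := diffPath N s) (F' := FreeGroupoid.map (diffFunctor N s))
    (fun X => 𝟙 (FreeGroupoid.mk (baer X (X.twist s))))
    (fun {X Y} f => (Category.comp_id _).trans ((h f).trans (Category.id_comp _).symm)) p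
  exact (Category.comp_id (addPath p (twistPath s p))).symm.trans
    (this.trans (Category.id_comp _))

/-- The sum of a path and its negative is carried by `cancel` to a path of split extensions. -/
lemma pmap_cancel (hs : (-1 : k) ^ s = -1) {X Y : HopfExt k H (N + 1)} (p : Path X Y) :
    addPath p (twistPath s p) ≫ ofHom (cancel Y hs) = ofHom (cancel X hs) ≫ splitPath p := by
  rw [addPath_twistPath]
  exact pmap_natural (Φ := diffFunctor N s) (Ψ := splitFunctor)
    { app := fun X => cancel X hs
      naturality := fun _ _ f => cancel_natural f hs } p

/-- If `(-1)^s = 1`, then `(-1)^s X` is isomorphic to `X` by the identity maps. -/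
def untwist (X : HopfExt k H N) (hs : (-1 : k) ^ s = 1) : X.twist s ⟶ X where
  f i := 𝟙 (X.X i)
  comm i := HopfBimod.hom_ext fun z => rfl
  top := HopfBimod.hom_ext fun z => rfl
  aug := HopfBimod.hom_ext fun z => by
    change lin X.aug z = lin ((-1 : k) ^ s • X.aug) z
    rw [hs, one_smul]

/-- For odd `s`, the functor `(-1)^s` inverts the fundamental group. -/
lemma Pi1.twist_odd (γ : Pi1 k H N) (hs : (-1 : k) ^ s = -1) (X : HopfExt k H (N + 1)) :
    twistPath s (γ.1 X) = (γ⁻¹).1 (X.twist s) := by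
  have h := pmap_cancel hs (γ.1 X)
  rw [splitLoop_eq_id, Category.comp_id] at h
  have h1 : HopfExt.addPath (γ.1 X) (twistPath s (γ.1 X)) = 𝟙 _ := by
    rw [← cancel_mono (ofHom (cancel X hs)), h, Category.id_comp]
  have h2 : γ * ofLoop (twistPath s (γ.1 X)) = 1 := by
    refine Pi1.ext_at (baer X (X.twist s)) ?_
    rw [← Pi1.addPath, ofLoop_self, h1]
    rfl
  rw [← eq_inv_of_mul_eq_one_right h2, ofLoop_self]

/-- For even `s`, the functor `(-1)^s` acts trivially on the fundamental group. -/
lemma Pi1.twist_even (γ : Pi1 k H N) (hs : (-1 : k) ^ s = 1) (X : HopfExt k H (N + 1)) :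
    twistPath s (γ.1 X) = γ.1 (X.twist s) := by
  have h := pmap_natural (Φ := twistFunctor (N + 1) s) (Ψ := 𝟭 _)
    { app := fun X => untwist X hs
      naturality := fun _ _ _ => HopfExt.hom_ext' fun i => rfl } (γ.1 X)
  rw [← cancel_mono (ofHom (untwist X hs)), Pi1.natural γ]
  exact h.trans (congrArg _ (pmap_id_functor _))

end TwistPi1

/-! ### Morphisms from and to Yoneda products -/

section SpliceTools

/-- The inclusion of the term `X i`, in degree `i < m`. -/
def spliceInl : ∀ (m : ℕ) (X Y : ℕ → HopfBimod k H) (i : ℕ) (_ : i < m), X i ⟶ spliceX m X Y i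
  | 0, _, _, _, h => absurd h (by omega)
  | _ + 1, X, _, 0, _ => 𝟙 (X 0)
  | m + 1, X, Y, i + 1, h => spliceInl m (fun j => X (j + 1)) Y i (by omega)

lemma spliceX_cases : ∀ (m : ℕ) (X Y : ℕ → HopfBimod k H) (j : ℕ) (z : spliceX m X Y j),
    (∃ (h : j < m) (x : X j), z = lin (spliceInl m X Y j h) x) ∨
      ∃ (i : ℕ) (h : i + m = j) (y : Y i), z = lin (spliceInr m X Y i j h) y
  | 0, _, _, j, z => Or.inr ⟨j, rfl, z, rfl⟩
  | _ + 1, _, _, 0, z => Or.inl ⟨Nat.succ_pos _, z, rfl⟩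
  | m + 1, X, Y, j + 1, z => by
    rcases spliceX_cases m (fun j => X (j + 1)) Y j z with ⟨h, x, hx⟩ | ⟨i, h, y, hy⟩
    · exact Or.inl ⟨by omega, x, hx⟩
    · exact Or.inr ⟨i, by omega, y, hy⟩

/-- A family of morphisms from a spliced sequence. -/
def spliceDesc : ∀ (m : ℕ) (X Y T : ℕ → HopfBimod k H) (_ : ∀ i, i < m → (X i ⟶ T i))
    (_ : ∀ i j, i + m = j → (Y i ⟶ T j)) (j : ℕ), spliceX m X Y j ⟶ T j
  | 0, _, _, _, _, b, j => b j j rfl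
  | _ + 1, _, _, _, a, _, 0 => a 0 (Nat.succ_pos _)
  | m + 1, X, Y, T, a, b, j + 1 =>
    spliceDesc m (fun j => X (j + 1)) Y (fun j => T (j + 1)) (fun j h => a (j + 1) (by omega))
      (fun i j h => b i (j + 1) (by omega)) j

@[simp] lemma spliceDesc_inl : ∀ (m : ℕ) (X Y T : ℕ → HopfBimod k H)
    (a : ∀ i, i < m → (X i ⟶ T i)) (b : ∀ i j, i + m = j → (Y i ⟶ T j)) (j : ℕ) (h : j < m)
    (x : X j), lin (spliceDesc m X Y T a b j) (lin (spliceInl m X Y j h) x) = lin (a j h) x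
  | 0, _, _, _, _, _, _, h, _ => absurd h (by omega)
  | _ + 1, _, _, _, _, _, 0, _, _ => rfl
  | m + 1, X, Y, T, a, b, j + 1, h, x =>
    spliceDesc_inl m (fun j => X (j + 1)) Y (fun j => T (j + 1)) (fun j h => a (j + 1) (by omega))
      (fun i j h => b i (j + 1) (by omega)) j (by omega) x

@[simp] lemma spliceDesc_inr : ∀ (m : ℕ) (X Y T : ℕ → HopfBimod k H)
    (a : ∀ i, i < m → (X i ⟶ T i)) (b : ∀ i j, i + m = j → (Y i ⟶ T j)) (i j : ℕ) (h : i + m = j)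
    (y : Y i), lin (spliceDesc m X Y T a b j) (lin (spliceInr m X Y i j h) y) = lin (b i j h) y
  | 0, _, _, _, _, _, i, j, h, _ => by
    have h' : i = j := h
    subst h'
    rfl
  | m + 1, _, _, _, _, _, _, 0, h, _ => absurd h (by omega)
  | m + 1, X, Y, T, a, b, i, j + 1, h, y =>
    spliceDesc_inr m (fun j => X (j + 1)) Y (fun j => T (j + 1)) (fun j h => a (j + 1) (by omega))
      (fun i j h => b i (j + 1) (by omega)) i j (by omega) y

lemma spliceLift_inl : ∀ (m : ℕ) (X Y T : ℕ → HopfBimod k H) (a : ∀ i, T i ⟶ X i)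
    (b : ∀ i j, i + m = j → (T j ⟶ Y i)) (j : ℕ) (h : j < m) (t : T j),
    lin (spliceLift m X Y T a b j) t = lin (spliceInl m X Y j h) (lin (a j) t)
  | 0, _, _, _, _, _, _, h, _ => absurd h (by omega)
  | _ + 1, _, _, _, _, _, 0, _, _ => rfl
  | m + 1, X, Y, T, a, b, j + 1, h, t =>
    spliceLift_inl m (fun j => X (j + 1)) Y (fun j => T (j + 1)) (fun j => a (j + 1))
      (fun i j h => b i (j + 1) (by omega)) j (by omega) t

lemma spliceLift_inr_apply (m : ℕ) (X Y T : ℕ → HopfBimod k H) (a : ∀ i, T i ⟶ X i)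
    (b : ∀ i j, i + m = j → (T j ⟶ Y i)) (i j : ℕ) (h : i + m = j) (t : T j) :
    lin (spliceLift m X Y T a b j) t = lin (spliceInr m X Y i j h) (lin (b i j h) t) :=
  congrArg (fun φ => lin φ t) (spliceLift_inr m X Y T a b i j h)

lemma spliceD_inl : ∀ (m : ℕ) (X Y : ℕ → HopfBimod k H) (dX : ∀ i, X (i + 1) ⟶ X i)
    (dY : ∀ i, Y (i + 1) ⟶ Y i) (c : Y 0 ⟶ X m) (j : ℕ) (h : j + 1 < m + 1) (x : X (j + 1)),
    lin (spliceD m X Y dX dY c j) (lin (spliceInl (m + 1) X Y (j + 1) h) x) =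
      lin (spliceInl (m + 1) X Y j (by omega)) (lin (dX j) x)
  | 0, _, _, _, _, _, _, h, _ => absurd h (by omega)
  | _ + 1, _, _, _, _, _, 0, _, _ => rfl
  | m + 1, X, Y, dX, dY, c, j + 1, h, x =>
    spliceD_inl m (fun j => X (j + 1)) Y (fun j => dX (j + 1)) dY c j (by omega) x

lemma spliceD_inr_zero : ∀ (m : ℕ) (X Y : ℕ → HopfBimod k H) (dX : ∀ i, X (i + 1) ⟶ X i)
    (dY : ∀ i, Y (i + 1) ⟶ Y i) (c : Y 0 ⟶ X m) (h : 0 + (m + 1) = m + 1) (y : Y 0),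
    lin (spliceD m X Y dX dY c m) (lin (spliceInr (m + 1) X Y 0 (m + 1) h) y) =
      lin (spliceInl (m + 1) X Y m (by omega)) (lin c y)
  | 0, _, _, _, _, _, _, _ => rfl
  | m + 1, X, Y, dX, dY, c, _, y =>
    spliceD_inr_zero m (fun j => X (j + 1)) Y (fun j => dX (j + 1)) dY c (by omega) y

lemma spliceD_inr_succ : ∀ (m : ℕ) (X Y : ℕ → HopfBimod k H) (dX : ∀ i, X (i + 1) ⟶ X i)
    (dY : ∀ i, Y (i + 1) ⟶ Y i) (c : Y 0 ⟶ X m) (i j : ℕ) (h : i + 1 + (m + 1) = j + 1)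
    (y : Y (i + 1)),
    lin (spliceD m X Y dX dY c j) (lin (spliceInr (m + 1) X Y (i + 1) (j + 1) h) y) =
      lin (spliceInr (m + 1) X Y i j (by omega)) (lin (dY i) y)
  | 0, _, _, _, _, _, i, j, h, _ => by
    obtain rfl : i + 1 = j := by omega
    rfl
  | m + 1, _, _, _, _, _, _, 0, h, _ => absurd h (by omega)
  | m + 1, X, Y, dX, dY, c, i, j + 1, h, y =>
    spliceD_inr_succ m (fun j => X (j + 1)) Y (fun j => dX (j + 1)) dY c i j (by omega) y

lemma spliceDesc_comm (m : ℕ) (X Y T : ℕ → HopfBimod k H) (dX : ∀ i, X (i + 1) ⟶ X i)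
    (dY : ∀ i, Y (i + 1) ⟶ Y i) (c : Y 0 ⟶ X m) (dT : ∀ i, T (i + 1) ⟶ T i)
    (a : ∀ i, i < m + 1 → (X i ⟶ T i)) (b : ∀ i j, i + (m + 1) = j → (Y i ⟶ T j))
    (ha : ∀ i h x, lin (a i (by omega)) (lin (dX i) x) = lin (dT i) (lin (a (i + 1) h) x))
    (hb : ∀ i j h y, lin (b i j (by omega)) (lin (dY i) y) = lin (dT j) (lin (b (i + 1) (j + 1) h) y))
    (hc : ∀ y, lin (a m (by omega)) (lin c y) = lin (dT m) (lin (b 0 (m + 1) (by omega)) y))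
    (j : ℕ) :
    spliceD m X Y dX dY c j ≫ spliceDesc (m + 1) X Y T a b j =
      spliceDesc (m + 1) X Y T a b (j + 1) ≫ dT j :=
  HopfBimod.hom_ext fun z => by
    rcases spliceX_cases (m + 1) X Y (j + 1) z with ⟨h, x, rfl⟩ | ⟨i, h, y, rfl⟩
    · rw [lin_comp, lin_comp, spliceD_inl, spliceDesc_inl, spliceDesc_inl, ha]
    · rcases i with _ | i
      · obtain rfl : m = j := by omega
        rw [lin_comp, lin_comp, spliceD_inr_zero, spliceDesc_inl, spliceDesc_inr, hc]
      · rw [lin_comp, lin_comp, spliceD_inr_succ, spliceDesc_inr, spliceDesc_inr, hb]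

variable {m n N : ℕ}

section

variable (E : HopfExt k H (m + 1)) (F : HopfExt k H n) (h : n + (m + 1) = N)

/-- The inclusion of the terms of `E` into `E # F`. -/
def inl (i : ℕ) (hi : i < m + 1) : E.X i ⟶ (splice E F h).X i := spliceInl (m + 1) E.X F.X i hi

/-- The inclusion of the terms of `F` into `E # F`. -/
def inr (i j : ℕ) (hj : i + (m + 1) = j) : F.X i ⟶ (splice E F h).X j :=
  spliceInr (m + 1) E.X F.X i j hj

lemma splice_cases (j : ℕ) (z : (splice E F h).X j) :
    (∃ (hj : j < m + 1) (x : E.X j), z = lin (inl E F h j hj) x) ∨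
      ∃ (i : ℕ) (hj : i + (m + 1) = j) (y : F.X i), z = lin (inr E F h i j hj) y :=
  spliceX_cases _ _ _ _ _

lemma splice_d_inl (j : ℕ) (hj : j + 1 < m + 1) (x : E.X (j + 1)) :
    lin ((splice E F h).d j) (lin (inl E F h (j + 1) hj) x) =
      lin (inl E F h j (by omega)) (lin (E.d j) x) :=
  spliceD_inl _ _ _ _ _ _ _ hj x

lemma splice_d_inr_zero (hj : 0 + (m + 1) = m + 1) (y : F.X 0) :
    lin ((splice E F h).d m) (lin (inr E F h 0 (m + 1) hj) y) =
      lin (inl E F h m (by omega)) (lin (E.d m) (lin E.top (lin F.aug y))) :=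
  spliceD_inr_zero _ _ _ _ _ _ hj y

lemma splice_d_inr_succ (i j : ℕ) (hj : i + 1 + (m + 1) = j + 1) (y : F.X (i + 1)) :
    lin ((splice E F h).d j) (lin (inr E F h (i + 1) (j + 1) hj) y) =
      lin (inr E F h i j (by omega)) (lin (F.d i) y) :=
  spliceD_inr_succ _ _ _ _ _ _ _ _ hj y

lemma splice_top (x : unit k H) :
    lin (splice E F h).top x = lin (inr E F h n N h) (lin F.top x) := rfl

/-- A morphism from a Yoneda product. -/
def spliceHom {T : HopfExt k H N} (a : ∀ i, i < m + 1 → (E.X i ⟶ T.X i))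
    (b : ∀ i j, i + (m + 1) = j → (F.X i ⟶ T.X j))
    (ha : ∀ i h x, lin (a i (by omega)) (lin (E.d i) x) = lin (T.d i) (lin (a (i + 1) h) x))
    (hb : ∀ i j h y, lin (b i j (by omega)) (lin (F.d i) y) =
      lin (T.d j) (lin (b (i + 1) (j + 1) h) y))
    (hc : ∀ y, lin (a m (by omega)) (lin (E.d m) (lin E.top (lin F.aug y))) =
      lin (T.d m) (lin (b 0 (m + 1) (by omega)) y))
    (top : ∀ x, lin (b n N h) (lin F.top x) = lin T.top x)
    (aug : ∀ x, lin T.aug (lin (a 0 (by omega)) x) = lin E.aug x) : splice E F h ⟶ T where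
  f := spliceDesc (m + 1) E.X F.X T.X a b
  comm := spliceDesc_comm m E.X F.X T.X E.d F.d (F.aug ≫ E.top ≫ E.d m) T.d a b ha hb hc
  top := HopfBimod.hom_ext fun x => (spliceDesc_inr _ _ _ _ _ _ _ _ _ _).trans (top x)
  aug := HopfBimod.hom_ext fun x => aug x

variable {E F h}

lemma spliceHom_inl {T : HopfExt k H N} (a : ∀ i, i < m + 1 → (E.X i ⟶ T.X i))
    (b : ∀ i j, i + (m + 1) = j → (F.X i ⟶ T.X j)) (ha) (hb) (hc) (top) (aug) (i : ℕ)
    (hi : i < m + 1) (x : E.X i) :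
    lin ((spliceHom E F h a b ha hb hc top aug).f i) (lin (inl E F h i hi) x) = lin (a i hi) x :=
  spliceDesc_inl _ _ _ _ _ _ _ _ _

lemma spliceHom_inr {T : HopfExt k H N} (a : ∀ i, i < m + 1 → (E.X i ⟶ T.X i))
    (b : ∀ i j, i + (m + 1) = j → (F.X i ⟶ T.X j)) (ha) (hb) (hc) (top) (aug) (i j : ℕ)
    (hj : i + (m + 1) = j) (y : F.X i) :
    lin ((spliceHom E F h a b ha hb hc top aug).f j) (lin (inr E F h i j hj) y) = lin (b i j hj) y :=
  spliceDesc_inr _ _ _ _ _ _ _ _ _ _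

end

/-- The Yoneda product of two morphisms. -/
def spliceMap {E E' : HopfExt k H (m + 1)} {F F' : HopfExt k H n} (φ : E ⟶ E') (ψ : F ⟶ F')
    (h : n + (m + 1) = N) : splice E F h ⟶ splice E' F' h :=
  spliceHom E F h (fun i hi => φ.f i ≫ inl E' F' h i hi) (fun i j hj => ψ.f i ≫ inr E' F' h i j hj)
    (fun i hi x => by rw [lin_comp, lin_comp, Hom.comm_apply, splice_d_inl])
    (fun i j hj y => by rw [lin_comp, lin_comp, Hom.comm_apply, splice_d_inr_succ])
    (fun y => by
      rw [lin_comp, lin_comp, Hom.comm_apply, Hom.top_apply, ← Hom.aug_apply ψ, splice_d_inr_zero])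
    (fun x => by rw [lin_comp, Hom.top_apply, splice_top])
    (fun x => φ.aug_apply x)

end SpliceTools

/-! ### Tensor products of sequences -/

section Total

variable (A B : ℕ → HopfBimod k H)

/-- The degree `r` term `⨁ A s ⊗_H B t`, `s + t = r`, of the tensor product of two sequences. -/
def totX (r : ℕ) : HopfBimod k H :=
  pi fun x : {x // x ∈ Finset.HasAntidiagonal.antidiagonal r} => tensor (A x.1.1) (B x.1.2)

/-- The projection to a summand. -/
def totProj {r : ℕ} (s t : ℕ) (h : s + t = r) : totX A B r ⟶ tensor (A s) (B t) :=
  proj (fun x : {x // x ∈ Finset.HasAntidiagonal.antidiagonal r} => tensor (A x.1.1) (B x.1.2))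
    ⟨(s, t), Finset.HasAntidiagonal.mem_antidiagonal.2 h⟩

/-- The inclusion of a summand. -/
def totIncl {r : ℕ} (s t : ℕ) (h : s + t = r) : tensor (A s) (B t) ⟶ totX A B r :=
  incl (fun x : {x // x ∈ Finset.HasAntidiagonal.antidiagonal r} => tensor (A x.1.1) (B x.1.2))
    ⟨(s, t), Finset.HasAntidiagonal.mem_antidiagonal.2 h⟩

variable {A B}

lemma totX_ext {r : ℕ} {x y : totX A B r}
    (h : ∀ s t h, lin (totProj A B s t h) x = lin (totProj A B s t h) y) : x = y :=
  funext fun p => h p.1.1 p.1.2 (Finset.HasAntidiagonal.mem_antidiagonal.1 p.2)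

lemma exists_totX {r : ℕ} (z : ∀ s t : ℕ, s + t = r → tensor (A s) (B t)) :
    ∃ x : totX A B r, ∀ s t h, lin (totProj A B s t h) x = z s t h :=
  ⟨fun p => z p.1.1 p.1.2 (Finset.HasAntidiagonal.mem_antidiagonal.1 p.2), fun _ _ _ => rfl⟩

lemma totProj_incl_self {r : ℕ} (s t : ℕ) (h : s + t = r) (x : tensor (A s) (B t)) :
    lin (totProj A B s t h) (lin (totIncl A B s t h) x) = x :=
  Pi.single_eq_same _ _

lemma totProj_incl_ne {r : ℕ} (s t s' t' : ℕ) (h : s + t = r) (h' : s' + t' = r) (hs : s' ≠ s)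
    (x : tensor (A s) (B t)) : lin (totProj A B s' t' h') (lin (totIncl A B s t h) x) = 0 :=
  Pi.single_eq_of_ne (fun e => hs (congrArg (fun p => p.1.1) e)) _

variable {A' B' : ℕ → HopfBimod k H}

/-- The tensor product of two families of morphisms. -/
def totMap (f : ∀ i, A i ⟶ A' i) (g : ∀ i, B i ⟶ B' i) (r : ℕ) : totX A B r ⟶ totX A' B' r :=
  HopfBimod.lift fun x =>
    totProj A B x.1.1 x.1.2 (Finset.HasAntidiagonal.mem_antidiagonal.1 x.2) ≫
      tensorMap (f x.1.1) (g x.1.2)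

@[simp] lemma totProj_totMap (f : ∀ i, A i ⟶ A' i) (g : ∀ i, B i ⟶ B' i) {r : ℕ} (s t : ℕ)
    (h : s + t = r) (x : totX A B r) :
    lin (totProj A' B' s t h) (lin (totMap f g r) x) =
      lin (tensorMap (f s) (g t)) (lin (totProj A B s t h) x) :=
  lift_apply _ _ _ _

lemma totMap_totIncl (f : ∀ i, A i ⟶ A' i) (g : ∀ i, B i ⟶ B' i) {r : ℕ} (s t : ℕ)
    (h : s + t = r) (x : tensor (A s) (B t)) :
    lin (totMap f g r) (lin (totIncl A B s t h) x) =
      lin (totIncl A' B' s t h) (lin (tensorMap (f s) (g t)) x) := by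
  refine totX_ext fun s' t' h' => ?_
  rw [totProj_totMap]
  by_cases hs : s' = s
  · subst hs
    obtain rfl : t' = t := by omega
    rw [totProj_incl_self, totProj_incl_self]
  · rw [totProj_incl_ne _ _ _ _ _ _ hs, totProj_incl_ne _ _ _ _ _ _ hs, map_zero]

end Total

section Natural

variable {m n N : ℕ}

lemma tensorMap_comp_apply {M M' M'' P P' P'' : HopfBimod k H} (f : M ⟶ M') (g : P ⟶ P')
    (f' : M' ⟶ M'') (g' : P' ⟶ P'') (x : tensor M P) :
    lin (tensorMap f' g') (lin (tensorMap f g) x) = lin (tensorMap (f ≫ f') (g ≫ g')) x :=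
  congrArg (fun φ => lin φ x) (tensorMap_comp f g f' g')

lemma lunit_natural {M M' : HopfBimod k H} (f : M ⟶ M') (x : tensor (unit k H) M) :
    lin (lunit M') (lin (tensorMap (𝟙 _) f) x) = lin f (lin (lunit M) x) :=
  congrArg (fun φ => lin φ x) (tensorHom_ext (f := tensorMap (𝟙 _) f ≫ lunit M')
    (g := lunit M ≫ f) fun _ _ => ((isHom f).lact _ _).symm)

lemma runit_natural {M M' : HopfBimod k H} (f : M ⟶ M') (x : tensor M (unit k H)) :
    lin (runit M') (lin (tensorMap f (𝟙 _)) x) = lin f (lin (runit M) x) :=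
  congrArg (fun φ => lin φ x) (tensorHom_ext (f := tensorMap f (𝟙 _) ≫ runit M')
    (g := runit M ≫ f) fun _ _ => ((isHom f).ract _ _).symm)

/-- The tensor product of two morphisms. -/
def tensorExtMap {E E' : HopfExt k H m} {F F' : HopfExt k H n} (φ : E ⟶ E') (ψ : F ⟶ F')
    (h : m + n = N) : tensorExt E F h ⟶ tensorExt E' F' h where
  f := totMap φ.f ψ.f
  comm r := HopfBimod.hom_ext fun x => tensorX_ext (E := E') (F := F') fun s t hst => by
    refine (totProj_totMap φ.f ψ.f s t hst (lin (tensorD E F r) x)).trans ?_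
    refine Eq.trans ?_ (tensorProj_d E' F' s t hst _).symm
    refine (congrArg _ (tensorProj_d E F s t hst x)).trans ?_
    refine Eq.trans ?_ (congrArg₂ (fun a b => lin (tensorMap (E'.d s) (𝟙 _)) a +
      (-1 : k) ^ s • lin (tensorMap (𝟙 _) (F'.d t)) b)
      (totProj_totMap φ.f ψ.f (s + 1) t (by omega) x).symm
      (totProj_totMap φ.f ψ.f s (t + 1) (by omega) x).symm)
    rw [map_add, map_smul, tensorMap_comp_apply, tensorMap_comp_apply, tensorMap_comp_apply,
      tensorMap_comp_apply, φ.comm, ψ.comm]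
    simp only [Category.id_comp, Category.comp_id]
    rfl
  top := HopfBimod.hom_ext fun x => by
    refine (totMap_totIncl φ.f ψ.f m n h _).trans (congrArg (lin (totIncl E'.X F'.X m n h)) ?_)
    refine (tensorMap_comp_apply E.top F.top (φ.f m) (ψ.f n) _).trans ?_
    rw [φ.top, ψ.top]
    rfl
  aug := HopfBimod.hom_ext fun x => by
    refine (congrArg (lin (tensorMap E'.aug F'.aug ≫ lunit _))
      (totProj_totMap φ.f ψ.f 0 0 rfl x)).trans ?_
    rw [lin_comp, tensorMap_comp_apply, φ.aug, ψ.aug]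
    rfl

lemma Hom.topInv_apply {E E' : HopfExt k H m} (φ : E ⟶ E') : φ.f m ≫ E'.topInv = E.topInv :=
  HopfBimod.hom_ext fun x => by
    obtain ⟨x, rfl⟩ := E.top_bijective.2 x
    rw [lin_comp, φ.top_apply, topInv_top, topInv_top]

lemma tensorAugL_natural {E E' : HopfExt k H m} {F F' : HopfExt k H n} (φ : E ⟶ E') (ψ : F ⟶ F')
    (t : ℕ) (x : tensor (E.X 0) (F.X t)) :
    lin (tensorAugL E' F' t) (lin (tensorMap (φ.f 0) (ψ.f t)) x) =
      lin (ψ.f t) (lin (tensorAugL E F t) x) := by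
  rw [tensorAugL, tensorAugL, lin_comp, lin_comp, ← lunit_natural, tensorMap_comp_apply,
    tensorMap_comp_apply, φ.aug, Category.comp_id, Category.comp_id, Category.id_comp]

lemma tensorAugR_natural {E E' : HopfExt k H m} {F F' : HopfExt k H n} (φ : E ⟶ E') (ψ : F ⟶ F')
    (s : ℕ) (x : tensor (E.X s) (F.X 0)) :
    lin (tensorAugR E' F' s) (lin (tensorMap (φ.f s) (ψ.f 0)) x) =
      lin (φ.f s) (lin (tensorAugR E F s) x) := by
  rw [tensorAugR, tensorAugR, lin_comp, lin_comp, ← runit_natural, tensorMap_comp_apply,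
    tensorMap_comp_apply, ψ.aug, Category.comp_id, Category.comp_id, Category.id_comp]

lemma tensorTopL_natural {E E' : HopfExt k H m} {F F' : HopfExt k H n} (φ : E ⟶ E') (ψ : F ⟶ F')
    (t : ℕ) (x : tensor (E.X m) (F.X t)) :
    lin (tensorTopL E' F' t) (lin (tensorMap (φ.f m) (ψ.f t)) x) =
      lin (ψ.f t) (lin (tensorTopL E F t) x) := by
  rw [tensorTopL, tensorTopL, lin_comp, lin_comp, ← lunit_natural, tensorMap_comp_apply,
    tensorMap_comp_apply, φ.topInv_apply, Category.comp_id, Category.comp_id, Category.id_comp]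

lemma tensorTopR_natural {E E' : HopfExt k H m} {F F' : HopfExt k H n} (φ : E ⟶ E') (ψ : F ⟶ F')
    (s : ℕ) (x : tensor (E.X s) (F.X n)) :
    lin (tensorTopR E' F' s) (lin (tensorMap (φ.f s) (ψ.f n)) x) =
      lin (φ.f s) (lin (tensorTopR E F s) x) := by
  rw [tensorTopR, tensorTopR, lin_comp, lin_comp, ← runit_natural, tensorMap_comp_apply,
    tensorMap_comp_apply, ψ.topInv_apply, Category.comp_id, Category.comp_id, Category.id_comp]

/-- The projection of `E ⊗ F` to a summand. -/
def tproj (E : HopfExt k H m) (F : HopfExt k H n) (h : m + n = N) {r : ℕ} (s t : ℕ)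
    (hst : s + t = r) : (tensorExt E F h).X r ⟶ tensor (E.X s) (F.X t) := tensorProj E F s t hst

lemma tproj_map {E E' : HopfExt k H m} {F F' : HopfExt k H n} (φ : E ⟶ E') (ψ : F ⟶ F')
    (h : m + n = N) {r : ℕ} (s t : ℕ) (hst : s + t = r) (x : (tensorExt E F h).X r) :
    lin (tproj E' F' h s t hst) (lin ((tensorExtMap φ ψ h).f r) x) =
      lin (tensorMap (φ.f s) (ψ.f t)) (lin (tproj E F h s t hst) x) :=
  totProj_totMap φ.f ψ.f s t hst x

lemma lambda_inl (E : HopfExt k H m) (F : HopfExt k H (n + 1)) (h : m + (n + 1) = N) (r : ℕ)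
    (hr : r < n + 1) (x : (tensorExt E F h).X r) :
    lin ((lambda E F h).f r) x = lin (inl F E h r hr)
      (lin (tensorAugL E F r) (lin (tproj E F h 0 r (zero_add r)) x)) :=
  spliceLift_inl _ _ _ _ _ _ _ hr _

lemma lambda_inr (E : HopfExt k H m) (F : HopfExt k H (n + 1)) (h : m + (n + 1) = N) (i r : ℕ)
    (hr : i + (n + 1) = r) (x : (tensorExt E F h).X r) :
    lin ((lambda E F h).f r) x = lin (inr F E h i r hr)
      (lin (tensorTopR E F i) (lin (tproj E F h i (n + 1) hr) x)) :=
  spliceLift_inr_apply _ _ _ _ _ _ _ _ hr _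

lemma rho_inl (E : HopfExt k H (m + 1)) (F : HopfExt k H n) (s : ℕ) (hs : s = (m + 1) * n)
    (h : m + 1 + n = N) (h' : n + (m + 1) = N) (r : ℕ) (hr : r < m + 1)
    (x : (tensorExt E F h).X r) :
    lin ((rho E F s hs h h').f r) x = lin (inl E F h' r hr)
      ((-1 : k) ^ s • lin (tensorAugR E F r) (lin (tproj E F h r 0 (add_zero r)) x)) :=
  spliceLift_inl _ _ _ _ _ _ _ hr _

lemma rho_inr (E : HopfExt k H (m + 1)) (F : HopfExt k H n) (s : ℕ) (hs : s = (m + 1) * n)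
    (h : m + 1 + n = N) (h' : n + (m + 1) = N) (i r : ℕ) (hr : i + (m + 1) = r)
    (x : (tensorExt E F h).X r) :
    lin ((rho E F s hs h h').f r) x = lin (inr E F h' i r hr)
      ((-1 : k) ^ ((m + 1) * (n + i)) •
        lin (tensorTopL E F i) (lin (tproj E F h (m + 1) i (by omega)) x)) :=
  spliceLift_inr_apply _ _ _ _ _ _ _ _ hr _

lemma spliceMap_inl {E E' : HopfExt k H (m + 1)} {F F' : HopfExt k H n} (φ : E ⟶ E') (ψ : F ⟶ F')
    (h : n + (m + 1) = N) (r : ℕ) (hr : r < m + 1) (x : E.X r) :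
    lin ((spliceMap φ ψ h).f r) (lin (inl E F h r hr) x) =
      lin (inl E' F' h r hr) (lin (φ.f r) x) :=
  spliceHom_inl _ _ _ _ _ _ _ _ _ _

lemma spliceMap_inr {E E' : HopfExt k H (m + 1)} {F F' : HopfExt k H n} (φ : E ⟶ E') (ψ : F ⟶ F')
    (h : n + (m + 1) = N) (i r : ℕ) (hr : i + (m + 1) = r) (x : F.X i) :
    lin ((spliceMap φ ψ h).f r) (lin (inr E F h i r hr) x) =
      lin (inr E' F' h i r hr) (lin (ψ.f i) x) :=
  spliceHom_inr _ _ _ _ _ _ _ _ _ _ _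

lemma lambda_natural {E E' : HopfExt k H m} {F F' : HopfExt k H (n + 1)} (φ : E ⟶ E') (ψ : F ⟶ F')
    (h : m + (n + 1) = N) :
    tensorExtMap φ ψ h ≫ lambda E' F' h = lambda E F h ≫ spliceMap ψ φ h :=
  hom_ext' fun r => HopfBimod.hom_ext fun x => by
    rw [comp_f, comp_f, lin_comp, lin_comp]
    rcases Nat.lt_or_ge r (n + 1) with hr | hr
    · rw [lambda_inl E F h r hr, lambda_inl E' F' h r hr, spliceMap_inl, tproj_map,
        tensorAugL_natural]
    · obtain ⟨i, hi⟩ : ∃ i, i + (n + 1) = r := ⟨r - (n + 1), by omega⟩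
      rw [lambda_inr E F h i r hi, lambda_inr E' F' h i r hi, spliceMap_inr, tproj_map,
        tensorTopR_natural]

lemma rho_natural {E E' : HopfExt k H (m + 1)} {F F' : HopfExt k H n} (φ : E ⟶ E') (ψ : F ⟶ F')
    (s : ℕ) (hs : s = (m + 1) * n) (h : m + 1 + n = N) (h' : n + (m + 1) = N) :
    tensorExtMap φ ψ h ≫ rho E' F' s hs h h' =
      rho E F s hs h h' ≫ twistMap s (spliceMap φ ψ h') :=
  hom_ext' fun r => HopfBimod.hom_ext fun x => by
    rw [comp_f, comp_f, lin_comp, lin_comp]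
    rcases Nat.lt_or_ge r (m + 1) with hr | hr
    · refine (rho_inl E' F' s hs h h' r hr _).trans ?_
      refine Eq.trans ?_ (congrArg (lin ((spliceMap φ ψ h').f r))
        (rho_inl E F s hs h h' r hr x)).symm
      rw [spliceMap_inl, tproj_map, tensorAugR_natural, map_smul (lin (φ.f r))]
    · obtain ⟨i, hi⟩ : ∃ i, i + (m + 1) = r := ⟨r - (m + 1), by omega⟩
      refine (rho_inr E' F' s hs h h' i r hi _).trans ?_
      refine Eq.trans ?_ (congrArg (lin ((spliceMap φ ψ h').f r))
        (rho_inr E F s hs h h' i r hi x)).symm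
      rw [spliceMap_inr, tproj_map, tensorTopL_natural, map_smul (lin (ψ.f i))]

end Natural

/-! ### The loop bracket and its antisymmetry -/

section Bracket

variable {m n N : ℕ}

/-- The path `(-1)^s E # F ← E ⊗ F → F # E`, where `s = deg E * deg F`. -/
def swapPath (E : HopfExt k H (m + 1)) (F : HopfExt k H (n + 1)) (s : ℕ)
    (hs : s = (m + 1) * (n + 1)) (h : m + 1 + (n + 1) = N) (h' : n + 1 + (m + 1) = N) :
    Path ((splice E F h').twist s) (splice F E h) :=
  inv (ofHom (rho E F s hs h h')) ≫ ofHom (lambda E F h)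

lemma swapPath_natural {E E' : HopfExt k H (m + 1)} {F F' : HopfExt k H (n + 1)} (φ : E ⟶ E')
    (ψ : F ⟶ F') (s : ℕ) (hs : s = (m + 1) * (n + 1)) (h : m + 1 + (n + 1) = N)
    (h' : n + 1 + (m + 1) = N) :
    swapPath E F s hs h h' ≫ ofHom (spliceMap ψ φ h) =
      twistPath s (ofHom (spliceMap φ ψ h')) ≫ swapPath E' F' s hs h h' := by
  have h1 := congrArg ofHom (rho_natural φ ψ s hs h h')
  rw [ofHom_comp, ofHom_comp, ← IsIso.eq_comp_inv, Category.assoc, ← IsIso.inv_comp_eq] at h1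
  have h2 := congrArg ofHom (lambda_natural φ ψ h)
  rw [ofHom_comp, ofHom_comp] at h2
  rw [swapPath, swapPath, twistPath_ofHom, Category.assoc, ← h2, ← Category.assoc, h1,
    Category.assoc]

/-- The loop of `E` and `F` is made of the two swap paths, up to the identification of
`(-1)^s (-1)^s (E # F)` with `E # F`. -/
lemma loop_eq (E : HopfExt k H (m + 1)) (F : HopfExt k H (n + 1)) (h : m + n + 1 = N) (s : ℕ)
    (hs : s = (m + 1) * (n + 1)) (hs' : s = (n + 1) * (m + 1)) (h1 : m + 1 + (n + 1) = N + 1)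
    (h2 : n + 1 + (m + 1) = N + 1) :
    loop E F h = inv (ofHom (twistTwist (splice E F h2) s)) ≫
      twistPath s (swapPath E F s hs h1 h2) ≫ swapPath F E s hs' h2 h1 := by
  subst hs
  have e : inv (ofHom (twistMap _ (rho E F _ rfl h1 h2) ≫ twistTwist (splice E F h2) _)) =
      inv (ofHom (twistTwist (splice E F h2) _)) ≫ inv (ofHom (twistMap _ (rho E F _ rfl h1 h2))) :=
    IsIso.inv_eq_of_hom_inv_id (by rw [ofHom_comp]; simp)
  rw [swapPath, swapPath, twistPath_comp, twistPath_inv, twistPath_ofHom, twistPath_ofHom,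
    Category.assoc, ← Category.assoc (inv (ofHom (twistTwist _ _))), ← e, ← Groupoid.inv_eq_inv,
    ← Groupoid.inv_eq_inv]
  rfl

/-- The identities `(-1)^s (-1)^s X → X`, as a natural transformation. -/
def twistTwistNat (n s : ℕ) :
    twistFunctor (k := k) (H := H) n s ⋙ twistFunctor n s ⟶ 𝟭 (HopfExt k H n) where
  app X := twistTwist X s
  naturality _ _ _ := hom_ext' fun _ => (Category.comp_id _).trans (Category.id_comp _).symm

lemma twistTwist_natural (s : ℕ) {X Y : HopfExt k H N} (p : Path X Y) :
    twistPath s (twistPath s p) ≫ ofHom (twistTwist Y s) = ofHom (twistTwist X s) ≫ p := by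
  refine (congrArg (· ≫ _) (pmap_comp_functor _ _ p).symm).trans
    ((pmap_natural (twistTwistNat N s) p).trans ?_)
  exact congrArg _ (pmap_id_functor p)

lemma loop_natural {E E' : HopfExt k H (m + 1)} {F F' : HopfExt k H (n + 1)} (φ : E ⟶ E')
    (ψ : F ⟶ F') (h : m + n + 1 = N) (h2 : n + 1 + (m + 1) = N + 1) :
    loop E F h ≫ ofHom (spliceMap φ ψ h2) = ofHom (spliceMap φ ψ h2) ≫ loop E' F' h := by
  have h1 : m + 1 + (n + 1) = N + 1 := by omega
  rw [loop_eq E F h _ rfl (Nat.mul_comm _ _) h1 h2, loop_eq E' F' h _ rfl (Nat.mul_comm _ _) h1 h2]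
  rw [Category.assoc, Category.assoc, swapPath_natural, ← Category.assoc (twistPath _ _),
    ← twistPath_comp, swapPath_natural, twistPath_comp, Category.assoc, IsIso.inv_comp_eq,
    ← Category.assoc (ofHom (twistTwist _ _)), ← twistTwist_natural]
  simp only [Category.assoc, IsIso.hom_inv_id_assoc]

variable (m n N) in
/-- The loop bracket of two extensions. -/
def bracket₀ (h : m + n + 1 = N) (E : HopfExt k H (m + 1)) (F : HopfExt k H (n + 1)) : Pi1 k H N :=
  ofLoop (loop E F h)

lemma bracket₀_self (h : m + n + 1 = N) (E : HopfExt k H (m + 1)) (F : HopfExt k H (n + 1)) :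
    (bracket₀ m n N h E F).1 _ = loop E F h := ofLoop_self _

lemma bracket₀_congr (h : m + n + 1 = N) {E E' : HopfExt k H (m + 1)} {F F' : HopfExt k H (n + 1)}
    (φ : E ⟶ E') (ψ : F ⟶ F') : bracket₀ m n N h E F = bracket₀ m n N h E' F' :=
  Pi1.ext_path (ofHom (spliceMap φ ψ (by omega))) (by
    rw [bracket₀_self, bracket₀_self]
    exact loop_natural φ ψ h (by omega))

/-- The bracket only depends on the connected components of its arguments. -/
lemma bracket₀_zigzag (h : m + n + 1 = N) {E E' : HopfExt k H (m + 1)} {F F' : HopfExt k H (n + 1)}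
    (hE : Zigzag E E') (hF : Zigzag F F') : bracket₀ m n N h E F = bracket₀ m n N h E' F' := by
  have h1 : bracket₀ m n N h E F = bracket₀ m n N h E' F := by
    induction hE with
    | refl => rfl
    | tail _ hz ih =>
      rcases hz with ⟨⟨φ⟩⟩ | ⟨⟨φ⟩⟩
      · exact ih.trans (bracket₀_congr h φ (𝟙 F))
      · exact ih.trans (bracket₀_congr h φ (𝟙 F)).symm
  refine h1.trans ?_
  induction hF with
  | refl => rfl
  | tail _ hz ih =>
    rcases hz with ⟨⟨φ⟩⟩ | ⟨⟨φ⟩⟩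
    · exact ih.trans (bracket₀_congr h (𝟙 E') φ)
    · exact ih.trans (bracket₀_congr h (𝟙 E') φ).symm

/-- The loop bracket. -/
def bracket (m n N : ℕ) (h : m + n + 1 = N) (a : Pi0 k H (m + 1)) (b : Pi0 k H (n + 1)) :
    Pi1 k H N :=
  Quotient.liftOn₂ a b (bracket₀ m n N h) fun _ _ _ _ hE hF => bracket₀_zigzag h hE hF

lemma isLoopBracket_bracket : IsLoopBracket (k := k) (H := H) bracket :=
  fun _ _ _ h E F => bracket₀_self h E F

lemma bracket₀_antisymm (h : m + n + 1 = N) (h' : n + m + 1 = N) (E : HopfExt k H (m + 1))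
    (F : HopfExt k H (n + 1)) :
    bracket₀ m n N h E F = bracket₀ n m N h' F E ^ ((-1 : ℤ) ^ ((m + 1) * (n + 1))) := by
  obtain ⟨s, hs⟩ : ∃ s, s = (m + 1) * (n + 1) := ⟨_, rfl⟩
  have hs' : s = (n + 1) * (m + 1) := by rw [hs, Nat.mul_comm]
  have h1 : m + 1 + (n + 1) = N + 1 := by omega
  have h2 : n + 1 + (m + 1) = N + 1 := by omega
  -- `(-1)^s` applied to the loop of `E` and `F` is conjugate to the loop of `F` and `E`
  have key : twistPath s (loop E F h) ≫ swapPath E F s hs h1 h2 =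
      swapPath E F s hs h1 h2 ≫ loop F E h' := by
    rw [loop_eq E F h s hs hs' h1 h2, loop_eq F E h' s hs' hs h2 h1, twistPath_comp,
      twistPath_comp, twistPath_inv]
    have e : twistPath s (ofHom (twistTwist (splice E F h2) s)) =
      ofHom (twistTwist ((splice E F h2).twist s) s) := rfl
    rw [e, Category.assoc, Category.assoc, IsIso.inv_comp_eq]
    have := twistTwist_natural s (swapPath E F s hs h1 h2)
    rw [← IsIso.eq_comp_inv] at this
    rw [← Category.assoc, this]
    simp only [Category.assoc]
  rw [← bracket₀_self h E F, ← bracket₀_self h' F E] at key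
  rw [← hs]
  rcases Nat.even_or_odd s with he | ho
  · rw [Pi1.twist_even _ he.neg_one_pow] at key
    rw [he.neg_one_pow, zpow_one]
    exact Pi1.ext_path _ key
  · rw [Pi1.twist_odd _ ho.neg_one_pow] at key
    rw [ho.neg_one_pow, zpow_neg_one, ← Pi1.ext_path _ key, inv_inv]

end Bracket

/-! ### Yoneda products and Baer sums -/

section SpliceBaer

variable {m n N : ℕ}

section Projections

variable (E : HopfExt k H (m + 1)) (G : HopfExt k H n) (h : n + (m + 1) = N)

/-- The morphism of complexes `E # G → E` which is the identity in degrees at most `m`, is induced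
by the augmentation of `G` in degree `m + 1`, and vanishes above. -/
def spliceFst (j : ℕ) : (splice E G h).X j ⟶ E.X j :=
  spliceDesc (m + 1) E.X G.X E.X (fun _ _ => 𝟙 _) (fun i j _ => G.augAt i ≫ E.topAt j) j

/-- The projection of `E # G` to a term of `G`. -/
def spliceSnd (i j : ℕ) (hj : i + (m + 1) = j) : (splice E G h).X j ⟶ G.X i :=
  HopfBimod.inv (inr E G h i j hj) (spliceInr_bijective _ _ _ _ _ hj)

variable {E G h}

@[simp] lemma spliceFst_inl (j : ℕ) (hj : j < m + 1) (x : E.X j) :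
    lin (spliceFst E G h j) (lin (inl E G h j hj) x) = x :=
  spliceDesc_inl _ _ _ _ _ _ _ _ _

lemma spliceFst_inr (i j : ℕ) (hj : i + (m + 1) = j) (y : G.X i) :
    lin (spliceFst E G h j) (lin (inr E G h i j hj) y) = lin (E.topAt j) (lin (G.augAt i) y) :=
  spliceDesc_inr _ _ _ _ _ _ _ _ _ _

@[simp] lemma spliceSnd_inr (i j : ℕ) (hj : i + (m + 1) = j) (y : G.X i) :
    lin (spliceSnd E G h i j hj) (lin (inr E G h i j hj) y) = y := inv_lin _ _ _

lemma inr_surjective (i j : ℕ) (hj : i + (m + 1) = j) :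
    Function.Surjective (lin (inr E G h i j hj)) := (spliceInr_bijective _ _ _ _ _ hj).2

lemma spliceFst_d (j : ℕ) (z : (splice E G h).X (j + 1)) :
    lin (spliceFst E G h j) (lin ((splice E G h).d j) z) =
      lin (E.d j) (lin (spliceFst E G h (j + 1)) z) := by
  rcases splice_cases E G h (j + 1) z with ⟨hj, x, rfl⟩ | ⟨i, hj, y, rfl⟩
  · rw [splice_d_inl, spliceFst_inl, spliceFst_inl]
  · rcases i with _ | i
    · obtain rfl : m = j := by omega
      rw [splice_d_inr_zero, spliceFst_inl, spliceFst_inr, topAt_self, augAt_zero]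
    · rw [splice_d_inr_succ, spliceFst_inr, spliceFst_inr, augAt_d, map_zero, augAt_succ, map_zero,
        map_zero]

lemma spliceSnd_d (i j : ℕ) (hj : i + 1 + (m + 1) = j + 1) (z : (splice E G h).X (j + 1)) :
    lin (spliceSnd E G h i j (by omega)) (lin ((splice E G h).d j) z) =
      lin (G.d i) (lin (spliceSnd E G h (i + 1) (j + 1) hj) z) := by
  obtain ⟨y, rfl⟩ := inr_surjective (i + 1) (j + 1) hj z
  rw [splice_d_inr_succ, spliceSnd_inr, spliceSnd_inr]

lemma spliceFst_augAt (j : ℕ) (z : (splice E G h).X j) :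
    lin (E.augAt j) (lin (spliceFst E G h j) z) = lin ((splice E G h).augAt j) z := by
  cases j <;> rfl

lemma augAt_inl (j : ℕ) (hj : j < m + 1) (x : E.X j) :
    lin ((splice E G h).augAt j) (lin (inl E G h j hj) x) = lin (E.augAt j) x := by
  cases j <;> rfl

lemma augAt_inr (i j : ℕ) (hj : i + (m + 1) = j) (y : G.X i) :
    lin ((splice E G h).augAt j) (lin (inr E G h i j hj) y) = 0 := by
  subst hj
  rfl

lemma spliceFst_top (hj : 0 + (m + 1) = m + 1) (z : (splice E G h).X (m + 1)) :
    lin (spliceFst E G h (m + 1)) z = lin E.top (lin G.aug (lin (spliceSnd E G h 0 (m + 1) hj) z)) := by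
  obtain ⟨y, rfl⟩ := inr_surjective 0 (m + 1) hj z
  rw [spliceFst_inr, spliceSnd_inr, topAt_self, augAt_zero]

lemma splice_topAt (i j : ℕ) (hj : i + (m + 1) = j) (x : unit k H) :
    lin ((splice E G h).topAt j) x = lin (inr E G h i j hj) (lin (G.topAt i) x) := by
  by_cases hi : n = i
  · subst hi
    obtain rfl : N = j := by omega
    rw [topAt_self, topAt_self, splice_top]
  · have : N ≠ j := by omega
    rw [topAt_of_ne _ hi, topAt_of_ne _ this, lin_zero, lin_zero, map_zero]

lemma splice_baerTop (i j : ℕ) (hj : i + (m + 1) = j) (x : unit k H) :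
    lin ((splice E G h).baerTop j) x = lin (inr E G h i j hj) (lin (G.baerTop i) x) := by
  rw [baerTop, baerTop, lin_add, lin_add, lin_comp, lin_comp, splice_topAt i j hj,
    splice_topAt (i + 1) (j + 1) (by omega), splice_d_inr_succ, map_add]

end Projections

variable {E F : HopfExt k H (m + 1)} {G : HopfExt k H (n + 1)} {h : n + 1 + (m + 1) = N + 1}

lemma splice_baerTop_of_lt (j : ℕ) (hj : j < m + 1) (x : unit k H) :
    lin ((splice E G h).baerTop j) x = 0 := by
  rw [baerTop, topAt_of_ne _ (by omega), topAt_of_ne _ (by omega)]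
  simp

lemma spliceFst_baerTop (j : ℕ) (x : unit k H) :
    lin (spliceFst E G h j) (lin ((splice E G h).baerTop j) x) = 0 := by
  rcases Nat.lt_or_ge j (m + 1) with hj | hj
  · rw [splice_baerTop_of_lt j hj, map_zero]
  · obtain ⟨i, hi⟩ : ∃ i, i + (m + 1) = j := ⟨j - (m + 1), by omega⟩
    rw [splice_baerTop i j hi, spliceFst_inr, augAt_baerTop, map_zero]

lemma spliceSnd_baerTop (i j : ℕ) (hj : i + (m + 1) = j) (x : unit k H) :
    lin (spliceSnd E G h i j hj) (lin ((splice E G h).baerTop j) x) = lin (G.baerTop i) x := by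
  rw [splice_baerTop i j hj, spliceSnd_inr]

section SumLeft

variable (E F G h)

/-- The map `(u, v) ↦ (u, v)` on the components in `E` and `F`. -/
def sumFst (j : ℕ) : fib (splice E G h) (splice F G h) j ⟶ fib E F j :=
  fibLift (fibFst _ _ j ≫ spliceFst E G h j) (fibSnd _ _ j ≫ spliceFst F G h j) (fun z => by
    rw [lin_comp, lin_comp, spliceFst_augAt, spliceFst_augAt, fib_aug])

/-- The map `(u, v) ↦ u + v` on the components in `G`. -/
def sumSnd (i j : ℕ) (hj : i + (m + 1) = j) : fib (splice E G h) (splice F G h) j ⟶ G.X i :=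
  fibFst _ _ j ≫ spliceSnd E G h i j hj + fibSnd _ _ j ≫ spliceSnd F G h i j hj

/-- The map which induces `sumLeft`. -/
def sumAux (j : ℕ) : fib (splice E G h) (splice F G h) j ⟶ (splice (baer E F) G h).X j :=
  spliceLift (m + 1) (baer E F).X G.X (fib (splice E G h) (splice F G h))
    (fun j => sumFst E F G h j ≫ fibMk E F j) (fun i j hj => sumSnd E F G h i j hj) j

variable {E F G h}

@[simp] lemma fibFst_sumFst (j : ℕ) (z : fib (splice E G h) (splice F G h) j) :
    lin (fibFst E F j) (lin (sumFst E F G h j) z) =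
      lin (spliceFst E G h j) (lin (fibFst _ _ j) z) := fibFst_fibLift _ _ _ _

@[simp] lemma fibSnd_sumFst (j : ℕ) (z : fib (splice E G h) (splice F G h) j) :
    lin (fibSnd E F j) (lin (sumFst E F G h j) z) =
      lin (spliceFst F G h j) (lin (fibSnd _ _ j) z) := fibSnd_fibLift _ _ _ _

lemma sumSnd_apply (i j : ℕ) (hj : i + (m + 1) = j) (z : fib (splice E G h) (splice F G h) j) :
    lin (sumSnd E F G h i j hj) z = lin (spliceSnd E G h i j hj) (lin (fibFst _ _ j) z) +
      lin (spliceSnd F G h i j hj) (lin (fibSnd _ _ j) z) := rfl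

lemma sumAux_inl (j : ℕ) (hj : j < m + 1) (z : fib (splice E G h) (splice F G h) j) :
    lin (sumAux E F G h j) z =
      lin (inl (baer E F) G h j hj) (lin (fibMk E F j) (lin (sumFst E F G h j) z)) :=
  spliceLift_inl _ _ _ _ _ _ _ hj z

lemma sumAux_inr (i j : ℕ) (hj : i + (m + 1) = j) (z : fib (splice E G h) (splice F G h) j) :
    lin (sumAux E F G h j) z = lin (inr (baer E F) G h i j hj) (lin (sumSnd E F G h i j hj) z) :=
  spliceLift_inr_apply _ _ _ _ _ _ _ _ hj z

lemma sumFst_d (j : ℕ) (z : fib (splice E G h) (splice F G h) (j + 1)) :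
    lin (sumFst E F G h j) (lin (fibD _ _ j) z) =
      lin (fibD E F j) (lin (sumFst E F G h (j + 1)) z) :=
  fib_ext (by simp [spliceFst_d]) (by simp [spliceFst_d])

/-- The only degree that needs an argument is `m + 1`, where `sumFst` and `sumSnd` are compared by
moving the component in the last term of `F` to that of `E`. -/
lemma sumAux_comm (j : ℕ) (z : fib (splice E G h) (splice F G h) (j + 1)) :
    lin (sumAux E F G h j) (lin (fibD _ _ j) z) =
      lin ((splice (baer E F) G h).d j) (lin (sumAux E F G h (j + 1)) z) := by
  have key := spliceLift_comm m (baer E F).X G.X (fib (splice E G h) (splice F G h)) (baer E F).d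
    G.d (G.aug ≫ (baer E F).top ≫ (baer E F).d m) (fibD (splice E G h) (splice F G h))
    (fun j => sumFst E F G h j ≫ fibMk E F j) (fun i j hj => sumSnd E F G h i j hj)
    (fun i => HopfBimod.hom_ext fun z => by
      simp only [lin_comp, sumFst_d, baer_d_fibMk])
    (fun i j hj => HopfBimod.hom_ext fun z => by
      have hj' : i + 1 + (m + 1) = j + 1 := by omega
      simp only [lin_comp, sumSnd_apply, fibFst_fibD, fibSnd_fibD]
      rw [spliceSnd_d i j hj', spliceSnd_d i j hj', map_add])
    (HopfBimod.hom_ext fun z => by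
      rw [lin_comp, lin_comp, lin_comp, lin_comp, lin_comp, sumFst_d, ← baer_d_fibMk]
      congr 1
      have h0 : 0 + (m + 1) = m + 1 := by omega
      obtain ⟨w, hw1, hw2⟩ := exists_fib (X := E) (Y := F) (i := m + 1)
        (lin E.top (lin G.aug (lin (sumSnd E F G h 0 (m + 1) h0) z))) 0 rfl
      rw [baer_top _ w hw1 hw2]
      refine fibMk_eq (-lin G.aug (lin (spliceSnd F G h 0 (m + 1) h0) (lin (fibSnd _ _ _) z))) ?_ ?_
      · rw [fibFst_sumFst, spliceFst_top h0, hw1, sumSnd_apply, map_add, baerTop_self, map_add,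
          map_neg]
        abel
      · rw [fibSnd_sumFst, spliceFst_top h0, hw2, baerTop_self, map_neg]
        abel)
  exact congrArg (fun φ => lin φ z) (key j)

variable (E F G h) in
/-- The morphism `E # G + F # G → (E + F) # G`. -/
def sumLeft : baer (splice E G h) (splice F G h) ⟶ splice (baer E F) G h :=
  baerDesc (sumAux E F G h)
    (fun j z x h1 h2 => by
      rcases Nat.lt_or_ge j (m + 1) with hj | hj
      · rw [sumAux_inl j hj, fib_ext (z := lin (sumFst E F G h j) z) (w := 0), map_zero, map_zero]
        · rw [fibFst_sumFst, h1, spliceFst_baerTop, map_zero]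
        · rw [fibSnd_sumFst, h2, map_neg, spliceFst_baerTop, map_zero, neg_zero]
      · obtain ⟨i, hi⟩ : ∃ i, i + (m + 1) = j := ⟨j - (m + 1), by omega⟩
        rw [sumAux_inr i j hi, sumSnd_apply, h1, h2, map_neg, spliceSnd_baerTop,
          spliceSnd_baerTop, add_neg_cancel, map_zero])
    sumAux_comm
    (fun z x h1 h2 => by
      rw [sumAux_inr (n + 1) (N + 1) h, sumSnd_apply, h1, h2, map_zero, add_zero, splice_top,
        spliceSnd_inr, splice_top])
    (fun z => by
      change lin ((splice (baer E F) G h).augAt 0) _ = lin ((splice E G h).augAt 0) _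
      rw [sumAux_inl 0 (Nat.succ_pos m), augAt_inl, baer_augAt_fibMk, fibFst_sumFst,
        spliceFst_augAt])

lemma sumLeft_inl (j : ℕ) (hj : j < m + 1) (z : fib (splice E G h) (splice F G h) j) :
    lin ((sumLeft E F G h).f j) (lin (fibMk _ _ j) z) =
      lin (inl (baer E F) G h j hj) (lin (fibMk E F j) (lin (sumFst E F G h j) z)) :=
  (baerDesc_f _ _ _ _ _ _ _).trans (sumAux_inl j hj z)

lemma sumLeft_inr (i j : ℕ) (hj : i + (m + 1) = j) (z : fib (splice E G h) (splice F G h) j) :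
    lin ((sumLeft E F G h).f j) (lin (fibMk _ _ j) z) =
      lin (inr (baer E F) G h i j hj) (lin (sumSnd E F G h i j hj) z) :=
  (baerDesc_f _ _ _ _ _ _ _).trans (sumAux_inr i j hj z)

end SumLeft

section SumRight

variable {h' : m + 1 + (n + 1) = N + 1}

variable (E F G h') in
/-- The diagonal map `g ↦ (g, g)` on the terms of `G`. -/
def diagInl (i : ℕ) (hi : i < n + 1) : G.X i ⟶ fib (splice G E h') (splice G F h') i :=
  fibLift (inl G E h' i hi) (inl G F h' i hi) (fun x => by rw [augAt_inl, augAt_inl])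

variable (E F G h') in
/-- The map `(x, y) ↦ (x, y)` on the terms of `E` and `F`. -/
def diagInr (i j : ℕ) (hj : i + (n + 1) = j) : fib E F i ⟶ fib (splice G E h') (splice G F h') j :=
  fibLift (fibFst E F i ≫ inr G E h' i j hj) (fibSnd E F i ≫ inr G F h' i j hj) (fun x => by
    rw [lin_comp, lin_comp, augAt_inr, augAt_inr])

@[simp] lemma fibFst_diagInl (i : ℕ) (hi : i < n + 1) (x : G.X i) :
    lin (fibFst _ _ i) (lin (diagInl E F G h' i hi) x) = lin (inl G E h' i hi) x :=
  fibFst_fibLift _ _ _ _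

@[simp] lemma fibSnd_diagInl (i : ℕ) (hi : i < n + 1) (x : G.X i) :
    lin (fibSnd _ _ i) (lin (diagInl E F G h' i hi) x) = lin (inl G F h' i hi) x :=
  fibSnd_fibLift _ _ _ _

@[simp] lemma fibFst_diagInr (i j : ℕ) (hj : i + (n + 1) = j) (z : fib E F i) :
    lin (fibFst _ _ j) (lin (diagInr E F G h' i j hj) z) =
      lin (inr G E h' i j hj) (lin (fibFst E F i) z) := fibFst_fibLift _ _ _ _

@[simp] lemma fibSnd_diagInr (i j : ℕ) (hj : i + (n + 1) = j) (z : fib E F i) :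
    lin (fibSnd _ _ j) (lin (diagInr E F G h' i j hj) z) =
      lin (inr G F h' i j hj) (lin (fibSnd E F i) z) := fibSnd_fibLift _ _ _ _

variable (E F G h') in
/-- The map on Baer sums induced by `diagInr`. -/
def diagInrMk (i j : ℕ) (hj : i + (n + 1) = j) :
    (baer E F).X i ⟶ (baer (splice G E h') (splice G F h')).X j :=
  surjDesc (fibMk E F i) (fibMk_surjective i) (diagInr E F G h' i j hj ≫ fibMk _ _ j) fun z hz => by
    obtain ⟨x, h1, h2⟩ := fibMk_eq_zero_iff.1 hz
    rw [lin_comp, fibMk_eq_zero_iff]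
    exact ⟨x, by rw [fibFst_diagInr, h1, splice_baerTop i j hj],
      by rw [fibSnd_diagInr, h2, splice_baerTop i j hj, map_neg]⟩

lemma diagInrMk_fibMk (i j : ℕ) (hj : i + (n + 1) = j) (z : fib E F i) :
    lin (diagInrMk E F G h' i j hj) (lin (fibMk E F i) z) =
      lin (fibMk _ _ j) (lin (diagInr E F G h' i j hj) z) := surjDesc_apply _ _ _ _ _

variable (E F G h') in
/-- The morphism `G # (E + F) → G # E + G # F`. -/
def sumRight : splice G (baer E F) h' ⟶ baer (splice G E h') (splice G F h') :=
  spliceHom G (baer E F) h' (fun i hi => diagInl E F G h' i hi ≫ fibMk _ _ i)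
    (diagInrMk E F G h')
    (fun i hi x => by
      rw [lin_comp, lin_comp, baer_d_fibMk]
      congr 1
      exact fib_ext (by simp [splice_d_inl]) (by simp [splice_d_inl]))
    (fun i j hj y => by
      obtain ⟨z, rfl⟩ := fibMk_surjective (i + 1) y
      rw [baer_d_fibMk, diagInrMk_fibMk, diagInrMk_fibMk, baer_d_fibMk]
      congr 1
      exact fib_ext (by simp [splice_d_inr_succ]) (by simp [splice_d_inr_succ]))
    (fun y => by
      obtain ⟨z, rfl⟩ := fibMk_surjective 0 y
      have h1 : lin (baer E F).aug (lin (fibMk E F 0) z) = lin E.aug (lin (fibFst E F 0) z) := rfl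
      have h2 : lin E.aug (lin (fibFst E F 0) z) = lin F.aug (lin (fibSnd E F 0) z) := fib_aug z
      rw [diagInrMk_fibMk, baer_d_fibMk, lin_comp]
      congr 1
      refine fib_ext ?_ ?_
      · rw [fibFst_diagInl, fibFst_fibD, fibFst_diagInr, splice_d_inr_zero, h1]
      · rw [fibSnd_diagInl, fibSnd_fibD, fibSnd_diagInr, splice_d_inr_zero, h1, h2])
    (fun x => by
      obtain ⟨z, h1, h2⟩ := exists_fib (X := E) (Y := F) (i := m + 1) (lin E.top x) 0 rfl
      rw [baer_top x z h1 h2, diagInrMk_fibMk]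
      refine (baer_top x _ ?_ ?_).symm
      · rw [fibFst_diagInr, h1, splice_top]
      · rw [fibSnd_diagInr, h2, map_zero])
    (fun x => by
      change lin ((baer (splice G E h') (splice G F h')).augAt 0) _ = lin (G.augAt 0) x
      rw [lin_comp, baer_augAt_fibMk, fibFst_diagInl, augAt_inl])

lemma sumRight_inl (i : ℕ) (hi : i < n + 1) (x : G.X i) :
    lin ((sumRight E F G h').f i) (lin (inl G (baer E F) h' i hi) x) =
      lin (fibMk _ _ i) (lin (diagInl E F G h' i hi) x) := spliceHom_inl _ _ _ _ _ _ _ _ _ _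

lemma sumRight_inr (i j : ℕ) (hj : i + (n + 1) = j) (z : fib E F i) :
    lin ((sumRight E F G h').f j) (lin (inr G (baer E F) h' i j hj) (lin (fibMk E F i) z)) =
      lin (fibMk _ _ j) (lin (diagInr E F G h' i j hj) z) :=
  (spliceHom_inr _ _ _ _ _ _ _ _ _ _ _).trans (diagInrMk_fibMk i j hj z)

end SumRight

end SpliceBaer

section TwistBaer

variable {N : ℕ} (X Y : HopfExt k H (N + 1)) (s : ℕ)

/-- The first component of a pair of elements of `(-1)^s X` and `(-1)^s Y`, as an element of `X`. -/
def twistFst (i : ℕ) : fib (X.twist s) (Y.twist s) i ⟶ X.X i := fibFst (X.twist s) (Y.twist s) i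

/-- The second component of a pair of elements of `(-1)^s X` and `(-1)^s Y`, as an element
of `Y`. -/
def twistSnd (i : ℕ) : fib (X.twist s) (Y.twist s) i ⟶ Y.X i := fibSnd (X.twist s) (Y.twist s) i

/-- The identity on pairs of equal augmentation. -/
def twistFib (i : ℕ) : fib (X.twist s) (Y.twist s) i ⟶ fib X Y i :=
  fibLift (twistFst X Y s i) (twistSnd X Y s i) (fun z => by
    have h : (-1 : k) ^ s • lin (X.augAt i) (lin (twistFst X Y s i) z) =
        (-1 : k) ^ s • lin (Y.augAt i) (lin (twistSnd X Y s i) z) :=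
      (twist_augAt X s i _).symm.trans ((fib_aug z).trans (twist_augAt Y s i _))
    have h1 := congrArg (fun x => (-1 : k) ^ s • x) h
    simpa only [smul_smul, neg_one_pow_sq, one_smul] using h1)

variable {X Y s}

@[simp] lemma fibFst_twistFib (i : ℕ) (z : fib (X.twist s) (Y.twist s) i) :
    lin (fibFst X Y i) (lin (twistFib X Y s i) z) = lin (twistFst X Y s i) z :=
  fibFst_fibLift _ _ _ _

@[simp] lemma fibSnd_twistFib (i : ℕ) (z : fib (X.twist s) (Y.twist s) i) :
    lin (fibSnd X Y i) (lin (twistFib X Y s i) z) = lin (twistSnd X Y s i) z :=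
  fibSnd_fibLift _ _ _ _

variable (X Y s) in
/-- The isomorphism `(-1)^s X + (-1)^s Y → (-1)^s (X + Y)` given by the identity on pairs. -/
def twistBaer : baer (X.twist s) (Y.twist s) ⟶ (baer X Y).twist s :=
  baerDesc (F := (baer X Y).twist s) (fun i => twistFib X Y s i ≫ fibMk X Y i)
    (fun i z h h1 h2 => fibMk_eq_zero_iff.2 ⟨h, (fibFst_twistFib i z).trans h1,
      (fibSnd_twistFib i z).trans h2⟩)
    (fun i z => by
      refine Eq.trans ?_ (baer_d_fibMk i (lin (twistFib X Y s (i + 1)) z)).symm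
      refine congrArg (lin (fibMk X Y i)) (fib_ext ?_ ?_)
      · rw [fibFst_fibD, fibFst_twistFib]
        exact (fibFst_twistFib i _).trans (fibFst_fibD (X := X.twist s) (Y := Y.twist s) i z)
      · rw [fibSnd_fibD, fibSnd_twistFib]
        exact (fibSnd_twistFib i _).trans (fibSnd_fibD (X := X.twist s) (Y := Y.twist s) i z))
    (fun z h h1 h2 => (baer_top h _ ((fibFst_twistFib _ z).trans h1)
      ((fibSnd_twistFib _ z).trans h2)).symm)
    (fun z => congrArg (fun x => (-1 : k) ^ s • lin X.aug x) (fibFst_twistFib 0 z))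

lemma twistBaer_f (i : ℕ) (z : fib (X.twist s) (Y.twist s) i) :
    lin ((twistBaer X Y s).f i) (lin (fibMk _ _ i) z) =
      lin (fibMk X Y i) (lin (twistFib X Y s i) z) := baerDesc_f _ _ _ _ _ _ _

lemma twistBaer_natural {X' Y' : HopfExt k H (N + 1)} (φ : X ⟶ X') (ψ : Y ⟶ Y') :
    baerMap (twistMap s φ) (twistMap s ψ) ≫ twistBaer X' Y' s =
      twistBaer X Y s ≫ twistMap s (baerMap φ ψ) :=
  baer_hom_ext fun i z => by
    rw [comp_f, comp_f, lin_comp, lin_comp, baerMap_f, twistBaer_f, twistBaer_f]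
    refine Eq.trans ?_ (baerMap_f φ ψ i (lin (twistFib X Y s i) z)).symm
    refine congrArg (lin (fibMk X' Y' i)) (fib_ext ?_ ?_)
    · rw [fibFst_twistFib, fibFst_fibMap, fibFst_twistFib]
      exact fibFst_fibMap (twistMap s φ) (twistMap s ψ) i z
    · rw [fibSnd_twistFib, fibSnd_fibMap, fibSnd_twistFib]
      exact fibSnd_fibMap (twistMap s φ) (twistMap s ψ) i z

lemma twistBaer_twistTwist :
    twistBaer (X.twist s) (Y.twist s) s ≫ twistMap s (twistBaer X Y s) ≫ twistTwist (baer X Y) s =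
      baerMap (twistTwist X s) (twistTwist Y s) :=
  baer_hom_ext fun i z => by
    rw [baerMap_f]
    refine (congrArg (lin ((twistBaer X Y s).f i))
      (twistBaer_f (X := X.twist s) (Y := Y.twist s) i z)).trans ?_
    refine (twistBaer_f i _).trans (congrArg (lin (fibMk X Y i)) (fib_ext ?_ ?_))
    · rw [fibFst_twistFib, fibFst_fibMap]
      exact fibFst_twistFib (X := X.twist s) (Y := Y.twist s) i z
    · rw [fibSnd_twistFib, fibSnd_fibMap]
      exact fibSnd_twistFib (X := X.twist s) (Y := Y.twist s) i z

variable (Y s) in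
/-- Naturality of `twistBaer` in the first summand. -/
def twistBaerNat : twistFunctor (N + 1) s ⋙ translate (Y.twist s) ⟶
    translate Y ⋙ twistFunctor (N + 1) s where
  app X := twistBaer X Y s
  naturality _ _ φ := twistBaer_natural φ (𝟙 Y)

lemma twistPath_addRight {X' : HopfExt k H (N + 1)} (p : Path X X') :
    addRight (twistPath s p) (Y.twist s) ≫ ofHom (twistBaer X' Y s) =
      ofHom (twistBaer X Y s) ≫ twistPath s (addRight p Y) :=
  (congrArg (· ≫ ofHom (twistBaer X' Y s)) (pmap_comp_functor _ _ p).symm).trans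
    ((pmap_natural (twistBaerNat Y s) p).trans
      (congrArg (ofHom (twistBaer X Y s) ≫ ·) (pmap_comp_functor _ _ p)))

variable (X s) in
/-- Naturality of `twistBaer` in the second summand. -/
def twistBaerNat' : twistFunctor (N + 1) s ⋙ leftTranslate (X.twist s) ⟶
    leftTranslate X ⋙ twistFunctor (N + 1) s where
  app Y := twistBaer X Y s
  naturality _ _ φ := twistBaer_natural (𝟙 X) φ

lemma twistPath_addLeft {Y' : HopfExt k H (N + 1)} (p : Path Y Y') :
    addLeft (X.twist s) (twistPath s p) ≫ ofHom (twistBaer X Y' s) =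
      ofHom (twistBaer X Y s) ≫ twistPath s (addLeft X p) :=
  (congrArg (· ≫ ofHom (twistBaer X Y' s)) (pmap_comp_functor _ _ p).symm).trans
    ((pmap_natural (twistBaerNat' X s) p).trans
      (congrArg (ofHom (twistBaer X Y s) ≫ ·) (pmap_comp_functor _ _ p)))

lemma twistPath_addPath {X' Y' : HopfExt k H (N + 1)} (p : Path X X') (q : Path Y Y') :
    addPath (twistPath s p) (twistPath s q) ≫ ofHom (twistBaer X' Y' s) =
      ofHom (twistBaer X Y s) ≫ twistPath s (addPath p q) := by
  rw [addPath, addPath, Category.assoc, twistPath_addLeft, ← Category.assoc, twistPath_addRight,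
    twistPath_comp, Category.assoc]

end TwistBaer

end HopfExt

/-! ### Tensor products of resolutions -/

namespace HopfBimod

section Coker

variable {A B : HopfBimod k H} (f : A ⟶ B)

/-- The cokernel of a morphism of Hopf bimodules. -/
def coker : HopfBimod k H :=
  homology f (0 : B ⟶ unit k H) (HopfBimod.hom_ext fun _ => rfl)

/-- The projection to the cokernel. -/
def cokerMk : B ⟶ coker f :=
  kerLift (0 : B ⟶ unit k H) (𝟙 B) (HopfBimod.hom_ext fun _ => rfl) ≫ homologyπ _ _ _

lemma cokerMk_surjective : Function.Surjective (lin (cokerMk f)) := fun z => by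
  obtain ⟨x, hx, rfl⟩ := HopfExt.cls_surjective z
  exact ⟨x, rfl⟩

variable {f}

lemma cokerMk_eq_zero_iff {x : B} : lin (cokerMk f) x = 0 ↔ ∃ a, lin f a = x :=
  (HopfExt.cls_eq_zero_iff (f := f) (g := (0 : B ⟶ unit k H)) (x := x)
    (hx := lin_zero (N := unit k H) x)).trans (exists_congr fun _ => eq_comm)

end Coker

end HopfBimod

namespace HopfExt

section TotD

variable {A B A' B' : ℕ → HopfBimod k H} (dA : ∀ i, A (i + 1) ⟶ A i) (dB : ∀ i, B (i + 1) ⟶ B i)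
  (dA' : ∀ i, A' (i + 1) ⟶ A' i) (dB' : ∀ i, B' (i + 1) ⟶ B' i)

/-- The differential `a ⊗ b ↦ d a ⊗ b + (-1)^|a| a ⊗ d b`. -/
def totD (r : ℕ) : totX A B (r + 1) ⟶ totX A B r :=
  HopfBimod.lift fun x =>
    totProj A B (x.1.1 + 1) x.1.2
        (by have := Finset.HasAntidiagonal.mem_antidiagonal.1 x.2; omega) ≫
        tensorMap (dA x.1.1) (𝟙 _) +
      (-1 : k) ^ x.1.1 • totProj A B x.1.1 (x.1.2 + 1)
        (by have := Finset.HasAntidiagonal.mem_antidiagonal.1 x.2; omega) ≫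
        tensorMap (𝟙 _) (dB x.1.2)

lemma totProj_d {r : ℕ} (s t : ℕ) (h : s + t = r) (x : totX A B (r + 1)) :
    lin (totProj A B s t h) (lin (totD dA dB r) x) =
      lin (tensorMap (dA s) (𝟙 _)) (lin (totProj A B (s + 1) t (by omega)) x) +
      (-1 : k) ^ s • lin (tensorMap (𝟙 _) (dB t)) (lin (totProj A B s (t + 1) (by omega)) x) :=
  lift_apply _ _ _ _

variable {dA dB dA' dB'}

lemma totMap_totD (f : ∀ i, A i ⟶ A' i) (g : ∀ i, B i ⟶ B' i)
    (hf : ∀ i, dA i ≫ f i = f (i + 1) ≫ dA' i) (hg : ∀ i, dB i ≫ g i = g (i + 1) ≫ dB' i) (r : ℕ)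
    (x : totX A B (r + 1)) :
    lin (totMap f g r) (lin (totD dA dB r) x) = lin (totD dA' dB' r) (lin (totMap f g (r + 1)) x) :=
  totX_ext fun s t h => by
    rw [totProj_totMap, totProj_d, totProj_d, totProj_totMap, totProj_totMap, map_add, map_smul,
      tensorMap_comp_apply, tensorMap_comp_apply, tensorMap_comp_apply, tensorMap_comp_apply, hf,
      hg]
    simp only [Category.id_comp, Category.comp_id]

end TotD

end HopfExt

variable (k H) in
/-- A resolution of `H` in Hopf bimodules: an exact sequence `⋯ → X 1 → X 0 → H → 0`. -/
structure HopfRes where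
  X : ℕ → HopfBimod k H
  d : ∀ i, X (i + 1) ⟶ X i
  aug : X 0 ⟶ unit k H
  aug_surjective : Function.Surjective (lin aug)
  exact_zero : Function.Exact (lin (d 0)) (lin aug)
  exact : ∀ i, Function.Exact (lin (d (i + 1))) (lin (d i))

namespace HopfRes

open HopfExt

/-- The resolution underlying an extension. -/
def ofExt {n : ℕ} (E : HopfExt k H n) : HopfRes k H where
  X := E.X
  d := E.d
  aug := E.aug
  aug_surjective := E.aug_surjective
  exact_zero := E.exact_zero
  exact := E.exact

variable (R S : HopfRes k H)

lemma aug_d (x : R.X 1) : lin R.aug (lin (R.d 0) x) = 0 := R.exact_zero.apply_apply_eq_zero x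

lemma d_d (i : ℕ) (x : R.X (i + 2)) : lin (R.d i) (lin (R.d (i + 1)) x) = 0 :=
  (R.exact i).apply_apply_eq_zero x

/-- The morphism `e ⊗ f ↦ e (p f)`. -/
def augR (s : ℕ) : tensor (R.X s) (S.X 0) ⟶ R.X s := tensorMap (𝟙 _) S.aug ≫ runit _

lemma augR_surjective (s : ℕ) : Function.Surjective (lin (augR R S s)) :=
  runit_bijective.2.comp (tensor_surjective _ S.aug_surjective)

lemma augR_exact (s : ℕ) :
    Function.Exact (lin (tensorMap (𝟙 (R.X s)) (S.d 0))) (lin (augR R S s)) := fun x => by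
  refine Iff.trans ?_ (tensor_exact _ S.exact_zero x)
  exact map_eq_zero_iff (lin (runit _)) runit_bijective.1

lemma augR_d (s : ℕ) (x : tensor (R.X (s + 1)) (S.X 0)) :
    lin (augR R S s) (lin (tensorMap (R.d s) (𝟙 _)) x) =
      lin (R.d s) (lin (augR R S (s + 1)) x) := by
  rw [augR, augR, lin_comp, lin_comp, tensorMap_comp_apply, ← runit_natural, tensorMap_comp_apply]
  simp only [Category.id_comp, Category.comp_id]

lemma tensorMap_d_d_left (s : ℕ) {M : HopfBimod k H} (x : tensor (R.X (s + 2)) M) :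
    lin (tensorMap (R.d s) (𝟙 M)) (lin (tensorMap (R.d (s + 1)) (𝟙 M)) x) = 0 := by
  have : R.d (s + 1) ≫ R.d s = 0 := HopfBimod.hom_ext (R.d_d s)
  rw [tensorMap_comp_apply, this, tensorMap_zero_left, lin_zero]

lemma tensorMap_d_d_right (t : ℕ) {M : HopfBimod k H} (x : tensor M (R.X (t + 2))) :
    lin (tensorMap (𝟙 M) (R.d t)) (lin (tensorMap (𝟙 M) (R.d (t + 1))) x) = 0 := by
  have : R.d (t + 1) ≫ R.d t = 0 := HopfBimod.hom_ext (R.d_d t)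
  rw [tensorMap_comp_apply, this, tensorMap_zero_right, lin_zero]

lemma tensorAug_apply (x : tensor (R.X 0) (S.X 0)) :
    lin (lunit _) (lin (tensorMap R.aug S.aug) x) = lin R.aug (lin (augR R S 0) x) :=
  congrArg (fun φ => lin φ x) (tensorHom_ext (f := tensorMap R.aug S.aug ≫ lunit _)
    (g := augR R S 0 ≫ R.aug) fun _ _ => ((isHom R.aug).ract _ _).symm)

/-- The tensor product of two resolutions of `H`. -/
def tensor : HopfRes k H where
  X := totX R.X S.X
  d := totD R.d S.d
  aug := totProj R.X S.X 0 0 rfl ≫ tensorMap R.aug S.aug ≫ lunit _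
  aug_surjective h := by
    obtain ⟨x, rfl⟩ := R.aug_surjective h
    obtain ⟨y, rfl⟩ := augR_surjective R S 0 x
    obtain ⟨z, hz⟩ := exists_totX (A := R.X) (B := S.X) (r := 0) fun s t _ =>
      if h : 0 = s ∧ 0 = t then h.1 ▸ h.2 ▸ y else 0
    refine ⟨z, ?_⟩
    rw [lin_comp, lin_comp, tensorAug_apply, hz]
    simp
  exact_zero x := by
    rw [lin_comp, lin_comp, tensorAug_apply]
    constructor
    · intro hx
      obtain ⟨y, hy⟩ := (R.exact_zero _).1 hx
      obtain ⟨c, rfl⟩ := augR_surjective R S 1 y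
      have h2 : lin (augR R S 0) (lin (totProj R.X S.X 0 0 rfl) x -
          lin (tensorMap (R.d 0) (𝟙 _)) c) = 0 := by
        rw [map_sub, augR_d, hy, sub_self]
      obtain ⟨b, hb⟩ := (augR_exact R S 0 _).1 h2
      obtain ⟨z, hz⟩ := exists_totX (A := R.X) (B := S.X) (r := 1) fun s t _ =>
        if h : 1 = s ∧ 0 = t then h.1 ▸ h.2 ▸ c else if h : 0 = s ∧ 1 = t then h.1 ▸ h.2 ▸ b else 0
      refine ⟨z, totX_ext fun s t hst => ?_⟩
      obtain rfl : s = 0 := by omega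
      obtain rfl : t = 0 := by omega
      rw [totProj_d, hz, hz]
      simp [hb]
    · rintro ⟨y, rfl⟩
      rw [totProj_d, map_add, augR_d, map_smul, (augR_exact R S 0).apply_apply_eq_zero, smul_zero,
        add_zero, aug_d]
  exact r z := by
    constructor
    · intro hz
      have hz' : ∀ s t (hst : s + t = r), _ = lin (totProj R.X S.X s t hst) 0 := fun s t hst =>
        (totProj_d R.d S.d s t hst z).symm.trans (congrArg (lin (totProj R.X S.X s t hst)) hz)
      simp only [map_zero] at hz'
      obtain ⟨w, hw⟩ := total_exact (k := k) (C := fun p => HopfBimod.tensor (R.X p.1) (S.X p.2))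
        (B := fun s => R.X s) (fun s t => lin (tensorMap (R.d s) (𝟙 (S.X t))))
        (fun s t => lin (tensorMap (𝟙 (R.X s)) (S.d t))) (fun s => lin (augR R S s))
        (fun s => lin (R.d s)) (fun s t => tensorMap_interchange (R.d s) (S.d t))
        (fun s t => tensor_exact _ (S.exact t)) (augR_exact R S) (augR_surjective R S)
        (augR_d R S) R.exact r
        (fun p => if h : p.1 + p.2 = r + 1 then lin (totProj R.X S.X p.1 p.2 h) z else 0)
        (fun s t hst => by
          have h1 : s + 1 + t = r + 1 := by omega
          have h2 : s + (t + 1) = r + 1 := by omega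
          simp only [h1, h2, dite_true]
          exact hz' s t hst)
        (fun s t x => tensorMap_d_d_left R s x)
      obtain ⟨x, hx⟩ := exists_totX (A := R.X) (B := S.X) (r := r + 2) fun s t _ => w (s, t)
      refine ⟨x, totX_ext fun s t hst => ?_⟩
      rw [totProj_d, hx, hx]
      refine (hw s t hst).trans ?_
      simp [hst]
    · rintro ⟨x, rfl⟩
      refine totX_ext fun s t hst => ?_
      rw [totProj_d, totProj_d, totProj_d, map_add, map_add, tensorMap_d_d_left, map_smul,
        map_smul, tensorMap_interchange, tensorMap_d_d_right, pow_succ]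
      simp

end HopfRes

/-! ### Exact sequences with two copies of `H` on the left -/

variable (k H) in
/-- An exact sequence `0 → H ⊕ H → X (n-1) → ⋯ → X 0 → H → 0`; the inclusions of the two copies
of `H` into `X n ≅ H ⊕ H` are `topFst` and `topSnd`. -/
structure PairExt (n : ℕ) extends HopfRes k H where
  topFst : unit k H ⟶ X n
  topSnd : unit k H ⟶ X n
  indep : ∀ a b, lin topFst a + lin topSnd b = 0 → a = 0 ∧ b = 0
  span : ∀ x, ∃ a b, lin topFst a + lin topSnd b = x
  subsingleton : ∀ i, n < i → Subsingleton (X i)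

namespace PairExt

open HopfExt

variable {n N : ℕ}

/-- The difference of the two inclusions of `H`, extended by zero to all degrees. -/
def diffAt (P : PairExt k H n) (i : ℕ) : unit k H ⟶ P.X i :=
  if h : n = i then (P.topFst - P.topSnd) ≫ eqToHom (congrArg P.X h) else 0

lemma diffAt_self (P : PairExt k H n) : P.diffAt n = P.topFst - P.topSnd := by simp [diffAt]

lemma diffAt_of_ne (P : PairExt k H n) {i : ℕ} (h : n ≠ i) : P.diffAt i = 0 := by simp [diffAt, h]

/-- The antidiagonal copy of `H`, and its image under the differential. -/
def diffIncl (P : PairExt k H n) (i : ℕ) : unit k H ⟶ P.X i :=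
  P.diffAt i + P.diffAt (i + 1) ≫ P.d i

lemma diffIncl_self (P : PairExt k H n) : P.diffIncl n = P.topFst - P.topSnd := by
  rw [diffIncl, diffAt_self, diffAt_of_ne P (Nat.succ_ne_self n).symm]
  exact HopfBimod.hom_ext fun x => by simp

lemma aug_diffIncl (P : PairExt k H (N + 1)) (h : unit k H) :
    lin P.aug (lin (P.diffIncl 0) h) = 0 := by
  rw [diffIncl, diffAt_of_ne P (Nat.succ_ne_zero N), lin_add, lin_zero, zero_add, lin_comp,
    P.aug_d]

lemma d_diffIncl (P : PairExt k H n) (i : ℕ) (h : unit k H) :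
    ∃ h', lin (P.diffIncl i) h' = lin (P.d i) (lin (P.diffIncl (i + 1)) h) := by
  have e : lin (P.d i) (lin (P.diffIncl (i + 1)) h) = lin (P.d i) (lin (P.diffAt (i + 1)) h) := by
    rw [diffIncl, lin_add, lin_comp, map_add, P.d_d, add_zero]
  by_cases hi : n = i + 1
  · exact ⟨h, by rw [e, diffIncl, diffAt_of_ne P (i := i) (by omega), lin_add, lin_zero, zero_add,
      lin_comp]⟩
  · exact ⟨0, by rw [e, diffAt_of_ne P hi, map_zero, lin_zero, map_zero]⟩

/-- The projection of `P.X i` to the quotient by the antidiagonal copy of `H`. -/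
def quotMk (P : PairExt k H n) (i : ℕ) : P.X i ⟶ coker (P.diffIncl i) := cokerMk (P.diffIncl i)

lemma quotMk_surjective (P : PairExt k H n) (i : ℕ) : Function.Surjective (lin (P.quotMk i)) :=
  cokerMk_surjective _

lemma quotMk_eq_zero_iff {P : PairExt k H n} {i : ℕ} {x : P.X i} :
    lin (P.quotMk i) x = 0 ↔ ∃ a, lin (P.diffIncl i) a = x :=
  cokerMk_eq_zero_iff

lemma quotMk_eq_iff {P : PairExt k H n} {i : ℕ} {x y : P.X i} :
    lin (P.quotMk i) x = lin (P.quotMk i) y ↔ ∃ a, lin (P.diffIncl i) a = x - y := by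
  rw [← quotMk_eq_zero_iff, map_sub, sub_eq_zero]

/-- The differential induced on the quotients. -/
def quotD (P : PairExt k H n) (i : ℕ) : coker (P.diffIncl (i + 1)) ⟶ coker (P.diffIncl i) :=
  surjDesc (P.quotMk (i + 1)) (P.quotMk_surjective (i + 1)) (P.d i ≫ P.quotMk i) fun x hx => by
    obtain ⟨h, rfl⟩ := quotMk_eq_zero_iff.1 hx
    exact quotMk_eq_zero_iff.2 (P.d_diffIncl i h)

lemma quotD_mk (P : PairExt k H n) (i : ℕ) (x : P.X (i + 1)) :
    lin (P.quotD i) (lin (P.quotMk (i + 1)) x) = lin (P.quotMk i) (lin (P.d i) x) :=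
  surjDesc_apply _ _ _ _ _

/-- The augmentation induced on the quotient. -/
def quotAug (P : PairExt k H (N + 1)) : coker (P.diffIncl 0) ⟶ unit k H :=
  surjDesc (P.quotMk 0) (P.quotMk_surjective 0) P.aug fun x hx => by
    obtain ⟨h, rfl⟩ := quotMk_eq_zero_iff.1 hx
    exact P.aug_diffIncl h

lemma quotAug_mk (P : PairExt k H (N + 1)) (x : P.X 0) :
    lin P.quotAug (lin (P.quotMk 0) x) = lin P.aug x :=
  surjDesc_apply _ _ _ _ _

lemma quotTop_bijective (P : PairExt k H n) :
    Function.Bijective (lin (P.topFst ≫ P.quotMk n)) := by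
  constructor
  · rw [injective_iff_map_eq_zero]
    intro a ha
    obtain ⟨b, hb⟩ := quotMk_eq_zero_iff.1 ha
    have hb' : lin P.topFst b - lin P.topSnd b = lin P.topFst a := by
      rw [diffIncl_self] at hb
      exact hb
    obtain ⟨h1, h2⟩ := P.indep (b - a) (-b) (by rw [map_sub, map_neg, ← hb']; abel)
    rw [neg_eq_zero] at h2
    rw [h2, zero_sub, neg_eq_zero] at h1
    exact h1
  · intro z
    obtain ⟨x, rfl⟩ := P.quotMk_surjective _ z
    obtain ⟨a, b, rfl⟩ := P.span x
    refine ⟨a + b, (quotMk_eq_iff (x := lin P.topFst (a + b))).2 ⟨b, ?_⟩⟩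
    rw [diffIncl_self, lin_sub, map_add]
    abel

lemma quotD_exact_zero (P : PairExt k H (N + 1)) :
    Function.Exact (lin (P.quotD 0)) (lin P.quotAug) := fun z => by
  obtain ⟨x, rfl⟩ := P.quotMk_surjective _ z
  rw [quotAug_mk]
  constructor
  · intro hx
    obtain ⟨y, rfl⟩ := (P.exact_zero x).1 hx
    exact ⟨lin (P.quotMk 1) y, P.quotD_mk 0 y⟩
  · rintro ⟨w, hw⟩
    obtain ⟨y, rfl⟩ := P.quotMk_surjective _ w
    rw [quotD_mk, quotMk_eq_iff] at hw
    obtain ⟨h, hh⟩ := hw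
    have := P.aug_diffIncl h
    rwa [hh, map_sub, P.aug_d, zero_sub, neg_eq_zero] at this

lemma quotD_exact (P : PairExt k H (N + 1)) (i : ℕ) :
    Function.Exact (lin (P.quotD (i + 1))) (lin (P.quotD i)) := fun z => by
  obtain ⟨x, rfl⟩ := P.quotMk_surjective _ z
  rw [quotD_mk, quotMk_eq_zero_iff]
  constructor
  · rintro ⟨a, ha⟩
    rcases Nat.lt_or_ge N i with hi | hi
    · have := P.subsingleton (i + 1) (by omega)
      exact ⟨0, by rw [Subsingleton.elim x 0, map_zero, map_zero]⟩
    · rw [diffIncl, diffAt_of_ne P (by omega), lin_add, lin_zero, zero_add, lin_comp] at ha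
      obtain ⟨y, hy⟩ := (P.exact i (x - lin (P.diffAt (i + 1)) a)).1 (by
        rw [map_sub, ha, sub_self])
      refine ⟨lin (P.quotMk (i + 2)) (y - lin (P.diffAt (i + 2)) a), ?_⟩
      rw [quotD_mk, quotMk_eq_iff]
      refine ⟨-a, ?_⟩
      rw [map_neg, diffIncl, lin_add, lin_comp, map_sub, hy]
      abel
  · rintro ⟨w, hw⟩
    obtain ⟨y, rfl⟩ := P.quotMk_surjective _ w
    rw [quotD_mk, quotMk_eq_iff] at hw
    obtain ⟨h, hh⟩ := hw
    obtain ⟨h', hh'⟩ := P.d_diffIncl i h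
    refine ⟨-h', ?_⟩
    rw [map_neg, hh', hh, map_sub, P.d_d, zero_sub, neg_neg]

/-- The extension obtained by identifying the two copies of `H`, that is, the pushforward along
the addition `H ⊕ H → H`. -/
def collapse (P : PairExt k H (N + 1)) : HopfExt k H (N + 1) where
  X i := coker (P.diffIncl i)
  d := P.quotD
  top := P.topFst ≫ P.quotMk (N + 1)
  aug := P.quotAug
  top_bijective := P.quotTop_bijective
  subsingleton i hi :=
    have := P.subsingleton i hi
    (P.quotMk_surjective i).subsingleton
  aug_surjective h := by
    obtain ⟨x, hx⟩ := P.aug_surjective h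
    exact ⟨lin (P.quotMk 0) x, by rw [quotAug_mk, hx]⟩
  exact_zero := P.quotD_exact_zero
  exact := P.quotD_exact

variable (P : PairExt k H (N + 1)) {T : HopfExt k H (N + 1)}

/-- The projection to `collapse P`. -/
def collapseMk (i : ℕ) : P.X i ⟶ (collapse P).X i := P.quotMk i

lemma collapseMk_surjective (i : ℕ) : Function.Surjective (lin (collapseMk P i)) :=
  P.quotMk_surjective i

section Desc

variable (f : ∀ i, P.X i ⟶ T.X i)

lemma desc_diffIncl
    (comm : ∀ i x, lin (f i) (lin (P.d i) x) = lin (T.d i) (lin (f (i + 1)) x))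
    (top₁ : ∀ h, lin (f (N + 1)) (lin P.topFst h) = lin T.top h)
    (top₂ : ∀ h, lin (f (N + 1)) (lin P.topSnd h) = lin T.top h)
    (i : ℕ) (h : unit k H) : lin (f i) (lin (P.diffIncl i) h) = 0 := by
  have key : ∀ j, lin (f j) (lin (P.diffAt j) h) = 0 := fun j => by
    by_cases hj : N + 1 = j
    · subst hj
      rw [diffAt_self, lin_sub, map_sub, top₁, top₂, sub_self]
    · rw [diffAt_of_ne P hj, lin_zero, map_zero]
  rw [diffIncl, lin_add, lin_comp, map_add, comm, key, key, map_zero, add_zero]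

/-- The components of `collapseDesc`. -/
def quotDesc
    (comm : ∀ i x, lin (f i) (lin (P.d i) x) = lin (T.d i) (lin (f (i + 1)) x))
    (top₁ : ∀ h, lin (f (N + 1)) (lin P.topFst h) = lin T.top h)
    (top₂ : ∀ h, lin (f (N + 1)) (lin P.topSnd h) = lin T.top h)
    (i : ℕ) : coker (P.diffIncl i) ⟶ T.X i :=
  surjDesc (P.quotMk i) (P.quotMk_surjective i) (f i) fun x hx => by
    obtain ⟨h, rfl⟩ := quotMk_eq_zero_iff.1 hx
    exact desc_diffIncl P f comm top₁ top₂ i h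

lemma quotDesc_mk (comm) (top₁) (top₂) (i : ℕ) (x : P.X i) :
    lin (quotDesc P f comm top₁ top₂ i) (lin (P.quotMk i) x) = lin (f i) x :=
  surjDesc_apply _ _ _ _ _

/-- A morphism from the extension obtained by identifying the two copies of `H`. -/
def collapseDesc
    (comm : ∀ i x, lin (f i) (lin (P.d i) x) = lin (T.d i) (lin (f (i + 1)) x))
    (top₁ : ∀ h, lin (f (N + 1)) (lin P.topFst h) = lin T.top h)
    (top₂ : ∀ h, lin (f (N + 1)) (lin P.topSnd h) = lin T.top h)
    (aug : ∀ x, lin T.aug (lin (f 0) x) = lin P.aug x) : collapse P ⟶ T where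
  f := quotDesc P f comm top₁ top₂
  comm i := HopfBimod.hom_ext fun z => by
    obtain ⟨x, rfl⟩ := P.quotMk_surjective _ z
    refine (congrArg (lin (quotDesc P f comm top₁ top₂ i)) (P.quotD_mk i x)).trans ?_
    rw [quotDesc_mk, comm]
    exact congrArg (lin (T.d i)) (quotDesc_mk _ _ _ _ _ _ _).symm
  top := HopfBimod.hom_ext fun h => (quotDesc_mk P f comm top₁ top₂ _ _).trans (top₁ h)
  aug := HopfBimod.hom_ext fun z => by
    obtain ⟨x, rfl⟩ := P.quotMk_surjective _ z
    refine (congrArg (lin T.aug) (quotDesc_mk _ _ comm top₁ top₂ _ _)).trans ?_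
    rw [aug]
    exact (P.quotAug_mk x).symm

lemma collapseDesc_f (comm) (top₁) (top₂) (aug) (i : ℕ) (x : P.X i) :
    lin ((collapseDesc P f comm top₁ top₂ aug).f i) (lin (collapseMk P i) x) = lin (f i) x :=
  quotDesc_mk P f comm top₁ top₂ i x

end Desc

variable {P} in
lemma collapse_hom_ext {φ ψ : collapse P ⟶ T}
    (h : ∀ i x, lin (φ.f i) (lin (collapseMk P i) x) = lin (ψ.f i) (lin (collapseMk P i) x)) :
    φ = ψ :=
  hom_ext' fun i => HopfBimod.hom_ext fun z => by
    obtain ⟨x, rfl⟩ := collapseMk_surjective P i z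
    exact h i x

/-- The inclusion `h ↦ (i_X h, 0)`. -/
def pairTopFst (X Y : HopfExt k H (N + 1)) : unit k H ⟶ fib X Y (N + 1) :=
  fibLift X.top 0 (by simp only [augAt_succ, implies_true])

/-- The inclusion `h ↦ (0, i_Y h)`. -/
def pairTopSnd (X Y : HopfExt k H (N + 1)) : unit k H ⟶ fib X Y (N + 1) :=
  fibLift 0 Y.top (by simp only [augAt_succ, implies_true])

section PairTop

variable {X Y : HopfExt k H (N + 1)} (h : unit k H)

@[simp] lemma fibFst_pairTopFst : lin (fibFst X Y (N + 1)) (lin (pairTopFst X Y) h) = lin X.top h :=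
  fibFst_fibLift _ _ _ _

@[simp] lemma fibSnd_pairTopFst : lin (fibSnd X Y (N + 1)) (lin (pairTopFst X Y) h) = 0 :=
  fibSnd_fibLift _ _ _ _

@[simp] lemma fibFst_pairTopSnd : lin (fibFst X Y (N + 1)) (lin (pairTopSnd X Y) h) = 0 :=
  fibFst_fibLift _ _ _ _

@[simp] lemma fibSnd_pairTopSnd : lin (fibSnd X Y (N + 1)) (lin (pairTopSnd X Y) h) = lin Y.top h :=
  fibSnd_fibLift _ _ _ _

end PairTop

/-- The sequence of pairs of elements of `X` and `Y` of equal augmentation: the pullback of the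
direct sum of `X` and `Y` along the diagonal of `H`. -/
def ofPair (X Y : HopfExt k H (N + 1)) : PairExt k H (N + 1) where
  X := fib X Y
  d := fibD X Y
  aug := fibFst X Y 0 ≫ X.aug
  aug_surjective h := by
    obtain ⟨x, hx⟩ := X.aug_surjective h
    obtain ⟨y, hy⟩ := Y.aug_surjective h
    obtain ⟨z, h1, -⟩ := exists_fib (X := X) (Y := Y) (i := 0) x y (hx.trans hy.symm)
    exact ⟨z, by rw [lin_comp, h1, hx]⟩
  exact_zero z := by
    constructor
    · intro h
      obtain ⟨x, hx⟩ := (X.exact_zero _).1 h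
      obtain ⟨y, hy⟩ := (Y.exact_zero (lin (fibSnd X Y 0) z)).1 ((fib_aug z).symm.trans h)
      obtain ⟨w, h1, h2⟩ := exists_fib (X := X) (Y := Y) (i := 1) x y rfl
      exact ⟨w, fib_ext ((fibFst_fibD 0 _).trans ((congrArg _ h1).trans hx))
        ((fibSnd_fibD 0 _).trans ((congrArg _ h2).trans hy))⟩
    · rintro ⟨w, rfl⟩
      rw [lin_comp, fibFst_fibD, X.aug_d]
  exact i z := by
    constructor
    · intro h
      have h1 := congrArg (lin (fibFst X Y i)) h
      have h2 := congrArg (lin (fibSnd X Y i)) h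
      rw [fibFst_fibD, map_zero] at h1
      rw [fibSnd_fibD, map_zero] at h2
      obtain ⟨x, hx⟩ := (X.exact i _).1 h1
      obtain ⟨y, hy⟩ := (Y.exact i _).1 h2
      obtain ⟨w, h1, h2⟩ := exists_fib (X := X) (Y := Y) (i := i + 2) x y rfl
      exact ⟨w, fib_ext (by rw [fibFst_fibD, h1, hx]) (by rw [fibSnd_fibD, h2, hy])⟩
    · rintro ⟨w, rfl⟩
      exact fib_ext (by simp) (by simp)
  topFst := pairTopFst X Y
  topSnd := pairTopSnd X Y
  indep a b h := by
    have h1 := congrArg (lin (fibFst X Y _)) h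
    have h2 := congrArg (lin (fibSnd X Y _)) h
    simp only [map_add, fibFst_pairTopFst, fibFst_pairTopSnd, fibSnd_pairTopFst, fibSnd_pairTopSnd,
      add_zero, zero_add, map_zero] at h1 h2
    exact ⟨(map_eq_zero_iff _ X.top_bijective.1).1 h1, (map_eq_zero_iff _ Y.top_bijective.1).1 h2⟩
  span z := by
    obtain ⟨a, ha⟩ := X.top_bijective.2 (lin (fibFst X Y _) z)
    obtain ⟨b, hb⟩ := Y.top_bijective.2 (lin (fibSnd X Y _) z)
    exact ⟨a, b, fib_ext (by simp [ha]) (by simp [hb])⟩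
  subsingleton i hi := by
    have := X.subsingleton i hi
    have := Y.subsingleton i hi
    exact ⟨fun z w => fib_ext (Subsingleton.elim _ _) (Subsingleton.elim _ _)⟩

section Tensor

variable {m : ℕ}

/-- `topProjR` is a left inverse of `topInclR`, in terms of the summand of bidegree `(m, n)`. -/
lemma topR_apply {M : HopfBimod k H} (t : unit k H ⟶ M) (G : HopfExt k H n) (a : unit k H) :
    lin (runit M) (lin (tensorMap (𝟙 M) G.topInv)
      (lin (tensorMap t G.top) (lin (HopfBimod.inv (lunit _) lunit_bijective) a))) = lin t a := by
  obtain ⟨b, rfl⟩ := lunit_bijective.2 a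
  rw [inv_lin]
  exact congrArg (fun φ => lin φ b)
    (tensorHom_ext (f := tensorMap t G.top ≫ tensorMap (𝟙 M) G.topInv ≫ runit M)
      (g := lunit _ ≫ t) fun x y => by
        simp only [lin_comp, tensorMap_tmul, topInv_top, lin_id]
        exact ((isHom t).ract _ _).symm)

/-- `topProjL` is a left inverse of `topInclL`, in terms of the summand of bidegree `(n, m)`. -/
lemma topL_apply {M : HopfBimod k H} (t : unit k H ⟶ M) (G : HopfExt k H n) (a : unit k H) :
    lin (lunit M) (lin (tensorMap G.topInv (𝟙 M))
      (lin (tensorMap G.top t) (lin (HopfBimod.inv (lunit _) lunit_bijective) a))) = lin t a := by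
  obtain ⟨b, rfl⟩ := lunit_bijective.2 a
  rw [inv_lin]
  exact congrArg (fun φ => lin φ b)
    (tensorHom_ext (f := tensorMap G.top t ≫ tensorMap G.topInv (𝟙 M) ≫ lunit M)
      (g := lunit _ ≫ t) fun x y => by
        simp only [lin_comp, tensorMap_tmul, topInv_top, lin_id]
        exact ((isHom t).lact _ _).symm)

/-- The projection of `P ⊗_H G` in the last degree to `P.X m`. -/
def topProjR (P : PairExt k H m) (G : HopfExt k H n) (h : m + n = N) : totX P.X G.X N ⟶ P.X m :=
  totProj P.X G.X m n h ≫ tensorMap (𝟙 _) G.topInv ≫ runit _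

/-- The inclusion `h ↦ t h ⊗ i_G 1` of `H` into the last degree of `P ⊗_H G`. -/
def topInclR (P : PairExt k H m) (G : HopfExt k H n) (h : m + n = N) (t : unit k H ⟶ P.X m) :
    unit k H ⟶ totX P.X G.X N :=
  HopfBimod.inv (lunit _) lunit_bijective ≫ tensorMap t G.top ≫ totIncl P.X G.X m n h

/-- The projection of `G ⊗_H P` in the last degree to `P.X m`. -/
def topProjL (G : HopfExt k H n) (P : PairExt k H m) (h : n + m = N) : totX G.X P.X N ⟶ P.X m :=
  totProj G.X P.X n m h ≫ tensorMap G.topInv (𝟙 _) ≫ lunit _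

/-- The inclusion `h ↦ i_G 1 ⊗ t h` of `H` into the last degree of `G ⊗_H P`. -/
def topInclL (G : HopfExt k H n) (P : PairExt k H m) (h : n + m = N) (t : unit k H ⟶ P.X m) :
    unit k H ⟶ totX G.X P.X N :=
  HopfBimod.inv (lunit _) lunit_bijective ≫ tensorMap G.top t ≫ totIncl G.X P.X n m h

section

variable {P : PairExt k H m} {G : HopfExt k H n}

lemma tensorR_subsingleton (P : PairExt k H m) (G : HopfExt k H n) (s t : ℕ) (h : m < s ∨ n < t) :
    Subsingleton (HopfBimod.tensor (P.X s) (G.X t)) := by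
  rcases h with h | h
  · have := P.subsingleton s h
    exact tensor_subsingleton_left
  · have := G.subsingleton t h
    exact tensor_subsingleton_right

lemma tensorL_subsingleton (G : HopfExt k H n) (P : PairExt k H m) (s t : ℕ) (h : n < s ∨ m < t) :
    Subsingleton (HopfBimod.tensor (G.X s) (P.X t)) := by
  rcases h with h | h
  · have := G.subsingleton s h
    exact tensor_subsingleton_left
  · have := P.subsingleton t h
    exact tensor_subsingleton_right

lemma topProjR_incl (h : m + n = N) (t : unit k H ⟶ P.X m) (a : unit k H) :
    lin (topProjR P G h) (lin (topInclR P G h t) a) = lin t a := by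
  simp only [topProjR, topInclR, lin_comp]
  rw [totProj_incl_self, topR_apply]

lemma topProjL_incl (h : n + m = N) (t : unit k H ⟶ P.X m) (a : unit k H) :
    lin (topProjL G P h) (lin (topInclL G P h t) a) = lin t a := by
  simp only [topProjL, topInclL, lin_comp]
  rw [totProj_incl_self, topL_apply]

lemma topProjR_injective (h : m + n = N) : Function.Injective (lin (topProjR P G h)) :=
  (runit_bijective.1.comp (tensorMap_bijective (f := 𝟙 (P.X m)) Function.bijective_id
    (inv_bijective G.top_bijective)).1).comp fun x y hxy => totX_ext fun s t hst => by
      by_cases hs : s = m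
      · subst hs
        obtain rfl : t = n := by omega
        exact hxy
      · exact (tensorR_subsingleton P G s t (by omega)).elim _ _

lemma topProjL_injective (h : n + m = N) : Function.Injective (lin (topProjL G P h)) :=
  (lunit_bijective.1.comp (tensorMap_bijective (inv_bijective G.top_bijective)
    (g := 𝟙 (P.X m)) Function.bijective_id).1).comp fun x y hxy => totX_ext fun s t hst => by
      by_cases hs : s = n
      · subst hs
        obtain rfl : t = m := by omega
        exact hxy
      · exact (tensorL_subsingleton G P s t (by omega)).elim _ _

end

/-- The tensor product `P ⊗_H G`. -/
def tensorRight (P : PairExt k H m) (G : HopfExt k H n) (h : m + n = N) : PairExt k H N where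
  toHopfRes := HopfRes.tensor P.toHopfRes (HopfRes.ofExt G)
  topFst := topInclR P G h P.topFst
  topSnd := topInclR P G h P.topSnd
  indep a b hab := P.indep a b <| by
    have := congrArg (lin (topProjR P G h)) hab
    rw [← topProjR_incl (G := G) h P.topFst, ← topProjR_incl (G := G) h P.topSnd, ← map_add]
    exact this.trans (map_zero _)
  span x := by
    obtain ⟨a, b, hab⟩ := P.span (lin (topProjR P G h) x)
    refine ⟨a, b, topProjR_injective h ?_⟩
    rw [← hab, ← topProjR_incl (G := G) h P.topFst, ← topProjR_incl (G := G) h P.topSnd, ← map_add]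
    rfl
  subsingleton r hr := ⟨fun x y => totX_ext fun s t hst =>
    (tensorR_subsingleton P G s t (by omega)).elim _ _⟩

/-- The tensor product `G ⊗_H P`. -/
def tensorLeft (G : HopfExt k H n) (P : PairExt k H m) (h : n + m = N) : PairExt k H N where
  toHopfRes := HopfRes.tensor (HopfRes.ofExt G) P.toHopfRes
  topFst := topInclL G P h P.topFst
  topSnd := topInclL G P h P.topSnd
  indep a b hab := P.indep a b <| by
    have := congrArg (lin (topProjL G P h)) hab
    rw [← topProjL_incl (G := G) h P.topFst, ← topProjL_incl (G := G) h P.topSnd, ← map_add]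
    exact this.trans (map_zero _)
  span x := by
    obtain ⟨a, b, hab⟩ := P.span (lin (topProjL G P h) x)
    refine ⟨a, b, topProjL_injective h ?_⟩
    rw [← hab, ← topProjL_incl (G := G) h P.topFst, ← topProjL_incl (G := G) h P.topSnd, ← map_add]
    rfl
  subsingleton r hr := ⟨fun x y => totX_ext fun s t hst =>
    (tensorL_subsingleton G P s t (by omega)).elim _ _⟩

end Tensor

end PairExt

namespace HopfExt

/-! ### Tensor products and Baer sums -/

section TensorBaer

open PairExt

lemma tensorMap_add_left {M M' L L' : HopfBimod k H} (f f' : M ⟶ M') (g : L ⟶ L') :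
    tensorMap (f + f') g = tensorMap f g + tensorMap f' g := tensorHom_ext fun m n => by
  simp [TensorProduct.add_tmul]

lemma tensorMap_add_right {M M' L L' : HopfBimod k H} (f : M ⟶ M') (g g' : L ⟶ L') :
    tensorMap f (g + g') = tensorMap f g + tensorMap f g' := tensorHom_ext fun m n => by
  simp [TensorProduct.tmul_add]

variable {N : ℕ}

section

variable {X Y : HopfExt k H (N + 1)}

/-- `h ↦ (0, i_Y h)` represents the inclusion of `H` into a Baer sum. -/
lemma baer_top' (h : unit k H) (z : fib X Y (N + 1)) (h1 : lin (fibFst X Y _) z = 0)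
    (h2 : lin (fibSnd X Y _) z = lin Y.top h) :
    lin (fibMk X Y (N + 1)) z = lin (baer X Y).top h := by
  obtain ⟨w, hw1, hw2⟩ := exists_fib (X := X) (Y := Y) (i := N + 1) (lin X.top h) 0
    (by rw [augAt_succ, augAt_succ])
  rw [baer_top h w hw1 hw2]
  refine fibMk_eq (-h) ?_ ?_
  · rw [h1, hw1, baerTop_self, map_neg, add_neg_cancel]
  · rw [h2, hw2, baerTop_self, map_neg, zero_sub, neg_neg]

/-- On the last term, the identification of a Baer sum with `H` adds the two components. -/
lemma fibMk_topInv :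
    fibMk X Y (N + 1) ≫ (baer X Y).topInv =
      fibFst X Y (N + 1) ≫ X.topInv + fibSnd X Y (N + 1) ≫ Y.topInv := by
  refine HopfBimod.hom_ext fun z => ?_
  obtain ⟨a, ha⟩ := X.top_bijective.2 (lin (fibFst X Y _) z)
  obtain ⟨b, hb⟩ := Y.top_bijective.2 (lin (fibSnd X Y _) z)
  have hz : z = lin (pairTopFst X Y) a + lin (pairTopSnd X Y) b :=
    fib_ext (by simp [ha]) (by simp [hb])
  have h1 : lin (fibMk X Y (N + 1)) z = lin (baer X Y).top (a + b) := by
    rw [hz, map_add, map_add, baer_top' b (lin (pairTopSnd X Y) b) (by simp) (by simp),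
      baer_top a (lin (pairTopFst X Y) a) (by simp) (by simp)]
  rw [lin_comp, h1, topInv_top, lin_add, lin_comp, lin_comp, ← ha, ← hb, topInv_top, topInv_top]

lemma fibFst_aug : fibFst X Y 0 ≫ X.aug = fibSnd X Y 0 ≫ Y.aug :=
  HopfBimod.hom_ext fun z => fib_aug z

lemma fibMk_aug : fibMk X Y 0 ≫ (baer X Y).aug = fibFst X Y 0 ≫ X.aug := rfl

lemma pairTopFst_fibMk : pairTopFst X Y ≫ fibMk X Y (N + 1) = (baer X Y).top :=
  HopfBimod.hom_ext fun h => (baer_top h _ (fibFst_pairTopFst h) (fibSnd_pairTopFst h)).symm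

lemma pairTopSnd_fibMk : pairTopSnd X Y ≫ fibMk X Y (N + 1) = (baer X Y).top :=
  HopfBimod.hom_ext fun h => baer_top' h _ (fibFst_pairTopSnd h) (fibSnd_pairTopSnd h)

lemma fibMk_d (i : ℕ) : fibD X Y i ≫ fibMk X Y i = fibMk X Y (i + 1) ≫ (baer X Y).d i :=
  HopfBimod.hom_ext fun z => (baer_d_fibMk i z).symm

lemma fibFst_d (i : ℕ) : fibD X Y i ≫ fibFst X Y i = fibFst X Y (i + 1) ≫ X.d i :=
  HopfBimod.hom_ext fun z => fibFst_fibD i z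

lemma fibSnd_d (i : ℕ) : fibD X Y i ≫ fibSnd X Y i = fibSnd X Y (i + 1) ≫ Y.d i :=
  HopfBimod.hom_ext fun z => fibSnd_fibD i z

end

variable {m n : ℕ}

lemma id_d (G : HopfExt k H n) (i : ℕ) : G.d i ≫ 𝟙 (G.X i) = 𝟙 (G.X (i + 1)) ≫ G.d i := by simp

section Right

variable (E F : HopfExt k H (m + 1)) (G : HopfExt k H (n + 1)) (h : m + 1 + (n + 1) = N + 1)

/-- The tensor product with `G` of the sequence of pairs, with the two copies of `H` identified. -/
def pairRight : HopfExt k H (N + 1) := collapse (tensorRight (ofPair E F) G h)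

/-- The projection of the tensor product with `G` of the sequence of pairs to `pairRight`. -/
def pairRightMk (r : ℕ) : totX (fib E F) G.X r ⟶ (pairRight E F G h).X r :=
  collapseMk (tensorRight (ofPair E F) G h) r

variable {E F G h}

lemma pairRight_hom_ext {T : HopfExt k H (N + 1)} {φ ψ : pairRight E F G h ⟶ T}
    (he : ∀ i x, lin (φ.f i) (lin (pairRightMk E F G h i) x) =
      lin (ψ.f i) (lin (pairRightMk E F G h i) x)) : φ = ψ := collapse_hom_ext he

variable (E F G h)

/-- The morphism `(x, y) ⊗ g ↦ (x + y) ⊗ g` to `(E + F) ⊗_H G`. -/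
def pairRightSum : pairRight E F G h ⟶ tensorExt (baer E F) G h :=
  collapseDesc (tensorRight (ofPair E F) G h) (T := tensorExt (baer E F) G h)
    (totMap (fibMk E F) (fun i => 𝟙 (G.X i)))
    (fun r x => totMap_totD (fibMk E F) (fun i => 𝟙 (G.X i)) fibMk_d (id_d G) r x)
    (fun a => by
      refine (totMap_totIncl (fibMk E F) (fun i => 𝟙 (G.X i)) (m + 1) (n + 1) h _).trans
        (congrArg (lin (totIncl (baer E F).X G.X (m + 1) (n + 1) h)) ?_)
      refine (tensorMap_comp_apply (pairTopFst E F) G.top _ _ _).trans ?_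
      rw [pairTopFst_fibMk, Category.comp_id]
      rfl)
    (fun a => by
      refine (totMap_totIncl (fibMk E F) (fun i => 𝟙 (G.X i)) (m + 1) (n + 1) h _).trans
        (congrArg (lin (totIncl (baer E F).X G.X (m + 1) (n + 1) h)) ?_)
      refine (tensorMap_comp_apply (pairTopSnd E F) G.top _ _ _).trans ?_
      rw [pairTopSnd_fibMk, Category.comp_id]
      rfl)
    (fun x => by
      refine (congrArg (lin (tensorMap (baer E F).aug G.aug ≫ lunit _))
        (totProj_totMap (fibMk E F) (fun i => 𝟙 (G.X i)) 0 0 rfl x)).trans ?_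
      rw [lin_comp, tensorMap_comp_apply, fibMk_aug, Category.id_comp]
      rfl)

lemma pairRight_augAt (r : ℕ) (x : totX (fib E F) G.X r) :
    lin ((tensorExt E G h).augAt r) (lin (totMap (fibFst E F) (fun i => 𝟙 (G.X i)) r) x) =
      lin ((tensorExt F G h).augAt r) (lin (totMap (fibSnd E F) (fun i => 𝟙 (G.X i)) r) x) := by
  cases r with
  | zero =>
    refine (congrArg (lin (tensorMap E.aug G.aug ≫ lunit _))
      (totProj_totMap (fibFst E F) (fun i => 𝟙 (G.X i)) 0 0 rfl x)).trans ?_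
    refine Eq.trans ?_ (congrArg (lin (tensorMap F.aug G.aug ≫ lunit _))
      (totProj_totMap (fibSnd E F) (fun i => 𝟙 (G.X i)) 0 0 rfl x)).symm
    rw [lin_comp, lin_comp, tensorMap_comp_apply, tensorMap_comp_apply, fibFst_aug]
  | succ r => rfl

/-- The map `(x, y) ⊗ g ↦ (x ⊗ g, y ⊗ g)`. -/
def pairRightFib (r : ℕ) : totX (fib E F) G.X r ⟶ fib (tensorExt E G h) (tensorExt F G h) r :=
  fibLift (X := tensorExt E G h) (Y := tensorExt F G h)
    (totMap (fibFst E F) (fun i => 𝟙 (G.X i)) r) (totMap (fibSnd E F) (fun i => 𝟙 (G.X i)) r)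
    (pairRight_augAt E F G h r)

variable {E F G h}

lemma fibFst_pairRightFib (r : ℕ) (x : totX (fib E F) G.X r) :
    lin (fibFst (tensorExt E G h) (tensorExt F G h) r) (lin (pairRightFib E F G h r) x) =
      lin (totMap (fibFst E F) (fun i => 𝟙 (G.X i)) r) x := fibFst_fibLift _ _ _ _

lemma fibSnd_pairRightFib (r : ℕ) (x : totX (fib E F) G.X r) :
    lin (fibSnd (tensorExt E G h) (tensorExt F G h) r) (lin (pairRightFib E F G h r) x) =
      lin (totMap (fibSnd E F) (fun i => 𝟙 (G.X i)) r) x := fibSnd_fibLift _ _ _ _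

lemma tproj_fst_pairRightFib {r : ℕ} (s t : ℕ) (hst : s + t = r) (x : totX (fib E F) G.X r) :
    lin (tproj E G h s t hst) (lin (fibFst _ _ r) (lin (pairRightFib E F G h r) x)) =
      lin (tensorMap (fibFst E F s) (𝟙 (G.X t))) (lin (totProj (fib E F) G.X s t hst) x) :=
  (congrArg (lin (tproj E G h s t hst)) (fibFst_pairRightFib r x)).trans
    (totProj_totMap (fibFst E F) (fun i => 𝟙 (G.X i)) s t hst x)

lemma tproj_snd_pairRightFib {r : ℕ} (s t : ℕ) (hst : s + t = r) (x : totX (fib E F) G.X r) :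
    lin (tproj F G h s t hst) (lin (fibSnd _ _ r) (lin (pairRightFib E F G h r) x)) =
      lin (tensorMap (fibSnd E F s) (𝟙 (G.X t))) (lin (totProj (fib E F) G.X s t hst) x) :=
  (congrArg (lin (tproj F G h s t hst)) (fibSnd_pairRightFib r x)).trans
    (totProj_totMap (fibSnd E F) (fun i => 𝟙 (G.X i)) s t hst x)

lemma pairRightFib_d (r : ℕ) (x : totX (fib E F) G.X (r + 1)) :
    lin (pairRightFib E F G h r) (lin (totD (fibD E F) G.d r) x) =
      lin (fibD _ _ r) (lin (pairRightFib E F G h (r + 1)) x) := by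
  refine fib_ext ?_ ?_
  · rw [fibFst_fibD, fibFst_pairRightFib]
    refine (totMap_totD _ _ fibFst_d (id_d G) r x).trans ?_
    exact congrArg (lin (tensorD E G r)) (fibFst_pairRightFib (r + 1) x).symm
  · rw [fibSnd_fibD, fibSnd_pairRightFib]
    refine (totMap_totD _ _ fibSnd_d (id_d G) r x).trans ?_
    exact congrArg (lin (tensorD F G r)) (fibSnd_pairRightFib (r + 1) x).symm

variable (E F G h)

/-- The morphism `(x, y) ⊗ g ↦ (x ⊗ g, y ⊗ g)` to `E ⊗_H G + F ⊗_H G`. -/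
def pairRightPair : pairRight E F G h ⟶ baer (tensorExt E G h) (tensorExt F G h) :=
  collapseDesc (tensorRight (ofPair E F) G h) (T := baer (tensorExt E G h) (tensorExt F G h))
    (fun r => pairRightFib E F G h r ≫ fibMk _ _ r)
    (fun r x => (congrArg (lin (fibMk _ _ r)) (pairRightFib_d r x)).trans (baer_d_fibMk r _).symm)
    (fun a => by
      refine (baer_top a (lin (pairRightFib E F G h (N + 1)) (lin (topInclR (ofPair E F) G h (pairTopFst E F)) a)) ?_ ?_).symm
      · refine (fibFst_pairRightFib (N + 1) _).trans ?_
        refine (totMap_totIncl _ _ (m + 1) (n + 1) h _).trans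
          (congrArg (lin (totIncl E.X G.X (m + 1) (n + 1) h)) ?_)
        refine (tensorMap_comp_apply (pairTopFst E F) G.top _ _ _).trans ?_
        rw [Category.comp_id]
        exact congrArg (fun φ => lin (tensorMap φ G.top) _)
          (HopfBimod.hom_ext fun b => fibFst_pairTopFst b)
      · refine (fibSnd_pairRightFib (N + 1) _).trans ?_
        refine (totMap_totIncl _ _ (m + 1) (n + 1) h _).trans ?_
        refine (congrArg (lin (totIncl F.X G.X (m + 1) (n + 1) h))
          (?_ : _ = (0 : HopfBimod.tensor _ _))).trans (map_zero _)
        refine (tensorMap_comp_apply (pairTopFst E F) G.top _ _ _).trans ?_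
        have : pairTopFst E F ≫ fibSnd E F (m + 1) = 0 :=
          HopfBimod.hom_ext fun b => fibSnd_pairTopFst b
        rw [this, tensorMap_zero_left, lin_zero])
    (fun a => by
      refine baer_top' a (lin (pairRightFib E F G h (N + 1)) (lin (topInclR (ofPair E F) G h (pairTopSnd E F)) a)) ?_ ?_
      · refine (fibFst_pairRightFib (N + 1) _).trans ?_
        refine (totMap_totIncl _ _ (m + 1) (n + 1) h _).trans ?_
        refine (congrArg (lin (totIncl E.X G.X (m + 1) (n + 1) h))
          (?_ : _ = (0 : HopfBimod.tensor _ _))).trans (map_zero _)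
        refine (tensorMap_comp_apply (pairTopSnd E F) G.top _ _ _).trans ?_
        have : pairTopSnd E F ≫ fibFst E F (m + 1) = 0 :=
          HopfBimod.hom_ext fun b => fibFst_pairTopSnd b
        rw [this, tensorMap_zero_left, lin_zero]
      · refine (fibSnd_pairRightFib (N + 1) _).trans ?_
        refine (totMap_totIncl _ _ (m + 1) (n + 1) h _).trans
          (congrArg (lin (totIncl F.X G.X (m + 1) (n + 1) h)) ?_)
        refine (tensorMap_comp_apply (pairTopSnd E F) G.top _ _ _).trans ?_
        rw [Category.comp_id]
        exact congrArg (fun φ => lin (tensorMap φ G.top) _)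
          (HopfBimod.hom_ext fun b => fibSnd_pairTopSnd b))
    (fun x => by
      refine (congrArg (lin (tensorExt E G h).aug) (fibFst_pairRightFib 0 x)).trans ?_
      refine (congrArg (lin (tensorMap E.aug G.aug ≫ lunit _))
        (totProj_totMap (fibFst E F) (fun i => 𝟙 (G.X i)) 0 0 rfl x)).trans ?_
      rw [lin_comp, tensorMap_comp_apply, Category.id_comp]
      rfl)

variable {E F G h}

lemma pairRightPair_mk (r : ℕ) (x : totX (fib E F) G.X r) :
    lin ((pairRightPair E F G h).f r) (lin (pairRightMk E F G h r) x) =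
      lin (fibMk _ _ r) (lin (pairRightFib E F G h r) x) :=
  collapseDesc_f (tensorRight (ofPair E F) G h) (T := baer (tensorExt E G h) (tensorExt F G h))
    (fun r => pairRightFib E F G h r ≫ fibMk _ _ r) _ _ _ _ r x

lemma tproj_pairRightSum {r : ℕ} (s t : ℕ) (hst : s + t = r) (x : totX (fib E F) G.X r) :
    lin (tproj (baer E F) G h s t hst)
        (lin ((pairRightSum E F G h).f r) (lin (pairRightMk E F G h r) x)) =
      lin (tensorMap (fibMk E F s) (𝟙 (G.X t))) (lin (totProj (fib E F) G.X s t hst) x) :=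
  (congrArg (lin (tproj (baer E F) G h s t hst))
    (collapseDesc_f (tensorRight (ofPair E F) G h) (T := tensorExt (baer E F) G h)
      (totMap (fibMk E F) (fun i => 𝟙 (G.X i))) _ _ _ _ r x)).trans
    (totProj_totMap (fibMk E F) (fun i => 𝟙 (G.X i)) s t hst x)

end Right

section Left

variable (E F : HopfExt k H (m + 1)) (G : HopfExt k H (n + 1)) (h : n + 1 + (m + 1) = N + 1)

/-- The tensor product of `G` with the sequence of pairs, with the two copies of `H` identified. -/
def pairLeft : HopfExt k H (N + 1) := collapse (tensorLeft G (ofPair E F) h)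

/-- The projection of the tensor product of `G` with the sequence of pairs to `pairLeft`. -/
def pairLeftMk (r : ℕ) : totX G.X (fib E F) r ⟶ (pairLeft E F G h).X r :=
  collapseMk (tensorLeft G (ofPair E F) h) r

variable {E F G h}

lemma pairLeft_hom_ext {T : HopfExt k H (N + 1)} {φ ψ : pairLeft E F G h ⟶ T}
    (he : ∀ i x, lin (φ.f i) (lin (pairLeftMk E F G h i) x) =
      lin (ψ.f i) (lin (pairLeftMk E F G h i) x)) : φ = ψ := collapse_hom_ext he

variable (E F G h)

/-- The morphism `g ⊗ (x, y) ↦ g ⊗ (x + y)` to `G ⊗_H (E + F)`. -/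
def pairLeftSum : pairLeft E F G h ⟶ tensorExt G (baer E F) h :=
  collapseDesc (tensorLeft G (ofPair E F) h) (T := tensorExt G (baer E F) h)
    (totMap (fun i => 𝟙 (G.X i)) (fibMk E F))
    (fun r x => totMap_totD (fun i => 𝟙 (G.X i)) (fibMk E F) (id_d G) fibMk_d r x)
    (fun a => by
      refine (totMap_totIncl (fun i => 𝟙 (G.X i)) (fibMk E F) (n + 1) (m + 1) h _).trans
        (congrArg (lin (totIncl G.X (baer E F).X (n + 1) (m + 1) h)) ?_)
      refine (tensorMap_comp_apply G.top (pairTopFst E F) _ _ _).trans ?_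
      rw [pairTopFst_fibMk, Category.comp_id]
      rfl)
    (fun a => by
      refine (totMap_totIncl (fun i => 𝟙 (G.X i)) (fibMk E F) (n + 1) (m + 1) h _).trans
        (congrArg (lin (totIncl G.X (baer E F).X (n + 1) (m + 1) h)) ?_)
      refine (tensorMap_comp_apply G.top (pairTopSnd E F) _ _ _).trans ?_
      rw [pairTopSnd_fibMk, Category.comp_id]
      rfl)
    (fun x => by
      refine (congrArg (lin (tensorMap G.aug (baer E F).aug ≫ lunit _))
        (totProj_totMap (fun i => 𝟙 (G.X i)) (fibMk E F) 0 0 rfl x)).trans ?_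
      rw [lin_comp, tensorMap_comp_apply, fibMk_aug, Category.id_comp]
      rfl)

lemma pairLeft_augAt (r : ℕ) (x : totX G.X (fib E F) r) :
    lin ((tensorExt G E h).augAt r) (lin (totMap (fun i => 𝟙 (G.X i)) (fibFst E F) r) x) =
      lin ((tensorExt G F h).augAt r) (lin (totMap (fun i => 𝟙 (G.X i)) (fibSnd E F) r) x) := by
  cases r with
  | zero =>
    refine (congrArg (lin (tensorMap G.aug E.aug ≫ lunit _))
      (totProj_totMap (fun i => 𝟙 (G.X i)) (fibFst E F) 0 0 rfl x)).trans ?_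
    refine Eq.trans ?_ (congrArg (lin (tensorMap G.aug F.aug ≫ lunit _))
      (totProj_totMap (fun i => 𝟙 (G.X i)) (fibSnd E F) 0 0 rfl x)).symm
    rw [lin_comp, lin_comp, tensorMap_comp_apply, tensorMap_comp_apply, fibFst_aug]
  | succ r => rfl

/-- The map `g ⊗ (x, y) ↦ (g ⊗ x, g ⊗ y)`. -/
def pairLeftFib (r : ℕ) : totX G.X (fib E F) r ⟶ fib (tensorExt G E h) (tensorExt G F h) r :=
  fibLift (X := tensorExt G E h) (Y := tensorExt G F h)
    (totMap (fun i => 𝟙 (G.X i)) (fibFst E F) r) (totMap (fun i => 𝟙 (G.X i)) (fibSnd E F) r)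
    (pairLeft_augAt E F G h r)

variable {E F G h}

lemma fibFst_pairLeftFib (r : ℕ) (x : totX G.X (fib E F) r) :
    lin (fibFst (tensorExt G E h) (tensorExt G F h) r) (lin (pairLeftFib E F G h r) x) =
      lin (totMap (fun i => 𝟙 (G.X i)) (fibFst E F) r) x := fibFst_fibLift _ _ _ _

lemma fibSnd_pairLeftFib (r : ℕ) (x : totX G.X (fib E F) r) :
    lin (fibSnd (tensorExt G E h) (tensorExt G F h) r) (lin (pairLeftFib E F G h r) x) =
      lin (totMap (fun i => 𝟙 (G.X i)) (fibSnd E F) r) x := fibSnd_fibLift _ _ _ _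

lemma tproj_fst_pairLeftFib {r : ℕ} (s t : ℕ) (hst : s + t = r) (x : totX G.X (fib E F) r) :
    lin (tproj G E h s t hst) (lin (fibFst _ _ r) (lin (pairLeftFib E F G h r) x)) =
      lin (tensorMap (𝟙 (G.X s)) (fibFst E F t)) (lin (totProj G.X (fib E F) s t hst) x) :=
  (congrArg (lin (tproj G E h s t hst)) (fibFst_pairLeftFib r x)).trans
    (totProj_totMap (fun i => 𝟙 (G.X i)) (fibFst E F) s t hst x)

lemma tproj_snd_pairLeftFib {r : ℕ} (s t : ℕ) (hst : s + t = r) (x : totX G.X (fib E F) r) :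
    lin (tproj G F h s t hst) (lin (fibSnd _ _ r) (lin (pairLeftFib E F G h r) x)) =
      lin (tensorMap (𝟙 (G.X s)) (fibSnd E F t)) (lin (totProj G.X (fib E F) s t hst) x) :=
  (congrArg (lin (tproj G F h s t hst)) (fibSnd_pairLeftFib r x)).trans
    (totProj_totMap (fun i => 𝟙 (G.X i)) (fibSnd E F) s t hst x)

lemma pairLeftFib_d (r : ℕ) (x : totX G.X (fib E F) (r + 1)) :
    lin (pairLeftFib E F G h r) (lin (totD G.d (fibD E F) r) x) =
      lin (fibD _ _ r) (lin (pairLeftFib E F G h (r + 1)) x) := by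
  refine fib_ext ?_ ?_
  · rw [fibFst_fibD, fibFst_pairLeftFib]
    refine (totMap_totD _ _ (id_d G) fibFst_d r x).trans ?_
    exact congrArg (lin (tensorD G E r)) (fibFst_pairLeftFib (r + 1) x).symm
  · rw [fibSnd_fibD, fibSnd_pairLeftFib]
    refine (totMap_totD _ _ (id_d G) fibSnd_d r x).trans ?_
    exact congrArg (lin (tensorD G F r)) (fibSnd_pairLeftFib (r + 1) x).symm

variable (E F G h)

/-- The morphism `g ⊗ (x, y) ↦ (g ⊗ x, g ⊗ y)` to `G ⊗_H E + G ⊗_H F`. -/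
def pairLeftPair : pairLeft E F G h ⟶ baer (tensorExt G E h) (tensorExt G F h) :=
  collapseDesc (tensorLeft G (ofPair E F) h) (T := baer (tensorExt G E h) (tensorExt G F h))
    (fun r => pairLeftFib E F G h r ≫ fibMk _ _ r)
    (fun r x => (congrArg (lin (fibMk _ _ r)) (pairLeftFib_d r x)).trans (baer_d_fibMk r _).symm)
    (fun a => by
      refine (baer_top a (lin (pairLeftFib E F G h (N + 1)) (lin (topInclL G (ofPair E F) h (pairTopFst E F)) a)) ?_ ?_).symm
      · refine (fibFst_pairLeftFib (N + 1) _).trans ?_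
        refine (totMap_totIncl _ _ (n + 1) (m + 1) h _).trans
          (congrArg (lin (totIncl G.X E.X (n + 1) (m + 1) h)) ?_)
        refine (tensorMap_comp_apply G.top (pairTopFst E F) _ _ _).trans ?_
        rw [Category.comp_id]
        exact congrArg (fun φ => lin (tensorMap G.top φ) _)
          (HopfBimod.hom_ext fun b => fibFst_pairTopFst b)
      · refine (fibSnd_pairLeftFib (N + 1) _).trans ?_
        refine (totMap_totIncl _ _ (n + 1) (m + 1) h _).trans ?_
        refine (congrArg (lin (totIncl G.X F.X (n + 1) (m + 1) h))
          (?_ : _ = (0 : HopfBimod.tensor _ _))).trans (map_zero _)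
        refine (tensorMap_comp_apply G.top (pairTopFst E F) _ _ _).trans ?_
        have : pairTopFst E F ≫ fibSnd E F (m + 1) = 0 :=
          HopfBimod.hom_ext fun b => fibSnd_pairTopFst b
        rw [this, tensorMap_zero_right, lin_zero])
    (fun a => by
      refine baer_top' a (lin (pairLeftFib E F G h (N + 1)) (lin (topInclL G (ofPair E F) h (pairTopSnd E F)) a)) ?_ ?_
      · refine (fibFst_pairLeftFib (N + 1) _).trans ?_
        refine (totMap_totIncl _ _ (n + 1) (m + 1) h _).trans ?_
        refine (congrArg (lin (totIncl G.X E.X (n + 1) (m + 1) h))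
          (?_ : _ = (0 : HopfBimod.tensor _ _))).trans (map_zero _)
        refine (tensorMap_comp_apply G.top (pairTopSnd E F) _ _ _).trans ?_
        have : pairTopSnd E F ≫ fibFst E F (m + 1) = 0 :=
          HopfBimod.hom_ext fun b => fibFst_pairTopSnd b
        rw [this, tensorMap_zero_right, lin_zero]
      · refine (fibSnd_pairLeftFib (N + 1) _).trans ?_
        refine (totMap_totIncl _ _ (n + 1) (m + 1) h _).trans
          (congrArg (lin (totIncl G.X F.X (n + 1) (m + 1) h)) ?_)
        refine (tensorMap_comp_apply G.top (pairTopSnd E F) _ _ _).trans ?_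
        rw [Category.comp_id]
        exact congrArg (fun φ => lin (tensorMap G.top φ) _)
          (HopfBimod.hom_ext fun b => fibSnd_pairTopSnd b))
    (fun x => by
      refine (congrArg (lin (tensorExt G E h).aug) (fibFst_pairLeftFib 0 x)).trans ?_
      refine (congrArg (lin (tensorMap G.aug E.aug ≫ lunit _))
        (totProj_totMap (fun i => 𝟙 (G.X i)) (fibFst E F) 0 0 rfl x)).trans ?_
      rw [lin_comp, tensorMap_comp_apply, Category.id_comp]
      rfl)

variable {E F G h}

lemma pairLeftPair_mk (r : ℕ) (x : totX G.X (fib E F) r) :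
    lin ((pairLeftPair E F G h).f r) (lin (pairLeftMk E F G h r) x) =
      lin (fibMk _ _ r) (lin (pairLeftFib E F G h r) x) :=
  collapseDesc_f (tensorLeft G (ofPair E F) h) (T := baer (tensorExt G E h) (tensorExt G F h))
    (fun r => pairLeftFib E F G h r ≫ fibMk _ _ r) _ _ _ _ r x

lemma tproj_pairLeftSum {r : ℕ} (s t : ℕ) (hst : s + t = r) (x : totX G.X (fib E F) r) :
    lin (tproj G (baer E F) h s t hst)
        (lin ((pairLeftSum E F G h).f r) (lin (pairLeftMk E F G h r) x)) =
      lin (tensorMap (𝟙 (G.X s)) (fibMk E F t)) (lin (totProj G.X (fib E F) s t hst) x) :=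
  (congrArg (lin (tproj G (baer E F) h s t hst))
    (collapseDesc_f (tensorLeft G (ofPair E F) h) (T := tensorExt G (baer E F) h)
      (totMap (fun i => 𝟙 (G.X i)) (fibMk E F)) _ _ _ _ r x)).trans
    (totProj_totMap (fun i => 𝟙 (G.X i)) (fibMk E F) s t hst x)

end Left

end TensorBaer

/-! ### Additivity of the loop bracket -/

section Contract

variable {m n N : ℕ} (G : HopfExt k H n)

/-- The morphism `x ⊗ g ↦ x (p g)`. -/
def contractAugR (M : HopfBimod k H) : tensor M (G.X 0) ⟶ M := tensorMap (𝟙 M) G.aug ≫ runit M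

/-- The morphism `x ⊗ g ↦ x g` where `g` lies in the last term `H`. -/
def contractTopR (M : HopfBimod k H) : tensor M (G.X n) ⟶ M := tensorMap (𝟙 M) G.topInv ≫ runit M

/-- The morphism `g ⊗ x ↦ (p g) x`. -/
def contractAugL (M : HopfBimod k H) : tensor (G.X 0) M ⟶ M := tensorMap G.aug (𝟙 M) ≫ lunit M

/-- The morphism `g ⊗ x ↦ g x` where `g` lies in the last term `H`. -/
def contractTopL (M : HopfBimod k H) : tensor (G.X n) M ⟶ M := tensorMap G.topInv (𝟙 M) ≫ lunit M

variable {G} {M : HopfBimod k H} {E : HopfExt k H m}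

lemma tensorAugR_map (s : ℕ) (φ : M ⟶ E.X s) (x : tensor M (G.X 0)) :
    lin (tensorAugR E G s) (lin (tensorMap φ (𝟙 _)) x) = lin φ (lin (contractAugR G M) x) := by
  rw [tensorAugR, contractAugR, lin_comp, lin_comp, ← runit_natural, tensorMap_comp_apply,
    tensorMap_comp_apply, Category.comp_id, Category.comp_id, Category.id_comp, Category.id_comp]

lemma tensorTopR_map (s : ℕ) (φ : M ⟶ E.X s) (x : tensor M (G.X n)) :
    lin (tensorTopR E G s) (lin (tensorMap φ (𝟙 _)) x) = lin φ (lin (contractTopR G M) x) := by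
  rw [tensorTopR, contractTopR, lin_comp, lin_comp, ← runit_natural, tensorMap_comp_apply,
    tensorMap_comp_apply, Category.comp_id, Category.comp_id, Category.id_comp, Category.id_comp]

lemma tensorAugL_map (t : ℕ) (φ : M ⟶ E.X t) (x : tensor (G.X 0) M) :
    lin (tensorAugL G E t) (lin (tensorMap (𝟙 _) φ) x) = lin φ (lin (contractAugL G M) x) := by
  rw [tensorAugL, contractAugL, lin_comp, lin_comp, ← lunit_natural, tensorMap_comp_apply,
    tensorMap_comp_apply, Category.comp_id, Category.comp_id, Category.id_comp, Category.id_comp]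

lemma tensorTopL_map (t : ℕ) (φ : M ⟶ E.X t) (x : tensor (G.X n) M) :
    lin (tensorTopL G E t) (lin (tensorMap (𝟙 _) φ) x) = lin φ (lin (contractTopL G M) x) := by
  rw [tensorTopL, contractTopL, lin_comp, lin_comp, ← lunit_natural, tensorMap_comp_apply,
    tensorMap_comp_apply, Category.comp_id, Category.comp_id, Category.id_comp, Category.id_comp]

variable {A B : HopfExt k H (m + 1)}

lemma tensorAugL_fib (t : ℕ) (x : tensor (fib A B 0) (G.X t)) :
    lin (tensorAugL A G t) (lin (tensorMap (fibFst A B 0) (𝟙 _)) x) =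
      lin (tensorAugL (baer A B) G t) (lin (tensorMap (fibMk A B 0) (𝟙 _)) x) := by
  rw [tensorAugL, tensorAugL, lin_comp, lin_comp, tensorMap_comp_apply, tensorMap_comp_apply,
    fibMk_aug]

lemma tensorAugL_fib' (t : ℕ) (x : tensor (fib A B 0) (G.X t)) :
    lin (tensorAugL B G t) (lin (tensorMap (fibSnd A B 0) (𝟙 _)) x) =
      lin (tensorAugL (baer A B) G t) (lin (tensorMap (fibMk A B 0) (𝟙 _)) x) := by
  rw [tensorAugL, tensorAugL, lin_comp, lin_comp, tensorMap_comp_apply, tensorMap_comp_apply,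
    fibMk_aug, fibFst_aug]

lemma tensorAugR_fib (t : ℕ) (x : tensor (G.X t) (fib A B 0)) :
    lin (tensorAugR G A t) (lin (tensorMap (𝟙 _) (fibFst A B 0)) x) =
      lin (tensorAugR G (baer A B) t) (lin (tensorMap (𝟙 _) (fibMk A B 0)) x) := by
  rw [tensorAugR, tensorAugR, lin_comp, lin_comp, tensorMap_comp_apply, tensorMap_comp_apply,
    fibMk_aug]

lemma tensorAugR_fib' (t : ℕ) (x : tensor (G.X t) (fib A B 0)) :
    lin (tensorAugR G B t) (lin (tensorMap (𝟙 _) (fibSnd A B 0)) x) =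
      lin (tensorAugR G (baer A B) t) (lin (tensorMap (𝟙 _) (fibMk A B 0)) x) := by
  rw [tensorAugR, tensorAugR, lin_comp, lin_comp, tensorMap_comp_apply, tensorMap_comp_apply,
    fibMk_aug, fibFst_aug]

lemma tensorTopL_fib (t : ℕ) (x : tensor (fib A B (m + 1)) (G.X t)) :
    lin (tensorTopL A G t) (lin (tensorMap (fibFst A B _) (𝟙 _)) x) +
        lin (tensorTopL B G t) (lin (tensorMap (fibSnd A B _) (𝟙 _)) x) =
      lin (tensorTopL (baer A B) G t) (lin (tensorMap (fibMk A B _) (𝟙 _)) x) := by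
  rw [tensorTopL, tensorTopL, tensorTopL, lin_comp, lin_comp, lin_comp, tensorMap_comp_apply,
    tensorMap_comp_apply, tensorMap_comp_apply, fibMk_topInv, tensorMap_add_left, lin_add, map_add]

lemma tensorTopR_fib (t : ℕ) (x : tensor (G.X t) (fib A B (m + 1))) :
    lin (tensorTopR G A t) (lin (tensorMap (𝟙 _) (fibFst A B _)) x) +
        lin (tensorTopR G B t) (lin (tensorMap (𝟙 _) (fibSnd A B _)) x) =
      lin (tensorTopR G (baer A B) t) (lin (tensorMap (𝟙 _) (fibMk A B _)) x) := by
  rw [tensorTopR, tensorTopR, tensorTopR, lin_comp, lin_comp, lin_comp, tensorMap_comp_apply,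
    tensorMap_comp_apply, tensorMap_comp_apply, fibMk_topInv, tensorMap_add_right, lin_add, map_add]

end Contract

section Squares

variable {m n N : ℕ} (E F : HopfExt k H (m + 1)) (G : HopfExt k H (n + 1))
  (h1 : m + 1 + (n + 1) = N + 1) (h2 : n + 1 + (m + 1) = N + 1)

/-- The morphisms `λ` are compatible with `G # (E + F) → G # E + G # F`. -/
lemma pairRight_lambda :
    pairRightPair E F G h1 ≫ baerMap (lambda E G h1) (lambda F G h1) =
      pairRightSum E F G h1 ≫ lambda (baer E F) G h1 ≫ sumRight E F G h1 :=
  pairRight_hom_ext fun r x => by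
    rw [comp_f, comp_f, comp_f, lin_comp, lin_comp, lin_comp, pairRightPair_mk, baerMap_f]
    rcases Nat.lt_or_ge r (n + 1) with hr | hr
    · rw [lambda_inl (baer E F) G h1 r hr, sumRight_inl, tproj_pairRightSum]
      refine congrArg (lin (fibMk _ _ r)) (fib_ext ?_ ?_)
      · rw [fibFst_fibMap, fibFst_diagInl, lambda_inl E G h1 r hr, tproj_fst_pairRightFib,
          tensorAugL_fib]
      · rw [fibSnd_fibMap, fibSnd_diagInl, lambda_inl F G h1 r hr, tproj_snd_pairRightFib,
          tensorAugL_fib']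
    · obtain ⟨i, hi⟩ : ∃ i, i + (n + 1) = r := ⟨r - (n + 1), by omega⟩
      rw [lambda_inr (baer E F) G h1 i r hi, tproj_pairRightSum, tensorTopR_map, sumRight_inr]
      refine congrArg (lin (fibMk _ _ r)) (fib_ext ?_ ?_)
      · rw [fibFst_fibMap, fibFst_diagInr, lambda_inr E G h1 i r hi, tproj_fst_pairRightFib,
          tensorTopR_map]
      · rw [fibSnd_fibMap, fibSnd_diagInr, lambda_inr F G h1 i r hi, tproj_snd_pairRightFib,
          tensorTopR_map]

/-- The morphisms `λ` are compatible with `E # G + F # G → (E + F) # G`. -/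
lemma pairLeft_lambda :
    pairLeftPair E F G h2 ≫ baerMap (lambda G E h2) (lambda G F h2) ≫ sumLeft E F G h2 =
      pairLeftSum E F G h2 ≫ lambda G (baer E F) h2 :=
  pairLeft_hom_ext fun r x => by
    rw [comp_f, comp_f, comp_f, lin_comp, lin_comp, lin_comp, pairLeftPair_mk, baerMap_f]
    rcases Nat.lt_or_ge r (m + 1) with hr | hr
    · rw [lambda_inl G (baer E F) h2 r hr, sumLeft_inl r hr, tproj_pairLeftSum, tensorAugL_map]
      refine congrArg (fun z => lin (inl _ _ _ r hr) (lin (fibMk _ _ r) z)) (fib_ext ?_ ?_)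
      · rw [fibFst_sumFst, fibFst_fibMap, lambda_inl G E h2 r hr, tproj_fst_pairLeftFib,
          tensorAugL_map, spliceFst_inl]
      · rw [fibSnd_sumFst, fibSnd_fibMap, lambda_inl G F h2 r hr, tproj_snd_pairLeftFib,
          tensorAugL_map, spliceFst_inl]
    · obtain ⟨i, hi⟩ : ∃ i, i + (m + 1) = r := ⟨r - (m + 1), by omega⟩
      rw [lambda_inr G (baer E F) h2 i r hi, tproj_pairLeftSum, sumLeft_inr i r hi, sumSnd_apply,
        fibFst_fibMap, fibSnd_fibMap, lambda_inr G E h2 i r hi, lambda_inr G F h2 i r hi,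
        spliceSnd_inr, spliceSnd_inr, tproj_fst_pairLeftFib, tproj_snd_pairLeftFib, tensorTopR_fib]

variable (s : ℕ)

lemma twistFst_rho_inl (hs : s = (m + 1) * (n + 1)) (r : ℕ) (hr : r < m + 1)
    (z : fib (tensorExt E G h1) (tensorExt F G h1) r) :
    lin (twistFst (splice E G h2) (splice F G h2) s r)
        (lin (fibMap (rho E G s hs h1 h2) (rho F G s hs h1 h2) r) z) =
      lin (inl E G h2 r hr) ((-1 : k) ^ s • lin (tensorAugR E G r)
        (lin (tproj E G h1 r 0 (add_zero r)) (lin (fibFst _ _ r) z))) :=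
  (fibFst_fibMap _ _ r z).trans (rho_inl E G s hs h1 h2 r hr _)

lemma twistFst_rho_inr (hs : s = (m + 1) * (n + 1)) (i r : ℕ) (hr : i + (m + 1) = r)
    (z : fib (tensorExt E G h1) (tensorExt F G h1) r) :
    lin (twistFst (splice E G h2) (splice F G h2) s r)
        (lin (fibMap (rho E G s hs h1 h2) (rho F G s hs h1 h2) r) z) =
      lin (inr E G h2 i r hr) ((-1 : k) ^ ((m + 1) * (n + 1 + i)) • lin (tensorTopL E G i)
        (lin (tproj E G h1 (m + 1) i (by omega)) (lin (fibFst _ _ r) z))) :=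
  (fibFst_fibMap _ _ r z).trans (rho_inr E G s hs h1 h2 i r hr _)

lemma twistSnd_rho_inl (hs : s = (m + 1) * (n + 1)) (r : ℕ) (hr : r < m + 1)
    (z : fib (tensorExt E G h1) (tensorExt F G h1) r) :
    lin (twistSnd (splice E G h2) (splice F G h2) s r)
        (lin (fibMap (rho E G s hs h1 h2) (rho F G s hs h1 h2) r) z) =
      lin (inl F G h2 r hr) ((-1 : k) ^ s • lin (tensorAugR F G r)
        (lin (tproj F G h1 r 0 (add_zero r)) (lin (fibSnd _ _ r) z))) :=
  (fibSnd_fibMap _ _ r z).trans (rho_inl F G s hs h1 h2 r hr _)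

lemma twistSnd_rho_inr (hs : s = (m + 1) * (n + 1)) (i r : ℕ) (hr : i + (m + 1) = r)
    (z : fib (tensorExt E G h1) (tensorExt F G h1) r) :
    lin (twistSnd (splice E G h2) (splice F G h2) s r)
        (lin (fibMap (rho E G s hs h1 h2) (rho F G s hs h1 h2) r) z) =
      lin (inr F G h2 i r hr) ((-1 : k) ^ ((m + 1) * (n + 1 + i)) • lin (tensorTopL F G i)
        (lin (tproj F G h1 (m + 1) i (by omega)) (lin (fibSnd _ _ r) z))) :=
  (fibSnd_fibMap _ _ r z).trans (rho_inr F G s hs h1 h2 i r hr _)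

/-- The morphisms `ρ` are compatible with `E # G + F # G → (E + F) # G`. -/
lemma pairRight_rho (hs : s = (m + 1) * (n + 1)) :
    pairRightPair E F G h1 ≫ baerMap (rho E G s hs h1 h2) (rho F G s hs h1 h2) ≫
        twistBaer _ _ s ≫ twistMap s (sumLeft E F G h2) =
      pairRightSum E F G h1 ≫ rho (baer E F) G s hs h1 h2 :=
  pairRight_hom_ext fun r x => by
    rw [comp_f, comp_f, lin_comp, lin_comp, pairRightPair_mk, comp_f, lin_comp, baerMap_f]
    refine (congrArg (lin ((sumLeft E F G h2).f r)) (twistBaer_f r _)).trans ?_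
    rcases Nat.lt_or_ge r (m + 1) with hr | hr
    · refine Eq.trans ?_ (rho_inl (baer E F) G s hs h1 h2 r hr
        (lin ((pairRightSum E F G h1).f r) (lin (pairRightMk E F G h1 r) x))).symm
      rw [sumLeft_inl r hr, tproj_pairRightSum, tensorAugR_map, ← map_smul (lin (fibMk E F r))]
      refine congrArg (fun z => lin (inl _ _ _ r hr) (lin (fibMk _ _ r) z)) (fib_ext ?_ ?_)
      · rw [fibFst_sumFst, fibFst_twistFib, map_smul (lin (fibFst E F r))]
        rw [twistFst_rho_inl E F G h1 h2 s hs r hr, spliceFst_inl, tproj_fst_pairRightFib, tensorAugR_map]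
      · rw [fibSnd_sumFst, fibSnd_twistFib, map_smul (lin (fibSnd E F r))]
        rw [twistSnd_rho_inl E F G h1 h2 s hs r hr, spliceFst_inl, tproj_snd_pairRightFib, tensorAugR_map]
    · obtain ⟨i, hi⟩ : ∃ i, i + (m + 1) = r := ⟨r - (m + 1), by omega⟩
      refine Eq.trans ?_ (rho_inr (baer E F) G s hs h1 h2 i r hi
        (lin ((pairRightSum E F G h1).f r) (lin (pairRightMk E F G h1 r) x))).symm
      rw [sumLeft_inr i r hi, sumSnd_apply, fibFst_twistFib, fibSnd_twistFib, tproj_pairRightSum,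
        ← tensorTopL_fib, smul_add]
      refine congrArg (lin (inr _ _ _ i r hi)) (congrArg₂ (· + ·) ?_ ?_)
      · rw [twistFst_rho_inr E F G h1 h2 s hs i r hi, spliceSnd_inr, tproj_fst_pairRightFib]
      · rw [twistSnd_rho_inr E F G h1 h2 s hs i r hi, spliceSnd_inr, tproj_snd_pairRightFib]

/-- The morphisms `ρ` are compatible with `G # (E + F) → G # E + G # F`. -/
lemma pairLeft_rho (hs : s = (n + 1) * (m + 1)) :
    pairLeftPair E F G h2 ≫ baerMap (rho G E s hs h2 h1) (rho G F s hs h2 h1) ≫ twistBaer _ _ s =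
      pairLeftSum E F G h2 ≫ rho G (baer E F) s hs h2 h1 ≫ twistMap s (sumRight E F G h1) :=
  pairLeft_hom_ext fun r x => by
    rw [comp_f, comp_f, lin_comp, lin_comp, pairLeftPair_mk, comp_f, lin_comp, baerMap_f]
    refine (twistBaer_f r _).trans ?_
    rcases Nat.lt_or_ge r (n + 1) with hr | hr
    · refine Eq.trans ?_ (congrArg (lin ((sumRight E F G h1).f r))
        (rho_inl G (baer E F) s hs h2 h1 r hr _)).symm
      rw [sumRight_inl, tproj_pairLeftSum]
      refine congrArg (lin (fibMk _ _ r)) (fib_ext ?_ ?_)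
      · rw [fibFst_twistFib, fibFst_diagInl]
        refine ((fibFst_fibMap _ _ r _).trans (rho_inl G E s hs h2 h1 r hr _)).trans ?_
        rw [tproj_fst_pairLeftFib, tensorAugR_fib]
      · rw [fibSnd_twistFib, fibSnd_diagInl]
        refine ((fibSnd_fibMap _ _ r _).trans (rho_inl G F s hs h2 h1 r hr _)).trans ?_
        rw [tproj_snd_pairLeftFib, tensorAugR_fib']
    · obtain ⟨i, hi⟩ : ∃ i, i + (n + 1) = r := ⟨r - (n + 1), by omega⟩
      refine Eq.trans ?_ (congrArg (lin ((sumRight E F G h1).f r))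
        (rho_inr G (baer E F) s hs h2 h1 i r hi _)).symm
      rw [tproj_pairLeftSum, tensorTopL_map, ← map_smul (lin (fibMk E F i)), sumRight_inr]
      refine congrArg (lin (fibMk _ _ r)) (fib_ext ?_ ?_)
      · rw [fibFst_twistFib, fibFst_diagInr, map_smul (lin (fibFst E F i))]
        refine ((fibFst_fibMap _ _ r _).trans (rho_inr G E s hs h2 h1 i r hi _)).trans ?_
        rw [tproj_fst_pairLeftFib, tensorTopL_map]
      · rw [fibSnd_twistFib, fibSnd_diagInr, map_smul (lin (fibSnd E F i))]
        refine ((fibSnd_fibMap _ _ r _).trans (rho_inr G F s hs h2 h1 i r hi _)).trans ?_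
        rw [tproj_snd_pairLeftFib, tensorTopL_map]

end Squares

section Additive

variable {m n N : ℕ} (E F : HopfExt k H (m + 1)) (G : HopfExt k H (n + 1))

/-- The sum of the swap paths of `E`, `G` and of `F`, `G` is the swap path of `E + F`, `G`, up to
the comparison morphisms of the end points. -/
lemma addPath_swapPath_right (s : ℕ) (hs : s = (m + 1) * (n + 1)) (h1 : m + 1 + (n + 1) = N + 1)
    (h2 : n + 1 + (m + 1) = N + 1) :
    addPath (swapPath E G s hs h1 h2) (swapPath F G s hs h1 h2) =
      ofHom (twistBaer _ _ s) ≫ twistPath s (ofHom (sumLeft E F G h2)) ≫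
        swapPath (baer E F) G s hs h1 h2 ≫ ofHom (sumRight E F G h1) := by
  have hr := congrArg ofHom (pairRight_rho E F G h1 h2 s hs)
  have hl := congrArg ofHom (pairRight_lambda E F G h1)
  simp only [ofHom_comp] at hr hl
  rw [swapPath, swapPath, swapPath, ← addPath_comp, addPath_inv, addPath_ofHom, addPath_ofHom,
    IsIso.inv_comp_eq, twistPath_ofHom, ← cancel_epi (ofHom (pairRightPair E F G h1)), hl]
  simp only [← Category.assoc] at hr ⊢
  rw [hr]
  simp

/-- The sum of the swap paths of `G`, `E` and of `G`, `F` is the swap path of `G`, `E + F`, up to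
the comparison morphisms of the end points. The end points are compared in the directions opposite
to those of `addPath_swapPath_right`, so that the two relations can be composed. -/
lemma addPath_swapPath_left (s : ℕ) (hs : s = (n + 1) * (m + 1)) (h1 : m + 1 + (n + 1) = N + 1)
    (h2 : n + 1 + (m + 1) = N + 1) :
    twistPath s (ofHom (sumRight E F G h1)) ≫ inv (ofHom (twistBaer _ _ s)) ≫
        addPath (swapPath G E s hs h2 h1) (swapPath G F s hs h2 h1) ≫ ofHom (sumLeft E F G h2) =
      swapPath G (baer E F) s hs h2 h1 := by
  have hr := congrArg ofHom (pairLeft_rho E F G h1 h2 s hs)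
  have hl := congrArg ofHom (pairLeft_lambda E F G h2)
  simp only [ofHom_comp] at hr hl
  rw [swapPath, swapPath, swapPath, ← addPath_comp, addPath_inv, addPath_ofHom, addPath_ofHom,
    IsIso.eq_inv_comp, twistPath_ofHom, ← cancel_epi (ofHom (pairLeftSum E F G h2)), ← hl]
  simp only [← Category.assoc] at hr ⊢
  rw [← hr]
  simp

/-- The sum of the loops of `E`, `G` and of `F`, `G` is conjugate to the loop of `E + F`, `G`. -/
lemma addPath_loop (h : m + n + 1 = N) (h2 : n + 1 + (m + 1) = N + 1) :
    addPath (loop E G h) (loop F G h) ≫ ofHom (sumLeft E F G h2) =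
      ofHom (sumLeft E F G h2) ≫ loop (baer E F) G h := by
  obtain ⟨s, hs⟩ : ∃ s, s = (m + 1) * (n + 1) := ⟨_, rfl⟩
  have hs' : s = (n + 1) * (m + 1) := by rw [hs, Nat.mul_comm]
  have h1 : m + 1 + (n + 1) = N + 1 := by omega
  rw [loop_eq E G h s hs hs' h1 h2, loop_eq F G h s hs hs' h1 h2,
    loop_eq (baer E F) G h s hs hs' h1 h2, ← addPath_swapPath_left E F G s hs' h1 h2]
  simp only [← addPath_comp, addPath_inv, addPath_ofHom, Category.assoc]
  rw [IsIso.inv_comp_eq, ← twistBaer_twistTwist]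
  have hT := twistTwist_natural s (ofHom (sumLeft E F G h2))
  have hA := congrArg (twistPath s) (addPath_swapPath_right E F G s hs h1 h2)
  have hP := twistPath_addPath (s := s) (swapPath E G s hs h1 h2) (swapPath F G s hs h1 h2)
  rw [← IsIso.eq_comp_inv] at hP hT
  rw [hP, hA]
  simp only [twistPath_comp, ofHom_comp, twistPath_ofHom, Category.assoc]
  simp only [twistPath_ofHom] at hT
  rw [reassoc_of% hT]

variable {E F G} in
lemma bracket₀_add_left (h : m + n + 1 = N) :
    bracket₀ m n N h (baer E F) G = bracket₀ m n N h E G * bracket₀ m n N h F G := by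
  have h2 : n + 1 + (m + 1) = N + 1 := by omega
  refine (Pi1.ext_path (ofHom (sumLeft E F G h2)) ?_).symm
  rw [← Pi1.addPath, bracket₀_self, bracket₀_self, bracket₀_self]
  exact addPath_loop E F G h h2

lemma Pi1.mul_zpow (γ δ : Pi1 k H N) (i : ℤ) : (γ * δ) ^ i = γ ^ i * δ ^ i := by
  have h : Commute γ δ := Pi1.mul_comm γ δ
  exact h.mul_zpow i

lemma bracket₀_add_right (h : m + n + 1 = N) (E : HopfExt k H (m + 1)) (F G : HopfExt k H (n + 1)) :
    bracket₀ m n N h E (baer F G) = bracket₀ m n N h E F * bracket₀ m n N h E G := by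
  have h' : n + m + 1 = N := by omega
  rw [bracket₀_antisymm h h' E (baer F G), bracket₀_antisymm h h' E F, bracket₀_antisymm h h' E G,
    bracket₀_add_left h']
  exact Pi1.mul_zpow _ _ _

/-- The bracket with `Z` is idempotent, as `addSplit` connects `Z` to `Z + Z`. -/
lemma bracket₀_split (h : m + n + 1 = N) (F : HopfExt k H (m + 1)) (Z : HopfExt k H (n + 1))
    (s : unit k H ⟶ Z.X 0) (hs : s ≫ Z.aug = 𝟙 (unit k H)) : bracket₀ m n N h F Z = 1 := by
  have h1 := bracket₀_congr h (𝟙 F) (addSplit Z s hs)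
  rw [bracket₀_add_right] at h1
  exact (mul_eq_left.1 h1.symm)

end Additive

end HopfExt

end

theorem proposition5p3 (k H : Type*) [Field k] [Ring H] [HopfAlgebra k H] :
    ∃ Ω : ∀ m n N : ℕ, m + n + 1 = N →
        HopfExt.Pi0 k H (m + 1) → HopfExt.Pi0 k H (n + 1) → HopfExt.Pi1 k H N,
      -- `Ω` is the loop bracket, and it is determined by this
      HopfExt.IsLoopBracket Ω ∧
      (∀ Ω', HopfExt.IsLoopBracket Ω' → Ω' = Ω) ∧
      -- antisymmetry
      (∀ (m n N : ℕ) (h : m + n + 1 = N) (h' : n + m + 1 = N)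
        (a : HopfExt.Pi0 k H (m + 1)) (b : HopfExt.Pi0 k H (n + 1)),
        Ω m n N h a b = (Ω n m N h' b a) ^ ((-1 : ℤ) ^ ((m + 1) * (n + 1)))) ∧
      -- additivity in each variable with respect to Baer sums
      (∀ (m n N : ℕ) (h : m + n + 1 = N) (E : HopfExt k H (m + 1)) (F G : HopfExt k H (n + 1)),
        Ω m n N h (HopfExt.toPi0 E) (HopfExt.toPi0 (HopfExt.baer F G)) =
          Ω m n N h (HopfExt.toPi0 E) (HopfExt.toPi0 F) *
            Ω m n N h (HopfExt.toPi0 E) (HopfExt.toPi0 G)) ∧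
      (∀ (m n N : ℕ) (h : m + n + 1 = N) (E F : HopfExt k H (m + 1)) (G : HopfExt k H (n + 1)),
        Ω m n N h (HopfExt.toPi0 (HopfExt.baer E F)) (HopfExt.toPi0 G) =
          Ω m n N h (HopfExt.toPi0 E) (HopfExt.toPi0 G) *
            Ω m n N h (HopfExt.toPi0 F) (HopfExt.toPi0 G)) ∧
      -- the bracket with a trivial extension is trivial
      (∀ (m n N : ℕ) (h : m + n + 1 = N) (F : HopfExt k H (m + 1)) (Z : HopfExt k H (n + 1)),
        (∃ s : HopfBimod.unit k H ⟶ Z.X 0, s ≫ Z.aug = 𝟙 (HopfBimod.unit k H)) →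
          Ω m n N h (HopfExt.toPi0 F) (HopfExt.toPi0 Z) = 1) := by
  refine ⟨HopfExt.bracket, HopfExt.isLoopBracket_bracket, fun Ω hΩ => ?_, ?_,
    fun m n N h E F G => HopfExt.bracket₀_add_right h E F G,
    fun m n N h E F G => HopfExt.bracket₀_add_left h, ?_⟩
  · funext m n N h a b
    induction a using Quotient.inductionOn with | _ E
    induction b using Quotient.inductionOn with | _ F
    exact HopfExt.Pi1.ext_at (HopfExt.splice E F (by omega))
      ((hΩ m n N h E F).trans (HopfExt.isLoopBracket_bracket m n N h E F).symm)
  · intro m n N h h' a b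
    induction a using Quotient.inductionOn with | _ E
    induction b using Quotient.inductionOn with | _ F
    exact HopfExt.bracket₀_antisymm h h' E F
  · rintro m n N h F Z ⟨s, hs⟩
    exact HopfExt.bracket₀_split h F Z s hs
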